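/- **Setting.** Parameters: $\lambda_{\rm b},\lambda_{\rm o},L_{\rm o},p_{\rm b},\lambda_f,\delta>0$, $0\le\mu\le1$, integers $N_{\rm b}\ge2$, $N_{\rm r}\ge1$, $m_{\rm L},m_{\rm N}\ge1$, path-loss exponents $\alpha_{\rm L}>0$, $\alpha_{\rm N}>2$. Put $\lambda_{\rm r}=\mu\lambda_{\rm o}$, $\beta=2\lambda_{\rm o}L_{\rm o}/\pi$, $\zeta=(\lambda_f/4\pi)^2$, $\mathcal E=\lambda_f^2/4\pi$, $\mathcal P_{\rm L}(t)=e^{-\beta t}$, $\mathcal P_{\rm N}=1-\mathcal P_{\rm L}$. *Antenna.* $G_{\rm ULA}(\Delta)=\frac{\sin^2(\pi N_{\rm b}\Delta)}{N_{\rm b}\sin^2(\pi\Delta)}$ (with $G_{\rm ULA}(0)=N_{\rm b}$), $\tilde N_{\rm b}=\lfloor N_{\rm b}/2\rfloor-1$, $G_0=\frac\delta2N_{\rm b}$, $G_n=\frac\delta2G_{\rm ULA}(\frac{2n+1}{2N_{\rm b}})$ for $1\le n\le\tilde N_{\rm b}$, $G_{\tilde N_{\rm b}+1}=0$. For $|\Delta|\le\frac12$,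 $G_{\rm B}(\Delta)=G_0$ if $|\Delta|\le\frac1{N_{\rm b}}$, $G_{\rm B}(\Delta)=G_n$ if $\frac n{N_{\rm b}}<|\Delta|\le\frac{n+1}{N_{\rm b}}$ with $1\le n\le\tilde N_{\rm b}$, and $0$ otherwise; for $\frac12<|\Delta|\le1$, $G_{\rm B}(\Delta)=G_{\rm B}(1-|\Delta|)$. *Network.* The user is at the origin of $\mathbb R^2$. Base stations (BSs) form a homogeneous Poisson process $\Psi_{\rm b}$ of density $\lambda_{\rm b}$; the tagged BS $\mathbf b_0$ is the nearest one, at distance $t_{\rm bu}$. Each BS at distance $d$ is, independently, in $\Psi_{\rm b,L}$ with probability $\mathcal P_{\rm L}(d)$ and otherwise in $\Psi_{\rm b,N}$; it has a deviation $\Delta_i=\frac12\cos\phi_i-\frac12\cos\phi_i^*$ with $\phi_i,\phi_i^*$ independent and uniform on $[0,2\pi]$, and Nakagami fading $H_{v,i}\sim\Gamma(m_v,m_v)$ (density $m_v^{m_v}h^{m_v-1}e^{-m_vh}/\Gamma(m_v)$), all independent. RISs form an independent homogeneous Poisson process of density $\lambda_{\rm r}$ with independent uniform orientations; a RIS at distance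 $t$ from the user is *usable* if its link to the user is line-of-sight (LoS) (independently, with probability $\mathcal P_{\rm L}(t)$) and the user and $\mathbf b_0$ are both in front of it. The serving link has type $q={\rm DL}$ if the direct link is LoS (probability $\mathcal P_{\rm L}(t_{\rm bu})$ given $t_{\rm bu}$, independently of the rest); otherwise $q={\rm CL}$ if a usable RIS exists, and $q={\rm DN}$ if none does. For ${\rm CL}$, $t_{\rm ru}$ is the distance from the user to the nearest usable RIS, and $t_{\rm br}=\sqrt{t_{\rm bu}^2+t_{\rm ru}^2-2t_{\rm bu}t_{\rm ru}\cos\theta_0}$, where $\theta_0$ is, by assumption of the model, uniform on $(-\pi,\pi)$ and independent of everything else. With independent $H_q\sim\Gamma(m_q,m_q)$, $m_{\rm DL}=m_{\rm CL}=m_{\rm L}$, $m_{\rm DN}=m_{\rm N}$, and $$P^{\rm a}_{\rm DL}=p_{\rm b}N_{\rm b}\zeta t_{\rm bu}^{-\alpha_{\rm L}},\quad P^{\rm a}_{\rm CL}=p_{\rm b}N_{\rm b}N_{\rm r}^2\zeta(t_{\rm ru}t_{\rm br})^{-\alpha_{\rm L}},\quad P^{\rm a}_{\rm DN}=p_{\rm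 b}N_{\rm b}\zeta t_{\rm bu}^{-\alpha_{\rm N}},$$ the exposure (received power density) is $\mathcal W=\mathcal W_q=\mathcal W_1+\mathcal W_2$ when the serving link has type $q$, where $\mathcal W_1=\mathcal W_{1,q}=P^{\rm a}_qH_q/\mathcal E$ and $\mathcal W_2=\frac1{\mathcal E}\sum_{v\in\{\rm L,N\}}\sum_{\mathbf b_i\in\Psi_{{\rm b},v}\setminus\{\mathbf b_0\}}p_{\rm b}G_{\rm B}(\Delta_i)\zeta\|\mathbf b_i\|^{-\alpha_v}H_{v,i}$. *Auxiliary functions.* $f_\Phi(x)=\frac2{\pi\sqrt{1-4x^2}}$ on $[-\frac12,\frac12]$ and $0$ elsewhere, $f_\Delta(y)=\int_{-1/2}^{1/2}f_\Phi(x)f_\Phi(y+x)\,dx$; $p_n=2\int_{n/N_{\rm b}}^{(n+1)/N_{\rm b}}f_\Delta+2\int_{1-(n+1)/N_{\rm b}}^{1-n/N_{\rm b}}f_\Delta$ for $0\le n\le\tilde N_{\rm b}$, $p_{\tilde N_{\rm b}+1}=1-\sum_{n\le\tilde N_{\rm b}}p_n$; $\bar g_{\rm B}=\sum_{n=0}^{\tilde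 N_{\rm b}}G_np_n$; $\kappa_v(x)=\sum_{n=0}^{\tilde N_{\rm b}+1}p_n(1+xG_n/m_v)^{-m_v}$; ${\rm E}_n(x)=\int_1^\infty e^{-xt}t^{-n}dt$. Further $$\mathcal P_{\rm R}(t_{\rm bu},t,\theta)=\tfrac12-\tfrac1{2\pi}\arccos\frac{t-t_{\rm bu}\cos\theta}{\sqrt{t_{\rm bu}^2+t^2-2t_{\rm bu}t\cos\theta}},\qquad \bar a(t_{\rm bu},t)=\int_{-\pi}^{\pi}\mathcal P_{\rm L}(t)\mathcal P_{\rm R}(t_{\rm bu},t,\theta)\,d\theta,$$ $\mathcal P_{\rm CL}(t_{\rm bu})=1-\exp(-\lambda_{\rm r}\int_0^\infty\bar a(t_{\rm bu},t)t\,dt)$, $\mathcal A_{\rm DL}=\mathcal P_{\rm L}(t_{\rm bu})$, $\mathcal A_{\rm CL}=\mathcal P_{\rm N}(t_{\rm bu})\mathcal P_{\rm CL}(t_{\rm bu})$, $\mathcal A_{\rm DN}=\mathcal P_{\rm N}(t_{\rm bu})(1-\mathcal P_{\rm CL}(t_{\rm bu}))$, $f_{T_{\rm bu}}(t)=2\pi\lambda_{\rm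 b}te^{-\pi\lambda_{\rm b}t^2}$, and $f_{T_{\rm ru}|t_{\rm bu}}(t_{\rm ru})=\lambda_{\rm r}t_{\rm ru}\bar a(t_{\rm bu},t_{\rm ru})\exp(-\lambda_{\rm r}\int_0^{t_{\rm ru}}\bar a(t_{\rm bu},t)t\,dt)/\mathcal P_{\rm CL}(t_{\rm bu})$ (read as $0$ if $\lambda_{\rm r}=0$). For $g_{\rm DL},g_{\rm DN}$ depending on $t_{\rm bu}$ and $g_{\rm CL}$ on $(t_{\rm bu},t_{\rm ru},t_{\rm br})$, $\mathbb E_{t_{\rm bu},t_{\rm ru},t_{\rm br}}[\sum_q\mathcal A_qg_q]$ denotes $$\int_0^\infty\Big[\mathcal A_{\rm DL}g_{\rm DL}+\mathcal A_{\rm CL}\int_0^\infty\!\!\int_{-\pi}^{\pi}g_{\rm CL}\tfrac1{2\pi}f_{T_{\rm ru}|t_{\rm bu}}(t_{\rm ru})\,d\theta_0\,dt_{\rm ru}+\mathcal A_{\rm DN}g_{\rm DN}\Big]f_{T_{\rm bu}}(t_{\rm bu})\,dt_{\rm bu},$$ and $\mathbb E_{t_{\rm bu}}[g]=\int_0^\infty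 g f_{T_{\rm bu}}$. Let $\mathcal T_{\rm DL}=\mathcal T_{\rm DN}=t_{\rm bu}$, $\mathcal T_{\rm CL}=(t_{\rm bu},t_{\rm ru},t_{\rm br})$. **Theorem (Downlink EMFE).** Almost surely $\mathcal W<\infty$. (i) For each $q$, on the event that the serving link has type $q$, the conditional Laplace transform of $\mathcal W_q$ given $\mathcal T_q$ is, for $\operatorname{Re}s\ge0$, $$\mathcal L_{\mathcal W_q|\mathcal T_q}(s)=\Big(1+\frac{sP^{\rm a}_q}{m_q\mathcal E}\Big)^{-m_q}\prod_{v\in\{\rm L,N\}}\exp\Big(-2\pi\lambda_{\rm b}\int_{t_{\rm bu}}^\infty\Big[1-\kappa_v\Big(\frac{sp_{\rm b}}{4\pi x^{\alpha_v}}\Big)\Big]x\,\mathcal P_v(x)\,dx\Big),$$ and its conditional CDF is, for every $\omega\in\mathbb R$, given by the absolutely convergent integral $$F_{\mathcal W_q|\mathcal T_q}(\omega)=\frac12-\int_0^\infty\frac1{\pi x}\operatorname{Im}\big[e^{-jx\omega}\mathcal L_{\mathcal W_q|\mathcal T_q}(-jx)\big]dx.$$ (ii) For every $\omega\in\mathbb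 R$, $F_{\mathcal W}(\omega)=\mathbb P(\mathcal W\le\omega)=\mathbb E_{t_{\rm bu},t_{\rm ru},t_{\rm br}}\big[\sum_q\mathcal A_qF_{\mathcal W_q|\mathcal T_q}(\omega)\big]$. (iii) As identities in $[0,\infty]$, $\mathbb E[\mathcal W]=\mathbb E[\mathcal W_1]+\mathbb E[\mathcal W_2]$, where $$\mathbb E[\mathcal W_1]=\mathbb E_{t_{\rm bu},t_{\rm ru},t_{\rm br}}\Big[\sum_q\frac{P^{\rm a}_q}{\mathcal E}\mathcal A_q\Big],$$ $$\mathbb E[\mathcal W_2]=\frac{\lambda_{\rm b}p_{\rm b}\bar g_{\rm B}}2\Big(\mathbb E_{t_{\rm bu}}\big[t_{\rm bu}^{2-\alpha_{\rm L}}{\rm E}_{\alpha_{\rm L}-1}(\beta t_{\rm bu})\big]+\mathbb E_{t_{\rm bu}}\Big[\frac{t_{\rm bu}^{2-\alpha_{\rm N}}}{\alpha_{\rm N}-2}-t_{\rm bu}^{2-\alpha_{\rm N}}{\rm E}_{\alpha_{\rm N}-1}(\beta t_{\rm bu})\Big]\Big).$$ -/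

import Mathlib

open MeasureTheory ProbabilityTheory Set
open scoped ENNReal

namespace EMF

/-! ### Poisson point processes -/

section Poisson

variable {Ω X : Type*} [MeasurableSpace Ω] [MeasurableSpace X]

/-- Number of points of the random set `Φ` in `A`. -/
noncomputable def count (Φ : Ω → Set X) (A : Set X) (ω : Ω) : ℕ∞ := (Φ ω ∩ A).encard

/-- The information carried by the random set `Φ`: the sigma-algebra generated by all counts. -/
@[reducible] noncomputable def sigmaAlg (Φ : Ω → Set X) : MeasurableSpace Ω :=
  ⨆ A ∈ {A : Set X | MeasurableSet A}, MeasurableSpace.comap (count Φ A) ⊤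

/-- `Φ` is a (simple) Poisson point process on `X` with intensity measure `Λ`, under `P`. -/
structure IsPoissonProcess (Φ : Ω → Set X) (Λ : Measure X) (P : Measure Ω) : Prop where
  countable : ∀ ω, (Φ ω).Countable
  measurable_count : ∀ A, MeasurableSet A → Measurable (count Φ A)
  poisson : ∀ A, MeasurableSet A → Λ A ≠ ∞ → ∀ n : ℕ,
    P {ω | count Φ A ω = n} =
      ENNReal.ofReal (Real.exp (-(Λ A).toReal) * (Λ A).toReal ^ n / n.factorial)
  indep : ∀ (k : ℕ) (A : Fin k → Set X), (∀ i, MeasurableSet (A i)) →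
    Pairwise (fun i j => Disjoint (A i) (A j)) → iIndepFun (fun i => count Φ (A i)) P

end Poisson

/-- The uniform distribution on the interval `[a, b]`. -/
noncomputable def uniform (a b : ℝ) : Measure ℝ := ProbabilityTheory.cond volume (Icc a b)

/-- Nakagami-`m` (power) fading: the Gamma law with density `m ^ m h ^ (m - 1) exp (-m h) / Γ(m)`. -/
noncomputable def fadingLaw (m : ℕ) : Measure ℝ := gammaMeasure (m : ℝ) (m : ℝ)

/-! ### System parameters -/

/-- The state of a link: line of sight or not. -/
inductive LinkState
  | L
  | N

/-- The type of the serving link: direct LoS, cascaded LoS, direct NLoS. -/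
inductive LinkType
  | DL
  | CL
  | DN

/-- Parameters of the network. -/
structure Params where
  /-- density of base stations -/
  lamB : ℝ
  /-- density of obstacles -/
  lamO : ℝ
  /-- fraction of obstacles equipped with a RIS -/
  mu : ℝ
  /-- mean obstacle length -/
  Lo : ℝ
  /-- number of antennas of a base station -/
  Nb : ℕ
  /-- number of elements of a RIS -/
  Nr : ℕ
  /-- transmit power of a base station -/
  pb : ℝ
  /-- carrier wavelength -/
  wl : ℝ
  /-- roll-off compensation factor of the antenna pattern -/
  delta : ℝ
  /-- path-loss exponents -/
  alpha : LinkState → ℝ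
  /-- Nakagami shaping parameters -/
  m : LinkState → ℕ

/-- Admissible values of the parameters. -/
structure Params.Valid (p : Params) : Prop where
  lamB_pos : 0 < p.lamB
  lamO_pos : 0 < p.lamO
  mu_nonneg : 0 ≤ p.mu
  mu_le_one : p.mu ≤ 1
  Lo_pos : 0 < p.Lo
  two_le_Nb : 2 ≤ p.Nb
  one_le_Nr : 1 ≤ p.Nr
  pb_pos : 0 < p.pb
  wl_pos : 0 < p.wl
  delta_pos : 0 < p.delta
  alphaL_pos : 0 < p.alpha .L
  two_lt_alphaN : 2 < p.alpha .N
  one_le_m : ∀ v, 1 ≤ p.m v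

namespace Params

variable (p : Params)

/-- Blockage parameter `β`. -/
noncomputable def beta : ℝ := 2 * p.lamO * p.Lo / Real.pi

/-- Density of RISs. -/
noncomputable def lamR : ℝ := p.mu * p.lamO

/-- Reference path loss `ζ`. -/
noncomputable def zeta : ℝ := (p.wl / (4 * Real.pi)) ^ 2

/-- Effective antenna area of the user. -/
noncomputable def area : ℝ := p.wl ^ 2 / (4 * Real.pi)

/-- Probability that a link of length `t` is in state `v`. -/
noncomputable def linkProb : LinkState → ℝ → ℝ
  | .L, t => Real.exp (-p.beta * t)
  | .N, t => 1 - Real.exp (-p.beta * t)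

/-! ### Antenna pattern -/

/-- Gain of the uniform linear array at a spatial angle deviation `Δ`
(with the limit value where the quotient is `0 / 0`). -/
noncomputable def gainULA (Δ : ℝ) : ℝ :=
  if Real.sin (Real.pi * Δ) = 0 then (p.Nb : ℝ)
  else Real.sin (Real.pi * p.Nb * Δ) ^ 2 / (p.Nb * Real.sin (Real.pi * Δ) ^ 2)

/-- `Ñ_b = ⌊N_b / 2⌋ - 1`. -/
def NbT : ℕ := p.Nb / 2 - 1

/-- The levels `G_0, …, G_{Ñ_b}` and `G_{Ñ_b + 1} = 0` of the discrete antenna model. -/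
noncomputable def level (n : ℕ) : ℝ :=
  if n = 0 then p.delta / 2 * p.gainULA 0
  else if n ≤ p.NbT then p.delta / 2 * p.gainULA ((2 * n + 1) / (2 * p.Nb))
  else 0

/-- Discrete antenna model for a deviation of modulus `y ∈ [0, 1/2]`. -/
noncomputable def gainHalf (y : ℝ) : ℝ :=
  if y ≤ 1 / p.Nb then p.level 0
  else ∑ n ∈ Finset.Icc 1 p.NbT,
    if (n : ℝ) / p.Nb < y ∧ y ≤ ((n : ℝ) + 1) / p.Nb then p.level n else 0

/-- Discrete multi-lobe antenna model `G_B` on `[-1, 1]`. -/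
noncomputable def gainB (Δ : ℝ) : ℝ :=
  if |Δ| ≤ 1 / 2 then p.gainHalf |Δ|
  else if Δ < 0 then p.gainHalf |Δ + 1|
  else p.gainHalf |Δ - 1|

end Params

/-- Density of `cos φ / 2` for a uniform angle `φ`. -/
noncomputable def pdfPhi (x : ℝ) : ℝ :=
  if |x| ≤ 1 / 2 then 2 / (Real.pi * Real.sqrt (1 - 4 * x ^ 2)) else 0

/-- Density of the spatial angle deviation. -/
noncomputable def pdfDelta (y : ℝ) : ℝ :=
  if |y| ≤ 1 then ∫ x in (-(1 / 2 : ℝ))..(1 / 2), pdfPhi x * pdfPhi (y + x) else 0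

namespace Params

variable (p : Params)

/-- The formula for `p_n`, `n ≤ Ñ_b`. -/
noncomputable def gainProbAux (n : ℕ) : ℝ :=
  2 * (∫ y in ((n : ℝ) / p.Nb)..(((n : ℝ) + 1) / p.Nb), pdfDelta y) +
  2 * ∫ y in (1 - ((n : ℝ) + 1) / p.Nb)..(1 - (n : ℝ) / p.Nb), pdfDelta y

/-- The probability `p_n` of the beam gain `G_n`, `n ≤ Ñ_b + 1`. -/
noncomputable def gainProb (n : ℕ) : ℝ :=
  if n ≤ p.NbT then p.gainProbAux n
  else 1 - ∑ k ∈ Finset.range (p.NbT + 1), p.gainProbAux k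

/-- Mean beam gain. -/
noncomputable def meanGain : ℝ := ∑ n ∈ Finset.range (p.NbT + 1), p.level n * p.gainProb n

/-- `κ_v (x) = ∑_{n = 0}^{Ñ_b + 1} p_n (1 + x G_n / m_v) ^ (-m_v)`. -/
noncomputable def kappa (v : LinkState) (x : ℂ) : ℂ :=
  ∑ n ∈ Finset.range (p.NbT + 2),
    (p.gainProb n : ℂ) * (1 + x * (p.level n : ℂ) / (p.m v : ℂ)) ^ (-(p.m v : ℤ))

/-! ### Conditional Laplace transform and its inversion -/

/-- Laplace transform of the interfering power density over links in state `v`, when the serving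
base station is at distance `t`. -/
noncomputable def laplaceInterf (v : LinkState) (t : ℝ) (s : ℂ) : ℂ :=
  Complex.exp (-2 * Real.pi * p.lamB * ∫ d in Ioi t,
    (1 - p.kappa v (s * p.pb / (4 * Real.pi * (d ^ p.alpha v : ℝ)))) * d * (p.linkProb v d : ℂ))

/-- Conditional Laplace transform of the exposure, when the serving base station is at distance
`t` and the serving link has mean power `Pa` and shaping parameter `k`. -/
noncomputable def laplaceW (k : ℕ) (Pa t : ℝ) (s : ℂ) : ℂ :=
  (1 + s * Pa / (k * p.area)) ^ (-(k : ℤ)) * (p.laplaceInterf .L t s * p.laplaceInterf .N t s)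

/-- The integrand of the Gil-Pelaez inversion integral. -/
noncomputable def gilPelaezIntegrand (k : ℕ) (Pa t w x : ℝ) : ℝ :=
  1 / (Real.pi * x) *
    (Complex.exp (-Complex.I * x * w) * p.laplaceW k Pa t (-Complex.I * x)).im

/-- Gil-Pelaez inversion of the conditional Laplace transform, at the level `w`. -/
noncomputable def condCDF (k : ℕ) (Pa t w : ℝ) : ℝ :=
  1 / 2 - ∫ x in Ioi (0 : ℝ), p.gilPelaezIntegrand k Pa t w x

/-! ### Mean powers of the serving links -/

/-- Mean received power over a direct link of length `t` in state `v`. -/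
noncomputable def PaD (v : LinkState) (t : ℝ) : ℝ :=
  p.pb * p.Nb * p.zeta * t ^ (-p.alpha v)

/-- Mean received power over a cascaded link with RIS-user distance `tru` and BS-RIS
distance `tbr`. -/
noncomputable def PaCL (tru tbr : ℝ) : ℝ :=
  p.pb * p.Nb * (p.Nr : ℝ) ^ 2 * p.zeta * (tru * tbr) ^ (-p.alpha .L)

/-! ### Association probabilities and distance densities -/

end Params

/-- Third side of the triangle user, base station, RIS. -/
noncomputable def sideBR (tbu tru θ : ℝ) : ℝ :=
  Real.sqrt (tbu ^ 2 + tru ^ 2 - 2 * tbu * tru * Real.cos θ)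

/-- Probability of the reflection condition. -/
noncomputable def reflProb (tbu t θ : ℝ) : ℝ :=
  1 / 2 - 1 / (2 * Real.pi) * Real.arccos ((t - tbu * Real.cos θ) / sideBR tbu t θ)

namespace Params

variable (p : Params)

/-- `ā(t_bu, t)`: the integral over the angle of the probability that a RIS at distance `t`
provides a cascaded LoS link. -/
noncomputable def aBar (tbu t : ℝ) : ℝ :=
  ∫ θ in (-Real.pi)..Real.pi, p.linkProb .L t * reflProb tbu t θ

/-- Probability that a cascaded LoS link exists. -/
noncomputable def probCL (tbu : ℝ) : ℝ :=
  1 - Real.exp (-p.lamR * ∫ t in Ioi (0 : ℝ), p.aBar tbu t * t)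

/-- Association probabilities, given the BS-user distance. -/
noncomputable def assoc : LinkType → ℝ → ℝ
  | .DL, tbu => p.linkProb .L tbu
  | .CL, tbu => p.linkProb .N tbu * p.probCL tbu
  | .DN, tbu => p.linkProb .N tbu * (1 - p.probCL tbu)

/-- Density of the BS-user distance. -/
noncomputable def pdfBU (t : ℝ) : ℝ :=
  2 * Real.pi * p.lamB * t * Real.exp (-Real.pi * p.lamB * t ^ 2)

/-- Density of the RIS-user distance, given the BS-user distance. -/
noncomputable def pdfRU (tbu tru : ℝ) : ℝ :=
  p.lamR * tru * p.aBar tbu tru * Real.exp (-p.lamR * ∫ t in (0 : ℝ)..tru, p.aBar tbu t * t)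
    / p.probCL tbu

/-- Expectation over `t_bu` alone. -/
noncomputable def meanBU (g : ℝ → ℝ≥0∞) : ℝ≥0∞ :=
  ∫⁻ t in Ioi (0 : ℝ), g t * ENNReal.ofReal (p.pdfBU t)

/-- `E_{t_bu, t_ru, t_br} [A_DL gDL (t_bu) + A_CL gCL (t_bu, t_ru, t_br) + A_DN gDN (t_bu)]`,
the angle at the user being uniform on `(-π, π)`. -/
noncomputable def assocMean (gDL : ℝ → ℝ≥0∞) (gCL : ℝ → ℝ → ℝ → ℝ≥0∞) (gDN : ℝ → ℝ≥0∞) :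
    ℝ≥0∞ :=
  p.meanBU fun tbu =>
    ENNReal.ofReal (p.assoc .DL tbu) * gDL tbu +
    ENNReal.ofReal (p.assoc .CL tbu) *
      (∫⁻ tru in Ioi (0 : ℝ), ∫⁻ θ in Ioc (-Real.pi) Real.pi,
        gCL tbu tru (sideBR tbu tru θ) *
          ENNReal.ofReal (1 / (2 * Real.pi) * p.pdfRU tbu tru)) +
    ENNReal.ofReal (p.assoc .DN tbu) * gDN tbu

end Params

/-- Exponential integral `E_n (x) = ∫_1^∞ exp (-x t) / t ^ n dt`, for real order `n`. -/
noncomputable def expInt (n x : ℝ) : ℝ := ∫ t in Ioi (1 : ℝ), Real.exp (-x * t) / t ^ n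

/-! ### The random network

The plane is `ℂ` and the typical user is at the origin. -/

/-- A base station: its location, with independent marks. -/
abbrev BSPoint := ℂ × ℝ × ℝ × ℝ × ℝ × ℝ

/-- Location of the base station. -/
def BSPoint.loc (x : BSPoint) : ℂ := x.1
/-- Uniform variable deciding whether the interfering link is LoS. -/
def BSPoint.block (x : BSPoint) : ℝ := x.2.1
/-- Physical angle of departure towards the typical user. -/
def BSPoint.phi (x : BSPoint) : ℝ := x.2.2.1
/-- Physical angle of departure of the beam direction. -/
def BSPoint.phiStar (x : BSPoint) : ℝ := x.2.2.2.1
/-- Fading coefficient of the interfering link, if it is in state `v`. -/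
def BSPoint.fading (x : BSPoint) : LinkState → ℝ
  | .L => x.2.2.2.2.1
  | .N => x.2.2.2.2.2

/-- A RIS: its location, with independent marks. -/
abbrev RISPoint := ℂ × ℝ × ℝ

/-- Location of the RIS. -/
def RISPoint.loc (r : RISPoint) : ℂ := r.1
/-- Uniform variable deciding whether the RIS-user link is LoS. -/
def RISPoint.block (r : RISPoint) : ℝ := r.2.1
/-- Unit normal of the front side of the RIS. -/
noncomputable def RISPoint.normal (r : RISPoint) : ℂ := Complex.exp (r.2.2 * Complex.I)

namespace Params

variable (p : Params)

/-- Intensity of the independently marked homogeneous Poisson process of base stations. -/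
noncomputable def bsIntensity : Measure BSPoint :=
  (ENNReal.ofReal p.lamB • (volume : Measure ℂ)).prod
    ((uniform 0 1).prod ((uniform 0 (2 * Real.pi)).prod ((uniform 0 (2 * Real.pi)).prod
      ((fadingLaw (p.m .L)).prod (fadingLaw (p.m .N))))))

/-- Intensity of the independently marked homogeneous Poisson process of RISs
(uniform orientation). -/
noncomputable def risIntensity : Measure RISPoint :=
  (ENNReal.ofReal p.lamR • (volume : Measure ℂ)).prod
    ((uniform 0 1).prod (uniform 0 (2 * Real.pi)))

/-- The base station `x` is seen by the user through a link in state `v`. -/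
def InState (x : BSPoint) : LinkState → Prop
  | .L => x.block ≤ p.linkProb .L ‖x.loc‖
  | .N => ¬ x.block ≤ p.linkProb .L ‖x.loc‖

/-- The RIS `r` provides a cascaded LoS link between the user and a base station at `b`: the
RIS-user link is LoS, and the user and the base station are both in front of the RIS. -/
noncomputable def Usable (b : ℂ) (r : RISPoint) : Prop :=
  r.block ≤ p.linkProb .L ‖r.loc‖ ∧
    0 < inner ℝ r.normal (0 - r.loc) ∧ 0 < inner ℝ r.normal (b - r.loc)

end Params

/-- The random elements of the downlink. -/
structure Network (Ω : Type*) where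
  /-- base stations -/
  bs : Ω → Set BSPoint
  /-- RISs -/
  ris : Ω → Set RISPoint
  /-- uniform variable deciding whether the direct serving link is LoS -/
  block₀ : Ω → ℝ
  /-- angle between the user-BS and the user-RIS serving links -/
  theta₀ : Ω → ℝ
  /-- fading coefficient of the serving link, if it is of type `q` -/
  H : LinkType → Ω → ℝ

/-- State (hence fading parameter) of the links of a given type. -/
def LinkType.state : LinkType → LinkState
  | .DL => .L
  | .CL => .L
  | .DN => .N

/-- The joint law of the random elements of the downlink. -/
structure Network.IsModel {Ω : Type*} [MeasurableSpace Ω] (X : Network Ω) (p : Params)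
    (P : Measure Ω) : Prop where
  bs_poisson : IsPoissonProcess X.bs p.bsIntensity P
  ris_poisson : IsPoissonProcess X.ris p.risIntensity P
  block_meas : Measurable X.block₀
  block_law : P.map X.block₀ = uniform 0 1
  theta_meas : Measurable X.theta₀
  theta_law : P.map X.theta₀ = uniform (-Real.pi) Real.pi
  H_meas : ∀ q, Measurable (X.H q)
  H_law : ∀ q, P.map (X.H q) = fadingLaw (p.m q.state)
  indep : iIndep ![sigmaAlg X.bs, sigmaAlg X.ris,
    MeasurableSpace.comap X.block₀ inferInstance, MeasurableSpace.comap X.theta₀ inferInstance,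
    MeasurableSpace.comap (X.H .DL) inferInstance, MeasurableSpace.comap (X.H .CL) inferInstance,
    MeasurableSpace.comap (X.H .DN) inferInstance] P

namespace Network

variable {Ω : Type*} (X : Network Ω) (p : Params)

/-- The tagged base station: the one nearest to the user. -/
noncomputable def tagged (ω : Ω) : BSPoint :=
  Classical.epsilon fun x => x ∈ X.bs ω ∧ ∀ y ∈ X.bs ω, ‖x.loc‖ ≤ ‖y.loc‖

/-- BS-user distance. -/
noncomputable def tbu (ω : Ω) : ℝ := ‖(X.tagged ω).loc‖

/-- The RISs that provide a cascaded LoS link. -/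
def usableRIS (ω : Ω) : Set RISPoint := {r ∈ X.ris ω | p.Usable (X.tagged ω).loc r}

/-- RIS-user distance: distance to the nearest RIS that provides a cascaded LoS link. -/
noncomputable def tru (ω : Ω) : ℝ := sInf ((fun r : RISPoint => ‖r.loc‖) '' X.usableRIS p ω)

/-- BS-RIS distance. -/
noncomputable def tbr (ω : Ω) : ℝ := sideBR (X.tbu ω) (X.tru p ω) (X.theta₀ ω)

open Classical in
/-- Type of the serving link. -/
noncomputable def link (ω : Ω) : LinkType :=
  if X.block₀ ω ≤ p.linkProb .L (X.tbu ω) then .DL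
  else if (X.usableRIS p ω).Nonempty then .CL
  else .DN

/-- Mean serving power `P^a_q`. -/
noncomputable def Pa : LinkType → Ω → ℝ
  | .DL, ω => p.PaD .L (X.tbu ω)
  | .CL, ω => p.PaCL (X.tru p ω) (X.tbr p ω)
  | .DN, ω => p.PaD .N (X.tbu ω)

/-- Serving power density `W_{1,q}`, if the serving link is of type `q`. -/
noncomputable def W1q (q : LinkType) (ω : Ω) : ℝ≥0∞ :=
  ENNReal.ofReal (X.Pa p q ω * X.H q ω / p.area)

/-- Interfering power density over links in state `v`. -/
noncomputable def Wb (v : LinkState) (ω : Ω) : ℝ≥0∞ :=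
  ∑' x : ↥({x ∈ X.bs ω | p.InState x v} \ {X.tagged ω}),
    ENNReal.ofReal (p.pb * p.gainB (Real.cos x.1.phi / 2 - Real.cos x.1.phiStar / 2) * p.zeta *
      ‖x.1.loc‖ ^ (-p.alpha v) * x.1.fading v / p.area)

/-- Interfering power density `W_2`. -/
noncomputable def W2 (ω : Ω) : ℝ≥0∞ := X.Wb p .L ω + X.Wb p .N ω

/-- Exposure `W_q`, if the serving link is of type `q`. -/
noncomputable def Wq (q : LinkType) (ω : Ω) : ℝ≥0∞ := X.W1q p q ω + X.W2 p ω

/-- Serving power density. -/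
noncomputable def W1 (ω : Ω) : ℝ≥0∞ := X.W1q p (X.link p ω) ω

/-- Exposure. -/
noncomputable def W (ω : Ω) : ℝ≥0∞ := X.Wq p (X.link p ω) ω

/-- The event that the serving link is of type `q`. -/
def ev (q : LinkType) : Set Ω := {ω | X.link p ω = q}

end Network

/-- Values of the exposure that are at most `w`. -/
def atMost (w : ℝ) : Set ℝ≥0∞ := {y | (y : EReal) ≤ (w : EReal)}

/-- Laplace transform at `s` of a law on `[0, ∞]`. -/
noncomputable def laplace (ν : Measure ℝ≥0∞) (s : ℂ) : ℂ :=
  ∫ y, Complex.exp (-s * (y.toReal : ℂ)) ∂ν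

end EMF

open EMF

/-! Everything is read off one type of formula. On the event that the serving link has a given type,
the integral of an arbitrary measurable function `G` of the serving distances, the interference and
the serving fading equals an explicit iterated integral (`lintegral_ev_DL`, `lintegral_ev_CL`,
`lintegral_ev_DN`). Uniqueness of disintegration then identifies the conditional laws
(`condDistrib_exposure`). Particular choices of `G`, summed over the three types
(`lintegral_eq_assocMean`), give the distribution function and the mean of the serving power. The
mean of the interference follows from its joint law with the nearest distance, described next.

The probabilistic core is that, given that the nearest station lies at distance `t`, the stations
beyond `t` are distributed as those of the unconditioned Poisson process beyond `t`. To prove it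
without conditioning on a null event, the distance is placed in a cell `(r, R]`. This event depends
on the points inside the disk of radius `R` only, hence is independent of what lies outside.
Refining the cells, and using that the power received from beyond a threshold is monotone and
right-continuous in the threshold, gives the joint law of distance and interference as a composition
product (`map_nearest_interf`).

For fixed `t` the interference is a linear functional of a Poisson process. Its transform is the
exponential of an integral over the intensity (`integral_exp_lintegral`) and its mean is given by
Campbell's formula. Averaging over the marks turns the blockage variable into the LoS and NLoS
weights, the two antenna angles into the finite gain law (`lintegral_gainB`), and the fading into
rational Gamma transforms. Polar coordinates do the rest. The usable RISs are an independent
thinning whose intensity at distance `t` comes from the overlap of two half-circles of orientations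
(`uniform_inner_pos`, `risIntensity_usable`). Void probabilities then give the probability that one
exists and the law of the nearest distance (`map_risDist`).

For the distribution functions, the conditional exposure at fixed positive distance and power has a
finite mean, which controls the inversion integrand near `0`. The Gamma factor of the serving link
bounds the transform by a constant over `x` at infinity and excludes atoms. So the Gil-Pelaez
formula holds with absolute convergence at every level (`gilPelaez`, `norm_laplaceW_le`,
`exposureLaw_toReal_eq`).

Two devices take care of measurability. The tagged station is a choice function, replaced by the
measurable `nearest`, which agrees with it on an event of probability one. Point processes are
treated as random measures and passed through an s-finite kernel that fixes almost all of them
(`regularKernel`), which makes integrals jointly measurable in a parameter and the process. -/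

namespace EMF

/-! ### Poisson processes as random measures: counts, means, Campbell's formula. -/

section Poisson

open Filter Topology

variable {Ω X : Type*} [mX : MeasurableSpace X]

/-- The counting measure of the random set `Φ`. -/
noncomputable def pointMeasure (Φ : Ω → Set X) (ω : Ω) : Measure X :=
  Measure.count.restrict (Φ ω)

theorem pointMeasure_apply [MeasurableSingletonClass X] {Φ : Ω → Set X} {ω : Ω}
    (hc : (Φ ω).Countable) {A : Set X} (hA : MeasurableSet A) :
    pointMeasure Φ ω A = (count Φ A ω : ℝ≥0∞) := by
  rw [pointMeasure, Measure.restrict_apply hA, Measure.count_apply (hA.inter hc.measurableSet),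
    count, inter_comm]

theorem lintegral_pointMeasure [MeasurableSingletonClass X] {Φ : Ω → Set X} {ω : Ω}
    (hc : (Φ ω).Countable) (f : X → ℝ≥0∞) :
    ∫⁻ x, f x ∂pointMeasure Φ ω = ∑' x : Φ ω, f x := by
  rw [pointMeasure, lintegral_countable _ hc]
  simp

/-- The sigma-algebra on `Ω` is left free because two are needed: the ambient one, and `sigmaAlg Φ`,
in terms of which the independence of the network's random elements is stated. -/
theorem measurable_pointMeasure_of_count [MeasurableSpace Ω] [MeasurableSingletonClass X] {Φ : Ω → Set X}
    (hc : ∀ ω, (Φ ω).Countable) (hm : ∀ A, MeasurableSet A → Measurable (count Φ A)) :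
    Measurable (pointMeasure Φ) := by
  refine Measure.measurable_of_measurable_coe _ fun A hA => ?_
  simp_rw [fun ω => pointMeasure_apply (hc ω) hA]
  exact (Measurable.of_discrete (f := fun n : ℕ∞ => (n : ℝ≥0∞))).comp (hm A hA)

theorem measurable_pointMeasure_sigmaAlg [MeasurableSingletonClass X] {Φ : Ω → Set X}
    (hc : ∀ ω, (Φ ω).Countable) : Measurable[sigmaAlg Φ] (pointMeasure Φ) := by
  refine @measurable_pointMeasure_of_count Ω X _ (sigmaAlg Φ) _ Φ hc fun A hA => ?_
  exact Measurable.of_comap_le (le_iSup₂_of_le A hA le_rfl)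

/-- On the right half-plane the derivative of `exp (-w)` has modulus at most `1`, so the mean value
inequality on this convex set applies. This is the bound that turns integrability of a power into
integrability of its Laplace exponent. -/
theorem norm_one_sub_cexp_neg_le {z : ℂ} (hz : 0 ≤ z.re) : ‖1 - Complex.exp (-z)‖ ≤ ‖z‖ := by
  have hconv : Convex ℝ {w : ℂ | 0 ≤ w.re} := convex_halfSpace_re_ge 0
  have := hconv.norm_image_sub_le_of_norm_hasDerivWithin_le (f := fun w => Complex.exp (-w))
    (f' := fun w => Complex.exp (-w) * (-1)) (C := 1) (x := z) (y := 0)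
    (fun w _ => ((hasDerivAt_neg w).cexp).hasDerivWithinAt)
    (fun w hw => by
      simp only [mul_neg, mul_one, norm_neg, Complex.norm_exp, Complex.neg_re]
      exact Real.exp_le_one_iff.2 (neg_nonpos.2 hw)) hz (by simp)
  simpa using this

theorem norm_cexp_neg_le_one {z : ℂ} (hz : 0 ≤ z.re) : ‖Complex.exp (-z)‖ ≤ 1 := by
  rw [Complex.norm_exp, Complex.neg_re]
  exact Real.exp_le_one_iff.2 (neg_nonpos.2 hz)

namespace IsPoissonProcess

variable [MeasurableSpace Ω] {Φ : Ω → Set X} {Λ : Measure X} {P : Measure Ω}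

theorem measurable_pointMeasure [MeasurableSingletonClass X] (h : IsPoissonProcess Φ Λ P) :
    Measurable (pointMeasure Φ) :=
  measurable_pointMeasure_of_count h.countable h.measurable_count

theorem prob_count_eq (h : IsPoissonProcess Φ Λ P) {A : Set X} (hA : MeasurableSet A)
    (hΛ : Λ A ≠ ∞) (n : ℕ) :
    P {ω | count Φ A ω = n} = poissonMeasure (Λ A).toNNReal {n} := by
  rw [h.poisson A hA hΛ n, poissonMeasure_singleton]
  rfl

/-- The model prescribes only the probabilities of finite counts. As Poisson weights sum to `1`,
nothing is left for the value `⊤`. -/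
theorem count_lt_top [IsProbabilityMeasure P] (h : IsPoissonProcess Φ Λ P) {A : Set X}
    (hA : MeasurableSet A) (hΛ : Λ A ≠ ∞) : ∀ᵐ ω ∂P, count Φ A ω < ⊤ := by
  have hm : ∀ n : ℕ, MeasurableSet {ω | count Φ A ω = n} := fun n =>
    h.measurable_count A hA (measurableSet_singleton (n : ℕ∞))
  have h1 : P (⋃ n : ℕ, {ω | count Φ A ω = n}) = 1 := by
    rw [measure_iUnion _ hm]
    · simp_rw [h.prob_count_eq hA hΛ]
      rw [← measure_iUnion _ (fun _ => measurableSet_singleton _)]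
      · rw [iUnion_of_singleton]; exact measure_univ
      · intro i j hij; exact Set.disjoint_singleton.2 hij
    · intro i j hij
      rw [Function.onFun, Set.disjoint_left]
      rintro ω (h1 : _ = _) (h2 : _ = _)
      exact hij (by exact_mod_cast h1.symm.trans h2)
  have h2 := (prob_compl_eq_zero_iff (MeasurableSet.iUnion hm)).2 h1
  filter_upwards [measure_eq_zero_iff_ae_notMem.1 h2] with ω hω
  simp only [mem_compl_iff, mem_iUnion, not_exists, not_forall, not_not] at hω
  obtain ⟨n, hn⟩ := hω
  rw [show count Φ A ω = n from hn]
  exact ENat.natCast_lt_top n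

theorem map_toNat_count [IsProbabilityMeasure P] (h : IsPoissonProcess Φ Λ P) {A : Set X}
    (hA : MeasurableSet A) (hΛ : Λ A ≠ ∞) :
    P.map (fun ω => (count Φ A ω).toNat) = poissonMeasure (Λ A).toNNReal := by
  have hmeas : Measurable (fun ω => (count Φ A ω).toNat) :=
    (Measurable.of_discrete (f := ENat.toNat)).comp (h.measurable_count A hA)
  refine Measure.ext_of_singleton fun n => ?_
  rw [Measure.map_apply hmeas (measurableSet_singleton n), ← h.prob_count_eq hA hΛ n]
  refine measure_congr ?_
  filter_upwards [h.count_lt_top hA hΛ] with ω hω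
  refine propext ⟨fun (e : _ = _) => ?_, fun (e : _ = _) => ?_⟩
  · change count Φ A ω = n
    rw [← e, ENat.natCast_toNat hω.ne]
  · change (count Φ A ω).toNat = n
    rw [e, ENat.toNat_natCast]

theorem integral_exp_count [IsProbabilityMeasure P] (h : IsPoissonProcess Φ Λ P) {A : Set X}
    (hA : MeasurableSet A) (hΛ : Λ A ≠ ∞) (z : ℂ) :
    ∫ ω, Complex.exp (-z * ((count Φ A ω).toNat : ℂ)) ∂P =
      Complex.exp (-((Λ A).toReal * (1 - Complex.exp (-z)))) := by
  have hmeas : Measurable (fun ω => (count Φ A ω).toNat) :=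
    (Measurable.of_discrete (f := ENat.toNat)).comp (h.measurable_count A hA)
  have := integral_map (μ := P) hmeas.aemeasurable
    (f := fun n : ℕ => Complex.exp (-z * (n : ℂ))) .of_discrete
  rw [← this, h.map_toNat_count hA hΛ, integral_poissonMeasure]
  set r := (Λ A).toNNReal
  have hr : ((Λ A).toReal : ℂ) = ((r : ℝ) : ℂ) := rfl
  rw [hr]
  calc ∑' n : ℕ, (Real.exp (-r) * (r : ℝ) ^ n / n.factorial) • Complex.exp (-z * n)
      = ∑' n : ℕ, (Real.exp (-r) : ℂ) * (((r : ℝ) * Complex.exp (-z)) ^ n / n.factorial) := by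
        congr with n
        rw [Complex.real_smul]
        push_cast
        rw [mul_pow, ← Complex.exp_nat_mul]
        ring_nf
    _ = (Real.exp (-r) : ℂ) * Complex.exp ((r : ℝ) * Complex.exp (-z)) := by
        rw [tsum_mul_left, (NormedSpace.expSeries_div_hasSum_exp _).tsum_eq, Complex.exp_eq_exp_ℂ]
    _ = _ := by
        rw [Complex.ofReal_exp, ← Complex.exp_add]
        push_cast
        ring_nf

theorem lintegral_count_eq [IsProbabilityMeasure P] (h : IsPoissonProcess Φ Λ P) {A : Set X}
    (hA : MeasurableSet A) (hΛ : Λ A ≠ ∞) :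
    ∫⁻ ω, (count Φ A ω : ℝ≥0∞) ∂P = Λ A := by
  have hmeas : Measurable (fun ω => (count Φ A ω).toNat) :=
    (Measurable.of_discrete (f := ENat.toNat)).comp (h.measurable_count A hA)
  have e : ∫⁻ ω, (count Φ A ω : ℝ≥0∞) ∂P =
      ∫⁻ n : ℕ, (n : ℝ≥0∞) ∂(P.map (fun ω => (count Φ A ω).toNat)) := by
    rw [lintegral_map .of_discrete hmeas]
    refine lintegral_congr_ae ?_
    filter_upwards [h.count_lt_top hA hΛ] with ω hω
    obtain ⟨n, hn⟩ := ENat.ne_top_iff_exists.1 hω.ne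
    rw [← hn]; simp
  rw [e, h.map_toNat_count hA hΛ, lintegral_countable']
  set r := (Λ A).toNNReal
  have hr : Λ A = ENNReal.ofReal r := by
    rw [ENNReal.ofReal_coe_nnreal]; exact (ENNReal.coe_toNNReal hΛ).symm
  rw [hr, tsum_eq_zero_add' ENNReal.summable]
  simp only [Nat.cast_zero, zero_mul, zero_add]
  -- Poisson weights satisfy `(n + 1) P(n + 1) = r P(n)`, so the mean is `r` times the total mass.
  have hs : ∀ n : ℕ, ((n + 1 : ℕ) : ℝ≥0∞) * poissonMeasure r {n + 1} =
      ENNReal.ofReal r * poissonMeasure r {n} := by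
    intro n
    rw [poissonMeasure_singleton, poissonMeasure_singleton, ← ENNReal.ofReal_natCast,
      ← ENNReal.ofReal_mul (by positivity), ← ENNReal.ofReal_mul (by positivity)]
    congr 1
    rw [Nat.factorial_succ, pow_succ]
    push_cast
    field_simp
  simp_rw [hs]
  rw [ENNReal.tsum_mul_left]
  have : ∑' n : ℕ, poissonMeasure r {n} = 1 := by
    have := lintegral_countable' (μ := poissonMeasure r) (fun _ => 1)
    simpa using this.symm
  rw [this, mul_one]

/-- Mean counts are known only for sets of finite intensity, so the two measures are compared on
each set of an exhaustion. -/
theorem bind_pointMeasure [MeasurableSingletonClass X] [IsProbabilityMeasure P] [SigmaFinite Λ]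
    (h : IsPoissonProcess Φ Λ P) : P.bind (pointMeasure Φ) = Λ := by
  refine Measure.ext_of_iUnion_eq_univ (iUnion_spanningSets Λ) fun i => ?_
  ext A hA
  rw [Measure.restrict_apply hA, Measure.restrict_apply hA,
    Measure.bind_apply (hA.inter (measurableSet_spanningSets Λ i))
      h.measurable_pointMeasure.aemeasurable]
  simp_rw [fun ω => pointMeasure_apply (h.countable ω) (hA.inter (measurableSet_spanningSets Λ i))]
  refine h.lintegral_count_eq (hA.inter (measurableSet_spanningSets Λ i)) ?_
  exact ((measure_mono inter_subset_right).trans_lt (measure_spanningSets_lt_top Λ i)).ne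

/-- Campbell's formula. -/
theorem lintegral_lintegral_pointMeasure [MeasurableSingletonClass X] [IsProbabilityMeasure P]
    [SigmaFinite Λ] (h : IsPoissonProcess Φ Λ P) {f : X → ℝ≥0∞} (hf : Measurable f) :
    ∫⁻ ω, ∫⁻ x, f x ∂pointMeasure Φ ω ∂P = ∫⁻ x, f x ∂Λ := by
  rw [← Measure.lintegral_bind h.measurable_pointMeasure.aemeasurable hf.aemeasurable,
    h.bind_pointMeasure]

theorem iIndepFun_count (h : IsPoissonProcess Φ Λ P) {ι : Type*} [Fintype ι] {A : ι → Set X}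
    (hA : ∀ i, MeasurableSet (A i)) (hd : Pairwise (fun i j => Disjoint (A i) (A j))) :
    iIndepFun (fun i => count Φ (A i)) P := by
  let e := Fintype.equivFin ι
  have := h.indep (Fintype.card ι) (fun k => A (e.symm k)) (fun k => hA _)
    (fun k l hkl => hd (e.symm.injective.ne hkl))
  have h2 := this.precomp e.injective
  simpa [Function.comp_def] using h2

end IsPoissonProcess

end Poisson

/-! ### Laplace functional, and independence of the process inside and outside a set. -/

section PoissonFunctional

open Filter Topology

variable {Ω X : Type*} [mX : MeasurableSpace X] [MeasurableSpace Ω]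
  {Φ : Ω → Set X} {Λ : Measure X} {P : Measure Ω} [IsProbabilityMeasure P]

theorem integrable_one_sub_cexp {f : X → ℝ≥0∞} (hf : Measurable f) (hfi : ∫⁻ x, f x ∂Λ ≠ ∞)
    {s : ℂ} (hs : 0 ≤ s.re) :
    Integrable (fun x => 1 - Complex.exp (-(s * ((f x).toReal : ℂ)))) Λ := by
  have h1 : Integrable (fun x => (f x).toReal) Λ := integrable_toReal_of_lintegral_ne_top
    hf.aemeasurable hfi
  refine (h1.const_mul ‖s‖).mono ?_ (ae_of_all _ fun x => ?_)
  · exact (by fun_prop : Measurable _).aestronglyMeasurable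
  · refine (norm_one_sub_cexp_neg_le ?_).trans (le_of_eq ?_)
    · simpa using mul_nonneg hs ENNReal.toReal_nonneg
    · simp

/-- The integral of a simple function against the process is a finite combination of counts of its
level sets. These are disjoint, so the counts are independent Poisson variables and the transform
factorises. Integrability makes the mass of each nonzero level finite; the zero level, possibly of
infinite mass, contributes the factor `1`. -/
theorem IsPoissonProcess.integral_exp_simpleFunc [MeasurableSingletonClass X] (h : IsPoissonProcess Φ Λ P)
    (f : SimpleFunc X ℝ≥0∞) (hf : ∀ x, f x < ∞) (hfi : ∫⁻ x, f x ∂Λ ≠ ∞) (s : ℂ) :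
    ∫ ω, Complex.exp (-(s * ((∫⁻ x, f x ∂pointMeasure Φ ω).toReal : ℂ))) ∂P =
      Complex.exp (-∫ x, (1 - Complex.exp (-(s * ((f x).toReal : ℂ)))) ∂Λ) := by
  classical
  have hfin : ∀ c ∈ f.range, c ≠ 0 → Λ (f ⁻¹' {c}) ≠ ∞ := by
    intro c hc h0 htop
    have : c * Λ (f ⁻¹' {c}) ≤ ∫⁻ x, f x ∂Λ := by
      refine le_trans (mul_le_mul_right (measure_mono ?_) _)
        (mul_meas_ge_le_lintegral₀ f.measurable.aemeasurable c)
      intro x hx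
      exact (mem_singleton_iff.1 hx).ge
    rw [htop, ENNReal.mul_top h0] at this
    exact hfi (top_le_iff.1 this)
  have hmeasA : ∀ c, MeasurableSet (f ⁻¹' {c}) := fun c => f.measurableSet_preimage _
  have hind := h.iIndepFun_count (ι := f.range) (A := fun c => f ⁻¹' {(c : ℝ≥0∞)})
    (fun c => hmeasA c) (fun c d hcd => by
      refine Set.disjoint_left.2 fun x hx hx' => hcd ?_
      exact Subtype.ext ((mem_singleton_iff.1 hx).symm.trans (mem_singleton_iff.1 hx')))
  have hind' := (hind.comp (fun (c : f.range) (n : ℕ∞) =>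
      Complex.exp (-(s * ((c : ℝ≥0∞).toReal : ℂ)) * (n.toNat : ℂ)))
    (fun _ => .of_discrete)).integral_fun_prod_eq_prod_integral (fun c => by
      refine Measurable.aestronglyMeasurable ?_
      exact (Measurable.of_discrete (f := fun n : ℕ∞ =>
        Complex.exp (-(s * ((c : ℝ≥0∞).toReal : ℂ)) * (n.toNat : ℂ)))).comp
        (h.measurable_count _ (hmeasA c)))
  have hleft : ∀ᵐ ω ∂P, Complex.exp (-(s * ((∫⁻ x, f x ∂pointMeasure Φ ω).toReal : ℂ))) =
      ∏ c : f.range, Complex.exp (-(s * ((c : ℝ≥0∞).toReal : ℂ)) *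
        ((count Φ (f ⁻¹' {(c : ℝ≥0∞)}) ω).toNat : ℂ)) := by
    have hae : ∀ᵐ ω ∂P, ∀ c : f.range, (c : ℝ≥0∞) ≠ 0 → count Φ (f ⁻¹' {(c : ℝ≥0∞)}) ω < ⊤ := by
      rw [ae_all_iff]
      intro c
      by_cases hc0 : (c : ℝ≥0∞) = 0
      · simp [hc0]
      · filter_upwards [h.count_lt_top (hmeasA c) (hfin c c.2 hc0)] with ω hω _ using hω
    filter_upwards [hae] with ω hω
    rw [← Complex.exp_sum]
    congr 1
    rw [SimpleFunc.lintegral_eq_lintegral, SimpleFunc.lintegral]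
    simp_rw [fun c => pointMeasure_apply (h.countable ω) (hmeasA c)]
    have hterm : ∀ c ∈ f.range, c * (count Φ (f ⁻¹' {c}) ω : ℝ≥0∞) ≠ ∞ := by
      intro c hc
      by_cases hc0 : c = 0
      · simp [hc0]
      · obtain ⟨x, rfl⟩ := SimpleFunc.mem_range.1 hc
        refine ENNReal.mul_ne_top (hf x).ne ?_
        exact (ENat.toENNReal_lt_top.2 (hω ⟨_, hc⟩ hc0)).ne
    rw [ENNReal.toReal_sum hterm, ← Finset.sum_coe_sort]
    push_cast
    rw [Finset.mul_sum, ← Finset.sum_neg_distrib]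
    refine Finset.sum_congr rfl fun c _ => ?_
    by_cases hc0 : (c : ℝ≥0∞) = 0
    · simp [hc0]
    · obtain ⟨n, hn⟩ := ENat.ne_top_iff_exists.1 (hω c hc0).ne
      rw [← hn]
      simp only [ENat.toENNReal_coe, ENNReal.toReal_mul, ENNReal.toReal_natCast, ENat.toNat_natCast]
      push_cast
      ring
  rw [integral_congr_ae hleft]
  refine hind'.trans ?_
  have hright : ∫ x, (1 - Complex.exp (-(s * ((f x).toReal : ℂ)))) ∂Λ =
      ∑ c : f.range, ((Λ (f ⁻¹' {(c : ℝ≥0∞)})).toReal *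
        (1 - Complex.exp (-(s * ((c : ℝ≥0∞).toReal : ℂ))))) := by
    have e1 : ∀ x, (1 - Complex.exp (-(s * ((f x).toReal : ℂ)))) =
        ∑ c : f.range, (f ⁻¹' {(c : ℝ≥0∞)}).indicator
          (fun _ => 1 - Complex.exp (-(s * ((c : ℝ≥0∞).toReal : ℂ)))) x := by
      intro x
      rw [Finset.sum_eq_single (⟨f x, f.mem_range_self x⟩ : f.range)]
      · simp
      · intro c _ hc
        refine indicator_of_notMem ?_ _
        intro hx
        exact hc (Subtype.ext (mem_singleton_iff.1 hx).symm)
      · simp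
    simp_rw [e1]
    rw [integral_finsetSum]
    · refine Finset.sum_congr rfl fun c _ => ?_
      rw [integral_indicator_const _ (hmeasA c), measureReal_def, Complex.real_smul]
    · intro c _
      by_cases hc0 : (c : ℝ≥0∞) = 0
      · simp [hc0]
      · exact (integrable_indicator_iff (hmeasA c)).2
          (integrableOn_const (hfin c c.2 hc0))
  rw [hright, ← Finset.sum_neg_distrib, Complex.exp_sum]
  refine Finset.prod_congr rfl fun c _ => ?_
  by_cases hc0 : (c : ℝ≥0∞) = 0
  · simp [hc0]
  · exact h.integral_exp_count (hmeasA c) (hfin c c.2 hc0) _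

/-- The Laplace functional of a Poisson process. -/
theorem IsPoissonProcess.integral_exp_lintegral [MeasurableSingletonClass X] [SigmaFinite Λ] (h : IsPoissonProcess Φ Λ P)
    {f : X → ℝ≥0∞} (hf : Measurable f) (hfi : ∫⁻ x, f x ∂Λ ≠ ∞) {s : ℂ} (hs : 0 ≤ s.re) :
    ∫ ω, Complex.exp (-(s * ((∫⁻ x, f x ∂pointMeasure Φ ω).toReal : ℂ))) ∂P =
      Complex.exp (-∫ x, (1 - Complex.exp (-(s * ((f x).toReal : ℂ)))) ∂Λ) := by
  have hmg : ∀ {g : X → ℝ≥0∞}, Measurable g →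
      Measurable fun ω => ∫⁻ x, g x ∂pointMeasure Φ ω := fun hg =>
    (Measure.measurable_lintegral hg).comp h.measurable_pointMeasure
  have hle : ∀ n x, SimpleFunc.eapprox f n x ≤ f x := fun n x => by
    rw [← SimpleFunc.iSup_eapprox_apply hf x]
    exact le_iSup (fun n => (SimpleFunc.eapprox f n : X → ℝ≥0∞) x) n
  have hnat : ∀ {y : ℝ}, 0 ≤ y → 0 ≤ (s * (y : ℂ)).re := fun hy => by
    simpa using mul_nonneg hs hy
  have hlt : ∀ᵐ ω ∂P, ∫⁻ x, f x ∂pointMeasure Φ ω < ∞ := by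
    refine ae_lt_top (hmg hf) ?_
    rwa [h.lintegral_lintegral_pointMeasure hf]
  have hfae : ∀ᵐ x ∂Λ, f x < ∞ := ae_lt_top hf hfi
  -- Simple functions increase to `f`. The random integral converges by monotone convergence, then
  -- the expectation by domination by `1`, and the exponent by domination by `‖s‖ f`, which is where
  -- `0 ≤ s.re` is used.
  have hL : Tendsto (fun n => ∫ ω, Complex.exp
      (-(s * ((∫⁻ x, SimpleFunc.eapprox f n x ∂pointMeasure Φ ω).toReal : ℂ))) ∂P) atTop
      (𝓝 (∫ ω, Complex.exp (-(s * ((∫⁻ x, f x ∂pointMeasure Φ ω).toReal : ℂ))) ∂P)) := by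
    refine tendsto_integral_of_dominated_convergence (fun _ => 1) (fun n => ?_)
      (integrable_const _) (fun n => ae_of_all _ fun ω => ?_) ?_
    · have := hmg (SimpleFunc.eapprox f n).measurable
      exact (by fun_prop : Measurable _).aestronglyMeasurable
    · exact norm_cexp_neg_le_one (hnat ENNReal.toReal_nonneg)
    · filter_upwards [hlt] with ω hω
      have h1 : Tendsto (fun n => ∫⁻ x, SimpleFunc.eapprox f n x ∂pointMeasure Φ ω) atTop
          (𝓝 (∫⁻ x, f x ∂pointMeasure Φ ω)) :=
        lintegral_tendsto_of_tendsto_of_monotone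
          (fun n => (SimpleFunc.eapprox f n).measurable.aemeasurable)
          (ae_of_all _ fun x => fun i j hij => SimpleFunc.monotone_eapprox f hij x)
          (ae_of_all _ fun x => SimpleFunc.tendsto_eapprox hf x)
      have h2 := (ENNReal.tendsto_toReal hω.ne).comp h1
      have h3 : Continuous fun y : ℝ => Complex.exp (-(s * (y : ℂ))) := by fun_prop
      exact (h3.tendsto _).comp h2
  have hR : Tendsto (fun n => ∫ x, (1 - Complex.exp
      (-(s * ((SimpleFunc.eapprox f n x).toReal : ℂ)))) ∂Λ) atTop
      (𝓝 (∫ x, (1 - Complex.exp (-(s * ((f x).toReal : ℂ)))) ∂Λ)) := by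
    have hint : Integrable (fun x => (f x).toReal) Λ :=
      integrable_toReal_of_lintegral_ne_top hf.aemeasurable hfi
    refine tendsto_integral_of_dominated_convergence (fun x => ‖s‖ * (f x).toReal) (fun n => ?_)
      (hint.const_mul _) (fun n => ?_) ?_
    · have := (SimpleFunc.eapprox f n).measurable
      exact (by fun_prop : Measurable _).aestronglyMeasurable
    · filter_upwards [hfae] with x hx
      refine (norm_one_sub_cexp_neg_le (hnat ENNReal.toReal_nonneg)).trans ?_
      rw [norm_mul, Complex.norm_real, Real.norm_of_nonneg ENNReal.toReal_nonneg]
      gcongr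
      · exact hx.ne
      · exact hle n x
    · filter_upwards [hfae] with x hx
      have h2 := (ENNReal.tendsto_toReal hx.ne).comp (SimpleFunc.tendsto_eapprox hf x)
      have h3 : Continuous fun y : ℝ => 1 - Complex.exp (-(s * (y : ℂ))) := by fun_prop
      exact (h3.tendsto _).comp h2
  refine tendsto_nhds_unique hL ?_
  have := (Complex.continuous_exp.tendsto _).comp hR.neg
  refine this.congr fun n => ?_
  refine (h.integral_exp_simpleFunc _ (SimpleFunc.eapprox_lt_top f n) ?_ s).symm
  exact ((lintegral_mono (hle n)).trans_lt (lt_top_iff_ne_top.2 hfi)).ne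

/-- The atoms of `A` generated by a finite family of sets. -/
def atomOf {ι : Type*} (A : Set X) (B : ι → Set X) (σ : ι → Bool) : Set X :=
  {x ∈ A | ∀ i, x ∈ B i ↔ σ i = true}

theorem measurableSet_atomOf {ι : Type*} [Finite ι] {A : Set X} (hA : MeasurableSet A)
    {B : ι → Set X} (hB : ∀ i, MeasurableSet (B i)) (σ : ι → Bool) :
    MeasurableSet (atomOf A B σ) := by
  have e : atomOf A B σ = A ∩ ⋂ i, {x | x ∈ B i ↔ σ i = true} := by
    ext x; simp [atomOf]
  rw [e]
  refine hA.inter (MeasurableSet.iInter fun i => ?_)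
  cases hσ : σ i
  · have : {x | x ∈ B i ↔ false = true} = (B i)ᶜ := by ext x; simp
    rw [this]
    exact (hB i).compl
  · have : {x | x ∈ B i ↔ true = true} = B i := by ext x; simp
    rw [this]
    exact hB i

theorem measure_inter_eq_sum_atomOf {ι : Type*} [Fintype ι] [DecidableEq ι] {A : Set X}
    (hA : MeasurableSet A) {B : ι → Set X} (hB : ∀ i, MeasurableSet (B i)) (m : Measure X)
    (i : ι) :
    m (B i ∩ A) = ∑ σ : ι → Bool, if σ i = true then m (atomOf A B σ) else 0 := by
  classical
  rw [← Finset.sum_filter, ← measure_biUnion_finset]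
  · congr 1
    ext x
    simp only [mem_inter_iff, Finset.mem_filter, Finset.mem_univ, true_and, mem_iUnion,
      exists_prop, atomOf, mem_ofPred_eq]
    constructor
    · rintro ⟨h1, h2⟩
      exact ⟨fun j => decide (x ∈ B j), by simpa using h1, h2, fun j => by simp⟩
    · rintro ⟨σ, h1, h2, h3⟩
      exact ⟨(h3 i).2 h1, h2⟩
  · intro σ _ τ _ hστ
    rw [Function.onFun, Set.disjoint_left]
    rintro x ⟨_, h1⟩ ⟨_, h2⟩
    refine hστ (funext fun j => ?_)
    have := (h1 j).symm.trans (h2 j)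
    exact Bool.eq_iff_iff.2 this
  · exact fun σ _ => measurableSet_atomOf hA hB σ

/-- The restrictions of a Poisson process to a set and to its complement are independent. -/
theorem IsPoissonProcess.indepFun_restrict [MeasurableSingletonClass X] (h : IsPoissonProcess Φ Λ P) {A : Set X}
    (hA : MeasurableSet A) :
    IndepFun (fun ω => (pointMeasure Φ ω).restrict A)
      (fun ω => (pointMeasure Φ ω).restrict Aᶜ) P := by
  classical
  have hmc : ∀ B, MeasurableSet B → Measurable fun ω => pointMeasure Φ ω B := fun B hB =>
    (Measure.measurable_coe hB).comp h.measurable_pointMeasure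
  -- Independence of two families of masses may be checked on finite subfamilies. Each mass is a sum
  -- over atoms of the finite algebra generated by the sets involved. The atoms inside `A` and those
  -- inside `Aᶜ` form one disjoint family, whose counts are independent by the definition of a
  -- Poisson process.
  have key : IndepFun (fun ω (B : {B : Set X // MeasurableSet B}) => pointMeasure Φ ω (B ∩ A))
      (fun ω (B : {B : Set X // MeasurableSet B}) => pointMeasure Φ ω (B ∩ Aᶜ)) P := by
    refine IndepFun.process_indepFun_process (fun B => hmc _ (B.2.inter hA))
      (fun B => hmc _ (B.2.inter hA.compl)) fun I J => ?_
    let BI : I → Set X := fun i => i.1.1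
    let BJ : J → Set X := fun j => j.1.1
    have hBI : ∀ i, MeasurableSet (BI i) := fun i => i.1.2
    have hBJ : ∀ i, MeasurableSet (BJ i) := fun i => i.1.2
    let C : (I → Bool) ⊕ (J → Bool) → Set X := Sum.elim (atomOf A BI) (atomOf Aᶜ BJ)
    have hC : ∀ k, MeasurableSet (C k) := by
      rintro (σ | σ)
      · exact measurableSet_atomOf hA hBI σ
      · exact measurableSet_atomOf hA.compl hBJ σ
    have hdis : Pairwise fun k l => Disjoint (C k) (C l) := by
      rintro (σ | σ) (τ | τ) hne
      · refine Set.disjoint_left.2 ?_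
        rintro x ⟨_, h1⟩ ⟨_, h2⟩
        exact hne (congrArg _ (funext fun j => Bool.eq_iff_iff.2 ((h1 j).symm.trans (h2 j))))
      · exact Set.disjoint_left.2 fun x h1 h2 => h2.1 h1.1
      · exact Set.disjoint_left.2 fun x h1 h2 => h1.1 h2.1
      · refine Set.disjoint_left.2 ?_
        rintro x ⟨_, h1⟩ ⟨_, h2⟩
        exact hne (congrArg _ (funext fun j => Bool.eq_iff_iff.2 ((h1 j).symm.trans (h2 j))))
    have hind := (h.iIndepFun_count hC hdis).comp (fun _ (n : ℕ∞) => (n : ℝ≥0∞))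
      (fun _ => .of_discrete)
    have hind2 := hind.indepFun_finset (Finset.univ.map Function.Embedding.inl)
      (Finset.univ.map Function.Embedding.inr) (by
        rw [Finset.disjoint_left]; intro k; simp only [Finset.mem_map]; rintro ⟨_, _, rfl⟩; simp)
      (fun k => (Measurable.of_discrete (f := fun n : ℕ∞ => (n : ℝ≥0∞))).comp
        (h.measurable_count _ (hC k)))
    have hind3 := hind2.comp
      (φ := fun v (i : I) => ∑ σ : I → Bool,
        if σ i = true then v ⟨Sum.inl σ, Finset.mem_map_of_mem _ (Finset.mem_univ σ)⟩ else 0)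
      (ψ := fun v (j : J) => ∑ σ : J → Bool,
        if σ j = true then v ⟨Sum.inr σ, Finset.mem_map_of_mem _ (Finset.mem_univ σ)⟩ else 0)
      (measurable_pi_lambda _ fun i => Finset.measurable_fun_sum _ fun σ _ => by
        split_ifs <;> fun_prop)
      (measurable_pi_lambda _ fun i => Finset.measurable_fun_sum _ fun σ _ => by
        split_ifs <;> fun_prop)
    refine IndepFun.congr hind3 (ae_of_all _ fun ω => ?_) (ae_of_all _ fun ω => ?_)
    · funext i
      have := measure_inter_eq_sum_atomOf hA hBI (pointMeasure Φ ω) i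
      refine Eq.trans ?_ this.symm
      refine Finset.sum_congr rfl fun σ _ => ?_
      split_ifs
      · exact (pointMeasure_apply (h.countable ω) (hC (Sum.inl σ))).symm
      · rfl
    · funext i
      have := measure_inter_eq_sum_atomOf hA.compl hBJ (pointMeasure Φ ω) i
      refine Eq.trans ?_ this.symm
      refine Finset.sum_congr rfl fun σ _ => ?_
      split_ifs
      · exact (pointMeasure_apply (h.countable ω) (hC (Sum.inr σ))).symm
      · rfl
  -- The sigma-algebra of the restricted random measure is generated by the masses of the sets `B ∩
  -- D`, so the independence of these families of masses is enough.
  have hle : ∀ D : Set X, MeasurableSet D →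
      MeasurableSpace.comap (fun ω => (pointMeasure Φ ω).restrict D) inferInstance ≤
      MeasurableSpace.comap (fun ω (B : {B : Set X // MeasurableSet B}) =>
        pointMeasure Φ ω (B ∩ D)) inferInstance := by
    intro D hD
    rw [← measurable_iff_comap_le]
    refine Measure.measurable_of_measurable_coe _ fun B hB => ?_
    simp_rw [Measure.restrict_apply hB]
    exact (measurable_pi_apply (⟨B, hB⟩ : {B : Set X // MeasurableSet B})).comp
      (comap_measurable (fun ω (B : {B : Set X // MeasurableSet B}) =>
        pointMeasure Φ ω (B ∩ D)))
  rw [IndepFun_iff_Indep] at key ⊢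
  exact indep_of_indep_of_le_left (indep_of_indep_of_le_right key (hle _ hA.compl)) (hle _ hA)

end PoissonFunctional

/-! ### Gil-Pelaez inversion by Abel regularisation. -/

section GilPelaez

open Filter Topology

theorem integral_exp_neg_mul_cos {ε : ℝ} (hε : 0 < ε) (a : ℝ) :
    ∫ x in Ioi (0 : ℝ), Real.exp (-ε * x) * Real.cos (a * x) = ε / (ε ^ 2 + a ^ 2) := by
  have hre : (-(ε : ℂ) + a * Complex.I).re < 0 := by simpa using hε
  have h := integral_exp_mul_complex_Ioi hre 0
  have hint := integrableOn_exp_mul_complex_Ioi hre 0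
  have h2 := congrArg Complex.re h
  have h3 := integral_re hint
  simp only [RCLike.re_to_complex] at h3
  rw [← h3] at h2
  have e1 : ∀ x : ℝ, (Complex.exp ((-(ε : ℂ) + a * Complex.I) * x)).re =
      Real.exp (-ε * x) * Real.cos (a * x) := by
    intro x
    rw [Complex.exp_re]
    simp
  simp_rw [e1] at h2
  rw [h2]
  simp only [Complex.ofReal_zero, mul_zero, Complex.exp_zero]
  rw [Complex.div_re]
  simp [Complex.normSq_apply]
  ring

theorem abs_sin_mul_div_le (a x : ℝ) : |Real.sin (a * x) / x| ≤ |a| := by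
  rcases eq_or_ne x 0 with rfl | hx
  · simp
  · rw [abs_div, div_le_iff₀ (abs_pos.2 hx), ← abs_mul]
    exact Real.abs_sin_le_abs

theorem integrableOn_exp_neg_mul {ε : ℝ} (hε : 0 < ε) :
    IntegrableOn (fun x : ℝ => Real.exp (-ε * x)) (Ioi 0) :=
  exp_neg_integrableOn_Ioi 0 hε

/-- Both sides vanish at `a = 0`, and differentiation under the integral sign gives both the
derivative `ε / (ε ^ 2 + a ^ 2)`. The exponential is the regulariser that makes the Dirichlet
integral absolutely convergent. -/
theorem integral_exp_neg_mul_sin_div {ε : ℝ} (hε : 0 < ε) (a : ℝ) :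
    ∫ x in Ioi (0 : ℝ), Real.exp (-ε * x) * (Real.sin (a * x) / x) = Real.arctan (a / ε) := by
  have hmeas : ∀ b : ℝ, AEStronglyMeasurable
      (fun x : ℝ => Real.exp (-ε * x) * (Real.sin (b * x) / x)) (volume.restrict (Ioi 0)) :=
    fun b => (by fun_prop : Measurable _).aestronglyMeasurable
  have hder : ∀ b : ℝ, HasDerivAt (fun b => (∫ x in Ioi (0 : ℝ),
      Real.exp (-ε * x) * (Real.sin (b * x) / x)) - Real.arctan (b / ε)) 0 b := by
    intro b
    have h1 := (hasDerivAt_integral_of_dominated_loc_of_deriv_le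
      (μ := volume.restrict (Ioi (0 : ℝ)))
      (F := fun b x => Real.exp (-ε * x) * (Real.sin (b * x) / x))
      (F' := fun b x => Real.exp (-ε * x) * Real.cos (b * x)) (x₀ := b) (s := univ)
      (bound := fun x => Real.exp (-ε * x)) univ_mem (.of_forall hmeas) ?_ ?_ ?_
      (integrableOn_exp_neg_mul hε) ?_).2
    · rw [integral_exp_neg_mul_cos hε] at h1
      have h2 : HasDerivAt (fun b => Real.arctan (b / ε)) (ε / (ε ^ 2 + b ^ 2)) b := by
        have := ((hasDerivAt_id b).div_const ε).arctan
        convert! this using 1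
        simp only [id]
        field_simp
      have h3 := h1.sub h2
      rw [sub_self] at h3
      exact h3
    · refine ((integrableOn_exp_neg_mul hε).mul_const |b|).mono (hmeas b)
        (ae_of_all _ fun x => ?_)
      rw [norm_mul, norm_mul]
      gcongr
      rw [Real.norm_eq_abs, Real.norm_eq_abs, abs_abs]
      exact abs_sin_mul_div_le b x
    · exact (by fun_prop : Measurable _).aestronglyMeasurable
    · refine ae_of_all _ fun x c _ => ?_
      rw [norm_mul, Real.norm_of_nonneg (Real.exp_pos _).le]
      exact mul_le_of_le_one_right (Real.exp_pos _).le (Real.abs_cos_le_one _)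
    · refine (ae_restrict_iff' measurableSet_Ioi).2 (ae_of_all _ fun x (hx : 0 < x) c _ => ?_)
      have := (((hasDerivAt_id c).mul_const x).sin.div_const x).const_mul (Real.exp (-ε * x))
      convert! this using 1
      simp only [id]
      field_simp
  have hdiff : Differentiable ℝ fun b => (∫ x in Ioi (0 : ℝ),
      Real.exp (-ε * x) * (Real.sin (b * x) / x)) - Real.arctan (b / ε) := fun b =>
    (hder b).differentiableAt
  have := is_const_of_deriv_eq_zero hdiff (fun b => (hder b).deriv) a 0
  simpa [sub_eq_zero] using this

variable {μ : Measure ℝ} [IsProbabilityMeasure μ]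

theorem measurable_integral_sin (w : ℝ) :
    Measurable fun x : ℝ => ∫ y, Real.sin ((y - w) * x) ∂μ := by
  have h : StronglyMeasurable (Function.uncurry fun (x : ℝ) (y : ℝ) => Real.sin ((y - w) * x)) :=
    (by fun_prop : Measurable _).stronglyMeasurable
  exact (h.integral_prod_right).measurable

/-- Near `0` the factor `1 / x` is compensated by `|sin z| ≤ |z|` and the finite mean. At infinity
the assumed decay `C / x` of the transform makes the integrand `O(x ^ (-2))`. -/
theorem integrableOn_gilPelaez {w C : ℝ} (hμ : Integrable (fun y : ℝ => y) μ)
    (hC : ∀ x > 0, |∫ y, Real.sin ((y - w) * x) ∂μ| ≤ C / x) :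
    IntegrableOn (fun x : ℝ => 1 / (Real.pi * x) * ∫ y, Real.sin ((y - w) * x) ∂μ) (Ioi 0) := by
  have hm : Measurable fun x : ℝ => 1 / (Real.pi * x) * ∫ y, Real.sin ((y - w) * x) ∂μ := by
    have := measurable_integral_sin (μ := μ) w
    fun_prop
  rw [← Ioc_union_Ioi_eq_Ioi (zero_le_one' ℝ)]
  refine IntegrableOn.union ?_ ?_
  · refine Measure.integrableOn_of_bounded (M := 1 / Real.pi * ∫ y, |y - w| ∂μ)
      (by simp) hm.aestronglyMeasurable ?_
    refine (ae_restrict_iff' measurableSet_Ioc).2 (ae_of_all _ fun x hx => ?_)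
    have hx0 : 0 < x := hx.1
    have h1 : |∫ y, Real.sin ((y - w) * x) ∂μ| ≤ (∫ y, |y - w| ∂μ) * x := by
      rw [← integral_mul_const]
      refine (abs_integral_le_integral_abs).trans (integral_mono_of_nonneg
        (ae_of_all _ fun y => abs_nonneg _) ?_ (ae_of_all _ fun y => ?_))
      · exact ((hμ.sub (integrable_const w)).abs).mul_const x
      · simpa only [abs_mul, abs_of_pos hx0] using! Real.abs_sin_le_abs (x := (y - w) * x)
    rw [norm_mul, Real.norm_of_nonneg (by positivity), Real.norm_eq_abs]
    calc 1 / (Real.pi * x) * |∫ y, Real.sin ((y - w) * x) ∂μ|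
        ≤ 1 / (Real.pi * x) * ((∫ y, |y - w| ∂μ) * x) := by gcongr
      _ = _ := by field_simp
  · have hint : IntegrableOn (fun x : ℝ => C / Real.pi * x ^ (-2 : ℝ)) (Ioi 1) :=
      (integrableOn_Ioi_rpow_of_lt (by norm_num) one_pos).const_mul _
    refine hint.mono' hm.aestronglyMeasurable ?_
    refine (ae_restrict_iff' measurableSet_Ioi).2 (ae_of_all _ fun x (hx : 1 < x) => ?_)
    have hx0 : 0 < x := one_pos.trans hx
    rw [norm_mul, Real.norm_of_nonneg (by positivity), Real.norm_eq_abs]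
    calc 1 / (Real.pi * x) * |∫ y, Real.sin ((y - w) * x) ∂μ|
        ≤ 1 / (Real.pi * x) * (C / x) := by gcongr; exact hC x hx0
      _ = _ := by
        rw [Real.rpow_neg hx0.le, Real.rpow_two]
        field_simp

theorem tendsto_arctan_div_nat (a : ℝ) :
    Tendsto (fun n : ℕ => Real.arctan (a / (1 / ((n : ℝ) + 1)))) atTop
      (𝓝 (Real.pi / 2 * SignType.sign a)) := by
  have hn : Tendsto (fun n : ℕ => (n : ℝ) + 1) atTop atTop :=
    tendsto_atTop_add_const_right _ _ tendsto_natCast_atTop_atTop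
  simp_rw [div_div_eq_mul_div, div_one]
  rcases lt_trichotomy a 0 with ha | rfl | ha
  · have h1 := (Real.tendsto_arctan_atBot.mono_right nhdsWithin_le_nhds).comp
      (hn.const_mul_atTop_of_neg ha)
    simpa [sign_neg ha, Function.comp_def] using h1
  · simp
  · have h1 := (Real.tendsto_arctan_atTop.mono_right nhdsWithin_le_nhds).comp
      (hn.const_mul_atTop ha)
    simpa [sign_pos ha, Function.comp_def] using h1

/-- Gil-Pelaez inversion at a continuity point of a law with a finite mean. -/
theorem gilPelaez {w : ℝ} (hμ : Integrable (fun y : ℝ => y) μ) (hw : μ {w} = 0)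
    (hI : IntegrableOn (fun x : ℝ => 1 / (Real.pi * x) * ∫ y, Real.sin ((y - w) * x) ∂μ)
      (Ioi 0)) :
    μ.real (Iic w) =
      1 / 2 - ∫ x in Ioi (0 : ℝ), 1 / (Real.pi * x) * ∫ y, Real.sin ((y - w) * x) ∂μ := by
  set J : ℝ → ℝ := fun x => 1 / (Real.pi * x) * ∫ y, Real.sin ((y - w) * x) ∂μ with hJ
  -- With the factor `exp (-ε x)` the double integral converges absolutely, so Fubini applies and
  -- the inner integral is an arctangent. As `ε → 0` the arctangent tends to `π / 2` times the sign
  -- of `y - w`.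
  have hfub : ∀ ε : ℝ, 0 < ε → ∫ x in Ioi (0 : ℝ), Real.exp (-ε * x) * J x =
      1 / Real.pi * ∫ y, Real.arctan ((y - w) / ε) ∂μ := by
    intro ε hε
    have hprod : Integrable (Function.uncurry fun (x y : ℝ) =>
        Real.exp (-ε * x) * (Real.sin ((y - w) * x) / x)) ((volume.restrict (Ioi 0)).prod μ) := by
      have h1 : Integrable (fun z : ℝ × ℝ => Real.exp (-ε * z.1) * |z.2 - w|)
          ((volume.restrict (Ioi 0)).prod μ) :=
        Integrable.mul_prod (integrableOn_exp_neg_mul hε) (hμ.sub (integrable_const w)).abs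
      refine h1.mono (by fun_prop : Measurable _).aestronglyMeasurable (ae_of_all _ ?_)
      rintro ⟨x, y⟩
      simp only [Function.uncurry_apply_pair]
      rw [norm_mul, norm_mul]
      gcongr
      rw [Real.norm_eq_abs, Real.norm_eq_abs, abs_abs]
      exact abs_sin_mul_div_le _ x
    have h2 := integral_integral_swap hprod
    simp_rw [integral_exp_neg_mul_sin_div hε, integral_const_mul, integral_div] at h2
    rw [← h2, ← integral_const_mul]
    refine integral_congr_ae (ae_of_all _ fun x => ?_)
    simp only [hJ]
    rw [one_div, mul_inv]
    ring
  -- The regulariser is removed on the side of the inversion integral by dominated convergence, with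
  -- the integrable function of `hI` as the bound.
  have hL : Tendsto (fun n : ℕ => ∫ x in Ioi (0 : ℝ), Real.exp (-(1 / ((n : ℝ) + 1)) * x) * J x)
      atTop (𝓝 (∫ x in Ioi (0 : ℝ), J x)) := by
    refine tendsto_integral_of_dominated_convergence (fun x => ‖J x‖) (fun n => ?_)
      hI.norm (fun n => ?_) ?_
    · exact (by fun_prop : Measurable fun x : ℝ =>
        Real.exp (-(1 / ((n : ℝ) + 1)) * x)).aestronglyMeasurable.mul hI.aestronglyMeasurable
    · refine (ae_restrict_iff' measurableSet_Ioi).2 (ae_of_all _ fun x (hx : 0 < x) => ?_)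
      rw [norm_mul, Real.norm_of_nonneg (Real.exp_pos _).le]
      refine mul_le_of_le_one_left (norm_nonneg _) (Real.exp_le_one_iff.2 ?_)
      have : 0 ≤ 1 / ((n : ℝ) + 1) * x := by positivity
      linarith
    · refine ae_of_all _ fun x => ?_
      have h0 : Tendsto (fun n : ℕ => 1 / ((n : ℝ) + 1)) atTop (𝓝 0) :=
        tendsto_one_div_add_atTop_nhds_zero_nat
      have hc : Continuous fun e : ℝ => Real.exp (-e * x) * J x := by fun_prop
      simpa [Function.comp_def] using (hc.tendsto 0).comp h0
  have hR : Tendsto (fun n : ℕ => 1 / Real.pi *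
      ∫ y, Real.arctan ((y - w) / (1 / ((n : ℝ) + 1))) ∂μ) atTop
      (𝓝 (1 / Real.pi * ∫ y, Real.pi / 2 * (SignType.sign (y - w) : ℝ) ∂μ)) := by
    refine Tendsto.const_mul _ ?_
    refine tendsto_integral_of_dominated_convergence (fun _ => Real.pi / 2) (fun n => ?_)
      (integrable_const _) (fun n => ae_of_all _ fun y => ?_)
      (ae_of_all _ fun y => tendsto_arctan_div_nat _)
    · exact (by fun_prop : Measurable _).aestronglyMeasurable
    · rw [Real.norm_eq_abs, abs_le]
      exact ⟨(Real.neg_pi_div_two_lt_arctan _).le, (Real.arctan_lt_pi_div_two _).le⟩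
  have heq := tendsto_nhds_unique hL
    (hR.congr fun n => (hfub _ (by positivity)).symm)
  -- Without an atom at `w` the value `0` of the sign has probability zero, and the mean sign is a
  -- function of the distribution function alone.
  have hsign : ∫ y, (SignType.sign (y - w) : ℝ) ∂μ = 1 - 2 * μ.real (Iic w) := by
    have h1 : (fun y => (SignType.sign (y - w) : ℝ)) =ᵐ[μ]
        fun y => 1 - (Iic w).indicator (fun _ => (2 : ℝ)) y := by
      have hne : ∀ᵐ y ∂μ, y ≠ w := by
        simpa [ae_iff] using hw
      filter_upwards [hne] with y hy
      rcases lt_or_gt_of_ne hy with h | h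
      · rw [sign_neg (sub_neg.2 h), indicator_of_mem (mem_Iic.2 h.le)]; norm_num
      · rw [sign_pos (sub_pos.2 h), indicator_of_notMem (by simpa using h)]; norm_num
    rw [integral_congr_ae h1, integral_sub (integrable_const _)
      ((integrable_const _).indicator measurableSet_Iic), integral_indicator_const _
      measurableSet_Iic]
    simp [mul_comm]
  rw [heq, integral_const_mul, hsign]
  field_simp
  ring

end GilPelaez

/-! ### Laws of the fading and of half the cosine of a uniform angle. -/

section Laws

open Filter Topology

theorem integrableOn_pow_mul_cexp (n : ℕ) {z : ℂ} (hz : 0 < z.re) :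
    IntegrableOn (fun t : ℝ => (t : ℂ) ^ n * Complex.exp (-z * t)) (Ioi 0) := by
  have h := integrableOn_rpow_mul_exp_neg_mul_rpow (p := 1) (s := n) (b := z.re)
    (by have : (0 : ℝ) ≤ n := by positivity
        linarith) one_pos hz
  refine Integrable.mono h (by fun_prop : Measurable _).aestronglyMeasurable ?_
  refine (ae_restrict_iff' measurableSet_Ioi).2 (ae_of_all _ fun t (ht : 0 < t) => le_of_eq ?_)
  rw [norm_mul, norm_mul, norm_pow, Complex.norm_real, Complex.norm_exp, Real.rpow_natCast,
    norm_pow, Real.rpow_one, Real.norm_of_nonneg (Real.exp_pos _).le]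
  simp

/-- Induction by parts: the derivative of `t ^ (n + 1) exp (-z t)` integrates to zero. A complex `z`
is needed since the transforms are later evaluated on the imaginary axis. -/
theorem integral_pow_mul_cexp (n : ℕ) {z : ℂ} (hz : 0 < z.re) :
    ∫ t in Ioi (0 : ℝ), (t : ℂ) ^ n * Complex.exp (-z * t) = n.factorial / z ^ (n + 1) := by
  have hz0 : z ≠ 0 := by rintro rfl; simp at hz
  induction n with
  | zero =>
    have := integral_exp_mul_complex_Ioi (a := -z) (by simpa using hz) 0
    simp only [pow_zero, one_mul, this]
    simp
  | succ n ih =>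
    have hd : ∀ t ∈ Ici (0 : ℝ), HasDerivAt (fun t : ℝ => (t : ℂ) ^ (n + 1) *
        Complex.exp (-z * t)) ((n + 1 : ℂ) * ((t : ℂ) ^ n * Complex.exp (-z * t)) -
          z * ((t : ℂ) ^ (n + 1) * Complex.exp (-z * t))) t := by
      intro t _
      have h1 : HasDerivAt (fun t : ℂ => t ^ (n + 1) * Complex.exp (-z * t))
          (((n + 1 : ℕ) : ℂ) * (t : ℂ) ^ n * Complex.exp (-z * t) +
            (t : ℂ) ^ (n + 1) * (Complex.exp (-z * t) * (-z))) (t : ℂ) := by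
        have a := hasDerivAt_pow (n + 1) (t : ℂ)
        have b := ((hasDerivAt_id (t : ℂ)).const_mul (-z)).cexp
        have c := a.mul b
        convert! c using 1
        simp
      have h2 := h1.comp_ofReal
      convert! h2 using 1
      push_cast
      ring
    have hi1 := (integrableOn_pow_mul_cexp n hz).const_mul (n + 1 : ℂ)
    have hi2 := (integrableOn_pow_mul_cexp (n + 1) hz).const_mul z
    have hlim : Tendsto (fun t : ℝ => (t : ℂ) ^ (n + 1) * Complex.exp (-z * t)) atTop (𝓝 0) := by
      rw [tendsto_zero_iff_norm_tendsto_zero]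
      refine (tendsto_rpow_mul_exp_neg_mul_atTop_nhds_zero (n + 1 : ℕ) z.re hz).congr' ?_
      filter_upwards [eventually_gt_atTop 0] with t ht
      rw [norm_mul, norm_pow, Complex.norm_real, Complex.norm_exp, Real.rpow_natCast,
        Real.norm_of_nonneg ht.le]
      simp
    have := integral_Ioi_of_hasDerivAt_of_tendsto' hd (hi1.sub hi2) hlim
    rw [integral_sub hi1 hi2, integral_const_mul, integral_const_mul, ih] at this
    simp only [Complex.ofReal_zero, ne_eq, Nat.add_eq_zero_iff, one_ne_zero, and_false,
      not_false_eq_true, zero_pow, zero_mul, sub_zero, sub_eq_zero] at this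
    have h3 : ∫ t in Ioi (0 : ℝ), (t : ℂ) ^ (n + 1) * Complex.exp (-z * t) =
        ((n + 1 : ℂ) * (n.factorial / z ^ (n + 1))) / z := by
      rw [this, mul_div_cancel_left₀ _ hz0]
    rw [h3, Nat.factorial_succ]
    push_cast
    field_simp
    ring

variable {m : ℕ}

theorem isProbabilityMeasure_fadingLaw (hm : 1 ≤ m) : IsProbabilityMeasure (fadingLaw m) :=
  isProbabilityMeasure_gammaMeasure (by exact_mod_cast hm) (by exact_mod_cast hm)

instance : NullSingletonClass (fadingLaw m) := by
  unfold fadingLaw gammaMeasure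
  infer_instance

theorem ae_fadingLaw_nonneg : ∀ᵐ h ∂fadingLaw m, 0 ≤ h := by
  rw [ae_iff]
  have : {h : ℝ | ¬ 0 ≤ h} = Iio 0 := by ext; simp
  rw [this, fadingLaw, gammaMeasure, withDensity_apply _ measurableSet_Iio]
  exact lintegral_gammaPDF_of_nonpos le_rfl

theorem measurable_gammaPDF (a r : ℝ) : Measurable (gammaPDF a r) :=
  (measurable_gammaPDFReal a r).ennreal_ofReal

/-- The Laplace transform of the fading law. -/
theorem integral_cexp_fadingLaw (hm : 1 ≤ m) {s : ℂ} (hs : 0 ≤ s.re) :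
    ∫ h, Complex.exp (-(s * (h : ℂ))) ∂fadingLaw m = (1 + s / m) ^ (-(m : ℤ)) := by
  have hm0 : (0 : ℝ) < m := by exact_mod_cast hm
  have hmc : (m : ℂ) ≠ 0 := by exact_mod_cast hm0.ne'
  rw [fadingLaw, gammaMeasure, integral_withDensity_eq_integral_toReal_smul
    (measurable_gammaPDF _ _) (ae_of_all _ fun x => ENNReal.ofReal_lt_top)]
  have hsupp : ∫ x : ℝ, (gammaPDF m m x).toReal • Complex.exp (-(s * (x : ℂ))) =
      ∫ x in Ioi (0 : ℝ), (gammaPDF m m x).toReal • Complex.exp (-(s * (x : ℂ))) := by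
    rw [← integral_Ici_eq_integral_Ioi, setIntegral_eq_integral_of_forall_compl_eq_zero]
    intro x hx
    rw [gammaPDF_of_neg (by simpa using hx)]
    simp
  obtain ⟨n, rfl⟩ : ∃ n, m = n + 1 := ⟨m - 1, by omega⟩
  have hpt : ∀ x ∈ Ioi (0 : ℝ), (gammaPDF (n + 1 : ℕ) (n + 1 : ℕ) x).toReal •
      Complex.exp (-(s * (x : ℂ))) =
      ((n + 1 : ℕ) : ℂ) ^ (n + 1) / n.factorial *
        ((x : ℂ) ^ n * Complex.exp (-(s + (n + 1 : ℕ)) * x)) := by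
    intro x hx
    rw [gammaPDF_of_nonneg (le_of_lt hx), ENNReal.toReal_ofReal
      (by have : (0 : ℝ) < x := hx
          positivity), Complex.real_smul, Real.rpow_natCast]
    have h1 : Real.Gamma ((n + 1 : ℕ) : ℝ) = n.factorial := by
      rw [Nat.cast_add, Nat.cast_one, Real.Gamma_nat_eq_factorial]
    have h2 : x ^ (((n + 1 : ℕ) : ℝ) - 1) = x ^ n := by
      rw [Nat.cast_add, Nat.cast_one, add_sub_cancel_right, Real.rpow_natCast]
    rw [h1, h2]
    push_cast
    have h3 : Complex.exp (-(s + (n + 1)) * x) =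
        Complex.exp (-((n + 1) * x)) * Complex.exp (-(s * x)) := by
      rw [← Complex.exp_add]; ring_nf
    rw [h3]
    ring
  rw [hsupp, setIntegral_congr_fun measurableSet_Ioi hpt, integral_const_mul,
    integral_pow_mul_cexp n (by
      rw [Complex.add_re, Complex.natCast_re]
      linarith)]
  have hne : s + ((n + 1 : ℕ) : ℂ) ≠ 0 := by
    intro h0
    have := congrArg Complex.re h0
    rw [Complex.add_re, Complex.natCast_re, Complex.zero_re] at this
    linarith
  have hf : (n.factorial : ℂ) ≠ 0 := by exact_mod_cast n.factorial_ne_zero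
  have e : 1 + s / ((n + 1 : ℕ) : ℂ) = (s + ((n + 1 : ℕ) : ℂ)) / ((n + 1 : ℕ) : ℂ) := by
    rw [add_div, div_self hmc, add_comm]
  rw [e, zpow_neg, zpow_natCast, div_pow]
  field_simp

/-- The Gamma density with shape `m` and rate `m`, multiplied by its variable, is the density with
shape `m + 1` and rate `m`, of total mass `1`. -/
theorem lintegral_ofReal_fadingLaw (hm : 1 ≤ m) :
    ∫⁻ h, ENNReal.ofReal h ∂fadingLaw m = 1 := by
  have hm0 : (0 : ℝ) < m := by exact_mod_cast hm
  rw [fadingLaw, gammaMeasure, lintegral_withDensity_eq_lintegral_mul _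
    (measurable_gammaPDF _ _) ENNReal.measurable_ofReal,
    ← lintegral_gammaPDF_eq_one (a := m + 1) (r := m) (by positivity) hm0]
  refine lintegral_congr_ae ?_
  filter_upwards [Measure.ae_ne volume (0 : ℝ)] with x hx
  simp only [Pi.mul_apply]
  rcases lt_or_gt_of_ne hx with hx | hx
  · rw [gammaPDF_of_neg hx, gammaPDF_of_neg hx, zero_mul]
  · rw [gammaPDF_of_nonneg hx.le, gammaPDF_of_nonneg hx.le, ← ENNReal.ofReal_mul
      (by positivity), Real.Gamma_add_one hm0.ne', Real.rpow_add_one hm0.ne', add_sub_cancel_right,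
      Real.rpow_sub_one hx.ne']
    congr 1
    have := (Real.Gamma_pos_of_pos hm0).ne'
    field_simp

theorem isProbabilityMeasure_uniform {a b : ℝ} (hab : a < b) :
    IsProbabilityMeasure (uniform a b) :=
  cond_isProbabilityMeasure_of_finite (by simpa [Real.volume_Icc] using hab)
    (by simp [Real.volume_Icc])

theorem lintegral_uniform {a b : ℝ} (hab : a < b) (f : ℝ → ℝ≥0∞) :
    ∫⁻ x, f x ∂uniform a b = ENNReal.ofReal (1 / (b - a)) * ∫⁻ x in Ioc a b, f x := by
  rw [uniform, ProbabilityTheory.cond, lintegral_smul_measure, Real.volume_Icc,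
    setLIntegral_congr Ioc_ae_eq_Icc, one_div, ENNReal.ofReal_inv_of_pos (sub_pos.2 hab)]
  rfl

theorem measurable_pdfPhi : Measurable pdfPhi := by
  unfold pdfPhi
  refine Measurable.ite (measurableSet_le (by fun_prop) (by fun_prop)) (by fun_prop) (by fun_prop)

theorem pdfPhi_nonneg (x : ℝ) : 0 ≤ pdfPhi x := by
  unfold pdfPhi
  split_ifs <;> positivity

theorem pdfPhi_neg (x : ℝ) : pdfPhi (-x) = pdfPhi x := by simp [pdfPhi]

/-- Change of variables `x = cos φ / 2`, injective on `(0, π)`: its Jacobian `sin φ / 2` is the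
reciprocal of `π` times the density at `x`. -/
theorem lintegral_cos_half_Ioo (g : ℝ → ℝ≥0∞) :
    ∫⁻ φ in Ioo 0 Real.pi, g (Real.cos φ / 2) =
      ENNReal.ofReal Real.pi * ∫⁻ x, g x * ENNReal.ofReal (pdfPhi x) := by
  have hinj : InjOn (fun φ => Real.cos φ / 2) (Ioo 0 Real.pi) := by
    intro x hx y hy h
    exact Real.injOn_cos (Ioo_subset_Icc_self hx) (Ioo_subset_Icc_self hy) (by
      simpa using h)
  have himg : (fun φ => Real.cos φ / 2) '' Ioo 0 Real.pi = Ioo (-(1 / 2)) (1 / 2) := by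
    ext x
    constructor
    · rintro ⟨φ, hφ, rfl⟩
      have h1 := Real.strictAntiOn_cos (left_mem_Icc.2 Real.pi_pos.le)
        (Ioo_subset_Icc_self hφ) hφ.1
      have h2 := Real.strictAntiOn_cos (Ioo_subset_Icc_self hφ)
        (right_mem_Icc.2 Real.pi_pos.le) hφ.2
      rw [Real.cos_zero] at h1
      rw [Real.cos_pi] at h2
      constructor <;> dsimp only <;> linarith
    · rintro ⟨h1, h2⟩
      refine ⟨Real.arccos (2 * x), ⟨Real.arccos_pos.2 (by linarith), ?_⟩, ?_⟩
      · refine lt_of_le_of_ne (Real.arccos_le_pi _) fun h => ?_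
        have := Real.arccos_eq_pi.1 h
        linarith
      · simp only
        rw [Real.cos_arccos (by linarith) (by linarith)]
        ring
  have hcv := lintegral_image_eq_lintegral_abs_deriv_mul (s := Ioo 0 Real.pi)
    (f := fun φ => Real.cos φ / 2) (f' := fun φ => -Real.sin φ / 2) measurableSet_Ioo
    (fun x _ => ((Real.hasDerivAt_cos x).div_const 2).hasDerivWithinAt) hinj
    (fun x => g x * ENNReal.ofReal (pdfPhi x))
  have hsupp : ∫⁻ x, g x * ENNReal.ofReal (pdfPhi x) =
      ∫⁻ x in Ioo (-(1 / 2)) (1 / 2), g x * ENNReal.ofReal (pdfPhi x) := by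
    rw [setLIntegral_congr Ioo_ae_eq_Icc, setLIntegral_eq_of_support_subset]
    intro x hx
    by_contra hx'
    have : pdfPhi x = 0 := by
      unfold pdfPhi
      rw [if_neg]
      rw [abs_le]
      exact hx'
    exact hx (by simp [this])
  rw [hsupp, ← himg, hcv, ← lintegral_const_mul' _ _ ENNReal.ofReal_ne_top]
  refine setLIntegral_congr_fun measurableSet_Ioo fun φ hφ => ?_
  have hs : 0 < Real.sin φ := Real.sin_pos_of_mem_Ioo hφ
  have h1 : pdfPhi (Real.cos φ / 2) = 2 / (Real.pi * Real.sin φ) := by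
    unfold pdfPhi
    rw [if_pos]
    · congr 2
      rw [← Real.sqrt_sq hs.le, Real.sin_sq]
      congr 1
      ring
    · rw [abs_div, abs_two]
      have := Real.abs_cos_le_one φ
      linarith
  have e : ENNReal.ofReal Real.pi * (ENNReal.ofReal |-Real.sin φ / 2| *
      (g (Real.cos φ / 2) * ENNReal.ofReal (2 / (Real.pi * Real.sin φ)))) =
      g (Real.cos φ / 2) * (ENNReal.ofReal Real.pi * ENNReal.ofReal |-Real.sin φ / 2| *
        ENNReal.ofReal (2 / (Real.pi * Real.sin φ))) := by ring
  have h2 : Real.pi * |-Real.sin φ / 2| * (2 / (Real.pi * Real.sin φ)) = 1 := by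
    rw [abs_div, abs_neg, abs_of_pos hs, abs_two]
    field_simp
  rw [h1, e, ← ENNReal.ofReal_mul Real.pi_pos.le, ← ENNReal.ofReal_mul (by positivity), h2,
    ENNReal.ofReal_one, mul_one]

/-- The law of half the cosine of a uniform angle. -/
theorem lintegral_cos_half_uniform (g : ℝ → ℝ≥0∞) :
    ∫⁻ φ, g (Real.cos φ / 2) ∂uniform 0 (2 * Real.pi) =
      ∫⁻ x, g x * ENNReal.ofReal (pdfPhi x) := by
  have hpi := Real.pi_pos
  rw [lintegral_uniform (by positivity), ← Ioc_union_Ioc_eq_Ioc hpi.le (by linarith),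
    lintegral_union measurableSet_Ioc (Ioc_disjoint_Ioc_of_le le_rfl)]
  have h1 : ∫⁻ φ in Ioc 0 Real.pi, g (Real.cos φ / 2) =
      ENNReal.ofReal Real.pi * ∫⁻ x, g x * ENNReal.ofReal (pdfPhi x) := by
    rw [← lintegral_cos_half_Ioo, setLIntegral_congr Ioo_ae_eq_Ioc]
  -- The reflection `φ ↦ 2 π - φ` exchanges the two half-turns and preserves the cosine.
  have h2 : ∫⁻ φ in Ioc Real.pi (2 * Real.pi), g (Real.cos φ / 2) =
      ENNReal.ofReal Real.pi * ∫⁻ x, g x * ENNReal.ofReal (pdfPhi x) := by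
    rw [← lintegral_cos_half_Ioo, ← setLIntegral_congr Ioo_ae_eq_Ioc,
      ← lintegral_indicator measurableSet_Ioo, ← lintegral_indicator measurableSet_Ioo,
      ← lintegral_sub_left_eq_self _ (2 * Real.pi)]
    refine lintegral_congr fun x => ?_
    by_cases hx : x ∈ Ioo 0 Real.pi
    · rw [indicator_of_mem hx, indicator_of_mem (by
        constructor
        · linarith [hx.2]
        · linarith [hx.1]), Real.cos_two_pi_sub]
    · rw [indicator_of_notMem hx, indicator_of_notMem]
      rintro ⟨h3, h4⟩
      exact hx ⟨by linarith, by linarith⟩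
  rw [h1, h2, sub_zero, ← two_mul, ← mul_assoc, ← mul_assoc, ← ENNReal.ofReal_ofNat 2,
    ← ENNReal.ofReal_mul (by positivity), ← ENNReal.ofReal_mul (by positivity)]
  have : 1 / (2 * Real.pi) * 2 * Real.pi = 1 := by field_simp
  rw [this, ENNReal.ofReal_one, one_mul]

end Laws

/-! ### The angle deviation and the discrete law of the beam gain. -/

section Antenna

open Filter Topology

theorem measurable_pdfDelta : Measurable pdfDelta := by
  unfold pdfDelta
  refine Measurable.ite (measurableSet_le (by fun_prop) (by fun_prop)) ?_ measurable_const
  have h : StronglyMeasurable (Function.uncurry fun (y : ℝ) (x : ℝ) =>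
      pdfPhi x * pdfPhi (y + x)) := by
    have := measurable_pdfPhi
    exact (by fun_prop : Measurable _).stronglyMeasurable
  simp_rw [intervalIntegral.integral_of_le (by norm_num : (-(1 / 2 : ℝ)) ≤ 1 / 2)]
  exact h.integral_prod_right.measurable

theorem pdfDelta_nonneg (y : ℝ) : 0 ≤ pdfDelta y := by
  unfold pdfDelta
  split_ifs
  · exact intervalIntegral.integral_nonneg (by norm_num)
      fun x _ => mul_nonneg (pdfPhi_nonneg _) (pdfPhi_nonneg _)
  · rfl

theorem pdfDelta_neg (y : ℝ) : pdfDelta (-y) = pdfDelta y := by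
  unfold pdfDelta
  rw [abs_neg]
  split_ifs
  · have := intervalIntegral.integral_comp_neg (a := -(1 / 2 : ℝ)) (b := 1 / 2)
      (fun x => pdfPhi x * pdfPhi (y + x))
    rw [neg_neg] at this
    rw [← this]
    refine intervalIntegral.integral_congr fun x _ => ?_
    rw [pdfPhi_neg, ← pdfPhi_neg (y + -x)]
    congr 2
    ring
  · rfl

/-- Tonelli and a translation give the density of a difference of independent variables. It is kept
as a convolution in `ℝ≥0∞`, because the Bochner integral in `pdfDelta` takes the value `0` where the
convolution diverges. -/
theorem lintegral_deviation_aux {g : ℝ → ℝ≥0∞} (hg : Measurable g) :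
    ∫⁻ φ, ∫⁻ ψ, g (Real.cos φ / 2 - Real.cos ψ / 2) ∂uniform 0 (2 * Real.pi)
      ∂uniform 0 (2 * Real.pi) =
    ∫⁻ u, g u * ∫⁻ y, ENNReal.ofReal (pdfPhi y) * ENNReal.ofReal (pdfPhi (u + y)) := by
  have hf := measurable_pdfPhi
  rw [lintegral_cos_half_uniform
    (fun x => ∫⁻ ψ, g (x - Real.cos ψ / 2) ∂uniform 0 (2 * Real.pi))]
  have h0 : ∀ x, ∫⁻ ψ, g (x - Real.cos ψ / 2) ∂uniform 0 (2 * Real.pi) =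
      ∫⁻ y, g (x - y) * ENNReal.ofReal (pdfPhi y) := fun x =>
    lintegral_cos_half_uniform (fun y => g (x - y))
  simp_rw [h0]
  have h2 : ∀ x, (∫⁻ y, g (x - y) * ENNReal.ofReal (pdfPhi y)) * ENNReal.ofReal (pdfPhi x) =
      ∫⁻ y, g (x - y) * ENNReal.ofReal (pdfPhi y) * ENNReal.ofReal (pdfPhi x) := fun x =>
    (lintegral_mul_const _ (by fun_prop)).symm
  simp_rw [h2]
  rw [lintegral_lintegral_swap (by fun_prop)]
  have h1 : ∀ y, ∫⁻ x, g (x - y) * ENNReal.ofReal (pdfPhi y) * ENNReal.ofReal (pdfPhi x) =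
      ∫⁻ u, g u * ENNReal.ofReal (pdfPhi y) * ENNReal.ofReal (pdfPhi (u + y)) := by
    intro y
    rw [← lintegral_add_right_eq_self _ y]
    simp
  simp_rw [h1]
  rw [lintegral_lintegral_swap (by fun_prop)]
  refine lintegral_congr fun u => ?_
  rw [← lintegral_const_mul _ (by fun_prop)]
  simp_rw [mul_assoc]

/-- The convolution has total mass `1`, hence is finite almost everywhere, and where it is finite
the Bochner integral has the same value. The restriction to almost every point is genuine: at `u =
0` the convolution is infinite. -/
theorem ofReal_pdfDelta_ae : ∀ᵐ u, ENNReal.ofReal (pdfDelta u) =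
    ∫⁻ y, ENNReal.ofReal (pdfPhi y) * ENNReal.ofReal (pdfPhi (u + y)) := by
  have hf := measurable_pdfPhi
  have hprob := isProbabilityMeasure_uniform (a := 0) (b := 2 * Real.pi)
    (by have := Real.pi_pos; linarith)
  have h1 := lintegral_deviation_aux (g := fun _ => 1) measurable_const
  simp only [lintegral_const, measure_univ, mul_one, one_mul] at h1
  have hfin : ∀ᵐ u, ∫⁻ y, ENNReal.ofReal (pdfPhi y) * ENNReal.ofReal (pdfPhi (u + y)) < ∞ := by
    refine ae_lt_top ?_ (by rw [← h1]; simp)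
    exact Measurable.lintegral_prod_right' (f := fun z : ℝ × ℝ =>
      ENNReal.ofReal (pdfPhi z.2) * ENNReal.ofReal (pdfPhi (z.1 + z.2))) (by fun_prop)
  have hzero : ∀ x, 1 / 2 < |x| → pdfPhi x = 0 := fun x hx => if_neg (not_le.2 hx)
  filter_upwards [hfin] with u hu
  unfold pdfDelta
  split_ifs with hu1
  · rw [intervalIntegral.integral_of_le (by norm_num), ← integral_Icc_eq_integral_Ioc,
      integral_eq_lintegral_of_nonneg_ae
        (ae_of_all _ fun x => mul_nonneg (pdfPhi_nonneg _) (pdfPhi_nonneg _))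
        (by fun_prop : Measurable _).aestronglyMeasurable]
    simp_rw [ENNReal.ofReal_mul (pdfPhi_nonneg _)]
    rw [setLIntegral_eq_of_support_subset, ENNReal.ofReal_toReal hu.ne]
    intro x hx
    by_contra hx'
    rw [mem_Icc, ← abs_le, not_le] at hx'
    exact hx (by simp [hzero x hx'])
  · rw [ENNReal.ofReal_zero, eq_comm, lintegral_eq_zero_iff (by fun_prop)]
    refine ae_of_all _ fun y => ?_
    simp only [Pi.zero_apply, mul_eq_zero, ENNReal.ofReal_eq_zero]
    by_cases hy : 1 / 2 < |y|
    · exact Or.inl (hzero y hy).le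
    · right
      refine (hzero _ ?_).le
      have := abs_sub_abs_le_abs_sub (u + y) y
      have h3 := abs_add_le (u + y) (-y)
      rw [abs_neg, add_neg_cancel_right] at h3
      linarith

/-- The law of the spatial angle deviation. -/
theorem lintegral_deviation {g : ℝ → ℝ≥0∞} (hg : Measurable g) :
    ∫⁻ φ, ∫⁻ ψ, g (Real.cos φ / 2 - Real.cos ψ / 2) ∂uniform 0 (2 * Real.pi)
      ∂uniform 0 (2 * Real.pi) = ∫⁻ u, g u * ENNReal.ofReal (pdfDelta u) := by
  rw [lintegral_deviation_aux hg]
  refine lintegral_congr_ae ?_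
  filter_upwards [ofReal_pdfDelta_ae] with u hu
  rw [hu]

theorem lintegral_pdfDelta : ∫⁻ u, ENNReal.ofReal (pdfDelta u) = 1 := by
  have hprob := isProbabilityMeasure_uniform (a := 0) (b := 2 * Real.pi)
    (by have := Real.pi_pos; linarith)
  have h1 := lintegral_deviation (g := fun _ => 1) measurable_const
  simp only [lintegral_const, measure_univ, mul_one, one_mul] at h1
  exact h1.symm

theorem lintegral_even {g : ℝ → ℝ≥0∞} (he : ∀ x, g (-x) = g x) :
    ∫⁻ u, g u = 2 * ∫⁻ u in Ioi 0, g u := by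
  have h1 : ∫⁻ u in Iic 0, g u = ∫⁻ u in Ioi 0, g u := by
    rw [setLIntegral_congr Iio_ae_eq_Iic.symm, ← lintegral_indicator measurableSet_Iio,
      ← lintegral_indicator measurableSet_Ioi, ← lintegral_neg_eq_self]
    refine lintegral_congr fun x => ?_
    by_cases hx : 0 < x
    · rw [indicator_of_mem (by simpa using hx), indicator_of_mem (by simpa using hx), he]
    · rw [indicator_of_notMem (by simpa using hx), indicator_of_notMem (by simpa using hx)]
  rw [← lintegral_add_compl _ measurableSet_Ioi, compl_Ioi, h1, two_mul]

theorem integrable_pdfDelta : Integrable pdfDelta := by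
  refine ⟨measurable_pdfDelta.aestronglyMeasurable, ?_⟩
  rw [hasFiniteIntegral_iff_ofReal (ae_of_all _ pdfDelta_nonneg), lintegral_pdfDelta]
  exact ENNReal.one_lt_top

theorem ofReal_intervalIntegral_pdfDelta {a b : ℝ} (hab : a ≤ b) :
    ENNReal.ofReal (∫ y in a..b, pdfDelta y) = ∫⁻ y in Ioc a b, ENNReal.ofReal (pdfDelta y) := by
  rw [intervalIntegral.integral_of_le hab, ofReal_integral_eq_lintegral_ofReal
    integrable_pdfDelta.restrict (ae_of_all _ pdfDelta_nonneg)]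

theorem lintegral_Ioc_mesh (f : ℝ → ℝ≥0∞) (h : ℝ) (hh : 0 ≤ h) (K : ℕ) :
    ∫⁻ y in Ioc 0 (K * h), f y = ∑ n ∈ Finset.range K, ∫⁻ y in Ioc (n * h) ((n + 1) * h), f y := by
  induction K with
  | zero => simp
  | succ K ih =>
    rw [Finset.sum_range_succ, ← ih, ← Ioc_union_Ioc_eq_Ioc (a := 0) (b := K * h)
      (by positivity) (by push_cast; nlinarith), lintegral_union measurableSet_Ioc
      (Ioc_disjoint_Ioc_of_le le_rfl)]
    push_cast
    rfl

theorem lintegral_Ioc_mesh_rev (f : ℝ → ℝ≥0∞) (h : ℝ) (hh : 0 ≤ h) (K : ℕ) :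
    ∫⁻ y in Ioc (1 - K * h) 1, f y =
      ∑ n ∈ Finset.range K, ∫⁻ y in Ioc (1 - (n + 1) * h) (1 - n * h), f y := by
  induction K with
  | zero => simp
  | succ K ih =>
    rw [Finset.sum_range_succ, ← ih, ← Ioc_union_Ioc_eq_Ioc (b := 1 - K * h)
      (by push_cast; nlinarith) (by nlinarith [mul_nonneg (Nat.cast_nonneg (α := ℝ) K) hh]),
      lintegral_union measurableSet_Ioc (Ioc_disjoint_Ioc_of_le le_rfl)]
    push_cast
    exact add_comm _ _

namespace Params

variable (p : Params)

theorem measurable_gainHalf : Measurable p.gainHalf := by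
  unfold gainHalf
  refine Measurable.ite (measurableSet_le (by fun_prop) (by fun_prop)) measurable_const ?_
  refine Finset.measurable_fun_sum _ fun n _ => ?_
  exact Measurable.ite ((measurableSet_lt measurable_const measurable_id).inter
    (measurableSet_le measurable_id measurable_const)) measurable_const measurable_const

theorem measurable_gainB : Measurable p.gainB := by
  unfold gainB
  have := p.measurable_gainHalf
  exact Measurable.ite (measurableSet_le (by fun_prop) (by fun_prop)) (by fun_prop)
    (Measurable.ite (measurableSet_lt (by fun_prop) (by fun_prop)) (by fun_prop) (by fun_prop))

theorem gainB_neg (Δ : ℝ) : p.gainB (-Δ) = p.gainB Δ := by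
  unfold gainB
  rw [abs_neg]
  split_ifs with h1 h2 h3 h3
  · rfl
  · linarith
  · rw [show -Δ + 1 = -(Δ - 1) by ring, abs_neg]
  · rw [show -Δ - 1 = -(Δ + 1) by ring, abs_neg]
  · have : Δ = 0 := by linarith
    subst this
    simp at h1

variable {p}

theorem Valid.Nb_pos (hp : p.Valid) : (0 : ℝ) < p.Nb := by
  have := hp.two_le_Nb
  exact_mod_cast (by omega : 0 < p.Nb)

theorem Valid.NbT_succ_div_le (hp : p.Valid) {n : ℕ} (hn : n ≤ p.NbT) :
    ((n : ℝ) + 1) / p.Nb ≤ 1 / 2 := by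
  have h2 := hp.two_le_Nb
  have h0 := hp.Nb_pos
  have : (n + 1) * 2 ≤ p.Nb := by unfold NbT at hn; omega
  have h3 : ((n : ℝ) + 1) * 2 ≤ p.Nb := by exact_mod_cast this
  rw [div_le_div_iff₀ h0 two_pos]
  linarith

theorem Valid.gainHalf_eq_level (hp : p.Valid) {n : ℕ} (hn : n ≤ p.NbT) {y : ℝ}
    (h1 : (n : ℝ) / p.Nb < y) (h2 : y ≤ ((n : ℝ) + 1) / p.Nb) : p.gainHalf y = p.level n := by
  have h0 := hp.Nb_pos
  unfold gainHalf
  rcases Nat.eq_zero_or_pos n with rfl | hpos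
  · rw [if_pos (by simpa using h2)]
  · rw [if_neg, Finset.sum_eq_single n]
    · rw [if_pos ⟨h1, h2⟩]
    · intro k _ hk
      rw [if_neg]
      rintro ⟨h3, h4⟩
      have h5 := (div_lt_div_iff_of_pos_right h0).1 (h3.trans_le h2)
      have h6 := (div_lt_div_iff_of_pos_right h0).1 (h1.trans_le h4)
      have h7 : k < n + 1 := by exact_mod_cast h5
      have h8 : n < k + 1 := by exact_mod_cast h6
      omega
    · intro hnm
      exact absurd (Finset.mem_Icc.2 ⟨hpos, hn⟩) hnm
    · rw [not_le]
      refine lt_of_le_of_lt ?_ h1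
      have : (1 : ℝ) ≤ n := by exact_mod_cast hpos
      gcongr

theorem Valid.gainHalf_eq_zero (hp : p.Valid) {y : ℝ}
    (h1 : ((p.NbT : ℝ) + 1) / p.Nb < y) : p.gainHalf y = 0 := by
  have h0 := hp.Nb_pos
  unfold gainHalf
  rw [if_neg, Finset.sum_eq_zero]
  · intro k hk
    rw [if_neg]
    rintro ⟨_, h4⟩
    have h6 := (div_lt_div_iff_of_pos_right h0).1 (h1.trans_le h4)
    have h8 : p.NbT + 1 < k + 1 := by exact_mod_cast h6
    have := (Finset.mem_Icc.1 hk).2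
    omega
  · rw [not_le]
    refine lt_of_le_of_lt ?_ h1
    have : (0 : ℝ) ≤ p.NbT := by positivity
    gcongr
    linarith

theorem Valid.level_nonneg (hp : p.Valid) (n : ℕ) : 0 ≤ p.level n := by
  have hd := hp.delta_pos
  have hg : ∀ x, 0 ≤ p.gainULA x := fun x => by
    unfold gainULA
    split_ifs <;> positivity
  unfold level
  split_ifs
  · exact mul_nonneg (by positivity) (hg _)
  · exact mul_nonneg (by positivity) (hg _)
  · rfl

theorem level_NbT_succ : p.level (p.NbT + 1) = 0 := by
  unfold level
  rw [if_neg (by omega), if_neg (by omega)]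

theorem Valid.ofReal_gainProbAux (hp : p.Valid) (n : ℕ) :
    ENNReal.ofReal (p.gainProbAux n) =
      2 * (∫⁻ y in Ioc ((n : ℝ) / p.Nb) (((n : ℝ) + 1) / p.Nb), ENNReal.ofReal (pdfDelta y)) +
      2 * ∫⁻ y in Ioc (1 - ((n : ℝ) + 1) / p.Nb) (1 - (n : ℝ) / p.Nb),
        ENNReal.ofReal (pdfDelta y) := by
  have h0 := hp.Nb_pos
  have h1 : (n : ℝ) / p.Nb ≤ ((n : ℝ) + 1) / p.Nb := by gcongr; linarith
  have h2 : 1 - ((n : ℝ) + 1) / p.Nb ≤ 1 - (n : ℝ) / p.Nb := by linarith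
  unfold gainProbAux
  rw [ENNReal.ofReal_add, ENNReal.ofReal_mul zero_le_two, ENNReal.ofReal_mul zero_le_two,
    ofReal_intervalIntegral_pdfDelta h1, ofReal_intervalIntegral_pdfDelta h2,
    ENNReal.ofReal_ofNat]
  · exact mul_nonneg zero_le_two (intervalIntegral.integral_nonneg h1 fun _ _ => pdfDelta_nonneg _)
  · exact mul_nonneg zero_le_two (intervalIntegral.integral_nonneg h2 fun _ _ => pdfDelta_nonneg _)

theorem Valid.gainProbAux_nonneg (hp : p.Valid) (n : ℕ) : 0 ≤ p.gainProbAux n := by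
  have h0 := hp.Nb_pos
  have h1 : (n : ℝ) / p.Nb ≤ ((n : ℝ) + 1) / p.Nb := by gcongr; linarith
  have h2 : 1 - ((n : ℝ) + 1) / p.Nb ≤ 1 - (n : ℝ) / p.Nb := by linarith
  exact add_nonneg
    (mul_nonneg zero_le_two (intervalIntegral.integral_nonneg h1 fun _ _ => pdfDelta_nonneg _))
    (mul_nonneg zero_le_two (intervalIntegral.integral_nonneg h2 fun _ _ => pdfDelta_nonneg _))

/-- By evenness only `(0, 1]` matters. With `c = (Ñ_b + 1) / N_b ≤ 1 / 2`, the gain runs through the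
levels on `(0, c]`, repeats them in mirror image on `(1 - c, 1]`, and vanishes in between. The mass
of the middle interval is left as an integral here; it is identified with the last probability by
taking `ψ = 1`. -/
theorem Valid.lintegral_gainB_aux (hp : p.Valid) (ψ : ℝ → ℝ≥0∞) :
    ∫⁻ u, ψ (p.gainB u) * ENNReal.ofReal (pdfDelta u) =
      (∑ n ∈ Finset.range (p.NbT + 1), ENNReal.ofReal (p.gainProbAux n) * ψ (p.level n)) +
      (2 * ∫⁻ y in Ioc (((p.NbT : ℝ) + 1) / p.Nb) (1 - ((p.NbT : ℝ) + 1) / p.Nb),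
        ENNReal.ofReal (pdfDelta y)) * ψ 0 := by
  have h0 := hp.Nb_pos
  have hK := hp.NbT_succ_div_le le_rfl
  have hm := measurable_pdfDelta
  set c : ℝ := ((p.NbT : ℝ) + 1) / p.Nb with hc
  have hc0 : 0 ≤ c := by positivity
  have hc' : c = ((p.NbT + 1 : ℕ) : ℝ) * (1 / p.Nb) := by rw [hc]; push_cast; ring
  rw [lintegral_even (fun x => by rw [p.gainB_neg, pdfDelta_neg])]
  have hsupp : ∫⁻ u in Ioi 0, ψ (p.gainB u) * ENNReal.ofReal (pdfDelta u) =
      ∫⁻ u in Ioc 0 1, ψ (p.gainB u) * ENNReal.ofReal (pdfDelta u) := by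
    rw [← Ioc_union_Ioi_eq_Ioi (zero_le_one' ℝ), lintegral_union measurableSet_Ioi
      (Ioc_disjoint_Ioi le_rfl)]
    have : ∫⁻ u in Ioi (1 : ℝ), ψ (p.gainB u) * ENNReal.ofReal (pdfDelta u) =
        ∫⁻ u in Ioi (1 : ℝ), 0 := by
      refine setLIntegral_congr_fun measurableSet_Ioi fun u (hu : 1 < u) => ?_
      unfold pdfDelta
      rw [if_neg (by rw [abs_of_pos (one_pos.trans hu)]; exact not_le.2 hu)]
      simp
    rw [this, lintegral_zero, add_zero]
  rw [hsupp, ← Ioc_union_Ioc_eq_Ioc (b := 1 - c) (by linarith) (by linarith),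
    lintegral_union measurableSet_Ioc (Ioc_disjoint_Ioc_of_le le_rfl),
    ← Ioc_union_Ioc_eq_Ioc (a := 0) (b := c) (by linarith) (by linarith),
    lintegral_union measurableSet_Ioc (Ioc_disjoint_Ioc_of_le le_rfl)]
  have hA : ∫⁻ u in Ioc 0 c, ψ (p.gainB u) * ENNReal.ofReal (pdfDelta u) =
      ∑ n ∈ Finset.range (p.NbT + 1), ψ (p.level n) *
        ∫⁻ y in Ioc ((n : ℝ) / p.Nb) (((n : ℝ) + 1) / p.Nb), ENNReal.ofReal (pdfDelta y) := by
    rw [hc', lintegral_Ioc_mesh _ _ (by positivity)]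
    refine Finset.sum_congr rfl fun n hn => ?_
    have hn' : n ≤ p.NbT := Nat.lt_succ_iff.1 (Finset.mem_range.1 hn)
    rw [mul_one_div, mul_one_div, ← lintegral_const_mul _ (by fun_prop)]
    refine setLIntegral_congr_fun measurableSet_Ioc fun y hy => ?_
    have hy0 : 0 < y := lt_of_le_of_lt (by positivity) hy.1
    rw [gainB, if_pos (by rw [abs_of_pos hy0]; exact hy.2.trans (hp.NbT_succ_div_le hn')),
      abs_of_pos hy0, hp.gainHalf_eq_level hn' hy.1 hy.2]
  -- The reflection `u ↦ 1 - u` turns cells `(a, b]` into `[1 - b, 1 - a)`, so the endpoints are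
  -- discarded before the levels are compared.
  have hB : ∫⁻ u in Ioc (1 - c) 1, ψ (p.gainB u) * ENNReal.ofReal (pdfDelta u) =
      ∑ n ∈ Finset.range (p.NbT + 1), ψ (p.level n) *
        ∫⁻ y in Ioc (1 - ((n : ℝ) + 1) / p.Nb) (1 - (n : ℝ) / p.Nb),
          ENNReal.ofReal (pdfDelta y) := by
    rw [hc', lintegral_Ioc_mesh_rev _ _ (by positivity)]
    refine Finset.sum_congr rfl fun n hn => ?_
    have hn' : n ≤ p.NbT := Nat.lt_succ_iff.1 (Finset.mem_range.1 hn)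
    rw [mul_one_div, mul_one_div, ← lintegral_const_mul _ (by fun_prop),
      ← setLIntegral_congr Ioo_ae_eq_Ioc, ← setLIntegral_congr Ioo_ae_eq_Ioc]
    refine setLIntegral_congr_fun measurableSet_Ioo fun y hy => ?_
    have h5 := hp.NbT_succ_div_le hn'
    have hy0 : 1 / 2 < y := by linarith [hy.1]
    have hy1 : y < 1 := hy.2.trans_le (by
      have : (0 : ℝ) ≤ n / p.Nb := by positivity
      linarith)
    rw [gainB, if_neg (by rw [abs_of_pos (by linarith)]; linarith), if_neg (by linarith),
      abs_of_neg (by linarith), neg_sub,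
      hp.gainHalf_eq_level hn' (by linarith [hy.2]) (by linarith [hy.1])]
  have hR : ∫⁻ u in Ioc c (1 - c), ψ (p.gainB u) * ENNReal.ofReal (pdfDelta u) =
      ψ 0 * ∫⁻ u in Ioc c (1 - c), ENNReal.ofReal (pdfDelta u) := by
    rw [← lintegral_const_mul _ (by fun_prop),
      ← setLIntegral_congr Ioo_ae_eq_Ioc, ← setLIntegral_congr Ioo_ae_eq_Ioc]
    refine setLIntegral_congr_fun measurableSet_Ioo fun y hy => ?_
    have hy0 : 0 < y := hc0.trans_lt hy.1
    unfold gainB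
    rw [abs_of_pos hy0]
    split_ifs with h1 h2
    · rw [hp.gainHalf_eq_zero hy.1]
    · linarith
    · rw [abs_of_neg (by linarith [hy.2]), neg_sub, hp.gainHalf_eq_zero (by linarith [hy.2])]
  rw [hA, hB, hR]
  simp_rw [hp.ofReal_gainProbAux]
  rw [add_right_comm, ← Finset.sum_add_distrib, mul_add, Finset.mul_sum]
  congr 1
  · refine Finset.sum_congr rfl fun n _ => ?_
    ring
  · ring

/-- The deviation has total mass `1`. The preceding decomposition with `ψ = 1` therefore makes the
mass of the middle interval the complement of the other probabilities. -/
theorem Valid.ofReal_gainProb_last (hp : p.Valid) :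
    ENNReal.ofReal (p.gainProb (p.NbT + 1)) =
      2 * ∫⁻ y in Ioc (((p.NbT : ℝ) + 1) / p.Nb) (1 - ((p.NbT : ℝ) + 1) / p.Nb),
        ENNReal.ofReal (pdfDelta y) := by
  have h := hp.lintegral_gainB_aux (fun _ => 1)
  simp only [one_mul, mul_one, lintegral_pdfDelta] at h
  rw [gainProb, if_neg (by omega), ENNReal.ofReal_sub _
    (Finset.sum_nonneg fun n _ => hp.gainProbAux_nonneg n),
    ENNReal.ofReal_sum_of_nonneg (fun n _ => hp.gainProbAux_nonneg n), ENNReal.ofReal_one, h,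
    ENNReal.add_sub_cancel_left]
  exact (ENNReal.sum_lt_top.2 fun n _ => ENNReal.ofReal_lt_top).ne

theorem Valid.sum_gainProb (_hp : p.Valid) :
    ∑ n ∈ Finset.range (p.NbT + 2), p.gainProb n = 1 := by
  rw [Finset.sum_range_succ, gainProb, if_neg (by omega)]
  have : ∑ n ∈ Finset.range (p.NbT + 1), p.gainProb n =
      ∑ n ∈ Finset.range (p.NbT + 1), p.gainProbAux n :=
    Finset.sum_congr rfl fun n hn => if_pos (Nat.lt_succ_iff.1 (Finset.mem_range.1 hn))
  rw [this]
  ring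

theorem Valid.gainProb_nonneg (hp : p.Valid) {n : ℕ} (hn : n < p.NbT + 2) :
    0 ≤ p.gainProb n := by
  rcases Nat.lt_succ_iff_lt_or_eq.1 hn with h | rfl
  · rw [gainProb, if_pos (by omega)]
    exact hp.gainProbAux_nonneg n
  · have h := hp.lintegral_gainB_aux (fun _ => 1)
    simp only [one_mul, mul_one, lintegral_pdfDelta] at h
    rw [gainProb, if_neg (by omega), sub_nonneg, ← ENNReal.ofReal_le_ofReal_iff zero_le_one,
      ENNReal.ofReal_sum_of_nonneg (fun n _ => hp.gainProbAux_nonneg n), ENNReal.ofReal_one]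
    exact le_of_le_of_eq le_self_add h.symm

/-- The law of the beam gain. -/
theorem Valid.lintegral_gainB (hp : p.Valid) {ψ : ℝ → ℝ≥0∞} (hψ : Measurable ψ) :
    ∫⁻ φ, ∫⁻ φ', ψ (p.gainB (Real.cos φ / 2 - Real.cos φ' / 2)) ∂uniform 0 (2 * Real.pi)
      ∂uniform 0 (2 * Real.pi) =
    ∑ n ∈ Finset.range (p.NbT + 2), ENNReal.ofReal (p.gainProb n) * ψ (p.level n) := by
  rw [lintegral_deviation (g := fun u => ψ (p.gainB u)) (hψ.comp p.measurable_gainB),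
    hp.lintegral_gainB_aux, Finset.sum_range_succ _ (p.NbT + 1), level_NbT_succ, hp.ofReal_gainProb_last]
  congr 1
  refine Finset.sum_congr rfl fun n hn => ?_
  rw [gainProb, if_pos (Nat.lt_succ_iff.1 (Finset.mem_range.1 hn))]

end Params

end Antenna

/-! ### Marks of a station: the law of the power received from a given location. -/

section Marks

open Filter Topology

namespace Params

variable (p : Params)

/-- The law of the marks of a base station. -/
noncomputable def marks : Measure (ℝ × ℝ × ℝ × ℝ × ℝ) :=
  (uniform 0 1).prod ((uniform 0 (2 * Real.pi)).prod ((uniform 0 (2 * Real.pi)).prod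
      ((fadingLaw (p.m .L)).prod (fadingLaw (p.m .N)))))

/-- Received power density from an interfering base station in state `v`. -/
noncomputable def powerIn (v : LinkState) (x : BSPoint) : ℝ≥0∞ :=
  ENNReal.ofReal (p.pb * p.gainB (Real.cos x.phi / 2 - Real.cos x.phiStar / 2) * p.zeta *
      ‖x.loc‖ ^ (-p.alpha v) * x.fading v / p.area)

open Classical in
/-- Received power density from an interfering base station. -/
noncomputable def power (x : BSPoint) : ℝ≥0∞ :=
  if p.InState x .L then p.powerIn .L x else p.powerIn .N x

/-- Mean power density received from distance `d` with unit beam gain. -/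
noncomputable def coeff (v : LinkState) (d : ℝ) : ℝ := p.pb / (4 * Real.pi) * d ^ (-p.alpha v)

/-- The law of the received power density for a link in state `v` with mean power density `c`. -/
noncomputable def mixLaw (v : LinkState) (c : ℝ) : Measure ℝ≥0∞ :=
  ∑ n ∈ Finset.range (p.NbT + 2), ENNReal.ofReal (p.gainProb n) •
    (fadingLaw (p.m v)).map fun h => ENNReal.ofReal (c * p.level n * h)

variable {p}

theorem Valid.beta_pos (hp : p.Valid) : 0 < p.beta := by
  have := hp.lamO_pos
  have := hp.Lo_pos
  unfold beta
  positivity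

theorem Valid.area_pos (hp : p.Valid) : 0 < p.area := by
  have := hp.wl_pos
  unfold area
  positivity

theorem Valid.zeta_pos (hp : p.Valid) : 0 < p.zeta := by
  have := hp.wl_pos
  unfold zeta
  positivity

theorem Valid.zeta_div_area (hp : p.Valid) : p.zeta / p.area = 1 / (4 * Real.pi) := by
  have := hp.wl_pos
  unfold zeta area
  field_simp

theorem Valid.linkProb_nonneg (hp : p.Valid) (v : LinkState) {d : ℝ} (hd : 0 ≤ d) :
    0 ≤ p.linkProb v d := by
  have := hp.beta_pos
  cases v
  · exact (Real.exp_pos _).le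
  · simp only [linkProb, sub_nonneg, Real.exp_le_one_iff]
    nlinarith

theorem linkProb_N (d : ℝ) : p.linkProb .N d = 1 - p.linkProb .L d := rfl

theorem Valid.linkProb_le_one (hp : p.Valid) (v : LinkState) {d : ℝ} (hd : 0 ≤ d) :
    p.linkProb v d ≤ 1 := by
  cases v
  · have := hp.linkProb_nonneg .N hd
    rw [linkProb_N] at this
    linarith
  · have := hp.linkProb_nonneg .L hd
    rw [linkProb_N]
    linarith

theorem measurable_linkProb (v : LinkState) : Measurable (p.linkProb v) := by
  cases v <;> unfold linkProb <;> fun_prop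

theorem measurable_powerIn (v : LinkState) : Measurable (p.powerIn v) := by
  unfold powerIn BSPoint.loc BSPoint.phi BSPoint.phiStar
  have := p.measurable_gainB
  have h2 : Measurable fun x : BSPoint => x.fading v := by
    cases v <;> unfold BSPoint.fading <;> fun_prop
  fun_prop

theorem measurableSet_inState_L : MeasurableSet {x | p.InState x .L} := by
  have := p.measurable_linkProb .L
  unfold InState BSPoint.block BSPoint.loc
  exact measurableSet_le (by fun_prop) (by fun_prop)

theorem measurable_power : Measurable p.power :=
  Measurable.ite measurableSet_inState_L (measurable_powerIn _) (measurable_powerIn _)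

theorem Valid.coeff_nonneg (hp : p.Valid) (v : LinkState) {d : ℝ} (hd : 0 ≤ d) :
    0 ≤ p.coeff v d := by
  have := hp.pb_pos
  unfold coeff
  positivity

theorem Valid.power_eq (hp : p.Valid) (v : LinkState) (G d h : ℝ) :
    p.pb * G * p.zeta * d ^ (-p.alpha v) * h / p.area = p.coeff v d * G * h := by
  have h1 := hp.zeta_div_area
  have h2 := hp.area_pos
  have : p.zeta = p.area / (4 * Real.pi) := by
    rw [div_eq_iff h2.ne'] at h1; rw [h1]; ring
  rw [this, coeff]
  field_simp

theorem isProbabilityMeasure_uniform_zero_one : IsProbabilityMeasure (uniform 0 1) :=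
  isProbabilityMeasure_uniform one_pos

theorem isProbabilityMeasure_uniform_angle : IsProbabilityMeasure (uniform 0 (2 * Real.pi)) :=
  isProbabilityMeasure_uniform (by have := Real.pi_pos; linarith)

theorem Valid.isProbabilityMeasure_marks (hp : p.Valid) : IsProbabilityMeasure p.marks := by
  have := isProbabilityMeasure_uniform_zero_one
  have := isProbabilityMeasure_uniform_angle
  have := fun v => isProbabilityMeasure_fadingLaw (hp.one_le_m v)
  unfold marks
  infer_instance

theorem lintegral_uniform_ite {q : ℝ} (h0 : 0 ≤ q) (h1 : q ≤ 1) (A B : ℝ≥0∞) :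
    ∫⁻ u, (if u ≤ q then A else B) ∂uniform 0 1 =
      ENNReal.ofReal q * A + ENNReal.ofReal (1 - q) * B := by
  rw [lintegral_uniform one_pos, sub_zero, div_one, ENNReal.ofReal_one, one_mul,
    ← Ioc_union_Ioc_eq_Ioc h0 h1, lintegral_union measurableSet_Ioc
    (Ioc_disjoint_Ioc_of_le le_rfl)]
  congr 1
  · rw [setLIntegral_congr_fun (g := fun _ => A) measurableSet_Ioc (fun u hu => if_pos hu.2)]
    simp [mul_comm]
  · rw [setLIntegral_congr_fun (g := fun _ => B) measurableSet_Ioc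
      (fun u hu => if_neg (not_le.2 hu.1))]
    simp [mul_comm]

theorem lintegral_mixLaw (v : LinkState) (c : ℝ) {g : ℝ≥0∞ → ℝ≥0∞} (hg : Measurable g) :
    ∫⁻ y, g y ∂p.mixLaw v c = ∑ n ∈ Finset.range (p.NbT + 2), ENNReal.ofReal (p.gainProb n) *
      ∫⁻ h, g (ENNReal.ofReal (c * p.level n * h)) ∂fadingLaw (p.m v) := by
  unfold mixLaw
  rw [lintegral_finsetSum_measure]
  refine Finset.sum_congr rfl fun n _ => ?_
  rw [lintegral_smul_measure, lintegral_map hg (by fun_prop)]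
  rfl

/-- With location and blockage fixed, the two angles average to the gain law. Of the two fading
coordinates, the one of state `v` survives and the other integrates to `1`. -/
theorem Valid.lintegral_powerIn (hp : p.Valid) (v : LinkState) (z : ℂ) (u : ℝ)
    {g : ℝ≥0∞ → ℝ≥0∞} (hg : Measurable g) :
    ∫⁻ x, g (p.powerIn v (z, u, x)) ∂((uniform 0 (2 * Real.pi)).prod
      ((uniform 0 (2 * Real.pi)).prod ((fadingLaw (p.m .L)).prod (fadingLaw (p.m .N))))) =
      ∫⁻ y, g y ∂p.mixLaw v (p.coeff v ‖z‖) := by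
  have := isProbabilityMeasure_uniform_angle
  have := fun v => isProbabilityMeasure_fadingLaw (hp.one_le_m v)
  have hG := p.measurable_gainB
  have H : Measurable fun x : ℝ × ℝ × ℝ × ℝ => g (p.powerIn v (z, u, x)) :=
    (hg.comp (measurable_powerIn v)).comp (by fun_prop)
  rw [lintegral_prod _ H.aemeasurable, lintegral_mixLaw _ _ hg]
  have hψ : Measurable fun G => ∫⁻ h, g (ENNReal.ofReal (p.coeff v ‖z‖ * G * h))
      ∂fadingLaw (p.m v) := by
    exact Measurable.lintegral_prod_right' (f := fun z' : ℝ × ℝ =>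
      g (ENNReal.ofReal (p.coeff v ‖z‖ * z'.1 * z'.2))) (by fun_prop)
  rw [← hp.lintegral_gainB hψ]
  refine lintegral_congr fun φ => ?_
  have H1 : Measurable fun x : ℝ × ℝ × ℝ => g (p.powerIn v (z, u, φ, x)) :=
    H.comp (by fun_prop)
  rw [lintegral_prod _ H1.aemeasurable]
  refine lintegral_congr fun φ' => ?_
  have H2 : Measurable fun x : ℝ × ℝ => g (p.powerIn v (z, u, φ, φ', x)) :=
    H1.comp (by fun_prop)
  rw [lintegral_prod _ H2.aemeasurable]
  have hpow : ∀ a b : ℝ, p.powerIn v (z, u, φ, φ', a, b) = ENNReal.ofReal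
      (p.coeff v ‖z‖ * p.gainB (Real.cos φ / 2 - Real.cos φ' / 2) *
        BSPoint.fading (z, u, φ, φ', a, b) v) := by
    intro a b
    rw [← hp.power_eq]
    rfl
  simp_rw [hpow]
  cases v
  · refine lintegral_congr fun a => ?_
    simp [BSPoint.fading]
  · simp [BSPoint.fading]

theorem Valid.lintegral_power_marks (hp : p.Valid) (z : ℂ) {g : ℝ≥0∞ → ℝ≥0∞}
    (hg : Measurable g) :
    ∫⁻ x, g (p.power (z, x)) ∂p.marks =
      ENNReal.ofReal (p.linkProb .L ‖z‖) * ∫⁻ y, g y ∂p.mixLaw .L (p.coeff .L ‖z‖) +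
      ENNReal.ofReal (p.linkProb .N ‖z‖) * ∫⁻ y, g y ∂p.mixLaw .N (p.coeff .N ‖z‖) := by
  have := isProbabilityMeasure_uniform_zero_one
  have := isProbabilityMeasure_uniform_angle
  have := fun v => isProbabilityMeasure_fadingLaw (hp.one_le_m v)
  have H : Measurable fun x => g (p.power (z, x)) :=
    (hg.comp measurable_power).comp (by fun_prop)
  rw [marks, lintegral_prod _ H.aemeasurable, linkProb_N,
    ← lintegral_uniform_ite (hp.linkProb_nonneg .L (norm_nonneg z))
      (hp.linkProb_le_one .L (norm_nonneg z))]
  refine lintegral_congr fun u => ?_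
  by_cases hu : u ≤ p.linkProb .L ‖z‖
  · rw [if_pos hu, ← hp.lintegral_powerIn .L z u hg]
    refine lintegral_congr fun x => ?_
    rw [power, if_pos (show p.InState (z, u, x) .L from hu)]
  · rw [if_neg hu, ← hp.lintegral_powerIn .N z u hg]
    refine lintegral_congr fun x => ?_
    rw [power, if_neg (show ¬ p.InState (z, u, x) .L from hu)]

theorem Valid.map_power_marks (hp : p.Valid) (z : ℂ) :
    p.marks.map (fun x => p.power (z, x)) =
      ENNReal.ofReal (p.linkProb .L ‖z‖) • p.mixLaw .L (p.coeff .L ‖z‖) +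
      ENNReal.ofReal (p.linkProb .N ‖z‖) • p.mixLaw .N (p.coeff .N ‖z‖) := by
  refine Measure.ext_of_lintegral _ fun g hg => ?_
  have hm : Measurable fun x => p.power (z, x) := measurable_power.comp (by fun_prop)
  rw [lintegral_map hg hm, hp.lintegral_power_marks z hg,
    lintegral_add_measure, lintegral_smul_measure, lintegral_smul_measure]
  rfl

theorem Valid.isProbabilityMeasure_mixLaw (hp : p.Valid) (v : LinkState) (c : ℝ) :
    IsProbabilityMeasure (p.mixLaw v c) := by
  have := fun v => isProbabilityMeasure_fadingLaw (hp.one_le_m v)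
  constructor
  have h := lintegral_mixLaw (p := p) v c (g := fun _ => 1) measurable_const
  simp only [lintegral_const, measure_univ, mul_one, one_mul] at h
  rw [h, ← ENNReal.ofReal_sum_of_nonneg fun n hn => hp.gainProb_nonneg (Finset.mem_range.1 hn),
    hp.sum_gainProb, ENNReal.ofReal_one]

theorem Valid.meanGain_nonneg (hp : p.Valid) : 0 ≤ p.meanGain :=
  Finset.sum_nonneg fun n hn => mul_nonneg (hp.level_nonneg n)
    (hp.gainProb_nonneg ((Finset.mem_range.1 hn).trans (by omega)))

theorem Valid.lintegral_id_mixLaw (hp : p.Valid) (v : LinkState) {c : ℝ} (hc : 0 ≤ c) :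
    ∫⁻ y, y ∂p.mixLaw v c = ENNReal.ofReal (c * p.meanGain) := by
  rw [lintegral_mixLaw v c (g := fun y => y) measurable_id]
  have h1 : ∀ n, ∫⁻ h, ENNReal.ofReal (c * p.level n * h) ∂fadingLaw (p.m v) =
      ENNReal.ofReal (c * p.level n) := by
    intro n
    simp_rw [ENNReal.ofReal_mul (mul_nonneg hc (hp.level_nonneg n))]
    rw [lintegral_const_mul _ ENNReal.measurable_ofReal,
      lintegral_ofReal_fadingLaw (hp.one_le_m v), mul_one]
  simp_rw [h1]
  rw [Finset.sum_range_succ, level_NbT_succ, mul_zero, ENNReal.ofReal_zero, mul_zero, add_zero,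
    meanGain, Finset.mul_sum, ENNReal.ofReal_sum_of_nonneg]
  · refine Finset.sum_congr rfl fun n hn => ?_
    rw [← ENNReal.ofReal_mul (hp.gainProb_nonneg ((Finset.mem_range.1 hn).trans (by omega)))]
    congr 1
    ring
  · intro n hn
    exact mul_nonneg hc (mul_nonneg (hp.level_nonneg n)
      (hp.gainProb_nonneg ((Finset.mem_range.1 hn).trans (by omega))))

theorem integrable_one_sub_cexp_ennreal {μ : Measure ℝ≥0∞} [IsFiniteMeasure μ] {s : ℂ}
    (hs : 0 ≤ s.re) : Integrable (fun y : ℝ≥0∞ => 1 - Complex.exp (-(s * (y.toReal : ℂ)))) μ := by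
  refine Integrable.of_bound (C := 2) (by fun_prop : Measurable _).aestronglyMeasurable
    (ae_of_all _ fun y => ?_)
  refine (norm_sub_le _ _).trans ?_
  have := norm_cexp_neg_le_one (z := s * (y.toReal : ℂ))
    (by simpa using mul_nonneg hs ENNReal.toReal_nonneg)
  rw [norm_one]
  linarith

/-- Each gain level contributes the Gamma transform of a rescaled fading. Since the level
probabilities sum to `1`, the constants combine to the `1` in `1 - κ`. -/
theorem Valid.integral_cexp_mixLaw (hp : p.Valid) (v : LinkState) {c : ℝ} (hc : 0 ≤ c) {s : ℂ}
    (hs : 0 ≤ s.re) :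
    ∫ y, (1 - Complex.exp (-(s * (y.toReal : ℂ)))) ∂p.mixLaw v c = 1 - p.kappa v (s * c) := by
  have := fun v => isProbabilityMeasure_fadingLaw (hp.one_le_m v)
  have hfin : ∀ n, IsFiniteMeasure ((fadingLaw (p.m v)).map
      fun h => ENNReal.ofReal (c * p.level n * h)) := fun n => inferInstance
  unfold mixLaw
  rw [integral_finsetSum_measure]
  swap
  · intro n _
    exact (integrable_one_sub_cexp_ennreal hs).smul_measure ENNReal.ofReal_ne_top
  have h1 : ∀ n ∈ Finset.range (p.NbT + 2),
      ∫ y, (1 - Complex.exp (-(s * (y.toReal : ℂ)))) ∂(ENNReal.ofReal (p.gainProb n) •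
        (fadingLaw (p.m v)).map fun h => ENNReal.ofReal (c * p.level n * h)) =
      (p.gainProb n : ℂ) - (p.gainProb n : ℂ) *
        (1 + s * c * (p.level n : ℂ) / (p.m v : ℂ)) ^ (-(p.m v : ℤ)) := by
    intro n hn
    have hre : 0 ≤ (s * c * (p.level n : ℂ)).re := by
      rw [Complex.re_mul_ofReal, Complex.re_mul_ofReal]
      exact mul_nonneg (mul_nonneg hs hc) (hp.level_nonneg n)
    rw [integral_smul_measure, ENNReal.toReal_ofReal (hp.gainProb_nonneg (Finset.mem_range.1 hn)),
      integral_map (by fun_prop) (by fun_prop : Measurable _).aestronglyMeasurable]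
    have e : ∀ᵐ h ∂fadingLaw (p.m v), 1 - Complex.exp
        (-(s * ((ENNReal.ofReal (c * p.level n * h)).toReal : ℂ))) =
        1 - Complex.exp (-(s * c * (p.level n : ℂ) * (h : ℂ))) := by
      filter_upwards [ae_fadingLaw_nonneg] with h hh
      rw [ENNReal.toReal_ofReal (mul_nonneg (mul_nonneg hc (hp.level_nonneg n)) hh)]
      push_cast
      ring_nf
    rw [integral_congr_ae e, integral_sub (integrable_const _), integral_cexp_fadingLaw
      (hp.one_le_m v) hre]
    · simp [mul_sub]
    · refine Integrable.of_bound (C := 1) (by fun_prop : Measurable _).aestronglyMeasurable ?_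
      filter_upwards [ae_fadingLaw_nonneg] with h hh
      refine norm_cexp_neg_le_one ?_
      rw [Complex.re_mul_ofReal]
      exact mul_nonneg hre hh
  rw [Finset.sum_congr rfl h1, Finset.sum_sub_distrib, kappa]
  congr 1
  exact_mod_cast hp.sum_gainProb

/-- From `|1 - exp (-z)| ≤ |z|` and the mean of the mixture. The bound is linear in `c`, so the
Laplace exponent converges wherever the mean interference does. -/
theorem Valid.norm_one_sub_kappa_le (hp : p.Valid) (v : LinkState) {c : ℝ} (hc : 0 ≤ c) {s : ℂ}
    (hs : 0 ≤ s.re) : ‖1 - p.kappa v (s * c)‖ ≤ ‖s‖ * (c * p.meanGain) := by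
  have := hp.isProbabilityMeasure_mixLaw v c
  have hmean := hp.lintegral_id_mixLaw v hc
  have hint : Integrable (fun y : ℝ≥0∞ => y.toReal) (p.mixLaw v c) :=
    integrable_toReal_of_lintegral_ne_top measurable_id'.aemeasurable (by
      rw [hmean]; exact ENNReal.ofReal_ne_top)
  rw [← hp.integral_cexp_mixLaw v hc hs]
  refine (norm_integral_le_integral_norm _).trans ?_
  calc ∫ y, ‖1 - Complex.exp (-(s * (y.toReal : ℂ)))‖ ∂p.mixLaw v c
      ≤ ∫ y, ‖s‖ * y.toReal ∂p.mixLaw v c := by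
        refine integral_mono_of_nonneg (ae_of_all _ fun _ => norm_nonneg _) (hint.const_mul _)
          (ae_of_all _ fun y => ?_)
        refine (norm_one_sub_cexp_neg_le (by
          simpa using mul_nonneg hs ENNReal.toReal_nonneg)).trans (le_of_eq ?_)
        rw [norm_mul, Complex.norm_real, Real.norm_of_nonneg ENNReal.toReal_nonneg]
    _ = _ := by
        rw [integral_const_mul, integral_toReal measurable_id'.aemeasurable, hmean,
          ENNReal.toReal_ofReal (mul_nonneg hc hp.meanGain_nonneg)]
        exact ae_lt_top measurable_id' (by rw [hmean]; exact ENNReal.ofReal_ne_top)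

end Params

end Marks

/-! ### Interference from beyond a fixed distance: mean and Laplace exponent. -/

section Intensity

open Filter Topology

theorem sigmaFinite_ofReal_smul {X : Type*} [MeasurableSpace X] (μ : Measure X) [SigmaFinite μ]
    (r : ℝ) : SigmaFinite (ENNReal.ofReal r • μ) := by
  change SigmaFinite (r.toNNReal • μ)
  infer_instance

theorem lintegral_norm_complex {f : ℝ → ℝ≥0∞} (hf : Measurable f) :
    ∫⁻ z : ℂ, f ‖z‖ = ENNReal.ofReal (2 * Real.pi) *
      ∫⁻ r in Ioi (0 : ℝ), ENNReal.ofReal r * f r := by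
  rw [← Complex.lintegral_comp_polarCoord_symm, polarCoord_target, Measure.volume_eq_prod,
    ← Measure.prod_restrict, lintegral_prod_symm]
  · have : ∀ θ : ℝ, ∫⁻ r in Ioi (0 : ℝ), ENNReal.ofReal (r, θ).1 •
        f ‖Complex.polarCoord.symm (r, θ)‖ = ∫⁻ r in Ioi (0 : ℝ), ENNReal.ofReal r * f r := by
      intro θ
      refine setLIntegral_congr_fun measurableSet_Ioi fun r (hr : 0 < r) => ?_
      simp only [Complex.norm_polarCoord_symm, abs_of_pos hr, smul_eq_mul]
    simp_rw [this]
    rw [lintegral_const, Measure.restrict_apply MeasurableSet.univ, univ_inter, Real.volume_Ioo,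
      mul_comm, sub_neg_eq_add, two_mul]
  · have h2 : (fun a : ℝ × ℝ => ENNReal.ofReal a.1 • f ‖Complex.polarCoord.symm a‖) =
        fun a : ℝ × ℝ => ENNReal.ofReal a.1 * f |a.1| := by
      funext a
      rw [Complex.norm_polarCoord_symm, smul_eq_mul]
    rw [h2]
    fun_prop

namespace Params

variable (p : Params)

/-- Radial density of the mean interference, up to a constant factor. -/
noncomputable def weight (v : LinkState) (d : ℝ) : ℝ := d ^ (1 - p.alpha v) * p.linkProb v d

/-- Power density received from the base stations farther than `t`, as a function on marked
points. -/
noncomputable def powerFrom (t : ℝ) (x : BSPoint) : ℝ≥0∞ :=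
  {x : BSPoint | t < ‖x.loc‖}.indicator p.power x

variable {p}

theorem Valid.sigmaFinite_bsIntensity (hp : p.Valid) : SigmaFinite p.bsIntensity := by
  have h1 := sigmaFinite_ofReal_smul (volume : Measure ℂ) p.lamB
  have h2 := hp.isProbabilityMeasure_marks
  change SigmaFinite ((ENNReal.ofReal p.lamB • (volume : Measure ℂ)).prod p.marks)
  infer_instance

theorem measurableSet_lt_loc (t : ℝ) : MeasurableSet {x : BSPoint | t < ‖x.loc‖} := by
  unfold BSPoint.loc
  exact measurableSet_lt (by fun_prop) (by fun_prop)

theorem measurable_powerFrom (t : ℝ) : Measurable (p.powerFrom t) :=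
  measurable_power.indicator (measurableSet_lt_loc t)

/-- The exponential absorbs any power, so the LoS interference from beyond `t` has finite mean
whatever the path-loss exponent. -/
theorem Valid.integrableOn_rpow_mul_linkProb_L (hp : p.Valid) {t : ℝ} (ht : 0 < t) (a : ℝ) :
    IntegrableOn (fun d => d ^ a * p.linkProb .L d) (Ioi t) := by
  have hb := hp.beta_pos
  refine integrable_of_isBigO_exp_neg (b := p.beta / 2) (by positivity) ?_ ?_
  · unfold linkProb
    refine ContinuousOn.mul (fun x hx => ?_) (by fun_prop)
    exact (Real.continuousAt_rpow_const _ _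
      (Or.inl (ht.trans_le hx).ne')).continuousWithinAt
  · have h := (isLittleO_rpow_exp_pos_mul_atTop a (half_pos hb)).isBigO.mul
      (Asymptotics.isBigO_refl (fun d => Real.exp (-p.beta * d)) atTop)
    refine h.congr_right fun d => ?_
    rw [← Real.exp_add]
    ring_nf

/-- In the NLoS state the blockage factor tends to `1` and only the power law decays. This is where
`α_N > 2` is needed: it puts the exponent `1 - α_N` below `-1`. -/
theorem Valid.integrableOn_weight (hp : p.Valid) (v : LinkState) {t : ℝ} (ht : 0 < t) :
    IntegrableOn (p.weight v) (Ioi t) := by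
  cases v
  · exact hp.integrableOn_rpow_mul_linkProb_L ht _
  · have h1 : IntegrableOn (fun d : ℝ => d ^ (1 - p.alpha .N)) (Ioi t) :=
      integrableOn_Ioi_rpow_of_lt (by have := hp.two_lt_alphaN; linarith) ht
    have h2 := h1.sub (hp.integrableOn_rpow_mul_linkProb_L ht (1 - p.alpha .N))
    refine h2.congr (ae_of_all _ fun d => ?_)
    simp only [weight, linkProb_N, Pi.sub_apply]
    ring

theorem Valid.weight_nonneg (hp : p.Valid) (v : LinkState) {d : ℝ} (hd : 0 ≤ d) :
    0 ≤ p.weight v d := mul_nonneg (by positivity) (hp.linkProb_nonneg v hd)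

theorem measurable_weight (v : LinkState) : Measurable (p.weight v) := by
  have := p.measurable_linkProb v
  unfold weight
  fun_prop

/-- The scaling `d = t x` moves the lower limit to `1` and yields the exponential integral. -/
theorem integral_rpow_mul_linkProb_L {t : ℝ} (ht : 0 < t) (α : ℝ) :
    ∫ d in Ioi t, d ^ (1 - α) * p.linkProb .L d =
      t ^ (2 - α) * expInt (α - 1) (p.beta * t) := by
  have h := integral_comp_mul_left_Ioi (E := ℝ) (fun d : ℝ => d ^ (1 - α) * p.linkProb .L d) 1 ht
  rw [mul_one, smul_eq_mul] at h
  have h2 : ∫ d in Ioi t, d ^ (1 - α) * p.linkProb .L d =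
      t * ∫ x in Ioi (1 : ℝ), (t * x) ^ (1 - α) * p.linkProb .L (t * x) := by
    rw [h, ← mul_assoc, mul_inv_cancel₀ ht.ne', one_mul]
  rw [h2, expInt, show (2 : ℝ) - α = 1 + (1 - α) by ring, Real.rpow_add ht, Real.rpow_one,
    mul_assoc, ← integral_const_mul (t ^ (1 - α))]
  refine congrArg (t * ·) (setIntegral_congr_fun measurableSet_Ioi fun x (hx : 1 < x) => ?_)
  have hx0 : 0 < x := one_pos.trans hx
  simp only [linkProb]
  rw [Real.mul_rpow ht.le hx0.le, show α - 1 = -(1 - α) by ring, Real.rpow_neg hx0.le, div_inv_eq_mul,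
    show -(p.beta * t) * x = -p.beta * (t * x) by ring]
  ring

theorem integral_weight_L {t : ℝ} (ht : 0 < t) :
    ∫ d in Ioi t, p.weight .L d =
      t ^ (2 - p.alpha .L) * expInt (p.alpha .L - 1) (p.beta * t) :=
  integral_rpow_mul_linkProb_L ht _

theorem Valid.integral_weight_N (hp : p.Valid) {t : ℝ} (ht : 0 < t) :
    ∫ d in Ioi t, p.weight .N d = t ^ (2 - p.alpha .N) / (p.alpha .N - 2) -
      t ^ (2 - p.alpha .N) * expInt (p.alpha .N - 1) (p.beta * t) := by
  have hα := hp.two_lt_alphaN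
  have h1 : IntegrableOn (fun d : ℝ => d ^ (1 - p.alpha .N)) (Ioi t) :=
    integrableOn_Ioi_rpow_of_lt (by linarith) ht
  have e : p.weight .N = fun d => d ^ (1 - p.alpha .N) - d ^ (1 - p.alpha .N) * p.linkProb .L d := by
    funext d
    simp only [weight, linkProb_N]
    ring
  rw [e, integral_sub h1 (hp.integrableOn_rpow_mul_linkProb_L ht _),
    integral_rpow_mul_linkProb_L ht, integral_Ioi_rpow_of_lt (by linarith) ht,
    show 1 - p.alpha .N + 1 = 2 - p.alpha .N by ring,
    ← neg_sub (2 : ℝ) (p.alpha .N), div_neg, neg_div]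

theorem Valid.mul_coeff (_hp : p.Valid) (v : LinkState) {d : ℝ} (hd : 0 < d) :
    d * p.coeff v d = p.pb / (4 * Real.pi) * d ^ (1 - p.alpha v) := by
  rw [coeff, sub_eq_add_neg, Real.rpow_add hd, Real.rpow_one]
  ring

/-- Averaging the marks replaces gain and fading by `meanGain`. The mean is written as `weight / d`
so that the polar Jacobian cancels the quotient. The constant is `λ_b · 2 π · p_b / (4 π) = λ_b p_b
/ 2`. -/
theorem Valid.lintegral_powerFrom (hp : p.Valid) {t : ℝ} (ht : 0 < t) :
    ∫⁻ x, p.powerFrom t x ∂p.bsIntensity = ENNReal.ofReal (p.lamB * p.pb * p.meanGain / 2) *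
      (ENNReal.ofReal (∫ d in Ioi t, p.weight .L d) +
        ENNReal.ofReal (∫ d in Ioi t, p.weight .N d)) := by
  have hprob := hp.isProbabilityMeasure_marks
  have h1 := sigmaFinite_ofReal_smul (volume : Measure ℂ) p.lamB
  have hmg := hp.meanGain_nonneg
  have hpb := hp.pb_pos
  have hlam := hp.lamB_pos
  change ∫⁻ x, p.powerFrom t x ∂((ENNReal.ofReal p.lamB • (volume : Measure ℂ)).prod p.marks) = _
  rw [lintegral_prod _ (measurable_powerFrom t).aemeasurable, lintegral_smul_measure]
  have hin : ∀ z : ℂ, ∫⁻ x, p.powerFrom t (z, x) ∂p.marks = (Ioi t).indicator (fun d =>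
      ENNReal.ofReal (p.pb / (4 * Real.pi) * p.meanGain / d * p.weight .L d) +
      ENNReal.ofReal (p.pb / (4 * Real.pi) * p.meanGain / d * p.weight .N d)) ‖z‖ := by
    intro z
    by_cases hz : t < ‖z‖
    · have hz0 : 0 < ‖z‖ := ht.trans hz
      rw [indicator_of_mem (show ‖z‖ ∈ Ioi t from hz)]
      have : ∀ x, p.powerFrom t (z, x) = p.power (z, x) := fun x =>
        indicator_of_mem (show (z, x) ∈ {x : BSPoint | t < ‖x.loc‖} from hz) _
      simp_rw [this]
      rw [hp.lintegral_power_marks z (g := fun y => y) measurable_id,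
        hp.lintegral_id_mixLaw _ (hp.coeff_nonneg _ hz0.le),
        hp.lintegral_id_mixLaw _ (hp.coeff_nonneg _ hz0.le),
        ← ENNReal.ofReal_mul (hp.linkProb_nonneg _ hz0.le),
        ← ENNReal.ofReal_mul (hp.linkProb_nonneg _ hz0.le)]
      have e : ∀ v, p.linkProb v ‖z‖ * (p.coeff v ‖z‖ * p.meanGain) =
          p.pb / (4 * Real.pi) * p.meanGain / ‖z‖ * p.weight v ‖z‖ := by
        intro v
        have := hp.mul_coeff v hz0
        rw [weight]
        have h3 : p.coeff v ‖z‖ = p.pb / (4 * Real.pi) * ‖z‖ ^ (1 - p.alpha v) / ‖z‖ := by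
          rw [← this]; field_simp
        rw [h3]
        field_simp
      rw [e, e]
    · rw [indicator_of_notMem (show ‖z‖ ∉ Ioi t from hz)]
      have : ∀ x, p.powerFrom t (z, x) = 0 := fun x =>
        indicator_of_notMem (show (z, x) ∉ {x : BSPoint | t < ‖x.loc‖} from hz) _
      simp [this]
  simp_rw [hin]
  have hw := fun v => p.measurable_weight v
  have hmeas : Measurable fun d => ENNReal.ofReal (p.pb / (4 * Real.pi) * p.meanGain / d *
      p.weight .L d) + ENNReal.ofReal (p.pb / (4 * Real.pi) * p.meanGain / d * p.weight .N d) := by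
    have := hw .L
    have := hw .N
    fun_prop
  rw [lintegral_norm_complex (hmeas.indicator measurableSet_Ioi)]
  have h3 : ∫⁻ r in Ioi (0 : ℝ), ENNReal.ofReal r * (Ioi t).indicator (fun d =>
      ENNReal.ofReal (p.pb / (4 * Real.pi) * p.meanGain / d * p.weight .L d) +
      ENNReal.ofReal (p.pb / (4 * Real.pi) * p.meanGain / d * p.weight .N d)) r =
      ∫⁻ r in Ioi t, ENNReal.ofReal (p.pb / (4 * Real.pi) * p.meanGain) *
        (ENNReal.ofReal (p.weight .L r) + ENNReal.ofReal (p.weight .N r)) := by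
    rw [← lintegral_indicator measurableSet_Ioi, ← lintegral_indicator measurableSet_Ioi]
    refine lintegral_congr fun r => ?_
    by_cases hr : t < r
    · have hr0 : 0 < r := ht.trans hr
      rw [indicator_of_mem (show r ∈ Ioi 0 from hr0), indicator_of_mem (show r ∈ Ioi t from hr),
        indicator_of_mem (show r ∈ Ioi t from hr), mul_add, mul_add,
        ← ENNReal.ofReal_mul hr0.le, ← ENNReal.ofReal_mul hr0.le,
        ← ENNReal.ofReal_mul (by positivity), ← ENNReal.ofReal_mul (by positivity)]
      congr 2 <;> field_simp
    · rw [indicator_of_notMem (show r ∉ Ioi t from hr)]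
      by_cases hr0 : 0 < r
      · rw [indicator_of_mem (show r ∈ Ioi 0 from hr0),
          indicator_of_notMem (show r ∉ Ioi t from hr), mul_zero]
      · rw [indicator_of_notMem (show r ∉ Ioi 0 from hr0)]
  have hsum : Measurable fun r => ENNReal.ofReal (p.weight .L r) + ENNReal.ofReal (p.weight .N r) :=
    (hw .L).ennreal_ofReal.add (hw .N).ennreal_ofReal
  have hofR : ∀ v, ∫⁻ r in Ioi t, ENNReal.ofReal (p.weight v r) =
      ENNReal.ofReal (∫ d in Ioi t, p.weight v d) := fun v =>
    (ofReal_integral_eq_lintegral_ofReal (hp.integrableOn_weight v ht)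
      ((ae_restrict_iff' measurableSet_Ioi).2 (ae_of_all _ fun d (hd : t < d) =>
        hp.weight_nonneg v (ht.trans hd).le))).symm
  rw [h3, lintegral_const_mul _ hsum,
    lintegral_add_left (hw .L).ennreal_ofReal, hofR, hofR, smul_eq_mul, ← mul_assoc, ← mul_assoc,
    ← ENNReal.ofReal_mul hlam.le, ← ENNReal.ofReal_mul (by positivity)]
  congr 2
  field_simp
  norm_num

theorem Valid.lintegral_powerFrom_ne_top (hp : p.Valid) {t : ℝ} (ht : 0 < t) :
    ∫⁻ x, p.powerFrom t x ∂p.bsIntensity ≠ ∞ := by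
  rw [hp.lintegral_powerFrom ht]
  exact ENNReal.mul_ne_top ENNReal.ofReal_ne_top
    (ENNReal.add_ne_top.2 ⟨ENNReal.ofReal_ne_top, ENNReal.ofReal_ne_top⟩)

/-- The integrand in the exponent of the Laplace transform of the interference. -/
theorem mul_coeff_eq (v : LinkState) (s : ℂ) (d : ℝ) :
    s * p.pb / (4 * Real.pi * (d ^ p.alpha v : ℝ)) =
      s * (p.pb / (4 * Real.pi) * (d ^ p.alpha v)⁻¹ : ℝ) := by
  push_cast
  rw [mul_div_assoc, div_mul_eq_div_div, div_eq_mul_inv (_ / _)]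

theorem measurable_kappa (v : LinkState) : Measurable (p.kappa v) := by
  unfold kappa
  refine Finset.measurable_fun_sum _ fun n _ => ?_
  simp_rw [zpow_neg, zpow_natCast]
  fun_prop

theorem Valid.integrableOn_one_sub_kappa (hp : p.Valid) (v : LinkState) {t : ℝ} (ht : 0 < t)
    {s : ℂ} (hs : 0 ≤ s.re) :
    IntegrableOn (fun d : ℝ => (1 - p.kappa v (s * p.pb / (4 * Real.pi * (d ^ p.alpha v : ℝ)))) *
      d * (p.linkProb v d : ℂ)) (Ioi t) := by
  have hmg := hp.meanGain_nonneg
  have hpb := hp.pb_pos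
  have hk := p.measurable_kappa v
  have hl := p.measurable_linkProb v
  refine Integrable.mono' ((hp.integrableOn_weight v ht).const_mul
    (‖s‖ * (p.pb / (4 * Real.pi) * p.meanGain))) (by fun_prop : Measurable _).aestronglyMeasurable
    ((ae_restrict_iff' measurableSet_Ioi).2 (ae_of_all _ fun d (hd : t < d) => ?_))
  have hd0 : 0 < d := ht.trans hd
  rw [norm_mul, norm_mul, mul_coeff_eq, Complex.norm_real, Complex.norm_real,
    Real.norm_of_nonneg hd0.le, Real.norm_of_nonneg (hp.linkProb_nonneg v hd0.le)]
  have h1 := hp.norm_one_sub_kappa_le v (c := p.pb / (4 * Real.pi) * (d ^ p.alpha v)⁻¹)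
    (by positivity) hs
  have h2 := hp.linkProb_nonneg v hd0.le
  refine (mul_le_mul_of_nonneg_right (mul_le_mul_of_nonneg_right h1 hd0.le) h2).trans (le_of_eq ?_)
  rw [weight, sub_eq_add_neg, Real.rpow_add hd0, Real.rpow_one, Real.rpow_neg hd0.le]
  ring

/-- The Laplace exponent of the interference. -/
theorem Valid.integral_one_sub_cexp_powerFrom (hp : p.Valid) {t : ℝ} (ht : 0 < t) {s : ℂ}
    (hs : 0 ≤ s.re) :
    Complex.exp (-∫ x, (1 - Complex.exp (-(s * ((p.powerFrom t x).toReal : ℂ)))) ∂p.bsIntensity) =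
      p.laplaceInterf .L t s * p.laplaceInterf .N t s := by
  have hprob := hp.isProbabilityMeasure_marks
  have h1 := sigmaFinite_ofReal_smul (volume : Measure ℂ) p.lamB
  have hlam := hp.lamB_pos
  have hint := integrable_one_sub_cexp (Λ := p.bsIntensity) (p.measurable_powerFrom t)
    (hp.lintegral_powerFrom_ne_top ht) hs
  have hint' : Integrable (fun x => 1 - Complex.exp (-(s * ((p.powerFrom t x).toReal : ℂ))))
    ((ENNReal.ofReal p.lamB • (volume : Measure ℂ)).prod p.marks) := hint
  unfold laplaceInterf
  rw [← Complex.exp_add]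
  congr 1
  change -∫ x, (1 - Complex.exp (-(s * ((p.powerFrom t x).toReal : ℂ))))
    ∂((ENNReal.ofReal p.lamB • (volume : Measure ℂ)).prod p.marks) = _
  rw [integral_prod _ hint', integral_smul_measure, ENNReal.toReal_ofReal hlam.le]
  have hin : ∀ z : ℂ, ∫ x, (1 - Complex.exp (-(s * ((p.powerFrom t (z, x)).toReal : ℂ))))
      ∂p.marks = (Ioi t).indicator (fun d : ℝ =>
        (p.linkProb .L d : ℂ) * (1 - p.kappa .L (s * p.coeff .L d)) +
        (p.linkProb .N d : ℂ) * (1 - p.kappa .N (s * p.coeff .N d))) ‖z‖ := by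
    intro z
    by_cases hz : t < ‖z‖
    · have hz0 : 0 < ‖z‖ := ht.trans hz
      rw [indicator_of_mem (show ‖z‖ ∈ Ioi t from hz)]
      have : ∀ x, p.powerFrom t (z, x) = p.power (z, x) := fun x =>
        indicator_of_mem (show (z, x) ∈ {x : BSPoint | t < ‖x.loc‖} from hz) _
      simp_rw [this]
      have hm : Measurable fun x => p.power (z, x) := measurable_power.comp (by fun_prop)
      have hmap := integral_map (μ := p.marks) hm.aemeasurable
        (f := fun y : ℝ≥0∞ => 1 - Complex.exp (-(s * (y.toReal : ℂ))))
        (by fun_prop : Measurable _).aestronglyMeasurable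
      have := fun v => hp.isProbabilityMeasure_mixLaw v (p.coeff v ‖z‖)
      rw [← hmap, hp.map_power_marks, integral_add_measure
        ((integrable_one_sub_cexp_ennreal hs).smul_measure ENNReal.ofReal_ne_top)
        ((integrable_one_sub_cexp_ennreal hs).smul_measure ENNReal.ofReal_ne_top),
        integral_smul_measure, integral_smul_measure,
        hp.integral_cexp_mixLaw _ (hp.coeff_nonneg _ hz0.le) hs,
        hp.integral_cexp_mixLaw _ (hp.coeff_nonneg _ hz0.le) hs,
        ENNReal.toReal_ofReal (hp.linkProb_nonneg _ hz0.le),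
        ENNReal.toReal_ofReal (hp.linkProb_nonneg _ hz0.le), Complex.real_smul, Complex.real_smul]
    · rw [indicator_of_notMem (show ‖z‖ ∉ Ioi t from hz)]
      have : ∀ x, p.powerFrom t (z, x) = 0 := fun x =>
        indicator_of_notMem (show (z, x) ∉ {x : BSPoint | t < ‖x.loc‖} from hz) _
      simp [this]
  simp_rw [hin]
  -- Radial integration in dimension two: the constant is the dimension times the area of the unit
  -- disk, that is `2 π`.
  rw [integral_fun_norm_addHaar (volume : Measure ℂ), Complex.finrank_real_complex]
  have hball : (volume : Measure ℂ).real (Metric.ball 0 1) = Real.pi := by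
    rw [measureReal_def, Complex.volume_ball]
    simp
  have h3 : ∫ y in Ioi (0 : ℝ), y ^ (2 - 1) • (Ioi t).indicator (fun d : ℝ =>
        (p.linkProb .L d : ℂ) * (1 - p.kappa .L (s * p.coeff .L d)) +
        (p.linkProb .N d : ℂ) * (1 - p.kappa .N (s * p.coeff .N d))) y =
      ∫ d in Ioi t, ((1 - p.kappa .L (s * p.pb / (4 * Real.pi * (d ^ p.alpha .L : ℝ)))) *
      d * (p.linkProb .L d : ℂ) + (1 - p.kappa .N (s * p.pb / (4 * Real.pi *
        (d ^ p.alpha .N : ℝ)))) * d * (p.linkProb .N d : ℂ)) := by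
    rw [← integral_indicator measurableSet_Ioi, ← integral_indicator measurableSet_Ioi]
    congr 1
    funext r
    by_cases hr : t < r
    · have hr0 : 0 < r := ht.trans hr
      rw [indicator_of_mem (show r ∈ Ioi 0 from hr0), indicator_of_mem (show r ∈ Ioi t from hr),
        indicator_of_mem (show r ∈ Ioi t from hr), mul_coeff_eq, mul_coeff_eq,
        ← Real.rpow_neg hr0.le, ← Real.rpow_neg hr0.le, Complex.real_smul]
      simp only [coeff]
      push_cast
      ring
    · rw [indicator_of_notMem (show r ∉ Ioi t from hr)]
      by_cases hr0 : 0 < r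
      · rw [indicator_of_mem (show r ∈ Ioi 0 from hr0),
          indicator_of_notMem (show r ∉ Ioi t from hr), smul_zero]
      · rw [indicator_of_notMem (show r ∉ Ioi 0 from hr0)]
  rw [h3, integral_add (hp.integrableOn_one_sub_kappa .L ht hs)
    (hp.integrableOn_one_sub_kappa .N ht hs), hball]
  simp only [Complex.real_smul, nsmul_eq_mul]
  push_cast
  ring

end Params

end Intensity

/-! ### Random orientations: probability that two points lie in front of a RIS. -/

section Orientation

open Filter Topology InnerProductGeometry

/-- Two half-circles of directions whose axes differ by `δ` overlap in an arc of length `π - |δ|`.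
-/
theorem volume_cos_pos_inter {δ : ℝ} (h1 : -Real.pi ≤ δ) (h2 : δ ≤ Real.pi) :
    volume (Ioc (-Real.pi) Real.pi ∩ {ψ : ℝ | 0 < Real.cos ψ ∧ 0 < Real.cos (ψ - δ)}) =
      ENNReal.ofReal (Real.pi - |δ|) := by
  have hpi := Real.pi_pos
  -- The sign of the cosine is decided only on `[-3 π / 2, 3 π / 2]`. The difference `ψ - δ` falls
  -- in this range because the first condition has already confined `ψ` to `(-π / 2, π / 2)`.
  have hcos : ∀ x : ℝ, -(Real.pi + Real.pi / 2) ≤ x → x ≤ Real.pi + Real.pi / 2 →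
      (0 < Real.cos x ↔ -(Real.pi / 2) < x ∧ x < Real.pi / 2) := by
    intro x hx1 hx2
    constructor
    · intro h
      by_contra hn
      rw [not_and_or, not_lt, not_lt] at hn
      rcases hn with hn | hn
      · rw [← Real.cos_neg] at h
        exact absurd (Real.cos_nonpos_of_pi_div_two_le_of_le (by linarith) (by linarith)) h.not_ge
      · exact absurd (Real.cos_nonpos_of_pi_div_two_le_of_le hn (by linarith)) h.not_ge
    · rintro ⟨ha, hb⟩
      exact Real.cos_pos_of_mem_Ioo ⟨ha, hb⟩
  rcases le_total 0 δ with hδ | hδ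
  · have : Ioc (-Real.pi) Real.pi ∩ {ψ : ℝ | 0 < Real.cos ψ ∧ 0 < Real.cos (ψ - δ)} =
        Ioo (δ - Real.pi / 2) (Real.pi / 2) := by
      ext x
      simp only [mem_inter_iff, mem_Ioc, mem_ofPred_eq, mem_Ioo]
      constructor
      · rintro ⟨⟨a, b⟩, c, d⟩
        rw [hcos x (by linarith) (by linarith)] at c
        rw [hcos _ (by linarith) (by linarith)] at d
        constructor <;> linarith
      · rintro ⟨a, b⟩
        refine ⟨⟨by linarith, by linarith⟩, ?_, ?_⟩
        · rw [hcos x (by linarith) (by linarith)]; constructor <;> linarith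
        · rw [hcos _ (by linarith) (by linarith)]; constructor <;> linarith
    rw [this, Real.volume_Ioo, abs_of_nonneg hδ]
    congr 1; ring
  · have : Ioc (-Real.pi) Real.pi ∩ {ψ : ℝ | 0 < Real.cos ψ ∧ 0 < Real.cos (ψ - δ)} =
        Ioo (-(Real.pi / 2)) (Real.pi / 2 + δ) := by
      ext x
      simp only [mem_inter_iff, mem_Ioc, mem_ofPred_eq, mem_Ioo]
      constructor
      · rintro ⟨⟨a, b⟩, c, d⟩
        rw [hcos x (by linarith) (by linarith)] at c
        rw [hcos _ (by linarith) (by linarith)] at d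
        constructor <;> linarith
      · rintro ⟨a, b⟩
        refine ⟨⟨by linarith, by linarith⟩, ?_, ?_⟩
        · rw [hcos x (by linarith) (by linarith)]; constructor <;> linarith
        · rw [hcos _ (by linarith) (by linarith)]; constructor <;> linarith
    rw [this, Real.volume_Ioo, abs_of_nonpos hδ]
    congr 1; ring

/-- Lebesgue measure of a periodic set over two periods. -/
theorem volume_inter_Ioc_of_periodic {S : Set ℝ} (hS : MeasurableSet S)
    (hper : ∀ x, x + 2 * Real.pi ∈ S ↔ x ∈ S) (a b α : ℝ) :
    volume (Ioc a (a + 2 * Real.pi) ∩ S) =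
      volume (Ioc b (b + 2 * Real.pi) ∩ {ψ | ψ + α ∈ S}) := by
  have hpi := Real.pi_pos
  have hS' : MeasurableSet {ψ | ψ + α ∈ S} := (measurable_add_const α) hS
  have key : ∀ (T : Set ℝ), MeasurableSet T → ∀ c : ℝ,
      volume.real (Ioc c (c + 2 * Real.pi) ∩ T) =
        ∫ x in c..(c + 2 * Real.pi), T.indicator (fun _ => (1 : ℝ)) x := by
    intro T hT c
    rw [intervalIntegral.integral_of_le (by linarith), integral_indicator_const _ hT,
      smul_eq_mul, mul_one, measureReal_restrict_apply hT, inter_comm]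
  have hp : Function.Periodic (S.indicator (fun _ => (1 : ℝ))) (2 * Real.pi) := by
    intro x
    by_cases hx : x ∈ S
    · rw [indicator_of_mem hx, indicator_of_mem ((hper x).2 hx)]
    · rw [indicator_of_notMem hx, indicator_of_notMem (fun h => hx ((hper x).1 h))]
  have h : volume.real (Ioc a (a + 2 * Real.pi) ∩ S) =
      volume.real (Ioc b (b + 2 * Real.pi) ∩ {ψ | ψ + α ∈ S}) := by
    rw [key S hS, key _ hS']
    have e : ∀ x, {ψ | ψ + α ∈ S}.indicator (fun _ => (1 : ℝ)) x =
        S.indicator (fun _ => (1 : ℝ)) (x + α) := fun x => rfl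
    simp_rw [e]
    rw [intervalIntegral.integral_comp_add_right (fun x => S.indicator (fun _ => (1 : ℝ)) x),
      show b + 2 * Real.pi + α = b + α + 2 * Real.pi by ring]
    exact hp.intervalIntegral_add_eq a (b + α)
  refine (measureReal_eq_measureReal_iff ?_ ?_).1 h
  · exact ((measure_mono inter_subset_left).trans_lt measure_Ioc_lt_top).ne
  · exact ((measure_mono inter_subset_left).trans_lt measure_Ioc_lt_top).ne

theorem inner_cexp_mul_I (ψ : ℝ) (v : ℂ) :
    inner ℝ (Complex.exp (ψ * Complex.I)) v = ‖v‖ * Real.cos (ψ - v.arg) := by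
  conv_lhs => rw [← Complex.norm_mul_exp_arg_mul_I v]
  rw [Complex.inner, ← Complex.exp_conj, mul_assoc, ← Complex.exp_add, Complex.re_ofReal_mul]
  have : v.arg * Complex.I + (starRingEnd ℂ) (ψ * Complex.I) = ((v.arg - ψ : ℝ) : ℂ) * Complex.I := by
    simp; ring
  rw [this, Complex.exp_ofReal_mul_I_re, ← Real.cos_neg, neg_sub]

/-- The probability that a uniform unit vector has positive inner product with two given vectors. -/
theorem uniform_inner_pos {v w : ℂ} (hv : v ≠ 0) (hw : w ≠ 0) :
    uniform 0 (2 * Real.pi) {ψ | 0 < inner ℝ (Complex.exp (ψ * Complex.I)) v ∧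
      0 < inner ℝ (Complex.exp (ψ * Complex.I)) w} =
      ENNReal.ofReal (1 / 2 - 1 / (2 * Real.pi) * angle v w) := by
  have hpi := Real.pi_pos
  have hset : {ψ : ℝ | 0 < inner ℝ (Complex.exp (ψ * Complex.I)) v ∧
      0 < inner ℝ (Complex.exp (ψ * Complex.I)) w} =
      {ψ | 0 < Real.cos (ψ - v.arg) ∧ 0 < Real.cos (ψ - w.arg)} := by
    ext ψ
    have h1 := norm_pos_iff.2 hv
    have h2 := norm_pos_iff.2 hw
    simp only [mem_ofPred_eq, inner_cexp_mul_I, mul_pos_iff_of_pos_left h1,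
      mul_pos_iff_of_pos_left h2]
  have hm : MeasurableSet {ψ : ℝ | 0 < Real.cos (ψ - v.arg) ∧ 0 < Real.cos (ψ - w.arg)} := by
    rw [ofPred_and]
    exact (measurableSet_lt measurable_const (by fun_prop)).inter
      (measurableSet_lt measurable_const (by fun_prop))
  have hvol : volume (Ioc 0 (0 + 2 * Real.pi) ∩
      {ψ : ℝ | 0 < Real.cos (ψ - v.arg) ∧ 0 < Real.cos (ψ - w.arg)}) =
      ENNReal.ofReal (Real.pi - angle v w) := by
    -- Rotation by `v.arg` makes the first condition `0 < cos ψ`. The second then has offset `w.arg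
    -- - v.arg`, which agrees with the argument of `w / v` only modulo `2 π`; hence the passage
    -- through `Real.Angle`. The modulus of that argument is the unoriented angle.
    rw [volume_inter_Ioc_of_periodic hm (fun x => by
      simp only [mem_ofPred_eq]
      rw [add_sub_right_comm, add_sub_right_comm, Real.cos_add_two_pi, Real.cos_add_two_pi])
      0 (-Real.pi) v.arg]
    have hδ := Complex.arg_mem_Ioc (w / v)
    have e : ∀ ψ : ℝ, Real.cos (ψ + v.arg - w.arg) = Real.cos (ψ - (w / v).arg) := by
      intro ψ
      have h : ((w.arg - v.arg : ℝ) : Real.Angle) = ((w / v).arg : Real.Angle) := by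
        rw [Real.Angle.coe_sub, Complex.arg_div_coe_angle hw hv]
      rw [← Real.Angle.cos_coe, ← Real.Angle.cos_coe, show ψ + v.arg - w.arg = ψ - (w.arg - v.arg) by ring,
        Real.Angle.coe_sub, h, ← Real.Angle.coe_sub]
    have hs : {ψ : ℝ | ψ + v.arg ∈
        {ψ : ℝ | 0 < Real.cos (ψ - v.arg) ∧ 0 < Real.cos (ψ - w.arg)}} =
        {ψ : ℝ | 0 < Real.cos ψ ∧ 0 < Real.cos (ψ - (w / v).arg)} := by
      ext ψ
      simp only [mem_ofPred_eq, add_sub_cancel_right, e]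
    rw [hs, show -Real.pi + 2 * Real.pi = Real.pi by ring, volume_cos_pos_inter hδ.1.le hδ.2,
      angle_comm, Complex.angle_eq_abs_arg hw hv]
  rw [zero_add] at hvol
  rw [hset, ← lintegral_indicator_one hm, lintegral_uniform (mul_pos two_pos hpi),
    lintegral_indicator_one hm, Measure.restrict_apply hm, inter_comm, hvol, sub_zero,
    ← ENNReal.ofReal_mul (by positivity)]
  congr 1
  field_simp

theorem sideBR_sq (b t θ : ℝ) : b ^ 2 + t ^ 2 - 2 * b * t * Real.cos θ =
    (t - b * Real.cos θ) ^ 2 + (b * Real.sin θ) ^ 2 := by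
  have := Real.sin_sq_add_cos_sq θ
  linear_combination (-b ^ 2) * this

theorem sideBR_pos {b θ : ℝ} (hb : 0 < b) (hθ : Real.sin θ ≠ 0) (t : ℝ) : 0 < sideBR b t θ := by
  rw [sideBR, Real.sqrt_pos, sideBR_sq]
  positivity

theorem sideBR_eq_norm (b t θ : ℝ) :
    sideBR b t θ = ‖(b : ℂ) - t * Complex.exp (θ * Complex.I)‖ := by
  rw [sideBR, Complex.norm_def, Complex.normSq_apply, Complex.exp_mul_I]
  congr 1
  simp [← Complex.ofReal_cos, ← Complex.ofReal_sin]
  have := Real.sin_sq_add_cos_sq θ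
  linear_combination (-t ^ 2) * this

theorem reflProb_nonneg (b t θ : ℝ) : 0 ≤ reflProb b t θ := by
  have hpi := Real.pi_pos
  have := Real.arccos_le_pi ((t - b * Real.cos θ) / sideBR b t θ)
  rw [reflProb, sub_nonneg, one_div_mul_eq_div, div_le_div_iff₀ (by positivity) (by positivity)]
  linarith

theorem reflProb_le (b t θ : ℝ) : reflProb b t θ ≤ 1 / 2 := by
  have hpi := Real.pi_pos
  have := Real.arccos_nonneg ((t - b * Real.cos θ) / sideBR b t θ)
  rw [reflProb, sub_le_self_iff]
  positivity

theorem measurable_sideBR : Measurable fun x : ℝ × ℝ × ℝ => sideBR x.1 x.2.1 x.2.2 := by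
  unfold sideBR
  fun_prop

theorem measurable_reflProb : Measurable fun x : ℝ × ℝ × ℝ => reflProb x.1 x.2.1 x.2.2 := by
  have := measurable_sideBR
  have h : Measurable fun x : ℝ × ℝ × ℝ =>
      Real.arccos ((x.2.1 - x.1 * Real.cos x.2.2) / sideBR x.1 x.2.1 x.2.2) :=
    Real.continuous_arccos.measurable.comp (by fun_prop)
  unfold reflProb
  fun_prop

theorem measurable_reflProb_right (b t : ℝ) : Measurable fun θ => reflProb b t θ := by
  have h := measurable_reflProb.comp (by fun_prop : Measurable fun θ : ℝ => (b, t, θ))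
  exact h

/-- The geometric form of the reflection probability. -/
theorem reflProb_eq_angle {b : ℂ} (hb : b ≠ 0) {t θ : ℝ} (ht : 0 < t)
    (hθ : Real.sin (θ - b.arg) ≠ 0) :
    (t * Complex.exp (θ * Complex.I) : ℂ) ≠ 0 ∧ b - t * Complex.exp (θ * Complex.I) ≠ 0 ∧
    1 / 2 - 1 / (2 * Real.pi) * angle (0 - t * Complex.exp (θ * Complex.I))
      (b - t * Complex.exp (θ * Complex.I)) = reflProb ‖b‖ t (θ - b.arg) := by
  have hb0 := norm_pos_iff.2 hb
  have hpos := sideBR_pos hb0 hθ t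
  have hz : (t * Complex.exp (θ * Complex.I) : ℂ) ≠ 0 :=
    mul_ne_zero (by exact_mod_cast ht.ne') (Complex.exp_ne_zero _)
  have hu : ‖Complex.exp (b.arg * Complex.I)‖ = 1 := Complex.norm_exp_ofReal_mul_I _
  -- A rotation puts `b` on the positive real axis, so that only the relative angle `θ - b.arg`
  -- remains.
  have hfac : b - t * Complex.exp (θ * Complex.I) =
      Complex.exp (b.arg * Complex.I) *
        ((‖b‖ : ℂ) - t * Complex.exp ((θ - b.arg : ℝ) * Complex.I)) := by
    conv_lhs => rw [← Complex.norm_mul_exp_arg_mul_I b]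
    rw [mul_sub, mul_left_comm _ (t : ℂ), ← Complex.exp_add]
    push_cast
    ring_nf
  have hn : ‖b - t * Complex.exp (θ * Complex.I)‖ = sideBR ‖b‖ t (θ - b.arg) := by
    rw [hfac, norm_mul, hu, one_mul, sideBR_eq_norm]
  refine ⟨hz, ?_, ?_⟩
  · rw [← norm_pos_iff, hn]; exact hpos
  · rw [reflProb, angle, hn]
    congr 3
    have hnz : ‖0 - t * Complex.exp (θ * Complex.I)‖ = t := by
      rw [zero_sub, norm_neg, norm_mul, Complex.norm_exp_ofReal_mul_I, Complex.norm_real,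
        Real.norm_of_nonneg ht.le, mul_one]
    have hin : inner ℝ (0 - t * Complex.exp (θ * Complex.I)) (b - t * Complex.exp (θ * Complex.I)) =
        t * (t - ‖b‖ * Real.cos (θ - b.arg)) := by
      have h1 : inner ℝ (t * Complex.exp (θ * Complex.I)) b = t * (‖b‖ * Real.cos (θ - b.arg)) := by
        rw [← inner_cexp_mul_I, ← Complex.real_smul, real_inner_smul_left]
      rw [zero_sub, inner_neg_left, inner_sub_right, h1, real_inner_self_eq_norm_sq, norm_mul,
        Complex.norm_exp_ofReal_mul_I, Complex.norm_real, Real.norm_of_nonneg ht.le]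
      ring
    rw [hin, hnz, mul_div_mul_left _ _ ht.ne']

end Orientation

/-! ### Intensity of the usable RISs by distance to the user. -/

section Rate

open Filter Topology InnerProductGeometry

namespace Params

variable {p : Params}

theorem aBar_eq (b t : ℝ) :
    p.aBar b t = p.linkProb .L t * ∫ θ in (-Real.pi)..Real.pi, reflProb b t θ := by
  rw [aBar, intervalIntegral.integral_const_mul]

theorem intervalIntegrable_reflProb (b t c d : ℝ) :
    IntervalIntegrable (reflProb b t) volume c d := by
  have hm := measurable_reflProb_right b t
  refine (intervalIntegrable_const (c := (1 / 2 : ℝ))).mono_fun hm.aestronglyMeasurable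
    (ae_of_all _ fun θ => ?_)
  simp only [Real.norm_of_nonneg (reflProb_nonneg _ _ _)]
  rw [Real.norm_of_nonneg (by norm_num)]
  exact reflProb_le _ _ _

theorem aBar_nonneg (b t : ℝ) : 0 ≤ p.aBar b t := by
  rw [aBar_eq]
  exact mul_nonneg (Real.exp_pos _).le (intervalIntegral.integral_nonneg
    (by have := Real.pi_pos; linarith) fun θ _ => reflProb_nonneg _ _ _)

theorem aBar_le (b t : ℝ) : p.aBar b t ≤ Real.pi * Real.exp (-p.beta * t) := by
  rw [aBar_eq, mul_comm]
  refine mul_le_mul_of_nonneg_right ?_ (Real.exp_pos _).le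
  have hpi := Real.pi_pos
  have := intervalIntegral.integral_mono_on (by linarith) (intervalIntegrable_reflProb b t
    (-Real.pi) Real.pi) (intervalIntegrable_const (c := (1 / 2 : ℝ))) fun θ _ => reflProb_le b t θ
  rw [intervalIntegral.integral_const, smul_eq_mul] at this
  linarith

theorem measurable_aBar : Measurable fun x : ℝ × ℝ => p.aBar x.1 x.2 := by
  have h1 : StronglyMeasurable fun y : (ℝ × ℝ) × ℝ => reflProb y.1.1 y.1.2 y.2 :=
    (measurable_reflProb.comp (by fun_prop :
      Measurable fun y : (ℝ × ℝ) × ℝ => (y.1.1, y.1.2, y.2))).stronglyMeasurable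
  have h2 : Measurable fun x : ℝ × ℝ => ∫ θ in (-Real.pi)..Real.pi, reflProb x.1 x.2 θ := by
    simp_rw [intervalIntegral.integral_of_le (show -Real.pi ≤ Real.pi by
      have := Real.pi_pos; linarith)]
    exact (h1.integral_prod_right (ν := volume.restrict (Ioc (-Real.pi) Real.pi))).measurable
  simp_rw [aBar_eq]
  have := p.measurable_linkProb .L
  fun_prop

/-- Dominated convergence: continuity in `t` of the reflection probability can fail only for angles
with `sin θ = 0`, where the RIS may coincide with the station, and these are countable. Continuity
is what lets the void probabilities be differentiated into a density. -/
theorem continuous_aBar {b : ℝ} (hb : 0 < b) : Continuous (p.aBar b) := by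
  have h1 : Continuous fun t => ∫ θ in (-Real.pi)..Real.pi, reflProb b t θ := by
    refine intervalIntegral.continuous_of_dominated_interval (bound := fun _ => 1 / 2)
      (fun t => (measurable_reflProb_right b t).aestronglyMeasurable)
      (fun t => ae_of_all _ fun θ _ => ?_) intervalIntegrable_const ?_
    · rw [Real.norm_of_nonneg (reflProb_nonneg _ _ _)]
      exact reflProb_le _ _ _
    · have hc : {θ : ℝ | Real.sin θ = 0}.Countable := by
        have : {θ : ℝ | Real.sin θ = 0} = range fun n : ℤ => (n : ℝ) * Real.pi := by
          ext θ
          simp [Real.sin_eq_zero_iff]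
        rw [this]
        exact countable_range _
      filter_upwards [hc.ae_notMem volume] with θ hθ _
      have hs := fun t => sideBR_pos hb (show Real.sin θ ≠ 0 from hθ) t
      have hcs : Continuous fun t => sideBR b t θ := by unfold sideBR; fun_prop
      have : Continuous fun t => (t - b * Real.cos θ) / sideBR b t θ :=
        (by fun_prop : Continuous fun t => t - b * Real.cos θ).div hcs fun t => (hs t).ne'
      have := Real.continuous_arccos.comp this
      unfold reflProb
      exact continuous_const.sub (continuous_const.mul this)
  have h2 : Continuous (p.linkProb .L) := by unfold linkProb; fun_prop
  have : p.aBar b = fun t => p.linkProb .L t * ∫ θ in (-Real.pi)..Real.pi, reflProb b t θ :=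
    funext fun t => aBar_eq b t
  rw [this]
  exact h2.mul h1

theorem Valid.integrableOn_aBar (hp : p.Valid) (b : ℝ) :
    IntegrableOn (fun t => p.aBar b t * t) (Ioi 0) := by
  have hb := hp.beta_pos
  have h1 : IntegrableOn (fun t : ℝ => Real.pi * (t ^ (1 : ℝ) * Real.exp (-p.beta * t)))
      (Ioi 0) := by
    have := (integrableOn_rpow_mul_exp_neg_mul_rpow (p := 1) (s := 1) (by norm_num) one_pos
      hb).const_mul Real.pi
    simp only [Real.rpow_one] at this ⊢
    exact this
  have hm : Measurable (p.aBar b) :=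
    measurable_aBar.comp (by fun_prop : Measurable fun t : ℝ => (b, t))
  refine Integrable.mono' h1 (by fun_prop : Measurable _).aestronglyMeasurable
    ((ae_restrict_iff' measurableSet_Ioi).2 (ae_of_all _ fun t (ht : 0 < t) => ?_))
  simp only [Real.norm_of_nonneg (mul_nonneg (aBar_nonneg _ _) ht.le), Real.rpow_one]
  have := p.aBar_le b t
  nlinarith

theorem measurableSet_usable : MeasurableSet {x : ℂ × RISPoint | p.Usable x.1 x.2} := by
  have := p.measurable_linkProb .L
  unfold Usable RISPoint.block RISPoint.loc RISPoint.normal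
  rw [ofPred_and, ofPred_and]
  refine (measurableSet_le (by fun_prop) (by fun_prop)).inter
    ((measurableSet_lt measurable_const ?_).inter (measurableSet_lt measurable_const ?_)) <;>
  fun_prop

theorem measurableSet_usable_right (b : ℂ) : MeasurableSet {r | p.Usable b r} :=
  (measurable_const.prodMk measurable_id : Measurable fun r : RISPoint => (b, r))
    measurableSet_usable

theorem measurable_risLoc : Measurable RISPoint.loc := measurable_fst

theorem Valid.lamR_nonneg (hp : p.Valid) : 0 ≤ p.lamR :=
  mul_nonneg hp.mu_nonneg hp.lamO_pos.le

theorem uniform_le {q : ℝ} (h0 : 0 ≤ q) (h1 : q ≤ 1) :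
    uniform 0 1 {u | u ≤ q} = ENNReal.ofReal q := by
  classical
  have := lintegral_uniform_ite h0 h1 1 0
  rw [mul_one, mul_zero, add_zero] at this
  rw [← this]
  exact (lintegral_indicator_one (measurableSet_Iic (a := q))).symm

/-- Intensity of the usable RISs, by distance to the user. -/
theorem Valid.risIntensity_usable (hp : p.Valid) {b : ℂ} (hb : b ≠ 0) {A : Set ℝ}
    (hA : MeasurableSet A) :
    p.risIntensity {r | p.Usable b r ∧ ‖r.loc‖ ∈ A} =
      ENNReal.ofReal p.lamR * ∫⁻ t in Ioi 0 ∩ A, ENNReal.ofReal (p.aBar ‖b‖ t * t) := by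
  have hpi := Real.pi_pos
  have h1 := isProbabilityMeasure_uniform_zero_one
  have h2 := isProbabilityMeasure_uniform_angle
  have h3 := sigmaFinite_ofReal_smul (volume : Measure ℂ) p.lamR
  have hS : MeasurableSet {r | p.Usable b r ∧ ‖r.loc‖ ∈ A} :=
    (measurableSet_usable_right b).inter (measurable_risLoc.norm hA)
  let O : ℂ → ℝ≥0∞ := fun z => uniform 0 (2 * Real.pi) {ψ |
    0 < inner ℝ (Complex.exp (ψ * Complex.I)) (0 - z) ∧
      0 < inner ℝ (Complex.exp (ψ * Complex.I)) (b - z)}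
  have hO : Measurable O := by
    have hm : MeasurableSet {y : ℂ × ℝ | 0 < inner ℝ (Complex.exp (y.2 * Complex.I)) (0 - y.1) ∧
      0 < inner ℝ (Complex.exp (y.2 * Complex.I)) (b - y.1)} := by
      rw [ofPred_and]
      refine (measurableSet_lt measurable_const ?_).inter (measurableSet_lt measurable_const ?_) <;>
      fun_prop
    exact measurable_measure_prodMk_left hm
  have hin : ∀ z : ℂ, ((uniform 0 1).prod (uniform 0 (2 * Real.pi)))
      (Prod.mk z ⁻¹' {r : RISPoint | p.Usable b r ∧ ‖r.loc‖ ∈ A}) =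
      A.indicator (fun d => ENNReal.ofReal (p.linkProb .L d)) ‖z‖ * O z := by
    intro z
    by_cases hz : ‖z‖ ∈ A
    · have e : (Prod.mk z ⁻¹' {r : RISPoint | p.Usable b r ∧ ‖r.loc‖ ∈ A}) =
          {u | u ≤ p.linkProb .L ‖z‖} ×ˢ {ψ : ℝ |
            0 < inner ℝ (Complex.exp (ψ * Complex.I)) (0 - z) ∧
            0 < inner ℝ (Complex.exp (ψ * Complex.I)) (b - z)} := by
        ext y
        simp only [Usable, RISPoint.block, RISPoint.loc, RISPoint.normal, mem_preimage,
          mem_ofPred_eq, mem_prod, hz, and_true]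
      rw [e, Measure.prod_prod, indicator_of_mem hz,
        uniform_le (hp.linkProb_nonneg _ (norm_nonneg _)) (hp.linkProb_le_one _ (norm_nonneg _))]
    · have e : (Prod.mk z ⁻¹' {r : RISPoint | p.Usable b r ∧ ‖r.loc‖ ∈ A}) = ∅ := by
        ext y
        simp [RISPoint.loc, hz]
      rw [e, measure_empty, indicator_of_notMem hz, zero_mul]
  rw [risIntensity, Measure.prod_apply hS, lintegral_smul_measure, smul_eq_mul]
  congr 1
  simp_rw [hin]
  have hl := p.measurable_linkProb .L
  have hAm : Measurable (A.indicator fun d => ENNReal.ofReal (p.linkProb .L d)) :=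
    (by fun_prop : Measurable fun d => ENNReal.ofReal (p.linkProb .L d)).indicator hA
  rw [← Complex.lintegral_comp_polarCoord_symm, polarCoord_target, Measure.volume_eq_prod,
    ← Measure.prod_restrict, lintegral_prod]
  · rw [inter_comm, ← setLIntegral_indicator hA]
    refine setLIntegral_congr_fun measurableSet_Ioi fun t (ht : 0 < t) => ?_
    have hn : ∀ θ, ‖Complex.polarCoord.symm (t, θ)‖ = t := fun θ => by
      rw [Complex.norm_polarCoord_symm, abs_of_pos ht]
    simp only [hn, smul_eq_mul]
    by_cases htA : t ∈ A
    · simp only [indicator_of_mem htA]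
      have hc : {θ : ℝ | Real.sin (θ - b.arg) = 0}.Countable := by
        have : {θ : ℝ | Real.sin (θ - b.arg) = 0} =
            range fun n : ℤ => (n : ℝ) * Real.pi + b.arg := by
          ext θ
          simp [Real.sin_eq_zero_iff, eq_sub_iff_add_eq]
        rw [this]
        exact countable_range _
      -- Off the directions aligned with `b`, the orientation probability at polar coordinates `(t,
      -- θ)` depends on `θ - b.arg` only. Periodicity removes the shift when the angle is
      -- integrated, which is why only `‖b‖` survives.
      have hae : ∀ᵐ θ ∂(volume.restrict (Ioo (-Real.pi) Real.pi)),
          ENNReal.ofReal t * (ENNReal.ofReal (p.linkProb .L t) * O (Complex.polarCoord.symm (t, θ)))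
          = ENNReal.ofReal (p.linkProb .L t * t) * ENNReal.ofReal (reflProb ‖b‖ t (θ - b.arg)) := by
        filter_upwards [ae_restrict_of_ae (hc.ae_notMem volume)] with θ hθ
        obtain ⟨hz, hbz, he⟩ := reflProb_eq_angle hb ht (show Real.sin (θ - b.arg) ≠ 0 from hθ)
        have hpol : Complex.polarCoord.symm (t, θ) = t * Complex.exp (θ * Complex.I) := by
          rw [Complex.polarCoord_symm_apply, Complex.exp_mul_I, Complex.ofReal_cos,
            Complex.ofReal_sin]
        have : O (Complex.polarCoord.symm (t, θ)) =
            ENNReal.ofReal (reflProb ‖b‖ t (θ - b.arg)) := by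
          rw [hpol, ← he]
          exact uniform_inner_pos (by rwa [zero_sub, neg_ne_zero]) hbz
        rw [this, ← mul_assoc, ← ENNReal.ofReal_mul ht.le, mul_comm t]
      rw [lintegral_congr_ae hae, lintegral_const_mul']
      · have hper : Function.Periodic (reflProb ‖b‖ t) (2 * Real.pi) := by
          intro θ
          simp only [reflProb, sideBR, Real.cos_add_two_pi]
        have hint : ∫ θ in (-Real.pi)..Real.pi, reflProb ‖b‖ t (θ - b.arg) =
            ∫ θ in (-Real.pi)..Real.pi, reflProb ‖b‖ t θ := by
          rw [intervalIntegral.integral_comp_sub_right (fun θ => reflProb ‖b‖ t θ),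
            show Real.pi - b.arg = -Real.pi - b.arg + 2 * Real.pi by ring,
            hper.intervalIntegral_add_eq _ (-Real.pi)]
          congr 1; ring
        have hm : Measurable fun θ => reflProb ‖b‖ t (θ - b.arg) :=
          (measurable_reflProb_right ‖b‖ t).comp (measurable_sub_const b.arg)
        have hi : IntegrableOn (fun θ => reflProb ‖b‖ t (θ - b.arg)) (Ioo (-Real.pi) Real.pi) := by
          refine Integrable.mono' (integrable_const (1 / 2 : ℝ)) hm.aestronglyMeasurable
            (ae_of_all _ fun θ => ?_)
          rw [Real.norm_of_nonneg (reflProb_nonneg _ _ _)]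
          exact reflProb_le _ _ _
        rw [← ofReal_integral_eq_lintegral_ofReal hi (ae_of_all _ fun θ => reflProb_nonneg _ _ _),
          ← integral_Ioc_eq_integral_Ioo, ← intervalIntegral.integral_of_le (by linarith), hint,
          ← ENNReal.ofReal_mul (mul_nonneg (hp.linkProb_nonneg _ ht.le) ht.le), aBar_eq]
        congr 1; ring
      · exact ENNReal.ofReal_ne_top
    · simp only [indicator_of_notMem htA, zero_mul, mul_zero, lintegral_zero]
  · refine Measurable.aemeasurable ?_
    have hpc : Measurable fun y : ℝ × ℝ => Complex.polarCoord.symm y := by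
      simp_rw [Complex.polarCoord_symm_apply]
      fun_prop
    have e1 := hAm.comp hpc.norm
    have e2 := hO.comp hpc
    exact (by fun_prop : Measurable fun y : ℝ × ℝ => ENNReal.ofReal y.1).mul (e1.mul e2)

/-- Mean number of usable RISs within distance `ρ`. -/
theorem Valid.risIntensity_usable_le (hp : p.Valid) {b : ℂ} (hb : b ≠ 0) {ρ : ℝ} (hρ : 0 ≤ ρ) :
    p.risIntensity {r | p.Usable b r ∧ ‖r.loc‖ ≤ ρ} =
      ENNReal.ofReal (p.lamR * ∫ t in (0 : ℝ)..ρ, p.aBar ‖b‖ t * t) := by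
  have h := hp.risIntensity_usable hb (measurableSet_Iic (a := ρ))
  refine h.trans ?_
  rw [Ioi_inter_Iic, ENNReal.ofReal_mul hp.lamR_nonneg, intervalIntegral.integral_of_le hρ,
    ofReal_integral_eq_lintegral_ofReal ((hp.integrableOn_aBar ‖b‖).mono_set Ioc_subset_Ioi_self)
      ((ae_restrict_iff' measurableSet_Ioc).2 (ae_of_all _ fun t ht =>
        mul_nonneg (aBar_nonneg _ _) ht.1.le))]

/-- Mean number of usable RISs. -/
theorem Valid.risIntensity_usable_univ (hp : p.Valid) {b : ℂ} (hb : b ≠ 0) :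
    p.risIntensity {r | p.Usable b r} =
      ENNReal.ofReal (p.lamR * ∫ t in Ioi (0 : ℝ), p.aBar ‖b‖ t * t) := by
  have h := hp.risIntensity_usable hb (MeasurableSet.univ)
  simp only [mem_univ, and_true, inter_univ] at h
  rw [h, ENNReal.ofReal_mul hp.lamR_nonneg,
    ofReal_integral_eq_lintegral_ofReal (hp.integrableOn_aBar ‖b‖)
      ((ae_restrict_iff' measurableSet_Ioi).2 (ae_of_all _ fun t (ht : 0 < t) =>
        mul_nonneg (aBar_nonneg _ _) ht.le))]

end Params

end Rate

/-! ### An s-finite stand-in for the identity kernel on measures. -/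

section Regular

variable {X : Type*} [MeasurableSpace X]

/-- The kernel sending a measure to its restriction to `A`, if the mass of `A` is in `[n, n + 1)`. -/
noncomputable def pieceKernel {A : Set X} (hA : MeasurableSet A) (n : ℕ) :
    Kernel (Measure X) X :=
  @Kernel.piecewise _ _ _ _ _ (Classical.decPred _)
    (Measure.measurable_coe hA (measurableSet_Ico (a := (n : ℝ≥0∞)) (b := n + 1)))
    ((⟨id, measurable_id⟩ : Kernel (Measure X) X).restrict hA) 0

theorem pieceKernel_apply {A : Set X} (hA : MeasurableSet A) (n : ℕ) (ν : Measure X) :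
    pieceKernel hA n ν = if ν A ∈ Ico (n : ℝ≥0∞) (n + 1) then ν.restrict A else 0 := by
  classical
  rw [pieceKernel, Kernel.piecewise_apply]
  simp only [mem_preimage]
  by_cases h : ν A ∈ Ico (n : ℝ≥0∞) (n + 1)
  · rw [if_pos h, if_pos h, Kernel.restrict_apply]
    rfl
  · rw [if_neg h, if_neg h, zero_apply]

instance {A : Set X} (hA : MeasurableSet A) (n : ℕ) : IsFiniteKernel (pieceKernel hA n) := by
  refine ⟨⟨n + 1, by finiteness, fun ν => ?_⟩⟩
  rw [pieceKernel_apply]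
  split_ifs with h
  · rw [Measure.restrict_apply_univ]
    exact h.2.le
  · simp

/-- An s-finite kernel that is the identity on the measures that are finite on the sets of a fixed
exhaustion. -/
noncomputable def regularKernel (Λ : Measure X) [SigmaFinite Λ] : Kernel (Measure X) X :=
  Kernel.sum fun i : ℕ × ℕ =>
    pieceKernel (MeasurableSet.disjointed (measurableSet_spanningSets Λ) i.1) i.2

instance (Λ : Measure X) [SigmaFinite Λ] : IsSFiniteKernel (regularKernel Λ) := by
  unfold regularKernel
  infer_instance

/-- Joint measurability of integrals in a parameter and a measure is obtained through s-finite
kernels, and the tautological kernel `ν ↦ ν` is not s-finite in general. Cutting `ν` along a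
disjoint exhaustion, and sorting by the integer part of the mass of each piece, gives finite
kernels. If every piece has finite mass, exactly one class is active for each piece and the sum
restores `ν`. -/
theorem regularKernel_eq {Λ : Measure X} [SigmaFinite Λ] {ν : Measure X}
    (h : ∀ i, ν (disjointed (spanningSets Λ) i) < ∞) : regularKernel Λ ν = ν := by
  have hA := fun i => MeasurableSet.disjointed (measurableSet_spanningSets Λ) i
  ext s hs
  rw [regularKernel, Kernel.sum_apply, Measure.sum_apply _ hs,
    ENNReal.tsum_prod (f := fun i n => pieceKernel (hA i) n ν s)]
  have h1 : ∀ i, ∑' n, pieceKernel (hA i) n ν s = ν (s ∩ disjointed (spanningSets Λ) i) := by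
    intro i
    have hx := ENNReal.ofReal_toReal (h i).ne
    set x := (ν (disjointed (spanningSets Λ) i)).toReal with hxdef
    have hx0 : 0 ≤ x := ENNReal.toReal_nonneg
    have hmem : ∀ n : ℕ, ν (disjointed (spanningSets Λ) i) ∈ Ico (n : ℝ≥0∞) (n + 1) ↔
        n = ⌊x⌋₊ := by
      intro n
      rw [← hx, eq_comm, Nat.floor_eq_iff hx0, mem_Ico]
      have e : (n : ℝ≥0∞) + 1 = ENNReal.ofReal ((n : ℝ) + 1) := by
        rw [ENNReal.ofReal_add (by positivity) zero_le_one, ENNReal.ofReal_natCast,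
          ENNReal.ofReal_one]
      rw [e, ← ENNReal.ofReal_natCast, ENNReal.ofReal_le_ofReal_iff hx0,
        ENNReal.ofReal_lt_ofReal_iff (by positivity)]
    rw [tsum_eq_single ⌊x⌋₊ fun n hn => by
      rw [pieceKernel_apply, if_neg (fun hc => hn ((hmem n).1 hc))]; rfl]
    rw [pieceKernel_apply, if_pos ((hmem _).2 rfl), Measure.restrict_apply hs]
  simp_rw [h1]
  rw [← measure_iUnion, ← inter_iUnion, iUnion_disjointed, iUnion_spanningSets, inter_univ]
  · exact fun i j hij => (disjoint_disjointed _ hij).mono inter_subset_right inter_subset_right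
  · exact fun i => hs.inter (hA i)

/-- Each piece of the exhaustion has finite intensity, hence almost surely finitely many points, and
there are countably many pieces. -/
theorem IsPoissonProcess.ae_regularKernel_eq [MeasurableSingletonClass X] {Ω : Type*}
    [MeasurableSpace Ω] {P : Measure Ω} [IsProbabilityMeasure P] {Φ : Ω → Set X} {Λ : Measure X}
    [SigmaFinite Λ] (h : IsPoissonProcess Φ Λ P) :
    ∀ᵐ ω ∂P, regularKernel Λ (pointMeasure Φ ω) = pointMeasure Φ ω := by
  have hA := fun i => MeasurableSet.disjointed (measurableSet_spanningSets Λ) i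
  have : ∀ i, ∀ᵐ ω ∂P, count Φ (disjointed (spanningSets Λ) i) ω < ⊤ := fun i =>
    h.count_lt_top (hA i)
      ((measure_mono (disjointed_subset _ _)).trans_lt (measure_spanningSets_lt_top Λ i)).ne
  filter_upwards [ae_all_iff.2 this] with ω hω
  refine regularKernel_eq fun i => ?_
  rw [pointMeasure_apply (h.countable ω) (hA i)]
  exact ENat.toENNReal_lt_top.2 (hω i)

end Regular

/-! ### The nearest station: almost sure uniqueness and measurability. -/

section Nearest

open Filter Topology

/-- Marked points within distance `r`. -/
def BSPoint.disk (r : ℝ) : Set BSPoint := {x | ‖x.loc‖ ≤ r}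

theorem BSPoint.measurable_loc : Measurable BSPoint.loc := measurable_fst

theorem BSPoint.measurableSet_disk (r : ℝ) : MeasurableSet (BSPoint.disk r) :=
  measurableSet_le BSPoint.measurable_loc.norm measurable_const

open BSPoint

namespace Params

variable {p : Params}

theorem Valid.bsIntensity_loc (hp : p.Valid) {B : Set ℂ} :
    p.bsIntensity {x | x.loc ∈ B} = ENNReal.ofReal p.lamB * volume B := by
  have h1 := sigmaFinite_ofReal_smul (volume : Measure ℂ) p.lamB
  have h2 := hp.isProbabilityMeasure_marks
  have : {x : BSPoint | x.loc ∈ B} = B ×ˢ univ := by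
    ext x; simp [BSPoint.loc]
  change ((ENNReal.ofReal p.lamB • (volume : Measure ℂ)).prod p.marks) _ = _
  rw [this, Measure.prod_prod, measure_univ, mul_one]
  rfl

theorem Valid.bsIntensity_disk (hp : p.Valid) {r : ℝ} (hr : 0 ≤ r) :
    p.bsIntensity (disk r) = ENNReal.ofReal (Real.pi * p.lamB * r ^ 2) := by
  have : disk r = {x | x.loc ∈ Metric.closedBall (0 : ℂ) r} := by
    ext x; simp [disk]
  rw [this, hp.bsIntensity_loc, Complex.volume_closedBall, ← ENNReal.ofReal_pow hr,
    ← ENNReal.ofReal_coe_nnreal, NNReal.coe_real_pi, ← ENNReal.ofReal_mul (by positivity),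
    ← ENNReal.ofReal_mul hp.lamB_pos.le]
  congr 1; ring

theorem Valid.bsIntensity_annulus (hp : p.Valid) {r R : ℝ} (hr : 0 ≤ r) (hrR : r ≤ R) :
    p.bsIntensity (disk R \ disk r) =
      ENNReal.ofReal (Real.pi * p.lamB * R ^ 2 - Real.pi * p.lamB * r ^ 2) := by
  have hl := hp.lamB_pos
  have hpi := Real.pi_pos
  rw [measure_sdiff (show disk r ⊆ disk R from fun x hx => le_trans hx hrR)
    (measurableSet_disk r).nullMeasurableSet (by rw [hp.bsIntensity_disk hr]; finiteness),
    hp.bsIntensity_disk hr, hp.bsIntensity_disk (hr.trans hrR), ENNReal.ofReal_sub _ (by positivity)]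

/-- Radii of disks with mean number of base stations `i.2 / (i.1 + 1)`. -/
noncomputable def radius (p : Params) (i : ℕ × ℕ) : ℝ :=
  Real.sqrt (i.2 / ((i.1 + 1) * (Real.pi * p.lamB)))

theorem radius_nonneg (i : ℕ × ℕ) : 0 ≤ p.radius i := Real.sqrt_nonneg _

theorem Valid.mul_radius_sq (hp : p.Valid) (i : ℕ × ℕ) :
    Real.pi * p.lamB * p.radius i ^ 2 = i.2 / (i.1 + 1) := by
  have hl := hp.lamB_pos
  have hpi := Real.pi_pos
  rw [radius, Real.sq_sqrt (by positivity)]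
  field_simp

theorem Valid.radius_le (hp : p.Valid) (k j : ℕ) : p.radius (k, j) ≤ p.radius (k, j + 1) := by
  have hl := hp.lamB_pos
  have hpi := Real.pi_pos
  refine Real.sqrt_le_sqrt ?_
  gcongr
  simp

end Params

variable {Ω : Type*} (X : Network Ω) (p : Params)

/-- Some disk contains exactly one base station; in particular, there is a unique nearest one. -/
def Network.regular : Set Ω := {ω | ∃ i, count X.bs (disk (p.radius i)) ω = 1}

/-- Location of the tagged base station. -/
noncomputable def Network.nearest : Ω → ℂ :=
  (X.regular p).indicator fun ω => (X.tagged ω).loc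

variable {X p}

/-- A disk with exactly one station makes that station the strict minimiser of the distance. The
choice defining `tagged` is then attained and has a single candidate. -/
theorem Network.tagged_spec {ω : Ω} {r : ℝ} (h : count X.bs (disk r) ω = 1) :
    X.tagged ω ∈ X.bs ω ∧ ‖(X.tagged ω).loc‖ ≤ r ∧
      ∀ y ∈ X.bs ω, y ≠ X.tagged ω → r < ‖y.loc‖ := by
  obtain ⟨x, hx⟩ := encard_eq_one.1 h
  have hx1 : x ∈ X.bs ω ∩ disk r := hx ▸ mem_singleton x
  have huniq : ∀ y ∈ X.bs ω, ‖y.loc‖ ≤ r → y = x := fun y hy hyr => by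
    have : y ∈ X.bs ω ∩ disk r := ⟨hy, hyr⟩
    rw [hx] at this
    exact this
  have hmin : ∀ y ∈ X.bs ω, ‖x.loc‖ ≤ ‖y.loc‖ := fun y hy => by
    by_cases hyr : ‖y.loc‖ ≤ r
    · rw [huniq y hy hyr]
    · exact (show ‖x.loc‖ ≤ r from hx1.2).trans (not_le.1 hyr).le
  have hs : X.tagged ω ∈ X.bs ω ∧ ∀ y ∈ X.bs ω, ‖(X.tagged ω).loc‖ ≤ ‖y.loc‖ :=
    Classical.epsilon_spec (p := fun x => x ∈ X.bs ω ∧ ∀ y ∈ X.bs ω, ‖x.loc‖ ≤ ‖y.loc‖)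
      ⟨x, hx1.1, hmin⟩
  have hr : ‖(X.tagged ω).loc‖ ≤ r := (hs.2 x hx1.1).trans hx1.2
  refine ⟨hs.1, hr, fun y hy hne => ?_⟩
  by_contra hc
  exact hne ((huniq y hy (not_lt.1 hc)).trans (huniq _ hs.1 hr).symm)

theorem Network.measurableSet_regular : MeasurableSet[sigmaAlg X.bs] (X.regular p) := by
  have : X.regular p = ⋃ i, count X.bs (disk (p.radius i)) ⁻¹' {1} := by
    ext ω; simp [regular]
  rw [this]
  refine MeasurableSet.iUnion fun i => ?_
  exact (le_iSup₂_of_le (f := fun A (_ : A ∈ {A : Set BSPoint | MeasurableSet A}) =>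
    MeasurableSpace.comap (count X.bs A) ⊤) (disk (p.radius i)) (measurableSet_disk _) le_rfl)
    _ ⟨{1}, trivial, rfl⟩

theorem Network.measurableSet_count {A : Set BSPoint} (hA : MeasurableSet A) (n : ℕ∞) :
    MeasurableSet[sigmaAlg X.bs] {ω | count X.bs A ω = n} :=
  (le_iSup₂_of_le (f := fun A (_ : A ∈ {A : Set BSPoint | MeasurableSet A}) =>
    MeasurableSpace.comap (count X.bs A) ⊤) A hA le_rfl) _ ⟨{n}, trivial, rfl⟩

/-- On the regular event, the nearest location lies in `B` exactly when some disk of the countable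
family holds one station and holds one station with location in `B`. This involves countably many
counts, so the location is a function of the information in the process, which is what independence
requires. -/
theorem Network.measurable_nearest : Measurable[sigmaAlg X.bs] (X.nearest p) := by
  intro B hB
  have hBm : MeasurableSet {x : BSPoint | x.loc ∈ B} := measurable_loc hB
  have h1 : X.nearest p ⁻¹' B =
      (⋃ i, {ω | count X.bs (disk (p.radius i)) ω = 1} ∩
        {ω | count X.bs (disk (p.radius i) ∩ {x | x.loc ∈ B}) ω = 1}) ∪
      ((X.regular p)ᶜ ∩ {_ω | (0 : ℂ) ∈ B}) := by
    ext ω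
    by_cases hω : ω ∈ X.regular p
    · simp only [mem_preimage, mem_union, mem_iUnion, mem_inter_iff, mem_ofPred_eq, mem_compl_iff,
        hω, not_true, false_and, or_false, nearest, indicator_of_mem]
      constructor
      · intro hb
        obtain ⟨i, hi⟩ := hω
        refine ⟨i, hi, ?_⟩
        obtain ⟨hs1, hs2, hs3⟩ := tagged_spec hi
        refine encard_eq_one.2 ⟨X.tagged ω, ?_⟩
        ext y
        simp only [mem_inter_iff, mem_singleton_iff, mem_ofPred_eq]
        constructor
        · rintro ⟨hy, hyr, -⟩
          by_contra hne
          exact absurd (hs3 y hy hne) (not_lt.2 hyr)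
        · rintro rfl
          exact ⟨hs1, hs2, hb⟩
      · rintro ⟨i, hi, hB1⟩
        obtain ⟨hs1, hs2, hs3⟩ := tagged_spec hi
        obtain ⟨y, hy⟩ := encard_eq_one.1 hB1
        have hy' : y ∈ X.bs ω ∩ (disk (p.radius i) ∩ {x | x.loc ∈ B}) := hy ▸ mem_singleton y
        have : y = X.tagged ω := by
          by_contra hne
          exact absurd (hs3 y hy'.1 hne) (not_lt.2 hy'.2.1)
        rw [← this]
        exact hy'.2.2
    · simp only [mem_preimage, mem_union, mem_iUnion, mem_inter_iff, mem_ofPred_eq, mem_compl_iff,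
        hω, not_false_eq_true, true_and, nearest, indicator_of_notMem]
      constructor
      · exact Or.inr
      · rintro (⟨i, hi, -⟩ | h)
        · exact absurd ⟨i, hi⟩ hω
        · exact h
  rw [h1]
  refine MeasurableSet.union (MeasurableSet.iUnion fun i => ?_) ?_
  · exact (measurableSet_count (measurableSet_disk _) _).inter
      (measurableSet_count ((measurableSet_disk _).inter hBm) _)
  · exact measurableSet_regular.compl.inter (MeasurableSet.const _)

variable {mΩ : MeasurableSpace Ω} {P : Measure Ω}

theorem Network.IsModel.sigmaAlg_bs_le (hX : X.IsModel p P) : sigmaAlg X.bs ≤ ‹MeasurableSpace Ω› :=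
  iSup₂_le fun A hA => (hX.bs_poisson.measurable_count A hA).comap_le

theorem Network.IsModel.sigmaAlg_ris_le (hX : X.IsModel p P) :
    sigmaAlg X.ris ≤ ‹MeasurableSpace Ω› :=
  iSup₂_le fun A hA => (hX.ris_poisson.measurable_count A hA).comap_le

theorem count_sdiff_of_count_eq_zero {Ω Y : Type*} {Φ : Ω → Set Y} {A : Set Y} {ω : Ω}
    (hA : count Φ A ω = 0) (B : Set Y) : count Φ (B \ A) ω = count Φ B ω := by
  rw [count, encard_eq_zero] at hA
  rw [count, count]
  congr 1
  ext x
  simp only [mem_inter_iff, Set.mem_sdiff]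
  refine ⟨fun ⟨h1, h2, _⟩ => ⟨h1, h2⟩, fun ⟨h1, h2⟩ => ⟨h1, h2, fun h3 => ?_⟩⟩
  exact (hA ▸ (show x ∈ Φ ω ∩ A from ⟨h1, h3⟩) : x ∈ (∅ : Set Y))

theorem count_mono {Ω Y : Type*} (Φ : Ω → Set Y) {A B : Set Y} (h : A ⊆ B) (ω : Ω) :
    count Φ A ω ≤ count Φ B ω := encard_le_encard (inter_subset_inter_right _ h)

theorem IsPoissonProcess.prob_count_eq_zero {Y : Type*} [MeasurableSpace Y] {Φ : Ω → Set Y}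
    {Λ : Measure Y} (h : IsPoissonProcess Φ Λ P) {A : Set Y} (hA : MeasurableSet A)
    (hΛ : Λ A ≠ ∞) : P {ω | count Φ A ω = 0} = ENNReal.ofReal (Real.exp (-(Λ A).toReal)) := by
  have := h.poisson A hA hΛ 0
  simpa using this

theorem IsPoissonProcess.indepFun_count {Y : Type*} [MeasurableSpace Y] {Φ : Ω → Set Y}
    {Λ : Measure Y} (h : IsPoissonProcess Φ Λ P) {A B : Set Y} (hA : MeasurableSet A)
    (hB : MeasurableSet B) (hAB : Disjoint A B) : IndepFun (count Φ A) (count Φ B) P := by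
  have := h.iIndepFun_count (A := fun i : Bool => if i then A else B)
    (fun i => by cases i <;> simpa) (fun i j hij => by
      cases i <;> cases j <;> simp_all [disjoint_comm])
  exact this.indepFun (i := true) (j := false) (by decide)

/-- Let the disks grow by annuli of mean mass `ε = 1 / (k + 1)`. If one disk is empty and the next
annulus holds exactly one station, the next disk is regular. These events are disjoint with
probabilities `ε exp (-ε) exp (-j ε)`, whose sum is at least `exp (-ε)` because `1 - exp (-ε) ≤ ε`.
Finally `k → ∞`. -/
theorem Network.IsModel.prob_regular [IsProbabilityMeasure P] (hX : X.IsModel p P)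
    (hp : p.Valid) : ∀ᵐ ω ∂P, ω ∈ X.regular p := by
  have hmG : MeasurableSet (X.regular p) := hX.sigmaAlg_bs_le _ measurableSet_regular
  refine (mem_ae_iff_prob_eq_one hmG).2 (le_antisymm prob_le_one ?_)
  have hbs := hX.bs_poisson
  have key : ∀ k : ℕ, ENNReal.ofReal (Real.exp (-(1 / ((k : ℝ) + 1)))) ≤ P (X.regular p) := by
    intro k
    set ε : ℝ := 1 / ((k : ℝ) + 1) with hε
    have hε0 : 0 < ε := by positivity
    let D : ℕ → Set BSPoint := fun j => disk (p.radius (k, j))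
    have hDm : ∀ j, MeasurableSet (D j) := fun j => measurableSet_disk _
    have hDmono : Monotone D := monotone_nat_of_le_succ fun j x hx => le_trans hx (hp.radius_le k j)
    have hΛ : ∀ j, p.bsIntensity (D j) = ENNReal.ofReal (j * ε) := by
      intro j
      rw [hp.bsIntensity_disk (Params.radius_nonneg _), hp.mul_radius_sq, hε]
      congr 1; ring
    have hΛa : ∀ j, p.bsIntensity (D (j + 1) \ D j) = ENNReal.ofReal ε := by
      intro j
      rw [hp.bsIntensity_annulus (Params.radius_nonneg _) (hp.radius_le k j), hp.mul_radius_sq,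
        hp.mul_radius_sq, hε]
      congr 1
      push_cast
      ring
    let E : ℕ → Set Ω := fun j => {ω | count X.bs (D j) ω = 0} ∩
      {ω | count X.bs (D (j + 1) \ D j) ω = 1}
    have hE1 : ∀ j, ∀ ω ∈ E j, count X.bs (D (j + 1)) ω = 1 := fun j ω hω => by
      rw [← count_sdiff_of_count_eq_zero hω.1]
      exact hω.2
    have hEm : ∀ j, MeasurableSet (E j) := fun j =>
      hX.sigmaAlg_bs_le _ ((measurableSet_count (hDm j) 0).inter
        (measurableSet_count ((hDm _).diff (hDm j)) 1))
    have hPE : ∀ j, P (E j) = ENNReal.ofReal (Real.exp (-ε) * ε * Real.exp (-ε) ^ j) := by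
      intro j
      have hind := (hbs.indepFun_count (hDm j) ((hDm (j + 1)).diff (hDm j))
        disjoint_sdiff_self_right).measure_inter_preimage_eq_mul {0} {1} trivial trivial
      have h0 := hbs.prob_count_eq_zero (hDm j) (by rw [hΛ]; finiteness)
      have h1 := hbs.poisson _ ((hDm (j + 1)).diff (hDm j)) (by rw [hΛa]; finiteness) 1
      rw [hΛ, ENNReal.toReal_ofReal (by positivity)] at h0
      rw [hΛa, ENNReal.toReal_ofReal hε0.le] at h1
      have e : P (E j) = P {ω | count X.bs (D j) ω = 0} *
          P {ω | count X.bs (D (j + 1) \ D j) ω = ((1 : ℕ) : ℕ∞)} := hind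
      rw [e, h0, h1, ← ENNReal.ofReal_mul (Real.exp_pos _).le, ← Real.exp_nat_mul]
      congr 1
      simp only [pow_one, Nat.factorial_one, Nat.cast_one, div_one]
      rw [mul_neg]
      ring
    have hEd : Pairwise (fun i j => Disjoint (E i) (E j)) := by
      have : ∀ i j, i < j → Disjoint (E i) (E j) := by
        intro i j hij
        rw [Set.disjoint_left]
        intro ω hi hj
        have h1 := hE1 i ω hi
        have h2 := count_mono X.bs (hDmono (Nat.succ_le_of_lt hij)) ω
        rw [Nat.succ_eq_add_one, h1, show count X.bs (D j) ω = 0 from hj.1] at h2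
        simp at h2
      intro i j hij
      rcases lt_or_gt_of_ne hij with h | h
      · exact this i j h
      · exact (this j i h).symm
    have hr1 : Real.exp (-ε) < 1 := by simpa using hε0
    calc ENNReal.ofReal (Real.exp (-ε))
        ≤ ENNReal.ofReal (∑' j : ℕ, Real.exp (-ε) * ε * Real.exp (-ε) ^ j) := by
          refine ENNReal.ofReal_le_ofReal ?_
          rw [tsum_mul_left, tsum_geometric_of_lt_one (Real.exp_pos _).le hr1, mul_assoc]
          have h1 : 0 < 1 - Real.exp (-ε) := by linarith
          have h2 : 1 ≤ ε * (1 - Real.exp (-ε))⁻¹ := by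
            rw [← div_eq_mul_inv, one_le_div h1]
            have := Real.add_one_le_exp (-ε)
            linarith
          have := Real.exp_pos (-ε)
          nlinarith
      _ = ∑' j, P (E j) := by
          rw [ENNReal.ofReal_tsum_of_nonneg (fun j => by positivity)
            ((summable_geometric_of_lt_one (Real.exp_pos _).le hr1).mul_left _)]
          simp_rw [hPE]
      _ = P (⋃ j, E j) := (measure_iUnion hEd hEm).symm
      _ ≤ P (X.regular p) := measure_mono (iUnion_subset fun j ω hω => ⟨(k, j + 1), hE1 j ω hω⟩)
  have hlim : Tendsto (fun k : ℕ => ENNReal.ofReal (Real.exp (-(1 / ((k : ℝ) + 1))))) atTop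
      (𝓝 (ENNReal.ofReal (Real.exp (-0)))) :=
    ENNReal.tendsto_ofReal ((Real.continuous_exp.tendsto _).comp
      tendsto_one_div_add_atTop_nhds_zero_nat.neg)
  rw [neg_zero, Real.exp_zero, ENNReal.ofReal_one] at hlim
  exact le_of_tendsto' hlim key

end Nearest

/-! ### Laws depending measurably on a parameter. -/

section LawKernel

variable {α β γ : Type*} [MeasurableSpace α] [MeasurableSpace β] [MeasurableSpace γ]

/-- The laws of a family of random variables depending measurably on a parameter. -/
noncomputable def lawKernel (μ : Measure β) [SFinite μ] {f : α × β → γ} (hf : Measurable f) :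
    Kernel α γ where
  toFun a := μ.map fun b => f (a, b)
  measurable' := by
    refine Measure.measurable_of_measurable_coe _ fun s hs => ?_
    have h : ∀ a, μ.map (fun b => f (a, b)) s = μ (Prod.mk a ⁻¹' (f ⁻¹' s)) := fun a => by
      exact Measure.map_apply (hf.comp measurable_prodMk_left) hs
    simp_rw [h]
    exact measurable_measure_prodMk_left (hf hs)

theorem lawKernel_apply (μ : Measure β) [SFinite μ] {f : α × β → γ} (hf : Measurable f) (a : α) :
    lawKernel μ hf a = μ.map fun b => f (a, b) := rfl

instance (μ : Measure β) [IsProbabilityMeasure μ] {f : α × β → γ} (hf : Measurable f) :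
    IsMarkovKernel (lawKernel μ hf) :=
  ⟨fun _ => Measure.isProbabilityMeasure_map (hf.comp measurable_prodMk_left).aemeasurable⟩

end LawKernel

/-! ### Power received from beyond a threshold, and dyadic rounding of the threshold. -/

section Interference

open Filter Topology BSPoint

/-- Power density received from base stations farther than `t`; the kernel `κ` serves to make this
jointly measurable. -/
noncomputable def interf (κ : Kernel (Measure BSPoint) BSPoint) (p : Params) (t : ℝ)
    (ν : Measure BSPoint) : ℝ≥0∞ := ∫⁻ x, p.powerFrom t x ∂κ ν

variable {κ : Kernel (Measure BSPoint) BSPoint} {p : Params}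

theorem measurable_interf [IsSFiniteKernel κ] :
    Measurable fun y : ℝ × Measure BSPoint => interf κ p y.1 y.2 := by
  have h1 : Measurable fun z : (ℝ × Measure BSPoint) × BSPoint => p.powerFrom z.1.1 z.2 := by
    have hS : MeasurableSet {z : (ℝ × Measure BSPoint) × BSPoint | z.1.1 < ‖z.2.loc‖} :=
      measurableSet_lt (by fun_prop) (measurable_loc.comp measurable_snd).norm
    exact (Params.measurable_power.comp measurable_snd).indicator hS
  have h2 := Measurable.lintegral_kernel_prod_right'
    (κ := κ.comap (Prod.snd : ℝ × Measure BSPoint → Measure BSPoint) measurable_snd) h1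
  exact h2

/-- The least point of the mesh `a + 2 ^ (-k) ℕ` that is at least `t`. -/
noncomputable def meshCeil (a : ℝ) (k : ℕ) (t : ℝ) : ℝ := a + ⌈(t - a) * 2 ^ k⌉ / 2 ^ k

theorem measurable_meshCeil (a : ℝ) (k : ℕ) : Measurable (meshCeil a k) := by
  unfold meshCeil
  have : Measurable fun t : ℝ => ⌈(t - a) * 2 ^ k⌉ := Int.measurable_ceil.comp (by fun_prop)
  have h2 : Measurable fun n : ℤ => (n : ℝ) := Measurable.of_discrete
  exact ((h2.comp this).div_const _).const_add _

theorem le_meshCeil (a : ℝ) (k : ℕ) (t : ℝ) : t ≤ meshCeil a k t := by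
  have := Int.le_ceil ((t - a) * 2 ^ k)
  rw [meshCeil, ← sub_le_iff_le_add', le_div_iff₀ (by positivity)]
  exact this

theorem meshCeil_le (a : ℝ) (k : ℕ) (t : ℝ) : meshCeil a k t ≤ t + 1 / 2 ^ k := by
  have := (Int.ceil_lt_add_one ((t - a) * 2 ^ k)).le
  rw [meshCeil, ← le_sub_iff_add_le', div_le_iff₀ (by positivity)]
  have h2 : (t + 1 / 2 ^ k - a) * 2 ^ k = (t - a) * 2 ^ k + 1 := by field_simp; ring
  rw [h2]
  exact this

/-- Since `⌈2 x⌉ ≤ 2 ⌈x⌉`, halving the mesh can only lower the rounded value. -/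
theorem meshCeil_antitone (a t : ℝ) : Antitone fun k => meshCeil a k t := by
  refine antitone_nat_of_succ_le fun k => ?_
  rw [meshCeil, meshCeil]
  have h : ⌈(t - a) * 2 ^ (k + 1)⌉ ≤ 2 * ⌈(t - a) * 2 ^ k⌉ := by
    rw [Int.ceil_le]
    push_cast
    have := Int.le_ceil ((t - a) * 2 ^ k)
    rw [pow_succ]
    linarith
  have h' : (⌈(t - a) * 2 ^ (k + 1)⌉ : ℝ) ≤ 2 * ⌈(t - a) * 2 ^ k⌉ := by exact_mod_cast h
  refine add_le_add_right ?_ a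
  rw [div_le_div_iff₀ (by positivity) (by positivity)]
  refine (mul_le_mul_of_nonneg_right h' (by positivity)).trans (le_of_eq ?_)
  rw [pow_succ]
  ring

theorem meshCeil_of_mem {a : ℝ} {k j : ℕ} {t : ℝ}
    (ht : t ∈ Ioc (a + j / 2 ^ k) (a + (j + 1 : ℕ) / 2 ^ k)) :
    meshCeil a k t = a + (j + 1 : ℕ) / 2 ^ k := by
  have h2 : (0 : ℝ) < 2 ^ k := by positivity
  have h : ⌈(t - a) * 2 ^ k⌉ = (j + 1 : ℕ) := by
    rw [Int.ceil_eq_iff]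
    obtain ⟨h1, h3⟩ := ht
    rw [← lt_sub_iff_add_lt', div_lt_iff₀ h2] at h1
    rw [← sub_le_iff_le_add', le_div_iff₀ h2] at h3
    push_cast at *
    constructor <;> linarith
  rw [meshCeil, h, Int.cast_natCast]

theorem iUnion_Ioc_mesh (a : ℝ) (k : ℕ) :
    ⋃ j : ℕ, Ioc (a + j / 2 ^ k) (a + (j + 1 : ℕ) / 2 ^ k) = Ioi a := by
  have h2 : (0 : ℝ) < 2 ^ k := by positivity
  ext t
  simp only [mem_iUnion, mem_Ioc, mem_Ioi]
  constructor
  · rintro ⟨j, h1, -⟩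
    have : (0 : ℝ) ≤ j / 2 ^ k := by positivity
    linarith
  · intro h
    have h0 : 0 < (t - a) * 2 ^ k := mul_pos (by linarith) h2
    have h3 : 0 < ⌈(t - a) * 2 ^ k⌉₊ := Nat.ceil_pos.2 h0
    obtain ⟨j, hj⟩ := Nat.exists_eq_succ_of_ne_zero h3.ne'
    rw [Nat.succ_eq_add_one, Nat.ceil_eq_iff (by omega)] at hj
    refine ⟨j, ?_, ?_⟩
    · rw [← lt_sub_iff_add_lt', div_lt_iff₀ h2]
      simpa using hj.1
    · rw [← sub_le_iff_le_add', le_div_iff₀ h2]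
      exact hj.2

theorem pairwise_disjoint_Ioc_mesh (a : ℝ) (k : ℕ) :
    Pairwise fun i j : ℕ => Disjoint (Ioc (a + i / 2 ^ k) (a + (i + 1 : ℕ) / 2 ^ k))
      (Ioc (a + (j : ℝ) / 2 ^ k) (a + (j + 1 : ℕ) / 2 ^ k)) := by
  have hm : Monotone fun j : ℕ => a + (j : ℝ) / 2 ^ k := fun i j hij => by
    simp only
    gcongr
  exact hm.pairwise_disjoint_on_Ioc_succ

theorem powerFrom_of_lt {t : ℝ} {x : BSPoint} (h : t < ‖x.loc‖) : p.powerFrom t x = p.power x :=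
  indicator_of_mem (show x ∈ {x : BSPoint | t < ‖x.loc‖} from h) _

theorem powerFrom_of_not_lt {t : ℝ} {x : BSPoint} (h : ¬ t < ‖x.loc‖) : p.powerFrom t x = 0 :=
  indicator_of_notMem (show x ∉ {x : BSPoint | t < ‖x.loc‖} from h) _

theorem powerFrom_antitone {s t : ℝ} (h : s ≤ t) (x : BSPoint) :
    p.powerFrom t x ≤ p.powerFrom s x := by
  by_cases hx : t < ‖x.loc‖
  · rw [powerFrom_of_lt hx, powerFrom_of_lt (h.trans_lt hx)]
  · rw [powerFrom_of_not_lt hx]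
    exact zero_le

theorem interf_antitone (ν : Measure BSPoint) : Antitone fun t => interf κ p t ν := by
  intro s t hst
  exact lintegral_mono fun x => powerFrom_antitone hst x

/-- Right-continuity in the threshold, due to the strict inequality in `powerFrom`: a station
strictly beyond `t` is strictly beyond the rounded threshold once the mesh is fine enough. Monotone
convergence does the rest, with no finiteness assumption. -/
theorem iSup_interf_meshCeil (a t : ℝ) (ν : Measure BSPoint) :
    ⨆ k, interf κ p (meshCeil a k t) ν = interf κ p t ν := by
  have hmono : Monotone fun k x => p.powerFrom (meshCeil a k t) x := by
    intro k l hkl x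
    exact powerFrom_antitone (meshCeil_antitone a t hkl) x
  unfold interf
  rw [← lintegral_iSup (fun k => Params.measurable_powerFrom _) hmono]
  refine lintegral_congr fun x => ?_
  by_cases hx : t < ‖x.loc‖
  · have hlim : Tendsto (fun k : ℕ => t + 1 / (2 : ℝ) ^ k) atTop (𝓝 (t + 0)) := by
      refine tendsto_const_nhds.add ?_
      simp_rw [← one_div_pow]
      exact tendsto_pow_atTop_nhds_zero_of_lt_one (by norm_num) (by norm_num)
    rw [add_zero] at hlim
    obtain ⟨k, hk⟩ := (hlim.eventually_lt_const hx).exists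
    refine le_antisymm (iSup_le fun l => powerFrom_antitone (le_meshCeil a l t) x)
      (le_iSup_of_le k ?_)
    rw [powerFrom_of_lt hx, powerFrom_of_lt ((meshCeil_le a k t).trans_lt hk)]
  · have h1 : ∀ k, p.powerFrom (meshCeil a k t) x = 0 := fun k =>
      powerFrom_of_not_lt fun h => hx ((le_meshCeil a k t).trans_lt h)
    simp [h1, powerFrom_of_not_lt hx]

/-- Membership of an increasing supremum in an open upper set. -/
theorem iSup_mem_iff {B : Set ℝ≥0∞} (hB : IsUpperSet B) (hBo : IsOpen B) {x : ℕ → ℝ≥0∞}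
    (hx : Monotone x) : ⨆ k, x k ∈ B ↔ ∃ k, x k ∈ B :=
  ⟨fun h => ((tendsto_atTop_iSup hx).eventually (hBo.mem_nhds h)).exists,
    fun ⟨k, hk⟩ => hB (le_iSup x k) hk⟩

namespace Params

theorem hasDerivAt_exp_neg_sq (p : Params) (t : ℝ) :
    HasDerivAt (fun t => -Real.exp (-Real.pi * p.lamB * t ^ 2)) (p.pdfBU t) t := by
  have h := (((hasDerivAt_pow 2 t).const_mul (-Real.pi * p.lamB)).exp).neg
  refine h.congr_deriv ?_
  rw [pdfBU]
  simp
  ring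

theorem continuous_pdfBU (p : Params) : Continuous p.pdfBU := by
  unfold pdfBU
  fun_prop

theorem Valid.pdfBU_nonneg (hp : p.Valid) {t : ℝ} (ht : 0 ≤ t) : 0 ≤ p.pdfBU t := by
  have := hp.lamB_pos
  unfold pdfBU
  positivity

theorem Valid.lintegral_pdfBU (hp : p.Valid) {r R : ℝ} (hr : 0 ≤ r) (hrR : r ≤ R) :
    ∫⁻ t in Ioc r R, ENNReal.ofReal (p.pdfBU t) = ENNReal.ofReal
      (Real.exp (-Real.pi * p.lamB * r ^ 2) - Real.exp (-Real.pi * p.lamB * R ^ 2)) := by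
  have hi := (p.continuous_pdfBU).intervalIntegrable (μ := volume) r R
  rw [← ofReal_integral_eq_lintegral_ofReal hi.1 ((ae_restrict_iff' measurableSet_Ioc).2
    (ae_of_all _ fun t ht => hp.pdfBU_nonneg (hr.trans ht.1.le))),
    ← intervalIntegral.integral_of_le hrR,
    intervalIntegral.integral_eq_sub_of_hasDerivAt (fun t _ => p.hasDerivAt_exp_neg_sq t) hi]
  congr 1
  ring

end Params

end Interference

/-! ### Joint law of the nearest distance and the interference. -/

section JointLaw

open Filter Topology BSPoint

variable {κ : Kernel (Measure BSPoint) BSPoint} {p : Params} {Ω : Type*}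
  {mΩ : MeasurableSpace Ω} {P : Measure Ω} {X : Network Ω}

theorem Network.lt_norm_nearest_iff {ω : Ω} (hω : ω ∈ X.regular p) (r : ℝ) :
    r < ‖X.nearest p ω‖ ↔ count X.bs (disk r) ω = 0 := by
  obtain ⟨i, hi⟩ := id hω
  obtain ⟨h1, h2, h3⟩ := tagged_spec hi
  rw [nearest, indicator_of_mem hω, count, encard_eq_zero, eq_empty_iff_forall_notMem]
  constructor
  · rintro hr y ⟨hy, hyr⟩
    have : ‖(X.tagged ω).loc‖ ≤ ‖y.loc‖ := by
      by_cases hyt : y = X.tagged ω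
      · rw [hyt]
      · exact h2.trans (h3 y hy hyt).le
    exact absurd (this.trans hyr) (not_le.2 hr)
  · intro h
    by_contra hc
    exact h _ ⟨h1, not_lt.1 hc⟩

/-- On the regular event every other station is strictly farther than the tagged one, so deleting
the tagged station amounts to keeping the points strictly beyond its distance. Each remaining point
is counted in exactly one of the two link states. -/
theorem Network.W2_eq {ω : Ω} (hc : (X.bs ω).Countable) (hω : ω ∈ X.regular p) :
    X.W2 p ω = ∫⁻ x, p.powerFrom ‖X.nearest p ω‖ x ∂pointMeasure X.bs ω := by
  classical
  obtain ⟨i, hi⟩ := id hω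
  obtain ⟨h1, h2, h3⟩ := tagged_spec hi
  have hW : ∀ v, X.Wb p v ω = ∑' x : BSPoint,
      ({x ∈ X.bs ω | p.InState x v} \ {X.tagged ω}).indicator (p.powerIn v) x := fun v =>
    tsum_subtype _ (p.powerIn v)
  rw [lintegral_pointMeasure hc, nearest, indicator_of_mem hω, W2, hW, hW, ← ENNReal.tsum_add,
    tsum_subtype (X.bs ω) (p.powerFrom ‖(X.tagged ω).loc‖)]
  refine tsum_congr fun x => ?_
  by_cases hx : x ∈ X.bs ω
  · rw [indicator_of_mem hx]
    by_cases hxt : x = X.tagged ω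
    · rw [indicator_of_notMem (fun h => h.2 hxt), indicator_of_notMem (fun h => h.2 hxt),
        powerFrom_of_not_lt (by rw [hxt]; exact lt_irrefl _), add_zero]
    · rw [powerFrom_of_lt (h2.trans_lt (h3 x hx hxt)), Params.power]
      by_cases hL : p.InState x .L
      · rw [if_pos hL, indicator_of_mem (s := {x ∈ X.bs ω | p.InState x .L} \ {X.tagged ω}) ⟨⟨hx, hL⟩, hxt⟩,
          indicator_of_notMem (fun h => h.1.2 hL), add_zero]
      · rw [if_neg hL, indicator_of_notMem (fun h => hL h.1.2),
          indicator_of_mem (s := {x ∈ X.bs ω | p.InState x .N} \ {X.tagged ω}) ⟨⟨hx, hL⟩, hxt⟩,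
          zero_add]
  · rw [indicator_of_notMem hx, indicator_of_notMem (fun h => hx h.1.1),
      indicator_of_notMem (fun h => hx h.1.1), add_zero]

theorem Network.IsModel.measurable_bs (hX : X.IsModel p P) : Measurable (pointMeasure X.bs) :=
  hX.bs_poisson.measurable_pointMeasure

theorem Network.IsModel.measurable_interf [IsSFiniteKernel κ] (hX : X.IsModel p P) :
    Measurable fun y : ℝ × Ω => interf κ p y.1 (pointMeasure X.bs y.2) :=
  EMF.measurable_interf.comp
    (measurable_fst.prodMk (hX.measurable_bs.comp measurable_snd))

theorem Network.IsModel.measurable_norm_nearest (hX : X.IsModel p P) :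
    Measurable fun ω => ‖X.nearest p ω‖ :=
  (Network.measurable_nearest.mono hX.sigmaAlg_bs_le le_rfl).norm

variable [IsProbabilityMeasure P]

theorem Network.IsModel.prob_nearest_mem_Ioc (hX : X.IsModel p P) (hp : p.Valid) {r R : ℝ}
    (hr : 0 ≤ r) (hrR : r ≤ R) :
    P {ω | ‖X.nearest p ω‖ ∈ Ioc r R} = ∫⁻ t in Ioc r R, ENNReal.ofReal (p.pdfBU t) := by
  have hbs := hX.bs_poisson
  have hl := hp.lamB_pos
  have hpi := Real.pi_pos
  have h0 : ∀ {a : ℝ}, 0 ≤ a → P {ω | count X.bs (disk a) ω = 0} =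
      ENNReal.ofReal (Real.exp (-Real.pi * p.lamB * a ^ 2)) := fun {a} ha => by
    rw [hbs.prob_count_eq_zero (measurableSet_disk a)
      (by rw [hp.bsIntensity_disk ha]; finiteness), hp.bsIntensity_disk ha,
      ENNReal.toReal_ofReal (by positivity)]
    ring_nf
  have hm : ∀ a : ℝ, MeasurableSet {ω | count X.bs (disk a) ω = 0} := fun a =>
    hX.sigmaAlg_bs_le _ (Network.measurableSet_count (measurableSet_disk a) 0)
  have hsub : {ω | count X.bs (disk R) ω = 0} ⊆ {ω | count X.bs (disk r) ω = 0} := by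
    intro ω (hω : count X.bs (disk R) ω = 0)
    have := count_mono X.bs (show disk r ⊆ disk R from fun x hx => le_trans hx hrR) ω
    rw [hω] at this
    exact nonpos_iff_eq_zero.1 this
  have hae : {ω | ‖X.nearest p ω‖ ∈ Ioc r R} =ᵐ[P]
      ({ω | count X.bs (disk r) ω = 0} \ {ω | count X.bs (disk R) ω = 0} : Set Ω) := by
    filter_upwards [hX.prob_regular hp] with ω hω
    refine propext ?_
    change (r < ‖X.nearest p ω‖ ∧ ‖X.nearest p ω‖ ≤ R) ↔
      (count X.bs (disk r) ω = 0 ∧ ¬ count X.bs (disk R) ω = 0)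
    rw [Network.lt_norm_nearest_iff hω, ← Network.lt_norm_nearest_iff hω R, not_lt]
  rw [measure_congr hae, measure_sdiff hsub (hm R).nullMeasurableSet (measure_ne_top _ _), h0 hr,
    h0 (hr.trans hrR), hp.lintegral_pdfBU hr hrR, ENNReal.ofReal_sub _ (Real.exp_pos _).le]

theorem Network.IsModel.nearest_pos (hX : X.IsModel p P) (hp : p.Valid) :
    ∀ᵐ ω ∂P, 0 < ‖X.nearest p ω‖ := by
  have h := hX.bs_poisson.prob_count_eq_zero (measurableSet_disk 0)
    (by rw [hp.bsIntensity_disk le_rfl]; finiteness)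
  rw [hp.bsIntensity_disk le_rfl] at h
  simp only [ne_eq, OfNat.ofNat_ne_zero, not_false_eq_true, zero_pow, mul_zero, ENNReal.ofReal_zero,
    ENNReal.toReal_zero, neg_zero, Real.exp_zero, ENNReal.ofReal_one] at h
  have h2 := (mem_ae_iff_prob_eq_one
    (hX.sigmaAlg_bs_le _ (Network.measurableSet_count (measurableSet_disk 0) 0))).2 h
  filter_upwards [hX.prob_regular hp, h2] with ω hω h3
  exact (Network.lt_norm_nearest_iff hω 0).2 h3

/-- Given that the nearest base station lies in an annulus, what happens beyond is independent. -/
theorem Network.IsModel.prob_nearest_interf (hX : X.IsModel p P) (hp : p.Valid)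
    (hκ : ∀ᵐ ω ∂P, κ (pointMeasure X.bs ω) = pointMeasure X.bs ω) {r R : ℝ}
    (hr : 0 ≤ r) (hrR : r ≤ R) {B : Set ℝ≥0∞} (hB : MeasurableSet B) :
    P {ω | ‖X.nearest p ω‖ ∈ Ioc r R ∧ interf κ p R (pointMeasure X.bs ω) ∈ B} =
      (∫⁻ t in Ioc r R, ENNReal.ofReal (p.pdfBU t)) *
        P {ω | interf κ p R (pointMeasure X.bs ω) ∈ B} := by
  have hbs := hX.bs_poisson
  have hind := hbs.indepFun_restrict (measurableSet_disk R)
  have hS1 : MeasurableSet {μ : Measure BSPoint | μ (disk r) = 0 ∧ μ (disk R) ≠ 0} := by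
    have e : {μ : Measure BSPoint | μ (disk r) = 0 ∧ μ (disk R) ≠ 0} =
        (fun μ : Measure BSPoint => μ (disk r)) ⁻¹' {0} ∩
        (fun μ : Measure BSPoint => μ (disk R)) ⁻¹' {0}ᶜ := rfl
    rw [e]
    exact (Measure.measurable_coe (measurableSet_disk r) (measurableSet_singleton 0)).inter
      (Measure.measurable_coe (measurableSet_disk R) (measurableSet_singleton 0).compl)
  have hS2 : MeasurableSet {μ : Measure BSPoint | ∫⁻ x, p.power x ∂μ ∈ B} :=
    Measure.measurable_lintegral Params.measurable_power hB
  have hmul := hind.measure_inter_preimage_eq_mul _ _ hS1 hS2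
  -- The distance lies in `(r, R]` when the disk of radius `r` is empty and that of radius `R` is
  -- not. This involves only points inside `disk R`, whereas the power from beyond `R` involves only
  -- points outside.
  have e1 : {ω | ‖X.nearest p ω‖ ∈ Ioc r R} =ᵐ[P] ((fun ω => (pointMeasure X.bs ω).restrict
      (disk R)) ⁻¹' {μ : Measure BSPoint | μ (disk r) = 0 ∧ μ (disk R) ≠ 0} : Set Ω) := by
    filter_upwards [hX.prob_regular hp] with ω hω
    refine propext ?_
    change (r < ‖X.nearest p ω‖ ∧ ‖X.nearest p ω‖ ≤ R) ↔
      ((pointMeasure X.bs ω).restrict (disk R) (disk r) = 0 ∧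
        (pointMeasure X.bs ω).restrict (disk R) (disk R) ≠ 0)
    rw [Measure.restrict_apply (measurableSet_disk r), Measure.restrict_apply (measurableSet_disk R),
      inter_self, inter_eq_left.2 (show disk r ⊆ disk R from fun x hx => le_trans hx hrR),
      pointMeasure_apply (hbs.countable ω) (measurableSet_disk r),
      pointMeasure_apply (hbs.countable ω) (measurableSet_disk R), Network.lt_norm_nearest_iff hω,
      ← not_lt, Network.lt_norm_nearest_iff hω]
    simp
  have hint : ∀ ω, κ (pointMeasure X.bs ω) = pointMeasure X.bs ω →
      interf κ p R (pointMeasure X.bs ω) =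
        ∫⁻ x, p.power x ∂(pointMeasure X.bs ω).restrict (disk R)ᶜ := by
    intro ω hω
    rw [interf, hω, ← lintegral_indicator (measurableSet_disk R).compl]
    have : {x : BSPoint | R < ‖x.loc‖} = (disk R)ᶜ := by ext x; simp [disk]
    unfold Params.powerFrom
    rw [this]
  have e2 : {ω | interf κ p R (pointMeasure X.bs ω) ∈ B} =ᵐ[P] ((fun ω =>
      (pointMeasure X.bs ω).restrict (disk R)ᶜ) ⁻¹' {μ : Measure BSPoint | ∫⁻ x, p.power x ∂μ ∈ B} :
      Set Ω) := by
    filter_upwards [hκ] with ω hω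
    refine propext ?_
    change interf κ p R (pointMeasure X.bs ω) ∈ B ↔ _ ∈ B
    rw [hint ω hω]
  rw [← hX.prob_nearest_mem_Ioc hp hr hrR, measure_congr e1, measure_congr e2, ← hmul]
  exact measure_congr (e1.inter e2)

variable [IsSFiniteKernel κ]

/-- Rounding the distance up to a mesh makes the threshold constant on each cell, where inside and
outside are independent. As the mesh is refined the power from beyond the rounded threshold
increases to the true one. An increasing supremum enters an open upper set exactly when some term
does, so monotone convergence applies on both sides. -/
theorem Network.IsModel.prob_lt_nearest_interf (hX : X.IsModel p P) (hp : p.Valid)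
    (hκ : ∀ᵐ ω ∂P, κ (pointMeasure X.bs ω) = pointMeasure X.bs ω) {a : ℝ} (ha : 0 ≤ a)
    {B : Set ℝ≥0∞} (hB : IsUpperSet B) (hBo : IsOpen B) :
    P {ω | a < ‖X.nearest p ω‖ ∧ interf κ p ‖X.nearest p ω‖ (pointMeasure X.bs ω) ∈ B} =
      ∫⁻ t in Ioi a, P {ω | interf κ p t (pointMeasure X.bs ω) ∈ B} *
        ENNReal.ofReal (p.pdfBU t) := by
  have hm := hX.measurable_interf (κ := κ)
  have hT := hX.measurable_norm_nearest
  have hpdf : Measurable p.pdfBU := p.continuous_pdfBU.measurable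
  let τ : ℝ → ℝ≥0∞ := fun t => P {ω | interf κ p t (pointMeasure X.bs ω) ∈ B}
  have hτ : Measurable τ := measurable_measure_prodMk_left (hm hBo.measurableSet)
  have hstep : ∀ k : ℕ, P {ω | a < ‖X.nearest p ω‖ ∧
      interf κ p (meshCeil a k ‖X.nearest p ω‖) (pointMeasure X.bs ω) ∈ B} =
      ∫⁻ t in Ioi a, τ (meshCeil a k t) * ENNReal.ofReal (p.pdfBU t) := by
    intro k
    have hrj : ∀ j : ℕ, 0 ≤ a + j / 2 ^ k := fun j => by positivity
    have hrle : ∀ j : ℕ, a + j / 2 ^ k ≤ a + (j + 1 : ℕ) / 2 ^ k := fun j => by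
      gcongr; simp
    have e : {ω | a < ‖X.nearest p ω‖ ∧
        interf κ p (meshCeil a k ‖X.nearest p ω‖) (pointMeasure X.bs ω) ∈ B} =
        ⋃ j : ℕ, {ω | ‖X.nearest p ω‖ ∈ Ioc (a + j / 2 ^ k) (a + (j + 1 : ℕ) / 2 ^ k) ∧
          interf κ p (a + (j + 1 : ℕ) / 2 ^ k) (pointMeasure X.bs ω) ∈ B} := by
      ext ω
      simp only [mem_ofPred_eq, mem_iUnion]
      rw [← mem_Ioi, ← iUnion_Ioc_mesh a k, mem_iUnion]
      constructor
      · rintro ⟨⟨j, hj⟩, h2⟩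
        refine ⟨j, hj, ?_⟩
        rwa [meshCeil_of_mem hj] at h2
      · rintro ⟨j, hj, h2⟩
        refine ⟨⟨j, hj⟩, ?_⟩
        rwa [meshCeil_of_mem hj]
    rw [e, measure_iUnion, ← iUnion_Ioc_mesh a k, lintegral_iUnion (fun j => measurableSet_Ioc)
      (pairwise_disjoint_Ioc_mesh a k)]
    · refine tsum_congr fun j => ?_
      rw [hX.prob_nearest_interf hp hκ (hrj j) (hrle j) hBo.measurableSet, mul_comm,
        ← lintegral_const_mul _ hpdf.ennreal_ofReal]
      refine setLIntegral_congr_fun measurableSet_Ioc fun t ht => ?_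
      simp only [meshCeil_of_mem ht, τ]
    · intro i j hij
      refine Set.disjoint_left.2 ?_
      rintro ω ⟨h1, -⟩ ⟨h2, -⟩
      exact Set.disjoint_left.1 (pairwise_disjoint_Ioc_mesh a k hij) h1 h2
    · intro j
      exact (hT measurableSet_Ioc).inter
        ((hm.comp measurable_prodMk_left) hBo.measurableSet)
  have hmemS : ∀ t ω, interf κ p t (pointMeasure X.bs ω) ∈ B ↔
      ∃ k, interf κ p (meshCeil a k t) (pointMeasure X.bs ω) ∈ B := by
    intro t ω
    rw [← iSup_interf_meshCeil a t]
    exact iSup_mem_iff hB hBo fun k l hkl => interf_antitone _ (meshCeil_antitone a t hkl)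
  have hmonoS : ∀ t ω, ∀ k l : ℕ, k ≤ l → interf κ p (meshCeil a k t) (pointMeasure X.bs ω) ∈ B →
      interf κ p (meshCeil a l t) (pointMeasure X.bs ω) ∈ B := fun t ω k l hkl h =>
    hB (interf_antitone _ (meshCeil_antitone a t hkl)) h
  have hL : P {ω | a < ‖X.nearest p ω‖ ∧
      interf κ p ‖X.nearest p ω‖ (pointMeasure X.bs ω) ∈ B} = ⨆ k : ℕ, P {ω | a < ‖X.nearest p ω‖ ∧
      interf κ p (meshCeil a k ‖X.nearest p ω‖) (pointMeasure X.bs ω) ∈ B} := by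
    rw [← Monotone.measure_iUnion]
    · congr 1
      ext ω
      simp only [mem_ofPred_eq, mem_iUnion, hmemS ‖X.nearest p ω‖ ω, exists_and_left]
    · intro k l hkl ω hω
      exact ⟨hω.1, hmonoS _ _ k l hkl hω.2⟩
  have hR : ∀ t, τ t = ⨆ k : ℕ, τ (meshCeil a k t) := by
    intro t
    simp only [τ]
    rw [← Monotone.measure_iUnion]
    · congr 1
      ext ω
      simp only [mem_ofPred_eq, mem_iUnion, hmemS t ω]
    · intro k l hkl ω hω
      exact hmonoS _ _ k l hkl hω
  rw [hL]
  simp_rw [hstep]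
  rw [← lintegral_iSup]
  · refine lintegral_congr fun t => ?_
    rw [← ENNReal.iSup_mul, ← hR]
  · exact fun k => (hτ.comp (measurable_meshCeil a k)).mul hpdf.ennreal_ofReal
  · intro k l hkl t
    simp only
    gcongr
    exact measure_mono fun ω hω => hmonoS t ω k l hkl hω

/-- The joint law of the distance to the tagged base station and the interference. -/
theorem Network.IsModel.map_nearest_interf (hX : X.IsModel p P) (hp : p.Valid)
    (hκ : ∀ᵐ ω ∂P, κ (pointMeasure X.bs ω) = pointMeasure X.bs ω) :
    P.map (fun ω => (‖X.nearest p ω‖, interf κ p ‖X.nearest p ω‖ (pointMeasure X.bs ω))) =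
      ((volume.restrict (Ioi 0)).withDensity fun t => ENNReal.ofReal (p.pdfBU t)) ⊗ₘ
        lawKernel P (hX.measurable_interf (κ := κ)) := by
  have hm := hX.measurable_interf (κ := κ)
  have hT := hX.measurable_norm_nearest
  have hpdf : Measurable p.pdfBU := p.continuous_pdfBU.measurable
  have hTS : Measurable fun ω => (‖X.nearest p ω‖, interf κ p ‖X.nearest p ω‖ (pointMeasure X.bs ω)) :=
    hT.prodMk (hm.comp (hT.prodMk measurable_id))
  have hprob := Measure.isProbabilityMeasure_map (μ := P) hTS.aemeasurable
  have key : ∀ a : ℝ, ∀ B : Set ℝ≥0∞, IsUpperSet B → IsOpen B →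
      P.map (fun ω => (‖X.nearest p ω‖, interf κ p ‖X.nearest p ω‖ (pointMeasure X.bs ω)))
        (Ioi a ×ˢ B) =
      (((volume.restrict (Ioi 0)).withDensity fun t => ENNReal.ofReal (p.pdfBU t)) ⊗ₘ
        lawKernel P (hX.measurable_interf (κ := κ))) (Ioi a ×ˢ B) := by
    intro a B hB hBo
    have hBm := hBo.measurableSet
    have hν : Measurable fun t => lawKernel P hm t B := Kernel.measurable_coe _ hBm
    rw [Measure.compProd_apply_prod measurableSet_Ioi hBm, Measure.map_apply hTS
      (measurableSet_Ioi.prod hBm), setLIntegral_withDensity_eq_setLIntegral_mul _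
      hpdf.ennreal_ofReal hν measurableSet_Ioi, Measure.restrict_restrict measurableSet_Ioi,
      Ioi_inter_Ioi]
    -- The previous formula is for thresholds `≥ 0`. The distance is almost surely positive, so `a`
    -- may be replaced by `max a 0`.
    have h := hX.prob_lt_nearest_interf hp hκ (le_max_right a 0) hB hBo
    refine Eq.trans ?_ (h.trans ?_)
    · refine measure_congr ?_
      filter_upwards [hX.nearest_pos hp] with ω hω
      refine propext ?_
      change (a < ‖X.nearest p ω‖ ∧ _) ↔ (max a 0 < ‖X.nearest p ω‖ ∧ _)
      rw [max_lt_iff, and_iff_left hω]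
    · refine lintegral_congr fun t => ?_
      have e : lawKernel P hm t B = P {ω | interf κ p t (pointMeasure X.bs ω) ∈ B} :=
        Measure.map_apply (hm.comp measurable_prodMk_left) hBm
      rw [Pi.mul_apply, mul_comm, e]
  -- Rays times open upper sets are stable under intersection and generate the product Borel
  -- sigma-algebra, so agreement on them determines the joint law.
  have hC : IsPiSystem (image2 (fun s t => s ×ˢ t) (range (Ioi : ℝ → Set ℝ))
      {B : Set ℝ≥0∞ | IsUpperSet B ∧ IsOpen B}) := by
    refine IsPiSystem.prod isPiSystem_Ioi ?_
    rintro s ⟨hs1, hs2⟩ t ⟨ht1, ht2⟩ -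
    exact ⟨hs1.inter ht1, hs2.inter ht2⟩
  have hgen2 : MeasurableSpace.generateFrom {B : Set ℝ≥0∞ | IsUpperSet B ∧ IsOpen B} =
      borel ℝ≥0∞ := by
    refine le_antisymm (MeasurableSpace.generateFrom_le fun s hs => ?_) ?_
    · exact MeasurableSpace.measurableSet_generateFrom hs.2
    · rw [borel_eq_generateFrom_Ioi]
      refine MeasurableSpace.generateFrom_mono ?_
      rintro _ ⟨c, rfl⟩
      exact ⟨isUpperSet_Ioi c, isOpen_Ioi⟩
  have hgen1 : MeasurableSpace.generateFrom (range (Ioi : ℝ → Set ℝ)) = borel ℝ :=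
    (borel_eq_generateFrom_Ioi ℝ).symm
  have hcov : ⋃ n : ℕ, Ioi (-(n : ℝ)) = univ := iUnion_eq_univ_iff.2 fun x => by
    obtain ⟨n, hn⟩ := exists_nat_gt (-x)
    exact ⟨n, by simp only [mem_Ioi]; linarith⟩
  refine Measure.ext_of_generateFrom_of_iUnion (image2 (fun s t => s ×ˢ t)
    (range (Ioi : ℝ → Set ℝ)) {B : Set ℝ≥0∞ | IsUpperSet B ∧ IsOpen B})
    (fun n : ℕ => Ioi (-(n : ℝ)) ×ˢ univ) ?_ hC ?_ ?_ (fun n => measure_ne_top _ _) ?_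
  · refine (generateFrom_eq_prod (hgen1.trans (BorelSpace.measurable_eq (α := ℝ)).symm)
      (hgen2.trans (BorelSpace.measurable_eq (α := ℝ≥0∞)).symm) ?_ ?_).symm
    · exact ⟨fun n : ℕ => Ioi (-(n : ℝ)), fun n => ⟨_, rfl⟩, hcov⟩
    · exact ⟨fun _ => univ, fun _ => ⟨isUpperSet_univ, isOpen_univ⟩, iUnion_const _⟩
  · rw [← iUnion_prod_const, hcov, univ_prod_univ]
  · exact fun n => ⟨_, ⟨_, rfl⟩, univ, ⟨isUpperSet_univ, isOpen_univ⟩, rfl⟩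
  · rintro _ ⟨_, ⟨a, rfl⟩, B, ⟨hB, hBo⟩, rfl⟩
    exact key a B hB hBo

end JointLaw

/-! ### Extended values below a real level. -/

section AtMost

/-- The condition `y ≠ ∞` cannot be dropped: `∞.toReal = 0` would pass for every `w ≥ 0`. -/
theorem mem_atMost_iff (w : ℝ) (y : ℝ≥0∞) : y ∈ atMost w ↔ y ≠ ∞ ∧ y.toReal ≤ w := by
  rw [atMost, mem_ofPred_eq]
  by_cases hy : y = ∞
  · simp [hy]
  · have h : (y : EReal) = ((y.toReal : ℝ) : EReal) := by
      conv_lhs => rw [← ENNReal.ofReal_toReal hy]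
      rw [EReal.coe_ennreal_ofReal, max_eq_left ENNReal.toReal_nonneg]
    rw [h, EReal.coe_le_coe_iff]
    simp [hy]

theorem measurableSet_atMost (w : ℝ) : MeasurableSet (atMost w) := by
  have : atMost w = {∞}ᶜ ∩ ENNReal.toReal ⁻¹' Iic w := by
    ext y
    exact mem_atMost_iff w y
  rw [this]
  exact (measurableSet_singleton _).compl.inter (ENNReal.measurable_toReal measurableSet_Iic)

end AtMost

/-! ### The exposure at fixed serving power and distance: transform, mean, inversion. -/

section Exposure

open Filter Topology

variable {κ : Kernel (Measure BSPoint) BSPoint} {p : Params} {Ω : Type*}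
  {mΩ : MeasurableSpace Ω} {P : Measure Ω} {X : Network Ω}

instance (m : ℕ) : SFinite (fadingLaw m) := by
  unfold fadingLaw gammaMeasure
  infer_instance

theorem Network.IsModel.measurable_interf_right [IsSFiniteKernel κ] (hX : X.IsModel p P)
    (t : ℝ) : Measurable fun ω => interf κ p t (pointMeasure X.bs ω) :=
  hX.measurable_interf.comp measurable_prodMk_left

theorem Network.IsModel.measurable_exposure [IsSFiniteKernel κ] (hX : X.IsModel p P) :
    Measurable fun y : (ℝ × ℝ) × (Ω × ℝ) => ENNReal.ofReal (y.1.1 * y.2.2 / p.area) +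
      interf κ p y.1.2 (pointMeasure X.bs y.2.1) := by
  have h := (hX.measurable_interf (κ := κ)).comp (measurable_fst.snd.prodMk measurable_snd.fst :
    Measurable fun y : (ℝ × ℝ) × (Ω × ℝ) => (y.1.2, y.2.1))
  exact (by fun_prop : Measurable fun y : (ℝ × ℝ) × (Ω × ℝ) =>
    ENNReal.ofReal (y.1.1 * y.2.2 / p.area)).add h

theorem Network.IsModel.measurable_exposure_right [IsSFiniteKernel κ] (hX : X.IsModel p P) (Pa t : ℝ) :
    Measurable fun y : Ω × ℝ => ENNReal.ofReal (Pa * y.2 / p.area) +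
      interf κ p t (pointMeasure X.bs y.1) :=
  hX.measurable_exposure.comp (measurable_prodMk_left (x := (Pa, t)))

variable [IsProbabilityMeasure P]

theorem Network.IsModel.lintegral_interf (hX : X.IsModel p P) (hp : p.Valid)
    (hκ : ∀ᵐ ω ∂P, κ (pointMeasure X.bs ω) = pointMeasure X.bs ω) (t : ℝ) :
    ∫⁻ ω, interf κ p t (pointMeasure X.bs ω) ∂P = ∫⁻ x, p.powerFrom t x ∂p.bsIntensity := by
  have := hp.sigmaFinite_bsIntensity
  rw [← hX.bs_poisson.lintegral_lintegral_pointMeasure (Params.measurable_powerFrom t)]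
  refine lintegral_congr_ae ?_
  filter_upwards [hκ] with ω hω
  rw [interf, hω]

theorem Network.IsModel.integral_cexp_interf (hX : X.IsModel p P) (hp : p.Valid)
    (hκ : ∀ᵐ ω ∂P, κ (pointMeasure X.bs ω) = pointMeasure X.bs ω) {t : ℝ} (ht : 0 < t) {s : ℂ}
    (hs : 0 ≤ s.re) :
    ∫ ω, Complex.exp (-(s * ((interf κ p t (pointMeasure X.bs ω)).toReal : ℂ))) ∂P =
      p.laplaceInterf .L t s * p.laplaceInterf .N t s := by
  have := hp.sigmaFinite_bsIntensity
  rw [← hp.integral_one_sub_cexp_powerFrom ht hs, ← hX.bs_poisson.integral_exp_lintegral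
    (Params.measurable_powerFrom t) (hp.lintegral_powerFrom_ne_top ht) hs]
  refine integral_congr_ae ?_
  filter_upwards [hκ] with ω hω
  rw [interf, hω]

/-- The interference factor is a characteristic function, of modulus at most `1`. The decay comes
from the Gamma factor: with `c = x Pa / (k area)`, `|1 - i c| ^ k ≥ |1 - i c| ≥ c`. Positivity of
`Pa` is essential here. -/
theorem Network.IsModel.norm_laplaceW_le (hX : X.IsModel p P) (hp : p.Valid) {k : ℕ} (hk : 1 ≤ k)
    (hκ : ∀ᵐ ω ∂P, κ (pointMeasure X.bs ω) = pointMeasure X.bs ω) {Pa t x : ℝ} (hPa : 0 < Pa)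
    (ht : 0 < t) (hx : 0 < x) :
    ‖p.laplaceW k Pa t (-Complex.I * x)‖ ≤ k * p.area / Pa / x := by
  have harea := hp.area_pos
  have hk0 : (0 : ℝ) < k := by exact_mod_cast hk
  have hre : 0 ≤ (-Complex.I * (x : ℂ)).re := by simp
  have h1 : ‖p.laplaceInterf .L t (-Complex.I * x) * p.laplaceInterf .N t (-Complex.I * x)‖ ≤ 1 := by
    rw [← hX.integral_cexp_interf hp hκ ht hre]
    refine (norm_integral_le_of_norm_le_const (C := 1) (ae_of_all _ fun ω => ?_)).trans (by simp)
    refine norm_cexp_neg_le_one ?_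
    rw [Complex.re_mul_ofReal]
    simp
  obtain ⟨c, hc⟩ : ∃ c, c = x * Pa / (k * p.area) := ⟨_, rfl⟩
  have hc0 : 0 < c := by rw [hc]; positivity
  set z : ℂ := 1 + -Complex.I * x * Pa / (k * p.area) with hz
  have hz' : z = 1 + ((-c : ℝ) : ℂ) * Complex.I := by
    rw [hz, hc]
    push_cast
    ring
  have hzim : c ≤ ‖z‖ := by
    have := Complex.abs_im_le_norm z
    rw [hz'] at this ⊢
    simpa [abs_of_pos hc0] using this
  have hz1 : 1 ≤ ‖z‖ := by
    have := Complex.abs_re_le_norm z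
    rw [hz'] at this ⊢
    simpa using this
  have h2 : ‖z ^ (-(k : ℤ))‖ ≤ k * p.area / Pa / x := by
    rw [zpow_neg, zpow_natCast, norm_inv, norm_pow]
    have h3 : ‖z‖ ≤ ‖z‖ ^ k := le_self_pow₀ hz1 (by omega)
    have h4 : c⁻¹ = k * p.area / Pa / x := by
      rw [hc, inv_div, div_div, mul_comm Pa]
    rw [← h4]
    exact inv_anti₀ hc0 (hzim.trans h3)
  rw [Params.laplaceW, norm_mul]
  calc _ ≤ k * p.area / Pa / x * 1 := mul_le_mul h2 h1 (norm_nonneg _) (by positivity)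
    _ = _ := mul_one _

variable [IsSFiniteKernel κ]

theorem Network.IsModel.ae_interf_lt_top (hX : X.IsModel p P) (hp : p.Valid)
    (hκ : ∀ᵐ ω ∂P, κ (pointMeasure X.bs ω) = pointMeasure X.bs ω) {t : ℝ} (ht : 0 < t) :
    ∀ᵐ ω ∂P, interf κ p t (pointMeasure X.bs ω) < ∞ :=
  ae_lt_top (hX.measurable_interf_right t) (by
    rw [hX.lintegral_interf hp hκ]
    exact hp.lintegral_powerFrom_ne_top ht)

/-- The law of the exposure, given the mean serving power and the distance to the tagged base
station. -/
noncomputable def Network.IsModel.exposureLaw (hX : X.IsModel p P)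
    (κ : Kernel (Measure BSPoint) BSPoint) [IsSFiniteKernel κ] (k : ℕ) :
    Kernel (ℝ × ℝ) ℝ≥0∞ :=
  lawKernel (P.prod (fadingLaw k)) (hX.measurable_exposure (κ := κ))

theorem Network.IsModel.exposureLaw_apply (hX : X.IsModel p P) (k : ℕ) (a : ℝ × ℝ) :
    hX.exposureLaw κ k a = (P.prod (fadingLaw k)).map fun y =>
      ENNReal.ofReal (a.1 * y.2 / p.area) + interf κ p a.2 (pointMeasure X.bs y.1) := rfl

variable {k : ℕ}

theorem Network.IsModel.isMarkovKernel_exposureLaw (hX : X.IsModel p P) (hk : 1 ≤ k) :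
    IsMarkovKernel (hX.exposureLaw κ k) := by
  have := isProbabilityMeasure_fadingLaw hk
  unfold exposureLaw
  infer_instance

theorem Network.IsModel.lintegral_exposureLaw (hX : X.IsModel p P) (k : ℕ) (Pa t : ℝ)
    {F : ℝ≥0∞ → ℝ≥0∞} (hF : Measurable F) :
    ∫⁻ y, F y ∂hX.exposureLaw κ k (Pa, t) = ∫⁻ y, ∫⁻ h, F (ENNReal.ofReal (Pa * h / p.area) + y)
      ∂fadingLaw k ∂lawKernel P (hX.measurable_interf (κ := κ)) t := by
  have hi := hX.measurable_interf_right (κ := κ) t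
  have hFm : Measurable fun z : ℝ≥0∞ × ℝ => F (ENNReal.ofReal (Pa * z.2 / p.area) + z.1) := by
    fun_prop
  rw [exposureLaw_apply, lintegral_map hF (hX.measurable_exposure_right Pa t),
    lintegral_prod (fun a : Ω × ℝ => F (ENNReal.ofReal (Pa * a.2 / p.area) +
      interf κ p t (pointMeasure X.bs a.1)))
      (hF.comp (hX.measurable_exposure_right Pa t)).aemeasurable]
  exact (lintegral_map (f := fun y => ∫⁻ h, F (ENNReal.ofReal (Pa * h / p.area) + y) ∂fadingLaw k)
    hFm.lintegral_prod_right' hi).symm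

theorem Network.IsModel.ae_prod_finite (hX : X.IsModel p P) (hp : p.Valid) (hk : 1 ≤ k)
    (hκ : ∀ᵐ ω ∂P, κ (pointMeasure X.bs ω) = pointMeasure X.bs ω) {t : ℝ} (ht : 0 < t) :
    ∀ᵐ y ∂P.prod (fadingLaw k), interf κ p t (pointMeasure X.bs y.1) < ∞ ∧ 0 ≤ y.2 := by
  have := isProbabilityMeasure_fadingLaw hk
  have h1 := Measure.quasiMeasurePreserving_fst (μ := P) (ν := fadingLaw k) |>.ae
    (hX.ae_interf_lt_top hp hκ ht)
  have h2 := Measure.quasiMeasurePreserving_snd (μ := P) (ν := fadingLaw k) |>.ae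
    (ae_fadingLaw_nonneg (m := k))
  filter_upwards [h1, h2] with y hy1 hy2 using ⟨hy1, hy2⟩

theorem toReal_exposure {Pa h : ℝ} (hp : p.Valid) (hPa : 0 ≤ Pa) (hh : 0 ≤ h) {y : ℝ≥0∞}
    (hy : y < ∞) : (ENNReal.ofReal (Pa * h / p.area) + y).toReal = Pa * h / p.area + y.toReal := by
  have := hp.area_pos
  rw [ENNReal.toReal_add ENNReal.ofReal_ne_top hy.ne, ENNReal.toReal_ofReal (by positivity)]

theorem Network.IsModel.ae_exposureLaw_lt_top (hX : X.IsModel p P) (hp : p.Valid) (hk : 1 ≤ k)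
    (hκ : ∀ᵐ ω ∂P, κ (pointMeasure X.bs ω) = pointMeasure X.bs ω) {t : ℝ} (ht : 0 < t) (Pa : ℝ) :
    ∀ᵐ y ∂hX.exposureLaw κ k (Pa, t), y < ∞ := by
  rw [exposureLaw_apply, ae_map_iff (hX.measurable_exposure_right Pa t).aemeasurable
    measurableSet_Iio]
  filter_upwards [hX.ae_prod_finite hp hk hκ ht] with y hy
  exact ENNReal.add_lt_top.2 ⟨ENNReal.ofReal_lt_top, hy.1⟩

/-- The Laplace transform of the exposure. -/
theorem Network.IsModel.laplace_exposureLaw (hX : X.IsModel p P) (hp : p.Valid) (hk : 1 ≤ k)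
    (hκ : ∀ᵐ ω ∂P, κ (pointMeasure X.bs ω) = pointMeasure X.bs ω) {Pa t : ℝ} (hPa : 0 ≤ Pa)
    (ht : 0 < t) {s : ℂ} (hs : 0 ≤ s.re) :
    laplace (hX.exposureLaw κ k (Pa, t)) s = p.laplaceW k Pa t s := by
  have := isProbabilityMeasure_fadingLaw hk
  have harea := hp.area_pos
  have hs' : 0 ≤ (s * ((Pa / p.area : ℝ) : ℂ)).re := by
    rw [Complex.re_mul_ofReal]; positivity
  rw [laplace, exposureLaw_apply, integral_map (hX.measurable_exposure_right Pa t).aemeasurable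
    (by fun_prop : Measurable _).aestronglyMeasurable]
  have h1 : ∀ᵐ y ∂P.prod (fadingLaw k), Complex.exp (-s * ((ENNReal.ofReal (Pa * y.2 / p.area) +
      interf κ p t (pointMeasure X.bs y.1)).toReal : ℂ)) =
      Complex.exp (-(s * ((interf κ p t (pointMeasure X.bs y.1)).toReal : ℂ))) *
      Complex.exp (-(s * ((Pa / p.area : ℝ) : ℂ) * (y.2 : ℂ))) := by
    filter_upwards [hX.ae_prod_finite hp hk hκ ht] with y hy
    rw [toReal_exposure hp hPa hy.2 hy.1, ← Complex.exp_add]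
    congr 1
    push_cast
    ring
  rw [integral_congr_ae h1, integral_prod_mul
    (fun ω => Complex.exp (-(s * ((interf κ p t (pointMeasure X.bs ω)).toReal : ℂ))))
    (fun h : ℝ => Complex.exp (-(s * ((Pa / p.area : ℝ) : ℂ) * (h : ℂ)))),
    hX.integral_cexp_interf hp hκ ht hs, integral_cexp_fadingLaw hk hs', Params.laplaceW, mul_comm]
  congr 3
  push_cast
  rw [mul_div_assoc', div_div, mul_comm (p.area : ℂ)]

/-- For fixed `t > 0` the mean is finite, although the unconditional mean may be infinite because of
short distances. The inversion formula is therefore applied to the conditional law. -/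
theorem Network.IsModel.lintegral_id_exposureLaw_ne_top (hX : X.IsModel p P) (hp : p.Valid)
    (hk : 1 ≤ k) (hκ : ∀ᵐ ω ∂P, κ (pointMeasure X.bs ω) = pointMeasure X.bs ω) {Pa t : ℝ}
    (hPa : 0 ≤ Pa) (ht : 0 < t) : ∫⁻ y, y ∂hX.exposureLaw κ k (Pa, t) ≠ ∞ := by
  have := isProbabilityMeasure_fadingLaw hk
  have harea := hp.area_pos
  rw [hX.lintegral_exposureLaw k Pa t (F := fun y => y) measurable_id]
  have h1 : ∀ y : ℝ≥0∞, ∫⁻ h, (ENNReal.ofReal (Pa * h / p.area) + y) ∂fadingLaw k =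
      ENNReal.ofReal (Pa / p.area) + y := by
    intro y
    have e : ∀ h : ℝ, ENNReal.ofReal (Pa * h / p.area) + y =
        ENNReal.ofReal (Pa / p.area) * ENNReal.ofReal h + y := fun h => by
      rw [← ENNReal.ofReal_mul (by positivity), div_mul_eq_mul_div]
    simp_rw [e]
    rw [lintegral_add_right _ measurable_const, lintegral_const, measure_univ, mul_one,
      lintegral_const_mul _ ENNReal.measurable_ofReal, lintegral_ofReal_fadingLaw hk, mul_one]
  simp_rw [h1]
  rw [lawKernel_apply, lintegral_map (by fun_prop) (hX.measurable_interf_right t),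
    lintegral_add_left measurable_const, lintegral_const, measure_univ, mul_one,
    hX.lintegral_interf hp hκ]
  exact ENNReal.add_ne_top.2 ⟨ENNReal.ofReal_ne_top, hp.lintegral_powerFrom_ne_top ht⟩

/-- Given a finite interference, the exposure takes the value `w` for at most one nonnegative value
of the fading, and the Gamma law has no atoms. So every level is a continuity point. -/
theorem Network.IsModel.exposureLaw_toReal_eq (hX : X.IsModel p P) (hp : p.Valid)
    (hk : 1 ≤ k) (hκ : ∀ᵐ ω ∂P, κ (pointMeasure X.bs ω) = pointMeasure X.bs ω) {Pa t : ℝ}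
    (hPa : 0 < Pa) (ht : 0 < t) (w : ℝ) :
    hX.exposureLaw κ k (Pa, t) (ENNReal.toReal ⁻¹' {w}) = 0 := by
  have := isProbabilityMeasure_fadingLaw hk
  have harea := hp.area_pos
  have hm := hX.measurable_exposure_right (κ := κ) Pa t
  have hS : MeasurableSet (ENNReal.toReal ⁻¹' {w}) :=
    ENNReal.measurable_toReal (measurableSet_singleton w)
  rw [exposureLaw_apply, Measure.map_apply hm hS, Measure.measure_prod_null (hm hS)]
  filter_upwards [hX.ae_interf_lt_top hp hκ ht] with ω hω
  have h1 : ∀ᵐ h ∂fadingLaw k, h ≠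
      (w - (interf κ p t (pointMeasure X.bs ω)).toReal) * p.area / Pa := by
    rw [ae_iff]
    simp
  refine measure_mono_null ?_ (ae_iff.1 (h1.and (ae_fadingLaw_nonneg (m := k))))
  intro h hh hc
  have hh' : (ENNReal.ofReal (Pa * h / p.area) +
    interf κ p t (pointMeasure X.bs ω)).toReal = w := hh
  rw [toReal_exposure hp hPa.le hc.2 hω] at hh'
  refine hc.1 ?_
  rw [← hh']
  field_simp
  ring

/-- This matches the sine form of the inversion lemma with the stated integrand: the imaginary part
of `exp (-i x w)` times the expectation of `exp (i x Y)`. -/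
theorem Network.IsModel.integral_sin_exposureLaw (hX : X.IsModel p P) (hp : p.Valid)
    (hk : 1 ≤ k) (hκ : ∀ᵐ ω ∂P, κ (pointMeasure X.bs ω) = pointMeasure X.bs ω) {Pa t : ℝ}
    (hPa : 0 < Pa) (ht : 0 < t) (w x : ℝ) :
    ∫ y, Real.sin ((y - w) * x) ∂(hX.exposureLaw κ k (Pa, t)).map ENNReal.toReal =
      (Complex.exp (-Complex.I * x * w) * p.laplaceW k Pa t (-Complex.I * x)).im := by
  have := hX.isMarkovKernel_exposureLaw (κ := κ) hk
  have hre : 0 ≤ (-Complex.I * (x : ℂ)).re := by simp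
  rw [← hX.laplace_exposureLaw hp hk hκ hPa.le ht hre, laplace, ← integral_const_mul,
    ← Complex.imCLM_apply, ← Complex.imCLM.integral_comp_comm,
    integral_map ENNReal.measurable_toReal.aemeasurable
    (by fun_prop : Measurable _).aestronglyMeasurable]
  · refine integral_congr_ae (ae_of_all _ fun y => ?_)
    simp only [Complex.imCLM_apply]
    rw [← Complex.exp_add, show -Complex.I * (x : ℂ) * w + -(-Complex.I * x) * (y.toReal : ℂ) =
      (((y.toReal - w) * x : ℝ) : ℂ) * Complex.I by push_cast; ring, Complex.exp_ofReal_mul_I_im]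
  · refine Integrable.of_bound (C := 1) (by fun_prop : Measurable _).aestronglyMeasurable
      (ae_of_all _ fun y => ?_)
    rw [← Complex.exp_add, show -Complex.I * (x : ℂ) * w + -(-Complex.I * x) * (y.toReal : ℂ) =
      (((y.toReal - w) * x : ℝ) : ℂ) * Complex.I by push_cast; ring, Complex.norm_exp_ofReal_mul_I]

/-- Absolute convergence of the inversion integral. -/
theorem Network.IsModel.integrableOn_gilPelaezIntegrand (hX : X.IsModel p P) (hp : p.Valid)
    (hk : 1 ≤ k) (hκ : ∀ᵐ ω ∂P, κ (pointMeasure X.bs ω) = pointMeasure X.bs ω) {Pa t : ℝ}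
    (hPa : 0 < Pa) (ht : 0 < t) (w : ℝ) :
    Integrable (fun y : ℝ => y) ((hX.exposureLaw κ k (Pa, t)).map ENNReal.toReal) ∧
    IntegrableOn (p.gilPelaezIntegrand k Pa t w) (Ioi 0) := by
  have := hX.isMarkovKernel_exposureLaw (κ := κ) hk
  have hprob := Measure.isProbabilityMeasure_map (μ := hX.exposureLaw κ k (Pa, t))
    ENNReal.measurable_toReal.aemeasurable
  have hint : Integrable (fun y : ℝ => y)
      ((hX.exposureLaw κ k (Pa, t)).map ENNReal.toReal) := by
    rw [integrable_map_measure measurable_id'.aestronglyMeasurable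
      ENNReal.measurable_toReal.aemeasurable]
    exact integrable_toReal_of_lintegral_ne_top measurable_id'.aemeasurable
      (hX.lintegral_id_exposureLaw_ne_top hp hk hκ hPa.le ht)
  refine ⟨hint, ?_⟩
  have h := integrableOn_gilPelaez (w := w) (C := k * p.area / Pa) hint fun x hx => by
    rw [hX.integral_sin_exposureLaw hp hk hκ hPa ht]
    refine (Complex.abs_im_le_norm _).trans ?_
    rw [norm_mul, show -Complex.I * (x : ℂ) * w = ((-(x * w) : ℝ) : ℂ) * Complex.I by
      push_cast; ring, Complex.norm_exp_ofReal_mul_I, one_mul]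
    exact hX.norm_laplaceW_le hp hk hκ hPa ht hx
  refine h.congr_fun (fun x _ => ?_) measurableSet_Ioi
  simp only [Params.gilPelaezIntegrand, hX.integral_sin_exposureLaw hp hk hκ hPa ht]

/-- The distribution function of the exposure. -/
theorem Network.IsModel.real_exposureLaw_atMost (hX : X.IsModel p P) (hp : p.Valid)
    (hk : 1 ≤ k) (hκ : ∀ᵐ ω ∂P, κ (pointMeasure X.bs ω) = pointMeasure X.bs ω) {Pa t : ℝ}
    (hPa : 0 < Pa) (ht : 0 < t) (w : ℝ) :
    (hX.exposureLaw κ k (Pa, t)).real (atMost w) = p.condCDF k Pa t w := by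
  have := hX.isMarkovKernel_exposureLaw (κ := κ) hk
  have hprob := Measure.isProbabilityMeasure_map (μ := hX.exposureLaw κ k (Pa, t))
    ENNReal.measurable_toReal.aemeasurable
  obtain ⟨hint, hI⟩ := hX.integrableOn_gilPelaezIntegrand hp hk hκ hPa ht w
  have hfun : (fun x : ℝ => 1 / (Real.pi * x) *
      ∫ y, Real.sin ((y - w) * x) ∂(hX.exposureLaw κ k (Pa, t)).map ENNReal.toReal) =
      p.gilPelaezIntegrand k Pa t w := by
    funext x
    rw [Params.gilPelaezIntegrand, hX.integral_sin_exposureLaw hp hk hκ hPa ht]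
  have h := gilPelaez (μ := (hX.exposureLaw κ k (Pa, t)).map ENNReal.toReal) (w := w) hint
    (by
      rw [Measure.map_apply ENNReal.measurable_toReal (measurableSet_singleton w)]
      exact hX.exposureLaw_toReal_eq hp hk hκ hPa ht w)
    (by rw [hfun]; exact hI)
  rw [hfun, map_measureReal_apply ENNReal.measurable_toReal measurableSet_Iic] at h
  rw [Params.condCDF, ← h]
  refine measureReal_congr ?_
  filter_upwards [hX.ae_exposureLaw_lt_top hp hk hκ ht Pa] with y hy
  refine propext ?_
  change y ∈ atMost w ↔ y.toReal ≤ w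
  rw [mem_atMost_iff, and_iff_right hy.ne]

theorem Network.IsModel.exposureLaw_atMost (hX : X.IsModel p P) (hp : p.Valid)
    (hk : 1 ≤ k) (hκ : ∀ᵐ ω ∂P, κ (pointMeasure X.bs ω) = pointMeasure X.bs ω) {Pa t : ℝ}
    (hPa : 0 < Pa) (ht : 0 < t) (w : ℝ) :
    hX.exposureLaw κ k (Pa, t) (atMost w) = ENNReal.ofReal (p.condCDF k Pa t w) := by
  have := hX.isMarkovKernel_exposureLaw (κ := κ) hk
  rw [← hX.real_exposureLaw_atMost hp hk hκ hPa ht, ofReal_measureReal]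

end Exposure

/-! ### Existence of, and distance to, the nearest usable RIS. -/

section RIS

open Filter Topology

/-- The set of usable RISs closer than `ρ`. -/
def Params.usableWithin (p : Params) (b : ℂ) (ρ : ℝ) : Set RISPoint :=
  {r | p.Usable b r ∧ ‖r.loc‖ < ρ}

/-- Distance to the nearest usable RIS; the kernel `κ` serves to make this jointly measurable. -/
noncomputable def risDist (κ : Kernel (Measure RISPoint) RISPoint) (p : Params) (b : ℂ)
    (ν : Measure RISPoint) : ℝ := sInf {ρ : ℝ | κ ν (p.usableWithin b ρ) ≠ 0}

/-- Existence of a usable RIS. -/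
def HasRIS (κ : Kernel (Measure RISPoint) RISPoint) (p : Params) (b : ℂ)
    (ν : Measure RISPoint) : Prop := κ ν {r | p.Usable b r} ≠ 0

variable {κ : Kernel (Measure RISPoint) RISPoint} {p : Params}

theorem Params.usableWithin_mono (b : ℂ) : Monotone (p.usableWithin b) :=
  fun _ _ h _ hr => ⟨hr.1, hr.2.trans_le h⟩

theorem Params.measurableSet_usableWithin (b : ℂ) (ρ : ℝ) : MeasurableSet (p.usableWithin b ρ) :=
  (Params.measurableSet_usable_right b).inter
    (measurableSet_lt Params.measurable_risLoc.norm measurable_const)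

theorem measurable_kernel_usable [IsSFiniteKernel κ] :
    Measurable fun y : ℂ × Measure RISPoint => κ y.2 {r | p.Usable y.1 r} := by
  have hS : MeasurableSet {z : (ℂ × Measure RISPoint) × RISPoint | p.Usable z.1.1 z.2} :=
    (measurable_fst.fst.prodMk measurable_snd :
      Measurable fun z : (ℂ × Measure RISPoint) × RISPoint => (z.1.1, z.2))
      Params.measurableSet_usable
  exact Kernel.measurable_kernel_prodMk_left
    (κ := κ.comap (Prod.snd : ℂ × Measure RISPoint → Measure RISPoint) measurable_snd) hS

theorem measurable_kernel_usableWithin [IsSFiniteKernel κ] (ρ : ℝ) :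
    Measurable fun y : ℂ × Measure RISPoint => κ y.2 (p.usableWithin y.1 ρ) := by
  have hS : MeasurableSet {z : (ℂ × Measure RISPoint) × RISPoint |
      p.Usable z.1.1 z.2 ∧ ‖z.2.loc‖ < ρ} :=
    ((measurable_fst.fst.prodMk measurable_snd :
      Measurable fun z : (ℂ × Measure RISPoint) × RISPoint => (z.1.1, z.2))
      Params.measurableSet_usable).inter
      (measurableSet_lt (Params.measurable_risLoc.comp measurable_snd).norm measurable_const)
  exact Kernel.measurable_kernel_prodMk_left
    (κ := κ.comap (Prod.snd : ℂ × Measure RISPoint → Measure RISPoint) measurable_snd) hS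

theorem measurableSet_hasRIS [IsSFiniteKernel κ] :
    MeasurableSet {y : ℂ × Measure RISPoint | HasRIS κ p y.1 y.2} :=
  measurable_kernel_usable (measurableSet_singleton (0 : ℝ≥0∞)).compl

/-- The sets `usableWithin` increase with the radius and, their defining inequality being strict,
are unions of those of smaller radius. So the radii of nonzero mass form an open upper ray, and the
infimum is below `ρ` exactly when `ρ` belongs to it. If no RIS is usable there are no such radii and
`sInf ∅ = 0`, which accounts for the first alternative. -/
theorem risDist_lt_iff {b : ℂ} {ν : Measure RISPoint} {ρ : ℝ} :
    risDist κ p b ν < ρ ↔ (¬ HasRIS κ p b ν ∧ 0 < ρ) ∨ κ ν (p.usableWithin b ρ) ≠ 0 := by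
  have hsub : ∀ ρ, p.usableWithin b ρ ⊆ {r | p.Usable b r} := fun ρ r hr => hr.1
  by_cases h : HasRIS κ p b ν
  · have hne : {ρ : ℝ | κ ν (p.usableWithin b ρ) ≠ 0}.Nonempty := by
      by_contra hc
      rw [not_nonempty_iff_eq_empty, eq_empty_iff_forall_notMem] at hc
      refine h ?_
      have hU : {r | p.Usable b r} = ⋃ n : ℕ, p.usableWithin b n := by
        ext r
        simp only [mem_iUnion, mem_ofPred_eq]
        constructor
        · intro hr
          obtain ⟨n, hn⟩ := exists_nat_gt ‖r.loc‖
          exact ⟨n, hr, hn⟩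
        · rintro ⟨n, hr⟩
          exact hr.1
      rw [hU]
      exact measure_iUnion_null fun n => not_not.1 (hc n)
    have hbdd : BddBelow {ρ : ℝ | κ ν (p.usableWithin b ρ) ≠ 0} := by
      refine ⟨0, fun ρ hρ => ?_⟩
      by_contra hc
      refine hρ ?_
      have : p.usableWithin b ρ = ∅ := eq_empty_iff_forall_notMem.2 fun r hr =>
        absurd (hr.2.trans (not_le.1 hc)) (not_lt.2 (norm_nonneg _))
      rw [this, measure_empty]
    rw [risDist, csInf_lt_iff hbdd hne]
    simp only [h, not_true, false_and, false_or]
    constructor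
    · rintro ⟨ρ', h1, h2⟩ hc
      exact h1 (measure_mono_null (Params.usableWithin_mono b h2.le) hc)
    · intro hρ
      by_contra hc
      push Not at hc
      refine hρ ?_
      have hU : p.usableWithin b ρ = ⋃ n : ℕ, p.usableWithin b (ρ - 1 / ((n : ℝ) + 1)) := by
        ext r
        simp only [mem_iUnion]
        constructor
        · rintro ⟨h1, h2⟩
          obtain ⟨n, hn⟩ := exists_nat_one_div_lt (sub_pos.2 h2)
          exact ⟨n, h1, by linarith⟩
        · rintro ⟨n, hr⟩
          refine Params.usableWithin_mono b ?_ hr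
          have : (0 : ℝ) < 1 / ((n : ℝ) + 1) := by positivity
          linarith
      rw [hU]
      refine measure_iUnion_null fun n => ?_
      by_contra hn
      have h1 := hc _ hn
      have : (0 : ℝ) < 1 / ((n : ℝ) + 1) := by positivity
      linarith
  · have h0 : κ ν {r | p.Usable b r} = 0 := not_not.1 h
    have hz : ∀ ρ, κ ν (p.usableWithin b ρ) = 0 := fun ρ => measure_mono_null (hsub ρ) h0
    have : risDist κ p b ν = 0 := by simp [risDist, hz]
    rw [this]
    simp [h, hz]

theorem measurable_risDist [IsSFiniteKernel κ] :
    Measurable fun y : ℂ × Measure RISPoint => risDist κ p y.1 y.2 := by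
  refine measurable_of_Iio fun ρ => ?_
  have e : (fun y : ℂ × Measure RISPoint => risDist κ p y.1 y.2) ⁻¹' Iio ρ =
      ({y | HasRIS κ p y.1 y.2}ᶜ ∩ {_y | 0 < ρ}) ∪
        (fun y : ℂ × Measure RISPoint => κ y.2 (p.usableWithin y.1 ρ)) ⁻¹' {0}ᶜ := by
    ext y
    exact risDist_lt_iff
  rw [e]
  exact (measurableSet_hasRIS.compl.inter (MeasurableSet.const _)).union
    (measurable_kernel_usableWithin ρ (measurableSet_singleton 0).compl)

theorem measurable_risDist_right [IsSFiniteKernel κ] (b : ℂ) :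
    Measurable fun ν : Measure RISPoint => risDist κ p b ν := by
  have h := (measurable_risDist (κ := κ) (p := p)).comp
    (measurable_prodMk_left (x := b) (β := Measure RISPoint))
  exact h

theorem measurableSet_hasRIS_right [IsSFiniteKernel κ] (b : ℂ) :
    MeasurableSet {ν : Measure RISPoint | HasRIS κ p b ν} := by
  have h := measurable_prodMk_left (x := b) (β := Measure RISPoint)
    (measurableSet_hasRIS (κ := κ) (p := p))
  exact h

section Density

/-- Mean number of usable RISs within distance `r`. -/
noncomputable def Params.meanRIS (p : Params) (b r : ℝ) : ℝ :=
  p.lamR * ∫ t in (0 : ℝ)..r, p.aBar b t * t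

/-- Subdensity of the distance to the nearest usable RIS. -/
noncomputable def Params.densRU (p : Params) (b r : ℝ) : ℝ :=
  p.lamR * r * p.aBar b r * Real.exp (-p.lamR * ∫ t in (0 : ℝ)..r, p.aBar b t * t)

namespace Params

theorem densRU_nonneg (hp : p.Valid) (b : ℝ) {r : ℝ} (hr : 0 ≤ r) : 0 ≤ p.densRU b r := by
  have h1 := hp.lamR_nonneg
  have h2 := p.aBar_nonneg b r
  unfold densRU
  positivity

theorem hasDerivAt_exp_neg_meanRIS {b : ℝ} (hb : 0 < b) (r : ℝ) :
    HasDerivAt (fun r => -Real.exp (-p.meanRIS b r)) (p.densRU b r) r := by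
  have hc : Continuous fun t => p.aBar b t * t := (continuous_aBar hb).mul continuous_id
  have h1 : HasDerivAt (p.meanRIS b) (p.lamR * (p.aBar b r * r)) r :=
    (hc.integral_hasStrictDerivAt 0 r).hasDerivAt.const_mul _
  refine h1.neg.exp.neg.congr_deriv ?_
  have e : (-p.meanRIS b) r = -p.lamR * ∫ t in (0 : ℝ)..r, p.aBar b t * t := by
    rw [neg_mul]
    rfl
  rw [e, densRU]
  ring

theorem continuous_densRU {b : ℝ} (hb : 0 < b) : Continuous (p.densRU b) := by
  have hc := continuous_aBar (p := p) hb
  have h1 : Continuous fun r => ∫ t in (0 : ℝ)..r, p.aBar b t * t :=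
    intervalIntegral.continuous_primitive
      (fun a c => (hc.mul continuous_id).intervalIntegrable a c) 0
  unfold densRU
  fun_prop

theorem lintegral_densRU (hp : p.Valid) {b ρ : ℝ} (hb : 0 < b) (hρ : 0 ≤ ρ) :
    ∫⁻ r in Ioc 0 ρ, ENNReal.ofReal (p.densRU b r) =
      ENNReal.ofReal (1 - Real.exp (-p.meanRIS b ρ)) := by
  have hi := (continuous_densRU (p := p) hb).intervalIntegrable (μ := volume) 0 ρ
  rw [← ofReal_integral_eq_lintegral_ofReal hi.1 ((ae_restrict_iff' measurableSet_Ioc).2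
    (ae_of_all _ fun t ht => densRU_nonneg hp b ht.1.le)),
    ← intervalIntegral.integral_of_le hρ,
    intervalIntegral.integral_eq_sub_of_hasDerivAt
      (fun t _ => hasDerivAt_exp_neg_meanRIS hb t) hi]
  congr 1
  simp [meanRIS]
  ring

theorem risIntensity_usableWithin (hp : p.Valid) {b : ℂ} (hb : b ≠ 0) {ρ : ℝ} (hρ : 0 ≤ ρ) :
    p.risIntensity (p.usableWithin b ρ) = ENNReal.ofReal (p.meanRIS ‖b‖ ρ) := by
  rw [meanRIS, ← hp.risIntensity_usable_le hb hρ]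
  have h1 := hp.risIntensity_usable hb (measurableSet_Iio (a := ρ))
  have h2 := hp.risIntensity_usable hb (measurableSet_Iic (a := ρ))
  refine h1.trans (Eq.trans ?_ h2.symm)
  congr 1
  rw [Ioi_inter_Iio, Ioi_inter_Iic]
  exact setLIntegral_congr Ioo_ae_eq_Ioc

theorem meanRIS_nonneg (hp : p.Valid) (b : ℝ) {ρ : ℝ} (hρ : 0 ≤ ρ) : 0 ≤ p.meanRIS b ρ :=
  mul_nonneg hp.lamR_nonneg (intervalIntegral.integral_nonneg hρ fun _ ht =>
    mul_nonneg (aBar_nonneg _ _) ht.1)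

theorem probCL_nonneg (hp : p.Valid) (b : ℝ) : 0 ≤ p.probCL b := by
  have h : 0 ≤ p.lamR * ∫ t in Ioi (0 : ℝ), p.aBar b t * t :=
    mul_nonneg hp.lamR_nonneg (setIntegral_nonneg measurableSet_Ioi fun _ ht =>
      mul_nonneg (aBar_nonneg _ _) (le_of_lt ht))
  rw [probCL, sub_nonneg, Real.exp_le_one_iff]
  linarith

theorem measurable_densRU : Measurable fun y : ℝ × ℝ => p.densRU y.1 y.2 := by
  have h1 := p.measurable_aBar
  have h4 : Measurable fun z : (ℝ × ℝ) × ℝ => p.aBar z.1.1 z.2 * z.2 :=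
    (h1.comp (measurable_fst.fst.prodMk measurable_snd)).mul measurable_snd
  have key : ∀ S : Set ((ℝ × ℝ) × ℝ), MeasurableSet S → Measurable fun y : ℝ × ℝ =>
      ∫ t, S.indicator (fun z => p.aBar z.1.1 z.2 * z.2) (y, t) := fun S hS =>
    (h4.indicator hS).stronglyMeasurable.integral_prod_right'.measurable
  have hS1 : MeasurableSet {z : (ℝ × ℝ) × ℝ | z.2 ∈ Ioc 0 z.1.2} :=
    (measurableSet_lt measurable_const measurable_snd).inter
      (measurableSet_le measurable_snd measurable_fst.snd)
  have hS2 : MeasurableSet {z : (ℝ × ℝ) × ℝ | z.2 ∈ Ioc z.1.2 0} :=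
    (measurableSet_lt measurable_fst.snd measurable_snd).inter
      (measurableSet_le measurable_snd measurable_const)
  -- The moving endpoint is absorbed into an indicator, which reduces to integrals with parameters
  -- over a fixed space. Both orientations of the interval occur, since the second coordinate may be
  -- negative.
  have h2 : Measurable fun y : ℝ × ℝ => ∫ t in (0 : ℝ)..y.2, p.aBar y.1 t * t := by
    have e : (fun y : ℝ × ℝ => ∫ t in (0 : ℝ)..y.2, p.aBar y.1 t * t) = fun y =>
        (∫ t, {z : (ℝ × ℝ) × ℝ | z.2 ∈ Ioc 0 z.1.2}.indicator
          (fun z => p.aBar z.1.1 z.2 * z.2) (y, t)) -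
        ∫ t, {z : (ℝ × ℝ) × ℝ | z.2 ∈ Ioc z.1.2 0}.indicator
          (fun z => p.aBar z.1.1 z.2 * z.2) (y, t) := by
      funext y
      rw [intervalIntegral, ← integral_indicator measurableSet_Ioc,
        ← integral_indicator measurableSet_Ioc]
      rfl
    rw [e]
    exact (key _ hS1).sub (key _ hS2)
  unfold densRU
  fun_prop

end Params

end Density

section Law

variable {Ω : Type*} {mΩ : MeasurableSpace Ω} {P : Measure Ω} {X : Network Ω}

theorem Network.IsModel.measurable_ris (hX : X.IsModel p P) : Measurable (pointMeasure X.ris) :=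
  hX.ris_poisson.measurable_pointMeasure

/-- For a fixed station location the usable RISs are the points of a Poisson process in a set of
finite intensity, so this is a void probability. It depends on the location through its modulus
only. -/
theorem Network.IsModel.prob_not_hasRIS (hX : X.IsModel p P) (hp : p.Valid)
    (hκ : ∀ᵐ ω ∂P, κ (pointMeasure X.ris ω) = pointMeasure X.ris ω) {b : ℂ} (hb : b ≠ 0) :
    P {ω | ¬ HasRIS κ p b (pointMeasure X.ris ω)} = ENNReal.ofReal (1 - p.probCL ‖b‖) := by
  have hris := hX.ris_poisson
  have hm := Params.measurableSet_usable_right (p := p) b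
  have h0 := hris.prob_count_eq_zero hm (by rw [hp.risIntensity_usable_univ hb]; finiteness)
  have hnn : 0 ≤ p.lamR * ∫ t in Ioi (0 : ℝ), p.aBar ‖b‖ t * t :=
    mul_nonneg hp.lamR_nonneg (setIntegral_nonneg measurableSet_Ioi fun t ht =>
      mul_nonneg (Params.aBar_nonneg _ _) (le_of_lt ht))
  rw [hp.risIntensity_usable_univ hb, ENNReal.toReal_ofReal hnn] at h0
  rw [Params.probCL, sub_sub_cancel, neg_mul, ← h0]
  refine measure_congr ?_
  filter_upwards [hκ] with ω hω
  refine propext ?_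
  change ¬ κ (pointMeasure X.ris ω) _ ≠ 0 ↔ count X.ris {r | p.Usable b r} ω = 0
  rw [hω, pointMeasure_apply (hris.countable ω) hm]
  simp

variable [IsProbabilityMeasure P]

/-- The nearest usable RIS is closer than `ρ` when `usableWithin b ρ` is not void. The probability
`1 - exp (-meanRIS)` is the integral of its derivative, the subdensity. -/
theorem Network.IsModel.prob_risDist_lt (hX : X.IsModel p P) (hp : p.Valid)
    (hκ : ∀ᵐ ω ∂P, κ (pointMeasure X.ris ω) = pointMeasure X.ris ω) {b : ℂ} (hb : b ≠ 0)
    {ρ : ℝ} (hρ : 0 < ρ) :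
    P {ω | risDist κ p b (pointMeasure X.ris ω) < ρ ∧ HasRIS κ p b (pointMeasure X.ris ω)} =
      ∫⁻ r in Ioc 0 ρ, ENNReal.ofReal (p.densRU ‖b‖ r) := by
  have hris := hX.ris_poisson
  have hm := p.measurableSet_usableWithin b ρ
  have hΛ := p.risIntensity_usableWithin hp hb hρ.le
  have h0 := hris.prob_count_eq_zero hm (by rw [hΛ]; finiteness)
  rw [hΛ, ENNReal.toReal_ofReal (p.meanRIS_nonneg hp _ hρ.le)] at h0
  have hms : MeasurableSet {ω | count X.ris (p.usableWithin b ρ) ω = 0} :=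
    hris.measurable_count _ hm (measurableSet_singleton 0)
  have hae : {ω | risDist κ p b (pointMeasure X.ris ω) < ρ ∧
      HasRIS κ p b (pointMeasure X.ris ω)} =ᵐ[P]
      ({ω | count X.ris (p.usableWithin b ρ) ω = 0}ᶜ : Set Ω) := by
    filter_upwards [hκ] with ω hω
    refine propext ?_
    change (risDist κ p b (pointMeasure X.ris ω) < ρ ∧ HasRIS κ p b (pointMeasure X.ris ω)) ↔
      ¬ count X.ris (p.usableWithin b ρ) ω = 0
    have h1 : κ (pointMeasure X.ris ω) (p.usableWithin b ρ) ≠ 0 ↔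
        ¬ count X.ris (p.usableWithin b ρ) ω = 0 := by
      rw [hω, pointMeasure_apply (hris.countable ω) hm]
      simp
    rw [risDist_lt_iff, h1]
    constructor
    · rintro ⟨h | h, h2⟩
      · exact absurd h2 h.1
      · exact h
    · intro h
      exact ⟨Or.inr h, fun hc => (h1.2 h)
        (measure_mono_null (show p.usableWithin b ρ ⊆ _ from fun r hr => hr.1) hc)⟩
  rw [measure_congr hae, prob_compl_eq_one_sub hms, h0,
    p.lintegral_densRU hp (norm_pos_iff.2 hb) hρ.le, ENNReal.ofReal_sub _ (Real.exp_pos _).le,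
    ENNReal.ofReal_one]

/-- The law of the distance to the nearest usable RIS. -/
theorem Network.IsModel.map_risDist [IsSFiniteKernel κ] (hX : X.IsModel p P) (hp : p.Valid)
    (hκ : ∀ᵐ ω ∂P, κ (pointMeasure X.ris ω) = pointMeasure X.ris ω) {b : ℂ} (hb : b ≠ 0) :
    (P.restrict {ω | HasRIS κ p b (pointMeasure X.ris ω)}).map
      (fun ω => risDist κ p b (pointMeasure X.ris ω)) =
    (volume.restrict (Ioi 0)).withDensity fun r => ENNReal.ofReal (p.densRU ‖b‖ r) := by
  have hmM := hX.measurable_ris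
  have hD : Measurable fun ω => risDist κ p b (pointMeasure X.ris ω) :=
    (measurable_risDist_right b).comp hmM
  have hfin : IsFiniteMeasure ((P.restrict {ω | HasRIS κ p b (pointMeasure X.ris ω)}).map
      (fun ω => risDist κ p b (pointMeasure X.ris ω))) := Measure.isFiniteMeasure_map _ _
  refine Measure.ext_of_generateFrom_of_iUnion (range Iio) (fun n : ℕ => Iio (n : ℝ))
    ((BorelSpace.measurable_eq (α := ℝ)).trans (borel_eq_generateFrom_Iio ℝ)) isPiSystem_Iio
    (iUnion_eq_univ_iff.2 fun x => exists_nat_gt x)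
    (fun n => ⟨_, rfl⟩) (fun n => measure_ne_top _ _) ?_
  rintro _ ⟨ρ, rfl⟩
  have hL : (P.restrict {ω | HasRIS κ p b (pointMeasure X.ris ω)}).map
      (fun ω => risDist κ p b (pointMeasure X.ris ω)) (Iio ρ) =
      P {ω | risDist κ p b (pointMeasure X.ris ω) < ρ ∧ HasRIS κ p b (pointMeasure X.ris ω)} := by
    rw [Measure.map_apply hD measurableSet_Iio, Measure.restrict_apply (hD measurableSet_Iio)]
    rfl
  rw [hL, withDensity_apply _ measurableSet_Iio, Measure.restrict_restrict measurableSet_Iio,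
    inter_comm, Ioi_inter_Iio]
  rcases le_or_gt ρ 0 with hρ | hρ
  · have h2 : p.usableWithin b ρ = ∅ := eq_empty_iff_forall_notMem.2 fun r hr =>
      absurd (hr.2.trans_le hρ) (not_lt.2 (norm_nonneg _))
    have h3 : {ω | risDist κ p b (pointMeasure X.ris ω) < ρ ∧
        HasRIS κ p b (pointMeasure X.ris ω)} = ∅ := by
      refine eq_empty_iff_forall_notMem.2 ?_
      rintro ω ⟨hω1, hω2⟩
      rw [risDist_lt_iff, h2, measure_empty] at hω1
      rcases hω1 with h | h
      · exact h.1 hω2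
      · exact h rfl
    rw [h3, measure_empty, Ioo_eq_empty (not_lt.2 hρ), Measure.restrict_empty,
      lintegral_zero_measure]
  · rw [hX.prob_risDist_lt hp hκ hb hρ, setLIntegral_congr Ioo_ae_eq_Ioc]

end Law

end RIS

/-! ### Factorisation of the joint law of the network's random elements. -/

section Independence

open Filter Topology

theorem measurable_pair {Ω α β : Type*} {m : MeasurableSpace Ω} [MeasurableSpace α]
    [MeasurableSpace β] {f : Ω → α} {g : Ω → β} (hf : Measurable[m] f) (hg : Measurable[m] g) :
    Measurable[m] fun ω => (f ω, g ω) := hf.prodMk hg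

theorem lintegral_indepFun {Ω α β : Type*} {mΩ : MeasurableSpace Ω} [MeasurableSpace α]
    [MeasurableSpace β] {P : Measure Ω} [IsFiniteMeasure P] {f : Ω → α} {g : Ω → β}
    (h : IndepFun f g P) (hf : Measurable f) (hg : Measurable g) {F : α × β → ℝ≥0∞}
    (hF : Measurable F) :
    ∫⁻ ω, F (f ω, g ω) ∂P = ∫⁻ ω, ∫⁻ ω', F (f ω, g ω') ∂P ∂P := by
  have h1 := (indepFun_iff_map_prod_eq_prod_map_map hf.aemeasurable hg.aemeasurable).1 h
  have h2 : Measurable fun a => ∫⁻ b, F (a, b) ∂P.map g := hF.lintegral_prod_right'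
  rw [← lintegral_map hF (hf.prodMk hg), h1, lintegral_prod _ hF.aemeasurable,
    lintegral_map h2 hf]
  refine lintegral_congr fun ω => ?_
  exact lintegral_map (f := fun b => F (f ω, b)) (hF.comp measurable_prodMk_left) hg

theorem indepFun_of_iIndep {Ω ι α β : Type*} {mΩ : MeasurableSpace Ω} [mα : MeasurableSpace α]
    [mβ : MeasurableSpace β] {P : Measure Ω} {m : ι → MeasurableSpace Ω} (hm : iIndep m P)
    (hle : ∀ i, m i ≤ mΩ) {S T : Set ι} (hST : Disjoint S T) {f : Ω → α} {g : Ω → β}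
    (hf : Measurable[⨆ i ∈ S, m i] f) (hg : Measurable[⨆ i ∈ T, m i] g) : IndepFun f g P := by
  rw [IndepFun_iff_Indep]
  exact indep_of_indep_of_le_left (indep_of_indep_of_le_right
    (indep_iSup_of_disjoint hle hm hST) hg.comap_le) hf.comap_le

/-- Position of the fading coefficient among the random elements of the network. -/
def LinkType.index : LinkType → Fin 7
  | .DL => 4
  | .CL => 5
  | .DN => 6

variable {κB : Kernel (Measure BSPoint) BSPoint} {p : Params} {Ω : Type*}
  {mΩ : MeasurableSpace Ω} {P : Measure Ω} {X : Network Ω}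

/-- Location of the tagged base station and interference. -/
noncomputable def Network.bsData (X : Network Ω) (p : Params)
    (κB : Kernel (Measure BSPoint) BSPoint) (ω : Ω) : ℂ × ℝ≥0∞ :=
  (X.nearest p ω, interf κB p ‖X.nearest p ω‖ (pointMeasure X.bs ω))

theorem Network.IsModel.measurable_bsData_sigmaAlg [IsSFiniteKernel κB] (hX : X.IsModel p P) :
    Measurable[sigmaAlg X.bs] (X.bsData p κB) := by
  have h1 : Measurable[sigmaAlg X.bs] (X.nearest p) := Network.measurable_nearest
  have h2 : Measurable[sigmaAlg X.bs] (pointMeasure X.bs) :=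
    measurable_pointMeasure_sigmaAlg hX.bs_poisson.countable
  have h3 : Measurable[sigmaAlg X.bs] fun ω => (‖X.nearest p ω‖, pointMeasure X.bs ω) :=
    measurable_pair (measurable_norm.comp h1) h2
  have h4 := (EMF.measurable_interf (κ := κB) (p := p)).comp h3
  exact measurable_pair h1 h4

theorem Network.IsModel.measurable_bsData [IsSFiniteKernel κB] (hX : X.IsModel p P) :
    Measurable (X.bsData p κB) :=
  hX.measurable_bsData_sigmaAlg.mono hX.sigmaAlg_bs_le le_rfl

variable [IsProbabilityMeasure P]

/-- The joint law of the random elements is a product. -/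
theorem Network.IsModel.lintegral_eq_iterated [IsSFiniteKernel κB] (hX : X.IsModel p P)
    (q : LinkType) {F : (ℂ × ℝ≥0∞) × Measure RISPoint × ℝ × ℝ × ℝ → ℝ≥0∞} (hF : Measurable F) :
    ∫⁻ ω, F (X.bsData p κB ω, pointMeasure X.ris ω, X.block₀ ω, X.theta₀ ω, X.H q ω) ∂P =
      ∫⁻ ω, ∫⁻ ω', ∫⁻ u, ∫⁻ θ, ∫⁻ h, F (X.bsData p κB ω, pointMeasure X.ris ω', u, θ, h)
        ∂fadingLaw (p.m q.state) ∂uniform (-Real.pi) Real.pi ∂uniform 0 1 ∂P ∂P := by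
  set m : Fin 7 → MeasurableSpace Ω := ![sigmaAlg X.bs, sigmaAlg X.ris,
    MeasurableSpace.comap X.block₀ inferInstance, MeasurableSpace.comap X.theta₀ inferInstance,
    MeasurableSpace.comap (X.H .DL) inferInstance, MeasurableSpace.comap (X.H .CL) inferInstance,
    MeasurableSpace.comap (X.H .DN) inferInstance] with hm
  have hind : iIndep m P := hX.indep
  have hle : ∀ i, m i ≤ mΩ := by
    intro i
    fin_cases i
    · exact hX.sigmaAlg_bs_le
    · exact hX.sigmaAlg_ris_le
    · exact hX.block_meas.comap_le
    · exact hX.theta_meas.comap_le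
    · exact (hX.H_meas .DL).comap_le
    · exact (hX.H_meas .CL).comap_le
    · exact (hX.H_meas .DN).comap_le
  have lift : ∀ {α : Type} [MeasurableSpace α] {f : Ω → α} {i : Fin 7} {S : Set (Fin 7)},
      Measurable[m i] f → i ∈ S → Measurable[⨆ i ∈ S, m i] f := fun hf hi =>
    hf.mono (le_iSup₂_of_le _ hi le_rfl) le_rfl
  have hY : Measurable[m 0] (X.bsData p κB) := hX.measurable_bsData_sigmaAlg
  have hM : Measurable[m 1] (pointMeasure X.ris) :=
    measurable_pointMeasure_sigmaAlg hX.ris_poisson.countable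
  have hu : Measurable[m 2] X.block₀ := comap_measurable _
  have hθ : Measurable[m 3] X.theta₀ := comap_measurable _
  have hH : Measurable[m q.index] (X.H q) := by
    cases q <;> exact comap_measurable _
  have hq : ∀ i : Fin 7, i ≤ 3 → i ≠ q.index := by
    cases q <;> decide
  -- One element is peeled off at a time. Positions `0` to `3` hold the stations, the RISs, the
  -- blockage variable and the angle; the fading of type `q` sits at `q.index`, distinct from these.
  have i4 : IndepFun X.theta₀ (X.H q) P := indepFun_of_iIndep hind hle (S := {3}) (T := {q.index})
    (by simpa using hq 3 le_rfl) (lift hθ rfl) (lift hH rfl)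
  have i3 : IndepFun X.block₀ (fun ω => (X.theta₀ ω, X.H q ω)) P :=
    indepFun_of_iIndep hind hle (S := {2}) (T := {3, q.index})
      (by simpa using hq 2 (by decide)) (lift hu rfl)
      (measurable_pair (lift hθ (by simp)) (lift hH (by simp)))
  have i2 : IndepFun (pointMeasure X.ris) (fun ω => (X.block₀ ω, X.theta₀ ω, X.H q ω)) P :=
    indepFun_of_iIndep hind hle (S := {1}) (T := {2, 3, q.index})
      (by simpa using hq 1 (by decide)) (lift hM rfl)
      (measurable_pair (lift hu (by simp)) (measurable_pair (lift hθ (by simp)) (lift hH (by simp))))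
  have i1 : IndepFun (X.bsData p κB)
      (fun ω => (pointMeasure X.ris ω, X.block₀ ω, X.theta₀ ω, X.H q ω)) P :=
    indepFun_of_iIndep hind hle (S := {0}) (T := {1, 2, 3, q.index})
      (by simpa using hq 0 (by decide)) (lift hY rfl)
      (measurable_pair (lift hM (by simp)) (measurable_pair (lift hu (by simp)) (measurable_pair (lift hθ (by simp)) (lift hH (by simp)))))
  have := isProbabilityMeasure_uniform (show -Real.pi < Real.pi by linarith [Real.pi_pos])
  have mY := hX.measurable_bsData (κB := κB)
  have mM := hX.measurable_ris
  have mu := hX.block_meas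
  have mθ := hX.theta_meas
  have mH := hX.H_meas q
  rw [lintegral_indepFun i1 mY (mM.prodMk (mu.prodMk (mθ.prodMk mH))) hF]
  refine lintegral_congr fun ω => ?_
  rw [lintegral_indepFun i2 mM (mu.prodMk (mθ.prodMk mH)) (F := fun z => F (X.bsData p κB ω, z))
    (by fun_prop)]
  refine lintegral_congr fun ω' => ?_
  rw [lintegral_indepFun i3 mu (mθ.prodMk mH)
    (F := fun z => F (X.bsData p κB ω, pointMeasure X.ris ω', z)) (by fun_prop)]
  have h4 : ∀ u, ∫⁻ ω'', F (X.bsData p κB ω, pointMeasure X.ris ω', u, X.theta₀ ω'', X.H q ω'') ∂P =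
      ∫⁻ θ, ∫⁻ h, F (X.bsData p κB ω, pointMeasure X.ris ω', u, θ, h)
        ∂fadingLaw (p.m q.state) ∂uniform (-Real.pi) Real.pi := by
    intro u
    rw [lintegral_indepFun i4 mθ mH
      (F := fun z => F (X.bsData p κB ω, pointMeasure X.ris ω', u, z)) (by fun_prop),
      ← hX.theta_law, ← hX.H_law q, lintegral_map _ mθ]
    · refine lintegral_congr fun ω'' => ?_
      rw [lintegral_map _ mH]
      fun_prop
    · refine Measurable.lintegral_prod_right' (f := fun z : ℝ × ℝ =>
        F (X.bsData p κB ω, pointMeasure X.ris ω', u, z.1, z.2)) (by fun_prop)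
  simp_rw [h4]
  rw [← hX.block_law, lintegral_map _ mu]
  have h5 : Measurable fun z : ((ℝ × ℝ) × ℝ) =>
      F (X.bsData p κB ω, pointMeasure X.ris ω', z.1.1, z.1.2, z.2) := by fun_prop
  have h6 : Measurable fun z : ℝ × ℝ => ∫⁻ h, F (X.bsData p κB ω, pointMeasure X.ris ω', z.1, z.2, h)
      ∂fadingLaw (p.m q.state) := h5.lintegral_prod_right'
  exact h6.lintegral_prod_right'

/-- The law of the distance to the tagged base station and the interference. -/
theorem Network.IsModel.lintegral_bsData [IsSFiniteKernel κB] (hX : X.IsModel p P) (hp : p.Valid)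
    (hκ : ∀ᵐ ω ∂P, κB (pointMeasure X.bs ω) = pointMeasure X.bs ω)
    {Φ : ℝ × ℝ≥0∞ → ℝ≥0∞} (hΦ : Measurable Φ) :
    ∫⁻ ω, Φ (‖(X.bsData p κB ω).1‖, (X.bsData p κB ω).2) ∂P =
      p.meanBU fun t => ∫⁻ y, Φ (t, y) ∂lawKernel P (hX.measurable_interf (κ := κB)) t := by
  have hT := hX.measurable_norm_nearest
  have hTS : Measurable fun ω =>
      (‖X.nearest p ω‖, interf κB p ‖X.nearest p ω‖ (pointMeasure X.bs ω)) :=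
    hT.prodMk (hX.measurable_interf.comp (hT.prodMk measurable_id))
  have hpdf : Measurable p.pdfBU := p.continuous_pdfBU.measurable
  have h1 := lintegral_map (μ := P) hΦ hTS
  rw [hX.map_nearest_interf hp hκ, Measure.lintegral_compProd hΦ,
    lintegral_withDensity_eq_lintegral_mul _ hpdf.ennreal_ofReal hΦ.lintegral_kernel_prod_right'] at h1
  refine h1.symm.trans (lintegral_congr fun t => ?_)
  rw [Pi.mul_apply, mul_comm]

end Independence

/-! ### Pathwise agreement of the model's quantities with their measurable versions. -/

section Pointwise

open Filter Topology

variable {κB : Kernel (Measure BSPoint) BSPoint} {κR : Kernel (Measure RISPoint) RISPoint}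
  {p : Params} {Ω : Type*} {mΩ : MeasurableSpace Ω} {P : Measure Ω} {X : Network Ω}

theorem pointMeasure_ne_zero_iff {Y : Type*} [MeasurableSpace Y]
    [MeasurableSingletonClass Y] {Φ : Ω → Set Y} {ω : Ω}
    (hc : (Φ ω).Countable) {A : Set Y} (hA : MeasurableSet A) :
    pointMeasure Φ ω A ≠ 0 ↔ (Φ ω ∩ A).Nonempty := by
  rw [pointMeasure_apply hc hA, count, nonempty_iff_ne_empty]
  simp

theorem Network.tbu_eq {ω : Ω} (hω : ω ∈ X.regular p) : X.tbu ω = ‖X.nearest p ω‖ := by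
  rw [tbu, nearest, indicator_of_mem hω]

theorem Network.usableRIS_nonempty_iff {ω : Ω} (hω : ω ∈ X.regular p)
    (hc : (X.ris ω).Countable) (hκ : κR (pointMeasure X.ris ω) = pointMeasure X.ris ω) :
    (X.usableRIS p ω).Nonempty ↔ HasRIS κR p (X.nearest p ω) (pointMeasure X.ris ω) := by
  rw [HasRIS, hκ, pointMeasure_ne_zero_iff hc (Params.measurableSet_usable_right _), nearest,
    indicator_of_mem hω]
  rfl

/-- One side is the infimum of the distances of the usable RISs, the other the infimum of the radii
exceeding one of these distances; they coincide. When there is no usable RIS both are `sInf ∅`. -/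
theorem Network.tru_eq {ω : Ω} (hω : ω ∈ X.regular p)
    (hc : (X.ris ω).Countable) (hκ : κR (pointMeasure X.ris ω) = pointMeasure X.ris ω) :
    X.tru p ω = risDist κR p (X.nearest p ω) (pointMeasure X.ris ω) := by
  have hset : {ρ : ℝ | κR (pointMeasure X.ris ω) (p.usableWithin (X.nearest p ω) ρ) ≠ 0} =
      {ρ | ∃ r ∈ X.usableRIS p ω, ‖r.loc‖ < ρ} := by
    ext ρ
    rw [mem_ofPred_eq, hκ, pointMeasure_ne_zero_iff hc (Params.measurableSet_usableWithin _ _),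
      nearest, indicator_of_mem hω]
    constructor
    · rintro ⟨r, hr, h1, h2⟩
      exact ⟨r, ⟨hr, h1⟩, h2⟩
    · rintro ⟨r, ⟨hr, h1⟩, h2⟩
      exact ⟨r, hr, h1, h2⟩
  rw [risDist, hset, tru]
  rcases (X.usableRIS p ω).eq_empty_or_nonempty with h | ⟨r₀, hr₀⟩
  · have e : {ρ : ℝ | ∃ r ∈ X.usableRIS p ω, ‖r.loc‖ < ρ} = ∅ := by
      ext ρ
      simp [h]
    rw [e, h, image_empty]
  · have hb : ∀ y ∈ (fun r : RISPoint => ‖r.loc‖) '' X.usableRIS p ω, 0 ≤ y := by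
      rintro _ ⟨r, -, rfl⟩
      exact norm_nonneg _
    have hb' : ∀ ρ ∈ {ρ : ℝ | ∃ r ∈ X.usableRIS p ω, ‖r.loc‖ < ρ}, 0 ≤ ρ := by
      rintro ρ ⟨r, -, h⟩
      exact (norm_nonneg _).trans h.le
    have hne : {ρ : ℝ | ∃ r ∈ X.usableRIS p ω, ‖r.loc‖ < ρ}.Nonempty :=
      ⟨‖r₀.loc‖ + 1, r₀, hr₀, by linarith⟩
    refine le_antisymm (le_csInf hne ?_) (le_csInf ⟨_, r₀, hr₀, rfl⟩ ?_)
    · rintro ρ ⟨r, hr, h⟩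
      exact (csInf_le ⟨0, hb⟩ ⟨r, hr, rfl⟩).trans h.le
    · rintro _ ⟨r, hr, rfl⟩
      refine le_of_forall_pos_le_add fun ε hε => csInf_le ⟨0, hb'⟩ ⟨r, hr, ?_⟩
      simpa using hε

theorem Network.mem_ev_DL {ω : Ω} :
    ω ∈ X.ev p .DL ↔ X.block₀ ω ≤ p.linkProb .L (X.tbu ω) := by
  change X.link p ω = .DL ↔ _
  unfold link
  split_ifs <;> simp_all

theorem Network.mem_ev_CL {ω : Ω} :
    ω ∈ X.ev p .CL ↔ ¬ X.block₀ ω ≤ p.linkProb .L (X.tbu ω) ∧ (X.usableRIS p ω).Nonempty := by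
  change X.link p ω = .CL ↔ _
  unfold link
  split_ifs <;> simp_all

theorem Network.mem_ev_DN {ω : Ω} :
    ω ∈ X.ev p .DN ↔ ¬ X.block₀ ω ≤ p.linkProb .L (X.tbu ω) ∧ ¬ (X.usableRIS p ω).Nonempty := by
  change X.link p ω = .DN ↔ _
  unfold link
  split_ifs <;> simp_all

end Pointwise

/-! ### Association probabilities and the normalisation of the RIS distance. -/

section Association

open Filter Topology

variable {p : Params}

theorem Params.measurable_probCL (p : Params) : Measurable p.probCL := by
  have h : Measurable fun z : ℝ × ℝ => p.aBar z.1 z.2 * z.2 := p.measurable_aBar.mul measurable_snd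
  have h2 : Measurable fun b => ∫ t in Ioi (0 : ℝ), p.aBar b t * t :=
    h.stronglyMeasurable.integral_prod_right'.measurable
  unfold Params.probCL
  fun_prop

theorem Params.measurable_assoc (p : Params) (q : LinkType) : Measurable (p.assoc q) := by
  have h1 := p.measurable_probCL
  have h2 := p.measurable_linkProb
  cases q
  · exact h2 .L
  · exact (h2 .N).mul h1
  · exact (h2 .N).mul (measurable_const.sub h1)

theorem Params.ae_densRU_eq_zero (hp : p.Valid) {t : ℝ} (h : p.probCL t = 0) :
    ∀ᵐ r ∂volume.restrict (Ioi 0), p.densRU t r = 0 := by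
  have h1 : p.lamR * ∫ r in Ioi (0 : ℝ), p.aBar t r * r = 0 := by
    rw [probCL, sub_eq_zero, eq_comm, Real.exp_eq_one_iff, neg_mul, neg_eq_zero] at h
    exact h
  rcases mul_eq_zero.1 h1 with h2 | h2
  · refine ae_of_all _ fun r => ?_
    simp [densRU, h2]
  · have h3 := (setIntegral_eq_zero_iff_of_nonneg_ae
      ((ae_restrict_iff' measurableSet_Ioi).2 (ae_of_all _ fun r hr =>
        mul_nonneg (aBar_nonneg _ _) (le_of_lt hr))) (hp.integrableOn_aBar t)).1 h2
    filter_upwards [h3] with r hr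
    rw [densRU, mul_assoc p.lamR, mul_comm r, show p.aBar t r * r = 0 from hr, mul_zero, zero_mul]

/-- The probability that a usable RIS exists cancels the denominator of `pdfRU`. If it vanishes, the
left side vanishes through this factor and the right side because the subdensity is zero almost
everywhere, so the convention for division by zero is harmless. -/
theorem Params.assoc_CL_mul (hp : p.Valid) {t : ℝ} (ht : 0 < t) (g : ℝ → ℝ → ℝ≥0∞) :
    ENNReal.ofReal (p.assoc .CL t) * ∫⁻ r in Ioi (0 : ℝ), ∫⁻ θ in Ioc (-Real.pi) Real.pi,
      g r θ * ENNReal.ofReal (1 / (2 * Real.pi) * p.pdfRU t r) =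
    ENNReal.ofReal (p.linkProb .N t) * ∫⁻ r in Ioi (0 : ℝ), ∫⁻ θ in Ioc (-Real.pi) Real.pi,
      g r θ * ENNReal.ofReal (1 / (2 * Real.pi) * p.densRU t r) := by
  rw [assoc, ENNReal.ofReal_mul (hp.linkProb_nonneg .N ht.le), mul_assoc]
  congr 1
  have hc := probCL_nonneg hp t
  rcases hc.eq_or_lt with h | h
  · rw [← h, ENNReal.ofReal_zero, zero_mul, eq_comm, ← lintegral_zero]
    refine lintegral_congr_ae ?_
    filter_upwards [ae_densRU_eq_zero hp h.symm] with r hr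
    simp [hr]
  · rw [← lintegral_const_mul' _ _ ENNReal.ofReal_ne_top]
    refine lintegral_congr fun r => ?_
    rw [← lintegral_const_mul' _ _ ENNReal.ofReal_ne_top]
    refine lintegral_congr fun θ => ?_
    rw [mul_left_comm, ← ENNReal.ofReal_mul hc]
    congr 2
    rw [pdfRU, densRU]
    field_simp

end Association

/-! ### Means over the three association events. -/

section Formulas

open Filter Topology

variable {κB : Kernel (Measure BSPoint) BSPoint} {κR : Kernel (Measure RISPoint) RISPoint}
  {p : Params} {Ω : Type*} {mΩ : MeasurableSpace Ω} {P : Measure Ω} {X : Network Ω}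

theorem Network.IsModel.measurable_nearest (hX : X.IsModel p P) : Measurable (X.nearest p) :=
  Network.measurable_nearest.mono hX.sigmaAlg_bs_le le_rfl

variable [IsProbabilityMeasure P]

theorem Network.IsModel.ae_regular (hX : X.IsModel p P) (hp : p.Valid)
    (hB : ∀ᵐ ω ∂P, κB (pointMeasure X.bs ω) = pointMeasure X.bs ω)
    (hR : ∀ᵐ ω ∂P, κR (pointMeasure X.ris ω) = pointMeasure X.ris ω) :
    ∀ᵐ ω ∂P, X.tbu ω = ‖X.nearest p ω‖ ∧ X.W2 p ω = (X.bsData p κB ω).2 ∧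
      X.tru p ω = risDist κR p (X.nearest p ω) (pointMeasure X.ris ω) ∧
      ((X.usableRIS p ω).Nonempty ↔ HasRIS κR p (X.nearest p ω) (pointMeasure X.ris ω)) := by
  filter_upwards [hX.prob_regular hp, hB, hR] with ω hω hB hR
  have hc := hX.ris_poisson.countable ω
  refine ⟨Network.tbu_eq hω, ?_, Network.tru_eq hω hc hR, Network.usableRIS_nonempty_iff hω hc hR⟩
  rw [Network.W2_eq (hX.bs_poisson.countable ω) hω, Network.bsData, interf, hB]

variable [IsSFiniteKernel κB]

/-- The blockage variable of the direct link is uniform and independent of the rest. Integrating it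
out with the tagged distance held fixed leaves the LoS and NLoS probabilities as weights. -/
theorem Network.IsModel.lintegral_ite_block (hX : X.IsModel p P) (hp : p.Valid)
    (q : LinkType) {F G : (ℂ × ℝ≥0∞) × Measure RISPoint × ℝ × ℝ → ℝ≥0∞} (hF : Measurable F)
    (hG : Measurable G) :
    ∫⁻ ω, (if X.block₀ ω ≤ p.linkProb .L ‖X.nearest p ω‖ then
        F (X.bsData p κB ω, pointMeasure X.ris ω, X.theta₀ ω, X.H q ω)
        else G (X.bsData p κB ω, pointMeasure X.ris ω, X.theta₀ ω, X.H q ω)) ∂P =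
      ∫⁻ ω, ∫⁻ ω', (ENNReal.ofReal (p.linkProb .L ‖X.nearest p ω‖) *
          ∫⁻ θ, ∫⁻ h, F (X.bsData p κB ω, pointMeasure X.ris ω', θ, h)
            ∂fadingLaw (p.m q.state) ∂uniform (-Real.pi) Real.pi +
        ENNReal.ofReal (p.linkProb .N ‖X.nearest p ω‖) *
          ∫⁻ θ, ∫⁻ h, G (X.bsData p κB ω, pointMeasure X.ris ω', θ, h)
            ∂fadingLaw (p.m q.state) ∂uniform (-Real.pi) Real.pi) ∂P ∂P := by
  have hL := p.measurable_linkProb .L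
  have hS : MeasurableSet {z : (ℂ × ℝ≥0∞) × Measure RISPoint × ℝ × ℝ × ℝ |
      z.2.2.1 ≤ p.linkProb .L ‖z.1.1‖} :=
    measurableSet_le (by fun_prop) (hL.comp measurable_fst.fst.norm)
  have h := hX.lintegral_eq_iterated (κB := κB) q
    (F := fun z => if z.2.2.1 ≤ p.linkProb .L ‖z.1.1‖ then F (z.1, z.2.1, z.2.2.2.1, z.2.2.2.2)
      else G (z.1, z.2.1, z.2.2.2.1, z.2.2.2.2))
    (Measurable.ite hS (by fun_prop) (by fun_prop))
  refine h.trans (lintegral_congr fun ω => lintegral_congr fun ω' => ?_)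
  rw [Params.linkProb_N, ← Params.lintegral_uniform_ite (hp.linkProb_nonneg .L (norm_nonneg _))
    (hp.linkProb_le_one .L (norm_nonneg _))]
  refine lintegral_congr fun u => ?_
  by_cases hu : u ≤ p.linkProb .L ‖X.nearest p ω‖
  · have hu' : u ≤ p.linkProb .L ‖(X.bsData p κB ω).1‖ := hu
    simp only [if_pos hu, if_pos hu']
  · have hu' : ¬ u ≤ p.linkProb .L ‖(X.bsData p κB ω).1‖ := hu
    simp only [if_neg hu, if_neg hu']

/-- Mean over the interference beyond distance `t` and the fading of the serving link. -/
noncomputable def Network.IsModel.meanMarks (hX : X.IsModel p P)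
    (κB : Kernel (Measure BSPoint) BSPoint) [IsSFiniteKernel κB] (k : ℕ) (t : ℝ)
    (G : ℝ≥0∞ × ℝ → ℝ≥0∞) : ℝ≥0∞ :=
  ∫⁻ y, ∫⁻ h, G (y, h) ∂fadingLaw k ∂lawKernel P (hX.measurable_interf (κ := κB)) t

/-- The test function is arbitrary, so this determines the joint law of distance, interference and
fading on the event. The conditional law and the contributions to distribution function and mean are
all instances. -/
theorem Network.IsModel.lintegral_ev_DL (hX : X.IsModel p P) (hp : p.Valid)
    (hB : ∀ᵐ ω ∂P, κB (pointMeasure X.bs ω) = pointMeasure X.bs ω)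
    (hR : ∀ᵐ ω ∂P, κR (pointMeasure X.ris ω) = pointMeasure X.ris ω)
    {G : ℝ × ℝ≥0∞ × ℝ → ℝ≥0∞} (hG : Measurable G) :
    ∫⁻ ω in X.ev p .DL, G (X.tbu ω, X.W2 p ω, X.H .DL ω) ∂P =
      p.meanBU fun t => ENNReal.ofReal (p.linkProb .L t) *
        hX.meanMarks κB (p.m .L) t fun z => G (t, z) := by
  have hL := p.measurable_linkProb .L
  have hu := isProbabilityMeasure_uniform (show -Real.pi < Real.pi by linarith [Real.pi_pos])
  have hE : MeasurableSet {ω | X.block₀ ω ≤ p.linkProb .L ‖X.nearest p ω‖} :=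
    measurableSet_le hX.block_meas (hL.comp hX.measurable_norm_nearest)
  have hae : X.ev p .DL =ᵐ[P] {ω | X.block₀ ω ≤ p.linkProb .L ‖X.nearest p ω‖} := by
    filter_upwards [hX.ae_regular hp hB hR] with ω hω
    refine propext ?_
    change ω ∈ X.ev p .DL ↔ X.block₀ ω ≤ p.linkProb .L ‖X.nearest p ω‖
    rw [Network.mem_ev_DL, hω.1]
  have hG' : Measurable fun z : (ℝ × ℝ≥0∞) × ℝ => G (z.1.1, z.1.2, z.2) := by fun_prop
  have hI : Measurable fun z : ℝ × ℝ≥0∞ => ∫⁻ h, G (z.1, z.2, h) ∂fadingLaw (p.m .L) :=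
    hG'.lintegral_prod_right'
  rw [Measure.restrict_congr_set hae, ← lintegral_indicator hE]
  have h := hX.lintegral_ite_block (κB := κB) hp .DL
    (F := fun z => G (‖z.1.1‖, z.1.2, z.2.2.2)) (G := fun _ => 0) (by fun_prop) (by fun_prop)
  have h2 := hX.lintegral_bsData (κB := κB) hp hB (Φ := fun z => ENNReal.ofReal (p.linkProb .L z.1) *
    ∫⁻ h, G (z.1, z.2, h) ∂fadingLaw (p.m .L)) (by fun_prop)
  refine Eq.trans (lintegral_congr_ae ?_) (h.trans ((lintegral_congr fun ω => ?_).trans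
    (h2.trans ?_)))
  · filter_upwards [hX.ae_regular hp hB hR] with ω hω
    rw [indicator_apply, hω.1, hω.2.1]
    rfl
  · simp only [lintegral_zero, mul_zero, add_zero, lintegral_const, measure_univ, mul_one]
    rfl
  · refine lintegral_congr fun t => ?_
    exact congrArg (· * ENNReal.ofReal (p.pdfBU t)) (lintegral_const_mul
      (ENNReal.ofReal (p.linkProb .L t)) (hI.comp (measurable_prodMk_left (x := t))))

variable [IsSFiniteKernel κR]

/-- The RISs enter only through the absence of a usable one. They are independent of the stations,
so with the tagged location held fixed this contributes a void probability depending on its modulus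
only. -/
theorem Network.IsModel.lintegral_ev_DN (hX : X.IsModel p P) (hp : p.Valid)
    (hB : ∀ᵐ ω ∂P, κB (pointMeasure X.bs ω) = pointMeasure X.bs ω)
    (hR : ∀ᵐ ω ∂P, κR (pointMeasure X.ris ω) = pointMeasure X.ris ω)
    {G : ℝ × ℝ≥0∞ × ℝ → ℝ≥0∞} (hG : Measurable G) :
    ∫⁻ ω in X.ev p .DN, G (X.tbu ω, X.W2 p ω, X.H .DN ω) ∂P =
      p.meanBU fun t => ENNReal.ofReal (p.assoc .DN t) *
        hX.meanMarks κB (p.m .N) t fun z => G (t, z) := by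
  have hL := p.measurable_linkProb .L
  have hu := isProbabilityMeasure_uniform (show -Real.pi < Real.pi by linarith [Real.pi_pos])
  have hassoc := p.measurable_assoc .DN
  have hRIS : MeasurableSet {ω | HasRIS κR p (X.nearest p ω) (pointMeasure X.ris ω)} :=
    (hX.measurable_nearest.prodMk hX.measurable_ris) measurableSet_hasRIS
  have hE : MeasurableSet {ω | ¬ X.block₀ ω ≤ p.linkProb .L ‖X.nearest p ω‖ ∧
      ¬ HasRIS κR p (X.nearest p ω) (pointMeasure X.ris ω)} :=
    (measurableSet_le hX.block_meas (hL.comp hX.measurable_norm_nearest)).compl.inter hRIS.compl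
  have hae : X.ev p .DN =ᵐ[P] {ω | ¬ X.block₀ ω ≤ p.linkProb .L ‖X.nearest p ω‖ ∧
      ¬ HasRIS κR p (X.nearest p ω) (pointMeasure X.ris ω)} := by
    filter_upwards [hX.ae_regular hp hB hR] with ω hω
    refine propext ?_
    change ω ∈ X.ev p .DN ↔ ¬ X.block₀ ω ≤ p.linkProb .L ‖X.nearest p ω‖ ∧
      ¬ HasRIS κR p (X.nearest p ω) (pointMeasure X.ris ω)
    rw [Network.mem_ev_DN, hω.1, hω.2.2.2]
  have hG' : Measurable fun z : (ℝ × ℝ≥0∞) × ℝ => G (z.1.1, z.1.2, z.2) := by fun_prop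
  have hI : Measurable fun z : ℝ × ℝ≥0∞ => ∫⁻ h, G (z.1, z.2, h) ∂fadingLaw (p.m .N) :=
    hG'.lintegral_prod_right'
  classical
  have hS : MeasurableSet {z : (ℂ × ℝ≥0∞) × Measure RISPoint × ℝ × ℝ | HasRIS κR p z.1.1 z.2.1} :=
    (measurable_fst.fst.prodMk measurable_snd.fst :
      Measurable fun z : (ℂ × ℝ≥0∞) × Measure RISPoint × ℝ × ℝ => (z.1.1, z.2.1))
      measurableSet_hasRIS
  rw [Measure.restrict_congr_set hae, ← lintegral_indicator hE]
  have h := hX.lintegral_ite_block (κB := κB) hp .DN (F := fun _ => 0)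
    (G := fun z => if HasRIS κR p z.1.1 z.2.1 then 0 else G (‖z.1.1‖, z.1.2, z.2.2.2))
    (by fun_prop) (Measurable.ite hS (by fun_prop) (by fun_prop))
  have h2 := hX.lintegral_bsData (κB := κB) hp hB (Φ := fun z => ENNReal.ofReal (p.assoc .DN z.1) *
    ∫⁻ h, G (z.1, z.2, h) ∂fadingLaw (p.m .N)) (by fun_prop)
  refine Eq.trans (lintegral_congr_ae ?_) (h.trans ((lintegral_congr_ae ?_).trans (h2.trans ?_)))
  · filter_upwards [hX.ae_regular hp hB hR] with ω hω
    rw [indicator_apply, hω.1, hω.2.1]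
    simp only [Network.bsData, mem_ofPred_eq]
    split_ifs <;> simp_all
  · filter_upwards [hX.nearest_pos hp] with ω hω
    have hb : X.nearest p ω ≠ 0 := norm_pos_iff.1 hω
    have hPr := hX.prob_not_hasRIS hp hR hb
    have hms : MeasurableSet {ω' | ¬ HasRIS κR p (X.nearest p ω) (pointMeasure X.ris ω')} :=
      (hX.measurable_ris (measurableSet_hasRIS_right _)).compl
    have e : ∀ ω', (∫⁻ _ : ℝ, ∫⁻ h, (if HasRIS κR p (X.bsData p κB ω).1 (pointMeasure X.ris ω') then 0
        else G (‖(X.bsData p κB ω).1‖, (X.bsData p κB ω).2, h)) ∂fadingLaw (p.m .N)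
          ∂uniform (-Real.pi) Real.pi) =
        {ω' | ¬ HasRIS κR p (X.nearest p ω) (pointMeasure X.ris ω')}.indicator (fun _ =>
          ∫⁻ h, G (‖(X.bsData p κB ω).1‖, (X.bsData p κB ω).2, h) ∂fadingLaw (p.m .N)) ω' := by
      intro ω'
      rw [lintegral_const, measure_univ, mul_one]
      by_cases hc : HasRIS κR p (X.bsData p κB ω).1 (pointMeasure X.ris ω')
      · rw [indicator_of_notMem (show ω' ∉ {ω' | ¬ HasRIS κR p (X.nearest p ω)
          (pointMeasure X.ris ω')} from fun h => h hc)]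
        simp only [if_pos hc, lintegral_zero]
      · rw [indicator_of_mem (show ω' ∈ {ω' | ¬ HasRIS κR p (X.nearest p ω) (pointMeasure X.ris ω')}
          from hc)]
        simp only [if_neg hc]
    simp only [lintegral_zero, mul_zero, zero_add]
    refine Eq.trans (lintegral_congr fun ω' => congrArg (ENNReal.ofReal (p.linkProb .N _) * ·)
      (e ω')) ?_
    rw [lintegral_const_mul _ (measurable_const.indicator hms), lintegral_indicator hms,
      lintegral_const, Measure.restrict_apply_univ, hPr, mul_comm (lintegral _ _), ← mul_assoc,
      ← ENNReal.ofReal_mul (hp.linkProb_nonneg .N (norm_nonneg _))]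
    rfl
  · refine lintegral_congr fun t => ?_
    exact congrArg (· * ENNReal.ofReal (p.pdfBU t)) (lintegral_const_mul
      (ENNReal.ofReal (p.assoc .DN t)) (hI.comp (measurable_prodMk_left (x := t))))

/-- With the tagged location held fixed, the distance to the nearest usable RIS has the subdensity
found above. It depends on the location through its modulus only, so the joint law of nearest
distance and interference suffices. The serving angle is independent of all this and contributes the
factor `1 / (2 π)`. -/
theorem Network.IsModel.lintegral_ev_CL (hX : X.IsModel p P) (hp : p.Valid)
    (hB : ∀ᵐ ω ∂P, κB (pointMeasure X.bs ω) = pointMeasure X.bs ω)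
    (hR : ∀ᵐ ω ∂P, κR (pointMeasure X.ris ω) = pointMeasure X.ris ω)
    {G : (ℝ × ℝ × ℝ) × ℝ≥0∞ × ℝ → ℝ≥0∞} (hG : Measurable G) :
    ∫⁻ ω in X.ev p .CL, G ((X.tbu ω, X.tru p ω, X.tbr p ω), X.W2 p ω, X.H .CL ω) ∂P =
      p.meanBU fun t => ENNReal.ofReal (p.assoc .CL t) *
        ∫⁻ r in Ioi (0 : ℝ), ∫⁻ θ in Ioc (-Real.pi) Real.pi,
          (hX.meanMarks κB (p.m .L) t fun z => G ((t, r, sideBR t r θ), z)) *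
          ENNReal.ofReal (1 / (2 * Real.pi) * p.pdfRU t r) := by
  have hpi := Real.pi_pos
  have hL := p.measurable_linkProb
  have hu := isProbabilityMeasure_uniform (show -Real.pi < Real.pi by linarith)
  have hside := measurable_sideBR
  have hdist := measurable_risDist (κ := κR) (p := p)
  have hdens := p.measurable_densRU
  have hRIS : MeasurableSet {ω | HasRIS κR p (X.nearest p ω) (pointMeasure X.ris ω)} :=
    (hX.measurable_nearest.prodMk hX.measurable_ris) measurableSet_hasRIS
  have hE : MeasurableSet {ω | ¬ X.block₀ ω ≤ p.linkProb .L ‖X.nearest p ω‖ ∧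
      HasRIS κR p (X.nearest p ω) (pointMeasure X.ris ω)} :=
    (measurableSet_le hX.block_meas ((hL .L).comp hX.measurable_norm_nearest)).compl.inter hRIS
  have hae : X.ev p .CL =ᵐ[P] {ω | ¬ X.block₀ ω ≤ p.linkProb .L ‖X.nearest p ω‖ ∧
      HasRIS κR p (X.nearest p ω) (pointMeasure X.ris ω)} := by
    filter_upwards [hX.ae_regular hp hB hR] with ω hω
    refine propext ?_
    change ω ∈ X.ev p .CL ↔ ¬ X.block₀ ω ≤ p.linkProb .L ‖X.nearest p ω‖ ∧
      HasRIS κR p (X.nearest p ω) (pointMeasure X.ris ω)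
    rw [Network.mem_ev_CL, hω.1, hω.2.2.2]
  classical
  have hS : MeasurableSet {z : (ℂ × ℝ≥0∞) × Measure RISPoint × ℝ × ℝ | HasRIS κR p z.1.1 z.2.1} :=
    (measurable_fst.fst.prodMk measurable_snd.fst :
      Measurable fun z : (ℂ × ℝ≥0∞) × Measure RISPoint × ℝ × ℝ => (z.1.1, z.2.1))
      measurableSet_hasRIS
  -- the integrand, as a function of the two distances, the interference and the angle
  have hA : Measurable fun z : ((ℝ × ℝ × ℝ≥0∞) × ℝ) × ℝ =>
      G ((z.1.1.1, z.1.1.2.1, sideBR z.1.1.1 z.1.1.2.1 z.1.2), z.1.1.2.2, z.2) := by fun_prop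
  have hA1 : Measurable fun z : (ℝ × ℝ × ℝ≥0∞) × ℝ => ∫⁻ h,
      G ((z.1.1, z.1.2.1, sideBR z.1.1 z.1.2.1 z.2), z.1.2.2, h) ∂fadingLaw (p.m .L) :=
    hA.lintegral_prod_right'
  obtain ⟨K, hKdef⟩ : ∃ K : ℝ × ℝ × ℝ≥0∞ → ℝ≥0∞, K = fun z => ∫⁻ θ, ∫⁻ h,
      G ((z.1, z.2.1, sideBR z.1 z.2.1 θ), z.2.2, h) ∂fadingLaw (p.m .L)
        ∂uniform (-Real.pi) Real.pi := ⟨_, rfl⟩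
  have hK : Measurable K := hKdef ▸ hA1.lintegral_prod_right'
  have hB1 : Measurable fun z : (ℝ × ℝ≥0∞) × ℝ =>
      K (z.1.1, z.2, z.1.2) * ENNReal.ofReal (p.densRU z.1.1 z.2) := by fun_prop
  have hΦ : Measurable fun z : ℝ × ℝ≥0∞ => ∫⁻ r in Ioi (0 : ℝ), K (z.1, r, z.2) *
      ENNReal.ofReal (p.densRU z.1 r) := hB1.lintegral_prod_right'
  rw [Measure.restrict_congr_set hae, ← lintegral_indicator hE]
  have h := hX.lintegral_ite_block (κB := κB) hp .CL (F := fun _ => 0)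
    (G := fun z => if HasRIS κR p z.1.1 z.2.1 then G ((‖z.1.1‖, risDist κR p z.1.1 z.2.1,
      sideBR ‖z.1.1‖ (risDist κR p z.1.1 z.2.1) z.2.2.1), z.1.2, z.2.2.2) else 0)
    (by fun_prop) (Measurable.ite hS (by fun_prop) (by fun_prop))
  have h2 := hX.lintegral_bsData (κB := κB) hp hB (Φ := fun z =>
    ENNReal.ofReal (p.linkProb .N z.1) * ∫⁻ r in Ioi (0 : ℝ), K (z.1, r, z.2) *
      ENNReal.ofReal (p.densRU z.1 r)) (by fun_prop)
  refine Eq.trans (lintegral_congr_ae ?_) (h.trans ((lintegral_congr_ae ?_).trans (h2.trans ?_)))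
  · filter_upwards [hX.ae_regular hp hB hR] with ω hω
    rw [indicator_apply, Network.tbr, hω.1, hω.2.1, hω.2.2.1]
    simp only [Network.bsData, mem_ofPred_eq]
    split_ifs <;> simp_all
  · filter_upwards [hX.nearest_pos hp] with ω hω
    have hb : X.nearest p ω ≠ 0 := norm_pos_iff.1 hω
    have hms : MeasurableSet {ω' | HasRIS κR p (X.nearest p ω) (pointMeasure X.ris ω')} :=
      hX.measurable_ris (measurableSet_hasRIS_right _)
    have hD : Measurable fun ω' => risDist κR p (X.nearest p ω) (pointMeasure X.ris ω') :=
      (measurable_risDist_right _).comp hX.measurable_ris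
    have e : ∀ ω', (∫⁻ θ, ∫⁻ h, (if HasRIS κR p (X.bsData p κB ω).1 (pointMeasure X.ris ω') then
        G ((‖(X.bsData p κB ω).1‖, risDist κR p (X.bsData p κB ω).1 (pointMeasure X.ris ω'),
          sideBR ‖(X.bsData p κB ω).1‖ (risDist κR p (X.bsData p κB ω).1 (pointMeasure X.ris ω')) θ),
          (X.bsData p κB ω).2, h) else 0) ∂fadingLaw (p.m .L) ∂uniform (-Real.pi) Real.pi) =
        {ω' | HasRIS κR p (X.nearest p ω) (pointMeasure X.ris ω')}.indicator (fun ω' =>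
          K (‖X.nearest p ω‖, risDist κR p (X.nearest p ω) (pointMeasure X.ris ω'),
            (X.bsData p κB ω).2)) ω' := by
      intro ω'
      rw [hKdef]
      by_cases hc : HasRIS κR p (X.bsData p κB ω).1 (pointMeasure X.ris ω')
      · rw [indicator_of_mem (show ω' ∈ {ω' | HasRIS κR p (X.nearest p ω) (pointMeasure X.ris ω')}
          from hc)]
        simp only [if_pos hc]
        rfl
      · rw [indicator_of_notMem hc]
        simp only [if_neg hc, lintegral_zero]
    have hKm : Measurable fun r => K (‖X.nearest p ω‖, r, (X.bsData p κB ω).2) := by fun_prop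
    have hdm : Measurable fun r => ENNReal.ofReal (p.densRU ‖X.nearest p ω‖ r) := by fun_prop
    simp only [lintegral_zero, mul_zero, zero_add]
    refine Eq.trans (lintegral_congr fun ω' => congrArg (ENNReal.ofReal (p.linkProb .N _) * ·)
      (e ω')) ?_
    rw [lintegral_const_mul' _ _ ENNReal.ofReal_ne_top, lintegral_indicator hms]
    have h3 := lintegral_map (μ := P.restrict {ω' | HasRIS κR p (X.nearest p ω)
      (pointMeasure X.ris ω')}) hKm hD
    rw [hX.map_risDist hp hR hb, lintegral_withDensity_eq_lintegral_mul _ hdm hKm] at h3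
    refine congrArg (ENNReal.ofReal (p.linkProb .N _) * ·) (h3.symm.trans ?_)
    refine lintegral_congr fun r => ?_
    rw [Pi.mul_apply, mul_comm]
    rfl
  -- The integral over the interference is moved inside those over the RIS distance and the angle,
  -- and the subdensity is traded for the association probability times `pdfRU`.
  · refine setLIntegral_congr_fun measurableSet_Ioi fun t ht => ?_
    refine congrArg (· * ENNReal.ofReal (p.pdfBU t)) ?_
    refine Eq.trans ?_ (Params.assoc_CL_mul hp ht fun r θ =>
      hX.meanMarks κB (p.m .L) t fun z => G ((t, r, sideBR t r θ), z)).symm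
    simp only
    rw [lintegral_const_mul' _ _ ENNReal.ofReal_ne_top]
    congr 1
    have hs1 : Measurable fun z : ℝ≥0∞ × ℝ => K (t, z.2, z.1) * ENNReal.ofReal (p.densRU t z.2) := by
      fun_prop
    rw [lintegral_lintegral_swap hs1.aemeasurable]
    refine lintegral_congr fun r => ?_
    have hs2 : Measurable fun z : ℝ≥0∞ × ℝ => ∫⁻ h, G ((t, r, sideBR t r z.2), z.1, h)
        ∂fadingLaw (p.m .L) :=
      hA1.comp (by fun_prop : Measurable fun z : ℝ≥0∞ × ℝ => ((t, r, z.1), z.2))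
    rw [lintegral_mul_const' _ _ ENNReal.ofReal_ne_top, lintegral_mul_const' _ _ ENNReal.ofReal_ne_top,
      hKdef, ENNReal.ofReal_mul (by positivity), ← mul_assoc]
    congr 1
    simp only
    rw [lintegral_lintegral_swap hs2.aemeasurable, lintegral_uniform (by linarith), mul_comm,
      show Real.pi - -Real.pi = 2 * Real.pi by ring]
    rfl

end Formulas

/-! ### Congruence and additivity of the averages over serving distances. -/

section AssocMean

variable {p : Params}

theorem Params.meanBU_congr {f g : ℝ → ℝ≥0∞} (h : ∀ t, 0 < t → f t = g t) :
    p.meanBU f = p.meanBU g :=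
  setLIntegral_congr_fun measurableSet_Ioi fun t ht => by simp only [h t ht]

theorem Params.meanBU_add_left {f : ℝ → ℝ≥0∞} (hf : Measurable f) (g : ℝ → ℝ≥0∞) :
    p.meanBU (fun t => f t + g t) = p.meanBU f + p.meanBU g := by
  have hpdf : Measurable p.pdfBU := p.continuous_pdfBU.measurable
  have h := lintegral_add_left (μ := volume.restrict (Ioi 0)) (hf.mul hpdf.ennreal_ofReal)
    fun t => g t * ENNReal.ofReal (p.pdfBU t)
  simp only [meanBU, add_mul]
  exact h

theorem ae_sin_ne_zero : ∀ᵐ θ : ℝ, Real.sin θ ≠ 0 := by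
  have h : {θ : ℝ | ¬ Real.sin θ ≠ 0} = range fun n : ℤ => (n : ℝ) * Real.pi := by
    ext θ
    simp only [mem_ofPred_eq, not_not, Real.sin_eq_zero_iff, mem_range]
  rw [ae_iff, h]
  exact (countable_range _).measure_zero _

/-- The third side of the triangle is positive unless `sin θ = 0`, a null set of angles. So
integrands need only agree at positive distances, where the serving powers are positive and the
inversion formula is valid. -/
theorem Params.assocMean_congr {f₁ g₁ : ℝ → ℝ≥0∞} {f₂ g₂ : ℝ → ℝ → ℝ → ℝ≥0∞} {f₃ g₃ : ℝ → ℝ≥0∞}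
    (h₁ : ∀ t, 0 < t → f₁ t = g₁ t)
    (h₂ : ∀ t r s, 0 < t → 0 < r → 0 < s → f₂ t r s = g₂ t r s)
    (h₃ : ∀ t, 0 < t → f₃ t = g₃ t) : p.assocMean f₁ f₂ f₃ = p.assocMean g₁ g₂ g₃ := by
  refine meanBU_congr fun t ht => ?_
  rw [h₁ t ht, h₃ t ht]
  congr 3
  refine setLIntegral_congr_fun measurableSet_Ioi fun r hr => lintegral_congr_ae ?_
  filter_upwards [ae_restrict_of_ae ae_sin_ne_zero] with θ hθ
  rw [h₂ t r _ ht hr (sideBR_pos ht hθ r)]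

end AssocMean

/-! ### From the means on each event to conditional laws and to total means. -/

section Links

open Filter Topology

variable {κB : Kernel (Measure BSPoint) BSPoint} {κR : Kernel (Measure RISPoint) RISPoint}
  {p : Params} {Ω : Type*} {mΩ : MeasurableSpace Ω} {P : Measure Ω} {X : Network Ω}
  [IsProbabilityMeasure P]

theorem Network.IsModel.aemeasurable_tbu (hX : X.IsModel p P) (hp : p.Valid) :
    AEMeasurable X.tbu P := by
  refine ⟨_, hX.measurable_norm_nearest, ?_⟩
  filter_upwards [hX.prob_regular hp] with ω hω
  exact Network.tbu_eq hω

theorem Network.IsModel.tbu_pos (hX : X.IsModel p P) (hp : p.Valid) : ∀ᵐ ω ∂P, 0 < X.tbu ω := by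
  filter_upwards [hX.prob_regular hp, hX.nearest_pos hp] with ω hω h
  rwa [Network.tbu_eq hω]

variable [IsSFiniteKernel κB]

theorem Network.IsModel.measurable_meanMarks (hX : X.IsModel p P) (k : ℕ)
    {G : ℝ × ℝ≥0∞ × ℝ → ℝ≥0∞} (hG : Measurable G) :
    Measurable fun t => hX.meanMarks κB k t fun z => G (t, z) := by
  have hG' : Measurable fun z : (ℝ × ℝ≥0∞) × ℝ => G (z.1.1, z.1.2, z.2) := by fun_prop
  have hI : Measurable fun z : ℝ × ℝ≥0∞ => ∫⁻ h, G (z.1, z.2, h) ∂fadingLaw k :=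
    hG'.lintegral_prod_right'
  exact hI.lintegral_kernel_prod_right'

theorem Network.IsModel.meanMarks_const (hX : X.IsModel p P) {k : ℕ} (hk : 1 ≤ k) (t : ℝ)
    (c : ℝ≥0∞) : hX.meanMarks κB k t (fun _ => c) = c := by
  have := isProbabilityMeasure_fadingLaw hk
  simp [meanMarks]

theorem Network.IsModel.meanMarks_exposure (hX : X.IsModel p P) (k : ℕ) (Pa t : ℝ)
    {F : ℝ≥0∞ → ℝ≥0∞} (hF : Measurable F) :
    hX.meanMarks κB k t (fun z => F (ENNReal.ofReal (Pa * z.2 / p.area) + z.1)) =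
      ∫⁻ y, F y ∂hX.exposureLaw κB k (Pa, t) :=
  (hX.lintegral_exposureLaw k Pa t hF).symm

theorem Network.IsModel.meanMarks_power (hX : X.IsModel p P) (hp : p.Valid) {k : ℕ} (hk : 1 ≤ k)
    {Pa : ℝ} (hPa : 0 ≤ Pa) (t : ℝ) :
    hX.meanMarks κB k t (fun z => ENNReal.ofReal (Pa * z.2 / p.area)) =
      ENNReal.ofReal (Pa / p.area) := by
  have harea := hp.area_pos
  have e : ∀ h : ℝ, ENNReal.ofReal (Pa * h / p.area) =
      ENNReal.ofReal (Pa / p.area) * ENNReal.ofReal h := fun h => by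
    rw [← ENNReal.ofReal_mul (by positivity), div_mul_eq_mul_div]
  simp_rw [meanMarks, e]
  simp [lintegral_const_mul _ ENNReal.measurable_ofReal, lintegral_ofReal_fadingLaw hk]

theorem Network.IsModel.aemeasurable_W2 (hX : X.IsModel p P) (hp : p.Valid)
    (hB : ∀ᵐ ω ∂P, κB (pointMeasure X.bs ω) = pointMeasure X.bs ω) :
    AEMeasurable (X.W2 p) P := by
  refine ⟨_, (hX.measurable_bsData (κB := κB)).snd, ?_⟩
  filter_upwards [hX.prob_regular hp, hB] with ω hω h
  rw [Network.W2_eq (hX.bs_poisson.countable ω) hω, Network.bsData, interf, h]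

/-- The conditional law of the exposure given data that determine the mean serving power and the
distance to the tagged base station. -/
theorem Network.IsModel.condDistrib_exposure (hX : X.IsModel p P) {α : Type*}
    [MeasurableSpace α]
    {E : Set Ω} {T : Ω → α} {W : Ω → ℝ≥0∞} {k : ℕ} (hk : 1 ≤ k) {Pa t : α → ℝ}
    (hPa : Measurable Pa) (ht : Measurable t) {h : Ω → ℝ} (hT : AEMeasurable T (P.restrict E))
    (hW : AEMeasurable W (P.restrict E)) (hh : Measurable h)
    (J : (α → ℝ≥0∞) → ℝ≥0∞)
    (hJ : ∀ G : α × ℝ≥0∞ × ℝ → ℝ≥0∞, Measurable G → ∫⁻ ω in E, G (T ω, W ω, h ω) ∂P =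
      J fun x => hX.meanMarks κB k (t x) fun z => G (x, z)) :
    condDistrib (fun ω => ENNReal.ofReal (Pa (T ω) * h ω / p.area) + W ω) T (P.restrict E)
      =ᵐ[(P.restrict E).map T]
      (hX.exposureLaw κB k).comap (fun x => (Pa x, t x)) (hPa.prodMk ht) := by
  have := hX.isMarkovKernel_exposureLaw (κ := κB) hk
  have hY : AEMeasurable (fun ω => ENNReal.ofReal (Pa (T ω) * h ω / p.area) + W ω)
      (P.restrict E) :=
    ((((hPa.comp_aemeasurable hT).mul hh.aemeasurable).div_const _).ennreal_ofReal).add hW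
  refine condDistrib_ae_eq_of_measure_eq_compProd T hY (Measure.ext_of_lintegral _ fun F hF => ?_)
  have hI : Measurable fun x => ∫⁻ y, F (x, y) ∂(hX.exposureLaw κB k).comap
      (fun x => (Pa x, t x)) (hPa.prodMk ht) x := hF.lintegral_kernel_prod_right'
  rw [lintegral_map' hF.aemeasurable (hT.prodMk hY), Measure.lintegral_compProd hF,
    lintegral_map' hI.aemeasurable hT]
  -- Nothing needs to be known about `J` beyond the formula `hJ`, which is used for the test
  -- function and for its mean under the candidate kernel. The latter does not depend on the marks,
  -- so both have the same average over the marks and `J` gives equal values.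
  have h1 := hJ (fun z => F (z.1, ENNReal.ofReal (Pa z.1 * z.2.2 / p.area) + z.2.1)) (by fun_prop)
  have h2 := hJ (fun z => ∫⁻ y, F (z.1, y) ∂(hX.exposureLaw κB k).comap
      (fun x => (Pa x, t x)) (hPa.prodMk ht) z.1) (hI.comp measurable_fst)
  refine h1.trans (Eq.trans (congrArg J (funext fun x => ?_)) h2.symm)
  refine Eq.trans ?_ (hX.meanMarks_const hk (t x) (∫⁻ y, F (x, y) ∂(hX.exposureLaw κB k).comap
    (fun x => (Pa x, t x)) (hPa.prodMk ht) x)).symm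
  exact hX.meanMarks_exposure k (Pa x) (t x) (F := fun y => F (x, y)) (by fun_prop)

variable [IsSFiniteKernel κR]

theorem Network.IsModel.aemeasurable_tru (hX : X.IsModel p P) (hp : p.Valid)
    (hR : ∀ᵐ ω ∂P, κR (pointMeasure X.ris ω) = pointMeasure X.ris ω) :
    AEMeasurable (X.tru p) P := by
  refine ⟨_, (measurable_risDist (κ := κR) (p := p)).comp (hX.measurable_nearest.prodMk hX.measurable_ris), ?_⟩
  filter_upwards [hX.prob_regular hp, hR] with ω hω h
  exact Network.tru_eq hω (hX.ris_poisson.countable ω) h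

theorem Network.IsModel.aemeasurable_tbr (hX : X.IsModel p P) (hp : p.Valid)
    (hR : ∀ᵐ ω ∂P, κR (pointMeasure X.ris ω) = pointMeasure X.ris ω) :
    AEMeasurable (X.tbr p) P :=
  measurable_sideBR.comp_aemeasurable ((hX.aemeasurable_tbu hp).prodMk
    ((hX.aemeasurable_tru hp hR).prodMk hX.theta_meas.aemeasurable))

theorem Network.IsModel.nullMeasurableSet_ev (hX : X.IsModel p P) (hp : p.Valid)
    (hR : ∀ᵐ ω ∂P, κR (pointMeasure X.ris ω) = pointMeasure X.ris ω) (q : LinkType) :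
    NullMeasurableSet (X.ev p q) P := by
  have h1 : NullMeasurableSet {ω | X.block₀ ω ≤ p.linkProb .L (X.tbu ω)} P :=
    nullMeasurableSet_le hX.block_meas.aemeasurable
      ((p.measurable_linkProb .L).comp_aemeasurable (hX.aemeasurable_tbu hp))
  have h2 : NullMeasurableSet {ω | (X.usableRIS p ω).Nonempty} P := by
    refine NullMeasurableSet.congr (MeasurableSet.nullMeasurableSet
      ((hX.measurable_nearest.prodMk hX.measurable_ris) (measurableSet_hasRIS (κ := κR) (p := p)))) ?_
    filter_upwards [hX.prob_regular hp, hR] with ω hω h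
    exact propext (Network.usableRIS_nonempty_iff hω (hX.ris_poisson.countable ω) h).symm
  cases q
  · convert h1 using 1
    ext ω
    exact Network.mem_ev_DL
  · convert h1.compl.inter h2 using 1
    ext ω
    exact Network.mem_ev_CL
  · convert h1.compl.inter h2.compl using 1
    ext ω
    exact Network.mem_ev_DN

theorem Network.IsModel.lintegral_eq_add_ev (hX : X.IsModel p P) (hp : p.Valid)
    (hR : ∀ᵐ ω ∂P, κR (pointMeasure X.ris ω) = pointMeasure X.ris ω) (f : Ω → ℝ≥0∞) :
    ∫⁻ ω, f ω ∂P = ∫⁻ ω in X.ev p .DL, f ω ∂P + ∫⁻ ω in X.ev p .CL, f ω ∂P +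
      ∫⁻ ω in X.ev p .DN, f ω ∂P := by
  have h3 := hX.nullMeasurableSet_ev hp hR
  have hd : ∀ q q', q ≠ q' → Disjoint (X.ev p q) (X.ev p q') := fun q q' h =>
    Set.disjoint_left.2 fun ω h1 h2 => h ((show X.link p ω = q from h1).symm.trans h2)
  have hU : (X.ev p .DL ∪ X.ev p .CL) ∪ X.ev p .DN = univ := by
    refine eq_univ_of_forall fun ω => ?_
    have : ω ∈ X.ev p (X.link p ω) := rfl
    cases h : X.link p ω <;> rw [h] at this <;> simp [this]
  rw [← setLIntegral_univ, ← hU, Measure.restrict_union₀ _ (h3 .DN), lintegral_add_measure,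
    Measure.restrict_union₀ (hd _ _ (by simp)).aedisjoint (h3 .CL), lintegral_add_measure]
  exact (disjoint_union_left.2 ⟨hd _ _ (by simp), hd _ _ (by simp)⟩).aedisjoint

/-- The mean of a function of the serving distances, the interference and the fading. -/
theorem Network.IsModel.lintegral_eq_assocMean (hX : X.IsModel p P) (hp : p.Valid)
    (hB : ∀ᵐ ω ∂P, κB (pointMeasure X.bs ω) = pointMeasure X.bs ω)
    (hR : ∀ᵐ ω ∂P, κR (pointMeasure X.ris ω) = pointMeasure X.ris ω)
    {G₁ : ℝ × ℝ≥0∞ × ℝ → ℝ≥0∞} (hG₁ : Measurable G₁)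
    {G₂ : (ℝ × ℝ × ℝ) × ℝ≥0∞ × ℝ → ℝ≥0∞} (hG₂ : Measurable G₂)
    {G₃ : ℝ × ℝ≥0∞ × ℝ → ℝ≥0∞} (hG₃ : Measurable G₃) {f : Ω → ℝ≥0∞}
    (h₁ : ∀ ω ∈ X.ev p .DL, f ω = G₁ (X.tbu ω, X.W2 p ω, X.H .DL ω))
    (h₂ : ∀ ω ∈ X.ev p .CL, f ω = G₂ ((X.tbu ω, X.tru p ω, X.tbr p ω), X.W2 p ω, X.H .CL ω))
    (h₃ : ∀ ω ∈ X.ev p .DN, f ω = G₃ (X.tbu ω, X.W2 p ω, X.H .DN ω)) :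
    ∫⁻ ω, f ω ∂P = p.assocMean (fun t => hX.meanMarks κB (p.m .L) t fun z => G₁ (t, z))
      (fun t r s => hX.meanMarks κB (p.m .L) t fun z => G₂ ((t, r, s), z))
      (fun t => hX.meanMarks κB (p.m .N) t fun z => G₃ (t, z)) := by
  have hc : ∀ {q : LinkType} {g : Ω → ℝ≥0∞}, (∀ ω ∈ X.ev p q, f ω = g ω) →
      ∫⁻ ω in X.ev p q, f ω ∂P = ∫⁻ ω in X.ev p q, g ω ∂P := fun h => by
    refine lintegral_congr_ae ?_
    filter_upwards [ae_restrict_mem₀ (hX.nullMeasurableSet_ev hp hR _)] with ω hω using h ω hω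
  have m₁ := (p.measurable_assoc .DL).ennreal_ofReal.mul
    (hX.measurable_meanMarks (κB := κB) (p.m .L) hG₁)
  have m₃ := (p.measurable_assoc .DN).ennreal_ofReal.mul
    (hX.measurable_meanMarks (κB := κB) (p.m .N) hG₃)
  rw [hX.lintegral_eq_add_ev hp hR, hc h₁, hc h₂, hc h₃, hX.lintegral_ev_DL hp hB hR hG₁,
    hX.lintegral_ev_CL hp hB hR hG₂, hX.lintegral_ev_DN hp hB hR hG₃, Params.assocMean, add_right_comm]
  -- The cascaded term is moved to the end: additivity of `meanBU` asks for measurability of the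
  -- left summand only, so that of the cascaded term is never required.
  simp only [add_right_comm _ _ (ENNReal.ofReal (p.assoc .DN _) * _)]
  rw [add_assoc]
  have e₁ := Params.meanBU_add_left (p := p) m₁ fun t => ENNReal.ofReal (p.assoc .DN t) *
    hX.meanMarks κB (p.m .N) t fun z => G₃ (t, z)
  have e₂ := Params.meanBU_add_left (p := p) (m₁.add m₃)
  refine Eq.trans ?_ (e₂ _).symm
  rw [← add_assoc]
  exact congrArg (· + _) e₁.symm

end Links

/-! ### Serving powers: measurability and positivity. -/

section Powers

variable {p : Params}

theorem Params.measurable_PaD (p : Params) (v : LinkState) : Measurable (p.PaD v) :=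
  (measurable_id.pow_const _).const_mul _

theorem Params.measurable_PaCL (p : Params) : Measurable fun x : ℝ × ℝ => p.PaCL x.1 x.2 :=
  ((measurable_fst.mul measurable_snd).pow_const _).const_mul _

theorem Params.Valid.PaD_pos (hp : p.Valid) (v : LinkState) {t : ℝ} (ht : 0 < t) :
    0 < p.PaD v t := by
  have h1 := hp.pb_pos
  have h2 := hp.zeta_pos
  have h3 : (0 : ℝ) < p.Nb := by exact_mod_cast lt_of_lt_of_le two_pos hp.two_le_Nb
  unfold PaD
  positivity

theorem Params.Valid.PaCL_pos (hp : p.Valid) {r s : ℝ} (hr : 0 < r) (hs : 0 < s) :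
    0 < p.PaCL r s := by
  have h1 := hp.pb_pos
  have h2 := hp.zeta_pos
  have h3 : (0 : ℝ) < p.Nb := by exact_mod_cast lt_of_lt_of_le two_pos hp.two_le_Nb
  have h4 : (0 : ℝ) < p.Nr := by exact_mod_cast hp.one_le_Nr
  unfold PaCL
  positivity

end Powers

/-! ### Conditional laws of the exposure for each link type. -/

section Conditional

open Filter Topology

variable {κB : Kernel (Measure BSPoint) BSPoint} {κR : Kernel (Measure RISPoint) RISPoint}
  {p : Params} {Ω : Type*} {mΩ : MeasurableSpace Ω} {P : Measure Ω} {X : Network Ω}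
  [IsProbabilityMeasure P]

theorem Network.IsModel.tbr_pos (hX : X.IsModel p P) (hp : p.Valid) :
    ∀ᵐ ω ∂P, 0 < X.tbr p ω := by
  have h : ∀ᵐ θ ∂P.map X.theta₀, Real.sin θ ≠ 0 := by
    rw [hX.theta_law]
    exact cond_absolutelyContinuous.ae_le ae_sin_ne_zero
  filter_upwards [hX.tbu_pos hp, ae_of_ae_map hX.theta_meas.aemeasurable h] with ω h1 h2
  exact sideBR_pos h1 h2 _

variable [IsSFiniteKernel κB]

theorem Network.IsModel.condDistrib_DL (hX : X.IsModel p P) (hp : p.Valid)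
    (hB : ∀ᵐ ω ∂P, κB (pointMeasure X.bs ω) = pointMeasure X.bs ω)
    (hR : ∀ᵐ ω ∂P, κR (pointMeasure X.ris ω) = pointMeasure X.ris ω) :
    ∀ᵐ t ∂((P.restrict (X.ev p .DL)).map X.tbu), 0 < t ∧
      condDistrib (X.Wq p .DL) X.tbu (P.restrict (X.ev p .DL)) t =
        hX.exposureLaw κB (p.m .L) (p.PaD .L t, t) := by
  have hT := (hX.aemeasurable_tbu hp).restrict (s := X.ev p .DL)
  have h := hX.condDistrib_exposure (κB := κB) (hp.one_le_m .L) (p.measurable_PaD .L)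
    measurable_id' hT ((hX.aemeasurable_W2 hp hB).restrict (s := X.ev p .DL)) (hX.H_meas .DL)
    (fun g => p.meanBU fun t => ENNReal.ofReal (p.linkProb .L t) * g t)
    fun G hG => hX.lintegral_ev_DL hp hB hR hG
  have hpos : ∀ᵐ t ∂((P.restrict (X.ev p .DL)).map X.tbu), 0 < t :=
    (ae_map_iff hT measurableSet_Ioi).2 (ae_restrict_of_ae (hX.tbu_pos hp))
  filter_upwards [h, hpos] with t h1 h2 using ⟨h2, h1⟩

variable [IsSFiniteKernel κR]

/-- The formula for the cascaded event is applied to the indicator of nonpositive RIS distances: the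
distance density is integrated over `(0, ∞)` only. -/
theorem Network.IsModel.tru_pos (hX : X.IsModel p P) (hp : p.Valid)
    (hB : ∀ᵐ ω ∂P, κB (pointMeasure X.bs ω) = pointMeasure X.bs ω)
    (hR : ∀ᵐ ω ∂P, κR (pointMeasure X.ris ω) = pointMeasure X.ris ω) :
    ∀ᵐ ω ∂P.restrict (X.ev p .CL), 0 < X.tru p ω := by
  have hm : Measurable ((Iic (0 : ℝ)).indicator (1 : ℝ → ℝ≥0∞)) :=
    measurable_one.indicator measurableSet_Iic
  have h := hX.lintegral_ev_CL hp hB hR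
    (G := fun z => (Iic (0 : ℝ)).indicator 1 z.1.2.1) (by fun_prop)
  have h0 : ∀ t, ∫⁻ r in Ioi (0 : ℝ), ∫⁻ θ in Ioc (-Real.pi) Real.pi,
      (hX.meanMarks κB (p.m .L) t fun _ => (Iic (0 : ℝ)).indicator 1 r) *
        ENNReal.ofReal (1 / (2 * Real.pi) * p.pdfRU t r) = 0 := by
    intro t
    rw [← lintegral_zero (μ := volume.restrict (Ioi (0 : ℝ)))]
    refine setLIntegral_congr_fun measurableSet_Ioi fun r hr => ?_
    rw [hX.meanMarks_const (hp.one_le_m .L),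
      indicator_of_notMem (show r ∉ Iic (0 : ℝ) from not_le.2 (mem_Ioi.1 hr))]
    simp
  simp only [h0, mul_zero, Params.meanBU, zero_mul, lintegral_zero] at h
  have h' := (lintegral_eq_zero_iff' (f := fun ω => (Iic (0 : ℝ)).indicator (1 : ℝ → ℝ≥0∞)
    (X.tru p ω)) (hm.comp_aemeasurable (hX.aemeasurable_tru hp hR).restrict)).1 h
  filter_upwards [h'] with ω hω
  by_contra hc
  rw [indicator_of_mem (show X.tru p ω ∈ Iic (0 : ℝ) from not_lt.1 hc)] at hω
  exact one_ne_zero hω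

theorem Network.IsModel.condDistrib_DN (hX : X.IsModel p P) (hp : p.Valid)
    (hB : ∀ᵐ ω ∂P, κB (pointMeasure X.bs ω) = pointMeasure X.bs ω)
    (hR : ∀ᵐ ω ∂P, κR (pointMeasure X.ris ω) = pointMeasure X.ris ω) :
    ∀ᵐ t ∂((P.restrict (X.ev p .DN)).map X.tbu), 0 < t ∧
      condDistrib (X.Wq p .DN) X.tbu (P.restrict (X.ev p .DN)) t =
        hX.exposureLaw κB (p.m .N) (p.PaD .N t, t) := by
  have hT := (hX.aemeasurable_tbu hp).restrict (s := X.ev p .DN)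
  have h := hX.condDistrib_exposure (κB := κB) (hp.one_le_m .N) (p.measurable_PaD .N)
    measurable_id' hT ((hX.aemeasurable_W2 hp hB).restrict (s := X.ev p .DN)) (hX.H_meas .DN)
    (fun g => p.meanBU fun t => ENNReal.ofReal (p.assoc .DN t) * g t)
    fun G hG => hX.lintegral_ev_DN hp hB hR hG
  have hpos : ∀ᵐ t ∂((P.restrict (X.ev p .DN)).map X.tbu), 0 < t :=
    (ae_map_iff hT measurableSet_Ioi).2 (ae_restrict_of_ae (hX.tbu_pos hp))
  filter_upwards [h, hpos] with t h1 h2 using ⟨h2, h1⟩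

theorem Network.IsModel.condDistrib_CL (hX : X.IsModel p P) (hp : p.Valid)
    (hB : ∀ᵐ ω ∂P, κB (pointMeasure X.bs ω) = pointMeasure X.bs ω)
    (hR : ∀ᵐ ω ∂P, κR (pointMeasure X.ris ω) = pointMeasure X.ris ω) :
    ∀ᵐ t ∂((P.restrict (X.ev p .CL)).map fun ω => (X.tbu ω, X.tru p ω, X.tbr p ω)),
      (0 < t.1 ∧ 0 < t.2.1 ∧ 0 < t.2.2) ∧
      condDistrib (X.Wq p .CL) (fun ω => (X.tbu ω, X.tru p ω, X.tbr p ω))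
        (P.restrict (X.ev p .CL)) t =
        hX.exposureLaw κB (p.m .L) (p.PaCL t.2.1 t.2.2, t.1) := by
  have hT := ((hX.aemeasurable_tbu hp).prodMk ((hX.aemeasurable_tru hp hR).prodMk
    (hX.aemeasurable_tbr hp hR))).restrict (s := X.ev p .CL)
  have h := hX.condDistrib_exposure (κB := κB) (hp.one_le_m .L)
    (Pa := fun x : ℝ × ℝ × ℝ => p.PaCL x.2.1 x.2.2) (p.measurable_PaCL.comp measurable_snd)
    measurable_fst hT ((hX.aemeasurable_W2 hp hB).restrict (s := X.ev p .CL)) (hX.H_meas .CL)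
    (fun g => p.meanBU fun t => ENNReal.ofReal (p.assoc .CL t) *
      ∫⁻ r in Ioi (0 : ℝ), ∫⁻ θ in Ioc (-Real.pi) Real.pi, g (t, r, sideBR t r θ) *
        ENNReal.ofReal (1 / (2 * Real.pi) * p.pdfRU t r))
    fun G hG => hX.lintegral_ev_CL hp hB hR hG
  have hS : MeasurableSet {t : ℝ × ℝ × ℝ | 0 < t.1 ∧ 0 < t.2.1 ∧ 0 < t.2.2} := by
    measurability
  have hpos : ∀ᵐ t ∂((P.restrict (X.ev p .CL)).map fun ω => (X.tbu ω, X.tru p ω, X.tbr p ω)),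
      0 < t.1 ∧ 0 < t.2.1 ∧ 0 < t.2.2 := by
    refine (ae_map_iff hT hS).2 ?_
    filter_upwards [ae_restrict_of_ae (hX.tbu_pos hp), hX.tru_pos hp hB hR,
      ae_restrict_of_ae (hX.tbr_pos hp)] with ω h1 h2 h3 using ⟨h1, h2, h3⟩
  filter_upwards [h, hpos] with t h1 h2 using ⟨h2, h1⟩

end Conditional

/-! ### Finiteness, distribution function and mean of the exposure. -/

section Moments

open Filter Topology

variable {κB : Kernel (Measure BSPoint) BSPoint} {κR : Kernel (Measure RISPoint) RISPoint}
  {p : Params} {Ω : Type*} {mΩ : MeasurableSpace Ω} {P : Measure Ω} {X : Network Ω}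
  [IsProbabilityMeasure P] [IsSFiniteKernel κB]

theorem Params.sigmaFinite_risIntensity (p : Params) : SigmaFinite p.risIntensity := by
  have h1 := sigmaFinite_ofReal_smul (volume : Measure ℂ) p.lamR
  have h2 := Params.isProbabilityMeasure_uniform_zero_one
  have h3 := Params.isProbabilityMeasure_uniform_angle
  unfold Params.risIntensity
  infer_instance

/-- The unconditional mean may be infinite, so it cannot be used. Instead the indicator of `{∞}` is
averaged over the nearest distance: at each fixed `t > 0` the interference has finite mean and is
almost surely finite. -/
theorem Network.IsModel.W2_lt_top (hX : X.IsModel p P) (hp : p.Valid)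
    (hB : ∀ᵐ ω ∂P, κB (pointMeasure X.bs ω) = pointMeasure X.bs ω) :
    ∀ᵐ ω ∂P, X.W2 p ω < ∞ := by
  have hm : Measurable (({∞} : Set ℝ≥0∞).indicator (1 : ℝ≥0∞ → ℝ≥0∞)) :=
    measurable_one.indicator (measurableSet_singleton _)
  have h := hX.lintegral_bsData (κB := κB) hp hB
    (Φ := fun z => ({∞} : Set ℝ≥0∞).indicator 1 z.2) (by fun_prop)
  have h0 : (p.meanBU fun t => ∫⁻ y, ({∞} : Set ℝ≥0∞).indicator 1 y
      ∂lawKernel P (hX.measurable_interf (κ := κB)) t) = p.meanBU fun _ => 0 := by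
    refine Params.meanBU_congr fun t ht => ?_
    rw [lawKernel_apply, lintegral_map hm (hX.measurable_interf_right t)]
    refine lintegral_eq_zero_of_ae_eq_zero ?_
    filter_upwards [hX.ae_interf_lt_top hp hB ht] with ω hω
    exact indicator_of_notMem (show _ ∉ ({∞} : Set ℝ≥0∞) from hω.ne) _
  have h1 := h.trans h0
  simp only [Params.meanBU, zero_mul, lintegral_zero] at h1
  have h1' := (lintegral_eq_zero_iff (f := fun ω => ({∞} : Set ℝ≥0∞).indicator
    (1 : ℝ≥0∞ → ℝ≥0∞) (X.bsData p κB ω).2) (hm.comp (hX.measurable_bsData (κB := κB)).snd)).1 h1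
  filter_upwards [h1', hX.prob_regular hp, hB] with ω hω h2 h3
  rw [Network.W2_eq (hX.bs_poisson.countable ω) h2, lt_top_iff_ne_top]
  intro hc
  have hc' : (X.bsData p κB ω).2 = ∞ := by rw [Network.bsData, interf, h3, hc]
  rw [hc', indicator_of_mem (mem_singleton _)] at hω
  exact one_ne_zero hω

theorem Params.measurable_setIntegral_weight (p : Params) (v : LinkState) :
    Measurable fun t => ∫ d in Ioi t, p.weight v d := by
  have hS : MeasurableSet {z : ℝ × ℝ | z.1 < z.2} := measurableSet_lt measurable_fst measurable_snd
  have h : Measurable fun t => ∫ d, {z : ℝ × ℝ | z.1 < z.2}.indicator (fun z => p.weight v z.2) (t, d) :=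
    (((p.measurable_weight v).comp measurable_snd).indicator hS).stronglyMeasurable
      |>.integral_prod_right'.measurable
  refine (funext fun t => ?_ : _ = fun t => ∫ d in Ioi t, p.weight v d) ▸ h
  exact integral_indicator (f := p.weight v) (measurableSet_Ioi (a := t))

theorem Network.IsModel.lintegral_W2 (hX : X.IsModel p P) (hp : p.Valid)
    (hB : ∀ᵐ ω ∂P, κB (pointMeasure X.bs ω) = pointMeasure X.bs ω) :
    ∫⁻ ω, X.W2 p ω ∂P = ENNReal.ofReal (p.lamB * p.pb * p.meanGain / 2) *
      (p.meanBU (fun t => ENNReal.ofReal (∫ d in Ioi t, p.weight .L d)) +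
        p.meanBU (fun t => ENNReal.ofReal (∫ d in Ioi t, p.weight .N d))) := by
  have hw := (p.measurable_setIntegral_weight .L).ennreal_ofReal
  have h := hX.lintegral_bsData (κB := κB) hp hB (Φ := Prod.snd) measurable_snd
  have h1 : ∫⁻ ω, X.W2 p ω ∂P = ∫⁻ ω, (X.bsData p κB ω).2 ∂P := by
    refine lintegral_congr_ae ?_
    filter_upwards [hX.prob_regular hp, hB] with ω h2 h3
    rw [Network.W2_eq (hX.bs_poisson.countable ω) h2, Network.bsData, interf, h3]
  rw [h1, ← Params.meanBU_add_left hw, Params.meanBU, ← lintegral_const_mul' _ _ ENNReal.ofReal_ne_top]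
  refine h.trans (setLIntegral_congr_fun measurableSet_Ioi fun t ht => ?_)
  simp only
  rw [← mul_assoc, ← hp.lintegral_powerFrom ht, ← hX.lintegral_interf hp hB, lawKernel_apply,
    lintegral_map measurable_id' (hX.measurable_interf_right t)]

variable [IsSFiniteKernel κR]

theorem Network.IsModel.aemeasurable_Wq (hX : X.IsModel p P) (hp : p.Valid)
    (hB : ∀ᵐ ω ∂P, κB (pointMeasure X.bs ω) = pointMeasure X.bs ω)
    (hR : ∀ᵐ ω ∂P, κR (pointMeasure X.ris ω) = pointMeasure X.ris ω) (q : LinkType) :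
    AEMeasurable (X.Wq p q) P := by
  have hPa : AEMeasurable (X.Pa p q) P := by
    have hD := fun v => (p.measurable_PaD v).comp_aemeasurable (hX.aemeasurable_tbu hp)
    cases q
    · exact hD .L
    · exact p.measurable_PaCL.comp_aemeasurable
        ((hX.aemeasurable_tru hp hR).prodMk (hX.aemeasurable_tbr hp hR))
    · exact hD .N
  exact ((hPa.mul (hX.H_meas q).aemeasurable).div_const _).ennreal_ofReal.add
    (hX.aemeasurable_W2 hp hB)

theorem Network.IsModel.lintegral_W1 (hX : X.IsModel p P) (hp : p.Valid)
    (hB : ∀ᵐ ω ∂P, κB (pointMeasure X.bs ω) = pointMeasure X.bs ω)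
    (hR : ∀ᵐ ω ∂P, κR (pointMeasure X.ris ω) = pointMeasure X.ris ω) :
    ∫⁻ ω, X.W1 p ω ∂P = p.assocMean (fun tbu => ENNReal.ofReal (p.PaD .L tbu / p.area))
      (fun _ tru tbr => ENNReal.ofReal (p.PaCL tru tbr / p.area))
      (fun tbu => ENNReal.ofReal (p.PaD .N tbu / p.area)) := by
  have hD := p.measurable_PaD
  have hC := p.measurable_PaCL
  rw [hX.lintegral_eq_assocMean (κB := κB) hp hB hR
    (G₁ := fun z => ENNReal.ofReal (p.PaD .L z.1 * z.2.2 / p.area)) (by fun_prop)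
    (G₂ := fun z => ENNReal.ofReal (p.PaCL z.1.2.1 z.1.2.2 * z.2.2 / p.area)) (by fun_prop)
    (G₃ := fun z => ENNReal.ofReal (p.PaD .N z.1 * z.2.2 / p.area)) (by fun_prop)
    (fun ω hω => by rw [Network.W1, show X.link p ω = .DL from hω]; rfl)
    (fun ω hω => by rw [Network.W1, show X.link p ω = .CL from hω]; rfl)
    (fun ω hω => by rw [Network.W1, show X.link p ω = .DN from hω]; rfl)]
  exact Params.assocMean_congr
    (fun t ht => hX.meanMarks_power hp (hp.one_le_m .L) (hp.PaD_pos .L ht).le t)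
    (fun t r s _ hr hs => hX.meanMarks_power hp (hp.one_le_m .L) (hp.PaCL_pos hr hs).le t)
    (fun t ht => hX.meanMarks_power hp (hp.one_le_m .N) (hp.PaD_pos .N ht).le t)

/-- The law of the exposure. -/
theorem Network.IsModel.lintegral_W (hX : X.IsModel p P) (hp : p.Valid)
    (hB : ∀ᵐ ω ∂P, κB (pointMeasure X.bs ω) = pointMeasure X.bs ω)
    (hR : ∀ᵐ ω ∂P, κR (pointMeasure X.ris ω) = pointMeasure X.ris ω) {F : ℝ≥0∞ → ℝ≥0∞}
    (hF : Measurable F) :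
    ∫⁻ ω, F (X.W p ω) ∂P = p.assocMean
      (fun t => ∫⁻ y, F y ∂hX.exposureLaw κB (p.m .L) (p.PaD .L t, t))
      (fun t r s => ∫⁻ y, F y ∂hX.exposureLaw κB (p.m .L) (p.PaCL r s, t))
      (fun t => ∫⁻ y, F y ∂hX.exposureLaw κB (p.m .N) (p.PaD .N t, t)) := by
  have hD := p.measurable_PaD
  have hC := p.measurable_PaCL
  have hW : ∀ {q : LinkType}, ∀ ω ∈ X.ev p q, F (X.W p ω) =
      F (ENNReal.ofReal (X.Pa p q ω * X.H q ω / p.area) + X.W2 p ω) := fun ω hω => by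
    rw [Network.W, show X.link p ω = _ from hω, Network.Wq, Network.W1q]
  have m₁ : ∀ v, Measurable fun z : ℝ × ℝ≥0∞ × ℝ =>
      F (ENNReal.ofReal (p.PaD v z.1 * z.2.2 / p.area) + z.2.1) := fun v => by fun_prop
  have m₂ : Measurable fun z : (ℝ × ℝ × ℝ) × ℝ≥0∞ × ℝ =>
      F (ENNReal.ofReal (p.PaCL z.1.2.1 z.1.2.2 * z.2.2 / p.area) + z.2.1) := by fun_prop
  have h := hX.lintegral_eq_assocMean (κB := κB) hp hB hR (m₁ .L) m₂ (m₁ .N)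
    (f := fun ω => F (X.W p ω)) hW hW hW
  refine h.trans (Params.assocMean_congr (fun t _ => ?_) (fun t r s _ _ _ => ?_) fun t _ => ?_)
  · exact hX.meanMarks_exposure (p.m .L) (p.PaD .L t) t hF
  · exact hX.meanMarks_exposure (p.m .L) (p.PaCL r s) t hF
  · exact hX.meanMarks_exposure (p.m .N) (p.PaD .N t) t hF

/-- The link type and the distances rest on a choice function that is controlled only outside a null
set, so the event is measurable only up to a null set. It is decomposed along the three link types.
-/
theorem Network.IsModel.nullMeasurableSet_W (hX : X.IsModel p P) (hp : p.Valid)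
    (hB : ∀ᵐ ω ∂P, κB (pointMeasure X.bs ω) = pointMeasure X.bs ω)
    (hR : ∀ᵐ ω ∂P, κR (pointMeasure X.ris ω) = pointMeasure X.ris ω) {A : Set ℝ≥0∞}
    (hA : MeasurableSet A) : NullMeasurableSet {ω | X.W p ω ∈ A} P := by
  have hu : {ω | X.W p ω ∈ A} = (X.ev p .DL ∩ X.Wq p .DL ⁻¹' A) ∪
      ((X.ev p .CL ∩ X.Wq p .CL ⁻¹' A) ∪ (X.ev p .DN ∩ X.Wq p .DN ⁻¹' A)) := by
    ext ω
    simp only [mem_ofPred_eq, mem_union, mem_inter_iff, mem_preimage, Network.ev, Network.W]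
    cases X.link p ω <;> simp
  have hn := fun q => (hX.nullMeasurableSet_ev hp hR q).inter
    ((hX.aemeasurable_Wq hp hB hR q).nullMeasurableSet_preimage hA)
  rw [hu]
  exact (hn .DL).union ((hn .CL).union (hn .DN))

theorem Network.IsModel.prob_W_mem_atMost (hX : X.IsModel p P) (hp : p.Valid)
    (hB : ∀ᵐ ω ∂P, κB (pointMeasure X.bs ω) = pointMeasure X.bs ω)
    (hR : ∀ᵐ ω ∂P, κR (pointMeasure X.ris ω) = pointMeasure X.ris ω) (w : ℝ) :
    P {ω | X.W p ω ∈ atMost w} = p.assocMean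
      (fun tbu => ENNReal.ofReal (p.condCDF (p.m .L) (p.PaD .L tbu) tbu w))
      (fun tbu tru tbr => ENNReal.ofReal (p.condCDF (p.m .L) (p.PaCL tru tbr) tbu w))
      (fun tbu => ENNReal.ofReal (p.condCDF (p.m .N) (p.PaD .N tbu) tbu w)) := by
  have hA := measurableSet_atMost w
  have h := hX.lintegral_W hp hB hR (F := (atMost w).indicator 1) (measurable_one.indicator hA)
  simp only [lintegral_indicator_one hA] at h
  have h0 : ∫⁻ ω, (atMost w).indicator (1 : ℝ≥0∞ → ℝ≥0∞) (X.W p ω) ∂P =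
      P {ω | X.W p ω ∈ atMost w} :=
    lintegral_indicator_one₀ (hX.nullMeasurableSet_W hp hB hR hA)
  rw [← h0, h]
  exact Params.assocMean_congr
    (fun t ht => hX.exposureLaw_atMost hp (hp.one_le_m .L) hB (hp.PaD_pos .L ht) ht w)
    (fun t r s ht hr hs => hX.exposureLaw_atMost hp (hp.one_le_m .L) hB (hp.PaCL_pos hr hs) ht w)
    (fun t ht => hX.exposureLaw_atMost hp (hp.one_le_m .N) hB (hp.PaD_pos .N ht) ht w)

end Moments

end EMF

open EMF

theorem theorem2 {Ω : Type*} [MeasurableSpace Ω] (P : Measure Ω) [IsProbabilityMeasure P]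
    (p : Params) (hp : p.Valid) (X : Network Ω) (hX : X.IsModel p P) :
    -- the exposure is almost surely finite
    (∀ᵐ ω ∂P, X.W p ω < ∞) ∧
    -- the inversion integrals converge absolutely
    (∀ k : ℕ, 1 ≤ k → ∀ Pa t w : ℝ, 0 < Pa → 0 < t →
      IntegrableOn (p.gilPelaezIntegrand k Pa t w) (Ioi 0)) ∧
    -- conditional Laplace transform of the exposure, given the serving distances, on the
    -- event that the serving link has a given type
    (∀ s : ℂ, 0 ≤ s.re →
      (∀ᵐ t ∂((P.restrict (X.ev p .DL)).map X.tbu),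
        laplace (condDistrib (X.Wq p .DL) X.tbu (P.restrict (X.ev p .DL)) t) s =
          p.laplaceW (p.m .L) (p.PaD .L t) t s) ∧
      (∀ᵐ t ∂((P.restrict (X.ev p .CL)).map fun ω => (X.tbu ω, X.tru p ω, X.tbr p ω)),
        laplace (condDistrib (X.Wq p .CL) (fun ω => (X.tbu ω, X.tru p ω, X.tbr p ω))
          (P.restrict (X.ev p .CL)) t) s =
          p.laplaceW (p.m .L) (p.PaCL t.2.1 t.2.2) t.1 s) ∧
      (∀ᵐ t ∂((P.restrict (X.ev p .DN)).map X.tbu),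
        laplace (condDistrib (X.Wq p .DN) X.tbu (P.restrict (X.ev p .DN)) t) s =
          p.laplaceW (p.m .N) (p.PaD .N t) t s)) ∧
    -- conditional CDFs
    (∀ w : ℝ,
      (∀ᵐ t ∂((P.restrict (X.ev p .DL)).map X.tbu),
        (condDistrib (X.Wq p .DL) X.tbu (P.restrict (X.ev p .DL)) t).real (atMost w) =
          p.condCDF (p.m .L) (p.PaD .L t) t w) ∧
      (∀ᵐ t ∂((P.restrict (X.ev p .CL)).map fun ω => (X.tbu ω, X.tru p ω, X.tbr p ω)),
        (condDistrib (X.Wq p .CL) (fun ω => (X.tbu ω, X.tru p ω, X.tbr p ω))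
          (P.restrict (X.ev p .CL)) t).real (atMost w) =
          p.condCDF (p.m .L) (p.PaCL t.2.1 t.2.2) t.1 w) ∧
      (∀ᵐ t ∂((P.restrict (X.ev p .DN)).map X.tbu),
        (condDistrib (X.Wq p .DN) X.tbu (P.restrict (X.ev p .DN)) t).real (atMost w) =
          p.condCDF (p.m .N) (p.PaD .N t) t w)) ∧
    -- CDF of the exposure
    (∀ w : ℝ,
      P {ω | X.W p ω ∈ atMost w} =
        p.assocMean
          (fun tbu => ENNReal.ofReal (p.condCDF (p.m .L) (p.PaD .L tbu) tbu w))
          (fun tbu tru tbr => ENNReal.ofReal (p.condCDF (p.m .L) (p.PaCL tru tbr) tbu w))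
          (fun tbu => ENNReal.ofReal (p.condCDF (p.m .N) (p.PaD .N tbu) tbu w))) ∧
    -- first moment
    (∫⁻ ω, X.W p ω ∂P = ∫⁻ ω, X.W1 p ω ∂P + ∫⁻ ω, X.W2 p ω ∂P) ∧
    (∫⁻ ω, X.W1 p ω ∂P =
      p.assocMean
        (fun tbu => ENNReal.ofReal (p.PaD .L tbu / p.area))
        (fun _ tru tbr => ENNReal.ofReal (p.PaCL tru tbr / p.area))
        (fun tbu => ENNReal.ofReal (p.PaD .N tbu / p.area))) ∧
    (∫⁻ ω, X.W2 p ω ∂P =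
      ENNReal.ofReal (p.lamB * p.pb * p.meanGain / 2) *
        (p.meanBU (fun tbu => ENNReal.ofReal
            (tbu ^ (2 - p.alpha .L) * expInt (p.alpha .L - 1) (p.beta * tbu))) +
          p.meanBU (fun tbu => ENNReal.ofReal
            (tbu ^ (2 - p.alpha .N) / (p.alpha .N - 2) -
              tbu ^ (2 - p.alpha .N) * expInt (p.alpha .N - 1) (p.beta * tbu))))) := by
  
  have hsB := hp.sigmaFinite_bsIntensity
  have hsR := p.sigmaFinite_risIntensity
  -- The auxiliary kernels, arbitrary until now, become the regularised identities attached to the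
  -- two intensities. The statement being proved does not involve them.
  have hB := hX.bs_poisson.ae_regularKernel_eq
  have hR := hX.ris_poisson.ae_regularKernel_eq
  refine ⟨?_, fun k hk Pa t w hPa ht =>
    (hX.integrableOn_gilPelaezIntegrand hp hk hB hPa ht w).2, fun s hs => ⟨?_, ?_, ?_⟩,
    fun w => ⟨?_, ?_, ?_⟩, fun w => ?_, ?_, ?_, ?_⟩
  · filter_upwards [hX.W2_lt_top hp hB] with ω hω
    exact ENNReal.add_lt_top.2 ⟨ENNReal.ofReal_lt_top, hω⟩
  · filter_upwards [hX.condDistrib_DL hp hB hR] with t ht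
    rw [ht.2, hX.laplace_exposureLaw hp (hp.one_le_m .L) hB (hp.PaD_pos .L ht.1).le ht.1 hs]
  · filter_upwards [hX.condDistrib_CL hp hB hR] with t ht
    rw [ht.2, hX.laplace_exposureLaw hp (hp.one_le_m .L) hB (hp.PaCL_pos ht.1.2.1 ht.1.2.2).le
      ht.1.1 hs]
  · filter_upwards [hX.condDistrib_DN hp hB hR] with t ht
    rw [ht.2, hX.laplace_exposureLaw hp (hp.one_le_m .N) hB (hp.PaD_pos .N ht.1).le ht.1 hs]
  · filter_upwards [hX.condDistrib_DL hp hB hR] with t ht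
    rw [ht.2, hX.real_exposureLaw_atMost hp (hp.one_le_m .L) hB (hp.PaD_pos .L ht.1) ht.1]
  · filter_upwards [hX.condDistrib_CL hp hB hR] with t ht
    rw [ht.2, hX.real_exposureLaw_atMost hp (hp.one_le_m .L) hB (hp.PaCL_pos ht.1.2.1 ht.1.2.2)
      ht.1.1]
  · filter_upwards [hX.condDistrib_DN hp hB hR] with t ht
    rw [ht.2, hX.real_exposureLaw_atMost hp (hp.one_le_m .N) hB (hp.PaD_pos .N ht.1) ht.1]
  · exact hX.prob_W_mem_atMost hp hB hR w
  · rw [← lintegral_add_right' _ (hX.aemeasurable_W2 hp hB)]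
    rfl
  · exact hX.lintegral_W1 hp hB hR
  · rw [hX.lintegral_W2 hp hB]
    congr 2
    · exact Params.meanBU_congr fun t ht => by rw [Params.integral_weight_L ht]
    · exact Params.meanBU_congr fun t ht => by rw [hp.integral_weight_N ht]
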